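/- **Setting.** Let $A=\mathbb C[x_1,\dots,x_N]$, let $W\in A$, let $G_W=\{\lambda\in(\mathbb C^\times)^N : W(\lambda_1x_1,\dots,\lambda_Nx_N)=W\}$ and let $G\subseteq G_W$ be a subgroup, acting on $A$ by ${}^gx_i=\lambda_ix_i$ for $g=(\lambda_1,\dots,\lambda_N)$. The crossed product $A[G]$ has the product $(a_1g_1)(a_2g_2)=a_1({}^{g_1}a_2)\,g_1g_2$. Let $\mathsf{HH}_c(A_W,A_W[G])$ be the cohomology of $\bigoplus_{p\ge0}\operatorname{Hom}_{\mathbb C}(A^{\otimes p},A[G])$ with respect to $\partial_H+\mathsf d_W$, where $\partial_H$ is the Hochschild differential and $(\mathsf d_W\phi)(a_1,\dots,a_{p})=\sum_{i=0}^{p}(-1)^i\phi(a_1,\dots,a_i,W,a_{i+1},\dots,a_p)$, with the cup product induced by $(\phi\cup\psi)(a_1,\dots,a_{p+q})=\phi(a_1,\dots,a_p)\,\psi(a_{p+1},\dots,a_{p+q})$. A polynomial $f\in A$ defines the class of the $0$-cochain $f\mathrm e$, and $f\,c$ denotes its cup product with a class $c$. **Generators.** For $g=(\lambda_i)\in G$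 let $I_g=\{i:\lambda_i\ne1\}$ and $l_g=|I_g|$. On the $g$-sector $\bigoplus_I A\,e_Ig$ of the Koszul cochains (with odd variables $e_1,\dots,e_N$, and $e_I=e_{i_1}\cdots e_{i_p}$ for $I=\{i_1<\dots<i_p\}$) put $\partial_K(\phi g)=\sum_i(x_i-{}^gx_i)e_i\phi g$ and $\tilde{\mathsf d}_W(a e_{i_1}\cdots e_{i_p}g)=\sum_m(-1)^{m-1}a\,\rho_{i_m}(g)(\partial^g_{x_{i_m}}W)\,e_{i_1}\cdots\widehat{e_{i_m}}\cdots e_{i_p}g$, where $\rho_i(g)$ applies $g$ to the variables $x_1,\dots,x_{i-1}$ only, and $\partial^g_{x_i}x^\gamma=(1+\lambda_i+\dots+\lambda_i^{\gamma_i-1})\,x^\gamma/x_i$ ($=0$ if $\gamma_i=0$). Let $\Upsilon^*(a e_{i_1}\cdots e_{i_p}g)$ be the Hochschild cochain $(a_1,\dots,a_p)\mapsto a\prod_m\rho_{i_m}(g)(\partial^g_{x_{i_m}}a_m)\,g$. The generator $\mathfrak 1_g\in\mathsf{HH}_c(A_W,A_W[G])$ is the class of $\Upsilon^*(\kappa)$,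 where $\kappa=e_{I_g}g+\kappa_{-2}+\kappa_{-4}+\cdots$ satisfies $(\partial_K+\tilde{\mathsf d}_W)\kappa=0$ and $\kappa_{-2m}$ is of degree $l_g-2m$ in the $e_i$. **Elementary polynomials.** An elementary invertible polynomial is one of: Fermat type, $W=x_1^n$; loop type, $W=x_1^{n_1}x_2+x_2^{n_2}x_3+\dots+x_N^{n_N}x_1$ with $N\ge2$; chain type, $W=x_1^{n_1}x_2+x_2^{n_2}x_3+\dots+x_N^{n_N}$ with $N\ge2$; all exponents $n,n_i$ are at least $2$. For $\mathrm e\ne g=(\lambda_i)\in G_W$ the twisted Hessian $\mathsf{Hess}^g(W)$ is, respectively, $$\frac{n}{1-\lambda_1}x_1^{n-2},\qquad \frac{(-1)^{N+1}+n_1\cdots n_N}{(1-\lambda_1)\cdots(1-\lambda_N)}\,x_1^{n_1-1}\cdots x_N^{n_N-1},\qquad \frac{n_1\cdots n_{l_g}}{(1-\lambda_1)\cdots(1-\lambda_{l_g})}\,x_1^{n_1-2}x_2^{n_2-1}\cdots x_{l_g}^{n_{l_g}-1}x_{l_g+1},$$ where the factor $x_{l_g+1}$ is omitted in the last formula if $l_g=N$.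 **Theorem.** Let $W$ be an elementary invertible polynomial and $G\subseteq G_W$ a subgroup. For every $g\in G$ the class $\mathfrak 1_g$ exists and is unique, and in $\mathsf{HH}_c(A_W,A_W[G])$: 1. if $g_1,g_2\in G$, $g_1,g_2\ne\mathrm e$ and $g_2\ne g_1^{-1}$, then $\mathfrak 1_{g_1}\cup\mathfrak 1_{g_2}=0$; 2. if $g\in G$, $g\ne\mathrm e$, then $\mathfrak 1_g\cup\mathfrak 1_{g^{-1}}=(-1)^{l_g(l_g-1)/2}\,\mathsf{Hess}^g(W)\,\mathfrak 1_{\mathrm e}$. This determines the full cup product for every invertible polynomial. Precisely, let $W=W_1\oplus\dots\oplus W_r$ be a sum of elementary invertible polynomials in separate blocks of variables, the blocks being ordered one after another, let $G\subseteq G_W$ be a subgroup, and write $g=(g_1,\dots,g_r)$ for the block components of $g\in G$. Then the $\mathfrak 1_g$ exist and are unique, every class in $\mathsf{HH}_c(A_W,A_W[G])$ is a finite sum of classes $f_g\mathfrak 1_g$ with $f_g\in A$, and for $g,h\in G$, $a,b\in A$, $$(a\,\mathfrak 1_g)\cup(b\,\mathfrak 1_h)=(-1)^{\sum_{j<k}l_{g_k}l_{h_j}}\;a\,b\,\Big(\prod_{k=1}^r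 s_k(g_k,h_k)\Big)\mathfrak 1_{gh},$$ where $s_k(g_k,h_k)=1$ if $g_k=\mathrm e$ or $h_k=\mathrm e$, $s_k(g_k,h_k)=(-1)^{l_{g_k}(l_{g_k}-1)/2}\,\mathsf{Hess}^{g_k}(W_k)$ if $h_k=g_k^{-1}\ne\mathrm e$, and $s_k(g_k,h_k)=0$ otherwise. -/

import Mathlib

open scoped DirectSum

/-! ## Compact type Hochschild cochains of a curved algebra

`A` and `B` are algebras over `k`, `B` is an `A`-bimodule through an algebra map `j : A → B`, and
`W : A` is the curvature.  The case of interest is `B = A[G]`, the crossed product. -/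

namespace Hochschild

section Cochains

variable (k A B : Type*) [CommRing k] [Ring A] [Algebra k A] [Ring B] [Algebra k B]

/-- `C^p(A, B) = Hom_k(A^{⊗ p}, B)`. -/
abbrev Cochain (p : ℕ) : Type _ := MultilinearMap k (fun _ : Fin p => A) B

/-- The cochains of compact type `⨁_p C^p(A, B)`. -/
def CompactCochain : Type _ := ⨁ p : ℕ, Cochain k A B p

noncomputable instance : AddCommGroup (CompactCochain k A B) :=
  inferInstanceAs (AddCommGroup (⨁ p : ℕ, Cochain k A B p))

noncomputable instance : Module k (CompactCochain k A B) :=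
  inferInstanceAs (Module k (⨁ p : ℕ, Cochain k A B p))

end Cochains

section DirectSumMaps

variable {k A B : Type*} [CommRing k] [Ring A] [Algebra k A] [Ring B] [Algebra k B]

/-- The inclusion `C^p(A, B) → ⨁_p C^p(A, B)`. -/
noncomputable def incl (p : ℕ) : Cochain k A B p →ₗ[k] CompactCochain k A B :=
  DirectSum.lof k ℕ (Cochain k A B) p

/-- The linear map out of `⨁_p C^p(A, B)` with given components. -/
noncomputable def lift {M : Type*} [AddCommMonoid M] [Module k M]
    (f : ∀ p, Cochain k A B p →ₗ[k] M) : CompactCochain k A B →ₗ[k] M :=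
  DirectSum.toModule k ℕ M f

theorem lift_incl {M : Type*} [AddCommMonoid M] [Module k M]
    (f : ∀ p, Cochain k A B p →ₗ[k] M) (p : ℕ) (φ : Cochain k A B p) :
    lift f (incl p φ) = f p φ :=
  DirectSum.toModule_lof k p φ

theorem CompactCochain.induction {motive : CompactCochain k A B → Prop}
    (x : CompactCochain k A B) (zero : motive 0)
    (incl : ∀ (p : ℕ) (φ : Cochain k A B p), motive (incl p φ))
    (add : ∀ x y, motive x → motive y → motive (x + y)) : motive x :=
  DirectSum.induction_lon (R := k) x zero incl add

end DirectSumMaps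

section Operations

variable {k A B : Type*} [CommRing k] [Ring A] [Algebra k A] [Ring B] [Algebra k B]

/-- `(a₀, …, a_p) ↦ (a₀, …, aᵢ aᵢ₊₁, …, a_p)`. -/
def contract {p : ℕ} (i : Fin p) (v : Fin (p + 1) → A) : Fin p → A := fun t =>
  if t < i then v t.castSucc else if t = i then v t.castSucc * v t.succ else v t.succ

theorem contract_update {p : ℕ} (i : Fin p) (v : Fin (p + 1) → A) (s : Fin (p + 1)) :
    ∃ (t : Fin p) (f : A →ₗ[k] A), ∀ x : A,
      contract i (Function.update v s x) = Function.update (contract i v) t (f x) := by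
  rcases lt_trichotomy s.val i.val with h | h | h
  · refine ⟨⟨s, by omega⟩, LinearMap.id, fun x => ?_⟩
    ext t
    simp only [contract, Function.update_apply, Fin.ext_iff, Fin.lt_def, Fin.val_castSucc,
      Fin.val_succ, LinearMap.id_apply]
    split_ifs <;> first | rfl | omega
  · refine ⟨i, LinearMap.mulRight k (v i.succ), fun x => ?_⟩
    ext t
    simp only [contract, Function.update_apply, Fin.ext_iff, Fin.lt_def, Fin.val_castSucc,
      Fin.val_succ, LinearMap.mulRight_apply]
    split_ifs with h1 h2 h3 h4 h5 h6
    all_goals first | rfl | omega | skip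
    all_goals
      have : t = i := Fin.ext (by omega)
      subst this; rfl
  · rcases Nat.lt_or_ge (i.val + 1) s.val with h' | h'
    · refine ⟨⟨s.val - 1, by omega⟩, LinearMap.id, fun x => ?_⟩
      ext t
      simp only [contract, Function.update_apply, Fin.ext_iff, Fin.lt_def, Fin.val_castSucc,
        Fin.val_succ, LinearMap.id_apply]
      split_ifs <;> first | rfl | omega
    · refine ⟨i, LinearMap.mulLeft k (v i.castSucc), fun x => ?_⟩
      ext t
      simp only [contract, Function.update_apply, Fin.ext_iff, Fin.lt_def, Fin.val_castSucc,
        Fin.val_succ, LinearMap.mulLeft_apply]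
      split_ifs with h1 h2 h3 h4 h5 h6
      all_goals first | rfl | omega | skip
      all_goals
        have : t = i := Fin.ext (by omega)
        subst this; rfl

/-- `φ ↦ ((a₀, …, a_p) ↦ φ(a₀, …, aᵢ aᵢ₊₁, …, a_p))`. -/
noncomputable def contractMap {p : ℕ} (i : Fin p) : Cochain k A B p →ₗ[k] Cochain k A B (p + 1) where
  toFun φ :=
    { toFun := fun v => φ (contract i v)
      map_update_add' := by
        intro inst v s x y
        obtain rfl : inst = instDecidableEqFin _ := Subsingleton.elim _ _
        obtain ⟨t, f, h⟩ := contract_update (k := k) i v s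
        simp [h]
      map_update_smul' := by
        intro inst v s c x
        obtain rfl : inst = instDecidableEqFin _ := Subsingleton.elim _ _
        obtain ⟨t, f, h⟩ := contract_update (k := k) i v s
        simp [h] }
  map_add' _ _ := rfl
  map_smul' _ _ := rfl

/-- `φ ↦ ((a₀, …, a_p) ↦ j(a₀) φ(a₁, …, a_p))`. -/
noncomputable def leftMap (j : A →ₐ[k] B) (p : ℕ) : Cochain k A B p →ₗ[k] Cochain k A B (p + 1) where
  toFun φ := LinearMap.uncurryLeft
    { toFun := fun a => (LinearMap.mulLeft k (j a)).compMultilinearMap φ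
      map_add' := fun a b => by ext; simp [add_mul]
      map_smul' := fun c a => by ext; simp }
  map_add' φ ψ := by ext; simp
  map_smul' c φ := by ext; simp

/-- `φ ↦ ((a₀, …, a_p) ↦ φ(a₀, …, a_{p-1}) j(a_p))`. -/
noncomputable def rightMap (j : A →ₐ[k] B) (p : ℕ) : Cochain k A B p →ₗ[k] Cochain k A B (p + 1) where
  toFun φ := MultilinearMap.uncurryRight
    (((LinearMap.mul k B).compl₂ j.toLinearMap).compMultilinearMap φ)
  map_add' φ ψ := by ext; simp
  map_smul' c φ := by ext; simp

/-- The Hochschild differential in degree `p`: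
`(∂φ)(a₀, …, a_p) = j(a₀) φ(a₁, …, a_p) + ∑_{i<p} (-1)^{i+1} φ(…, aᵢ aᵢ₊₁, …)
  + (-1)^{p+1} φ(a₀, …, a_{p-1}) j(a_p)`. -/
noncomputable def diffAt (j : A →ₐ[k] B) (p : ℕ) : Cochain k A B p →ₗ[k] Cochain k A B (p + 1) :=
  leftMap j p + ∑ i : Fin p, (-1 : k) ^ (i.val + 1) • contractMap i + (-1 : k) ^ (p + 1) • rightMap j p

/-- The curving differential out of degree `p + 1`:
`(d_W φ)(a₁, …, a_p) = ∑_{i=0}^{p} (-1)^i φ(a₁, …, aᵢ, W, aᵢ₊₁, …, a_p)`. -/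
noncomputable def curvAt (W : A) (p : ℕ) : Cochain k A B (p + 1) →ₗ[k] Cochain k A B p :=
  ∑ i : Fin (p + 1), (-1 : k) ^ i.val •
    ((LinearMap.applyₗ W).comp
      (MultilinearMap.curryMidLinearEquiv k (fun _ : Fin (p + 1) => A) B i).toLinearMap)

/-- The Hochschild differential `∂_H` on cochains of compact type. -/
noncomputable def diff (j : A →ₐ[k] B) : CompactCochain k A B →ₗ[k] CompactCochain k A B :=
  lift fun p => (incl (p + 1)).comp (diffAt j p)

/-- The curving differential `d_W` on cochains of compact type; it vanishes on `C^0`. -/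
noncomputable def curv (W : A) : CompactCochain k A B →ₗ[k] CompactCochain k A B :=
  lift fun p => match p with
    | 0 => 0
    | p + 1 => (incl p).comp (curvAt W p)

/-- The curved Hochschild differential `∂_H + d_W`. -/
noncomputable def curvedDiff (j : A →ₐ[k] B) (W : A) : CompactCochain k A B →ₗ[k] CompactCochain k A B :=
  diff j + curv W

/-- The cup product `(φ ∪ ψ)(a₁, …, a_{p+q}) = φ(a₁, …, a_p) ψ(a_{p+1}, …, a_{p+q})`. -/
noncomputable def cupAt (p q : ℕ) :
    Cochain k A B p →ₗ[k] Cochain k A B q →ₗ[k] Cochain k A B (p + q) :=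
  LinearMap.mk₂ k
    (fun φ ψ => ((LinearMap.mul' k B).compMultilinearMap
      (MultilinearMap.domCoprod φ ψ)).domDomCongr finSumFinEquiv)
    (fun φ φ' ψ => by ext; simp [add_mul]) (fun c φ ψ => by ext; simp)
    (fun φ ψ ψ' => by ext; simp [mul_add]) (fun c φ ψ => by ext; simp)

/-- The cup product on cochains of compact type. -/
noncomputable def cup : CompactCochain k A B →ₗ[k] CompactCochain k A B →ₗ[k] CompactCochain k A B :=
  lift fun p =>
    (lift fun q =>
      ((cupAt p q).compr₂ (incl (p + q))).flip).flip

/-! ### The cup product is compatible with the differential -/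

/-- The value of a cochain on the initial segment of a sequence. -/
def ev {p : ℕ} (φ : Cochain k A B p) (a : ℕ → A) : B := φ fun t => a t

theorem incl_eq_incl {m n : ℕ} (h : m = n) (φ : Cochain k A B m) (ψ : Cochain k A B n)
    (H : ∀ a : ℕ → A, ev φ a = ev ψ a) :
    incl m φ = incl n ψ := by
  subst h
  congr 1
  ext v
  have := H fun i => if h : i < m then v ⟨i, h⟩ else 0
  simpa [ev] using this

theorem ev_add {p : ℕ} (φ ψ : Cochain k A B p) (a : ℕ → A) : ev (φ + ψ) a = ev φ a + ev ψ a := rfl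

theorem ev_smul {p : ℕ} (c : k) (φ : Cochain k A B p) (a : ℕ → A) : ev (c • φ) a = c • ev φ a := rfl

theorem ev_cup {p q : ℕ} (φ : Cochain k A B p) (ψ : Cochain k A B q) (a : ℕ → A) :
    ev (cupAt p q φ ψ) a = ev φ a * ev ψ fun t => a (p + t) := by
  simp [ev, cupAt]

theorem ev_diff (j : A →ₐ[k] B) {p : ℕ} (φ : Cochain k A B p) (a : ℕ → A) :
    ev (diffAt j p φ) a = j (a 0) * ev φ (fun t => a (t + 1)) +
      ∑ i ∈ Finset.range p, (-1 : k) ^ (i + 1) •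
        ev φ (fun t => if t < i then a t else if t = i then a t * a (t + 1) else a (t + 1)) +
      (-1 : k) ^ (p + 1) • (ev φ a * j (a p)) := by
  have hc : ∀ i : Fin p, (contractMap i φ) (fun t : Fin (p + 1) => a t) =
      ev φ (fun t => if t < i.val then a t else if t = i.val then a t * a (t + 1)
        else a (t + 1)) := by
    intro i
    change φ _ = φ _
    congr 1
    ext t
    simp only [contract, Fin.ext_iff, Fin.lt_def, Fin.val_castSucc, Fin.val_succ]
  simp only [ev, diffAt, LinearMap.add_apply, LinearMap.sum_apply, LinearMap.smul_apply,
    _root_.add_apply, _root_.sum_apply, _root_.smul_apply, hc]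
  rw [Finset.sum_range (fun i => (-1 : k) ^ (i + 1) • φ (fun t : Fin p =>
    if t.val < i then a t else if t.val = i then a t * a (t + 1) else a (t + 1)))]
  simp [leftMap, rightMap, Fin.tail_def, Fin.init_def]

theorem ev_curv (W : A) {p : ℕ} (φ : Cochain k A B (p + 1)) (a : ℕ → A) :
    ev (curvAt W p φ) a = ∑ i ∈ Finset.range (p + 1), (-1 : k) ^ i •
      ev φ (fun t => if t < i then a t else if t = i then W else a (t - 1)) := by
  rw [Finset.sum_range]
  simp only [ev, curvAt, LinearMap.sum_apply, LinearMap.smul_apply, _root_.sum_apply,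
    _root_.smul_apply]
  refine Finset.sum_congr rfl fun i _ => ?_
  congr 1
  simp only [LinearMap.comp_apply, LinearEquiv.coe_coe, LinearMap.applyₗ_apply_apply,
    MultilinearMap.curryMidLinearEquiv_apply, MultilinearMap.curryMid_apply_apply]
  congr 1
  ext t
  rcases lt_trichotomy t i with h | h | h
  · rw [Fin.insertNth_apply_below h]
    simp [Fin.lt_def.1 h]
  · subst h; simp
  · rw [Fin.insertNth_apply_above h]
    have h' := Fin.lt_def.1 h
    simp [h'.not_gt, h'.ne']

/-- The sign operator `φ ↦ (-1)^p φ` for `φ ∈ C^p`. -/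
noncomputable def signOp : CompactCochain k A B →ₗ[k] CompactCochain k A B :=
  lift fun p => (-1 : k) ^ p • incl p

theorem ev_congr {p : ℕ} (φ : Cochain k A B p) {a b : ℕ → A} (h : ∀ t < p, a t = b t) :
    ev φ a = ev φ b := by
  unfold ev
  congr 1
  ext t
  exact h t t.2

theorem incl_eq_add {m n₁ n₂ : ℕ} (h₁ : m = n₁) (h₂ : m = n₂) (φ : Cochain k A B m)
    (φ₁ : Cochain k A B n₁) (φ₂ : Cochain k A B n₂)
    (H : ∀ a : ℕ → A, ev φ a = ev φ₁ a + ev φ₂ a) :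
    incl m φ =
      incl n₁ φ₁ + incl n₂ φ₂ := by
  subst h₁
  subst h₂
  rw [← map_add]
  exact incl_eq_incl rfl _ _ H

theorem cup_incl (p q : ℕ) (φ : Cochain k A B p) (ψ : Cochain k A B q) :
    cup (incl p φ) (incl q ψ) =
      incl (p + q) (cupAt p q φ ψ) := by
  simp [cup, lift_incl]

theorem diff_incl (j : A →ₐ[k] B) (p : ℕ) (φ : Cochain k A B p) :
    diff j (incl p φ) =
      incl (p + 1) (diffAt j p φ) := by
  simp [diff, lift_incl]

theorem curv_incl_zero (W : A) (φ : Cochain k A B 0) :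
    curv W (incl 0 φ) = 0 := by
  simp [curv, lift_incl]

theorem curv_incl_succ (W : A) (p : ℕ) (φ : Cochain k A B (p + 1)) :
    curv W (incl (p + 1) φ) =
      incl p (curvAt W p φ) := by
  simp [curv, lift_incl]

theorem signOp_incl (p : ℕ) (φ : Cochain k A B p) :
    signOp (incl p φ) =
      (-1 : k) ^ p • incl p φ := by
  simp [signOp, lift_incl]

theorem diff_cup_incl (j : A →ₐ[k] B) (p q : ℕ) (φ : Cochain k A B p) (ψ : Cochain k A B q) :
    incl (p + q + 1) (diffAt j (p + q) (cupAt p q φ ψ)) =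
      incl (p + 1 + q) (cupAt (p + 1) q (diffAt j p φ) ψ) +
      incl (p + (q + 1))
        ((-1 : k) ^ p • cupAt p (q + 1) φ (diffAt j q ψ)) := by
  refine incl_eq_add (by omega) (by omega) _ _ _ fun a => ?_
  simp only [ev_diff, ev_cup, ev_smul]
  rw [Finset.sum_range_add]
  have h1 : ∀ i ∈ Finset.range p, (-1 : k) ^ (i + 1) •
      ((ev φ fun t => if t < i then a t else if t = i then a t * a (t + 1) else a (t + 1)) *
        ev ψ fun t => if p + t < i then a (p + t) else if p + t = i then
          a (p + t) * a (p + t + 1) else a (p + t + 1)) =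
      ((-1 : k) ^ (i + 1) •
        (ev φ fun t => if t < i then a t else if t = i then a t * a (t + 1) else a (t + 1))) *
        ev ψ fun t => a (p + 1 + t) := by
    intro i hi
    rw [Finset.mem_range] at hi
    rw [smul_mul_assoc]
    congr 2
    refine ev_congr _ fun t _ => ?_
    rw [if_neg (by omega), if_neg (by omega)]
    congr 1; omega
  have h2 : ∀ i ∈ Finset.range q, (-1 : k) ^ (p + i + 1) •
      ((ev φ fun t => if t < p + i then a t else if t = p + i then a t * a (t + 1) else a (t + 1)) *
        ev ψ fun t => if p + t < p + i then a (p + t) else if p + t = p + i then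
          a (p + t) * a (p + t + 1) else a (p + t + 1)) =
      (-1 : k) ^ p • (ev φ a * ((-1 : k) ^ (i + 1) •
        ev ψ fun t => if t < i then a (p + t) else if t = i then a (p + t) * a (p + (t + 1))
          else a (p + (t + 1)))) := by
    intro i _
    rw [mul_smul_comm, smul_smul, ← pow_add]
    congr 1
    congr 1
    · exact ev_congr _ fun t ht => if_pos (by omega)
    · refine ev_congr _ fun t _ => ?_
      simp only [add_lt_add_iff_left, add_right_inj, add_assoc]
  rw [Finset.sum_congr rfl h1, Finset.sum_congr rfl h2, ← Finset.sum_mul, ← Finset.smul_sum,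
    ← Finset.mul_sum]
  have e1 : (fun t => a (p + (t + 1))) = fun t => a (p + 1 + t) := by
    ext t; congr 1; omega
  have e2 : (fun t => a (p + t + 1)) = fun t => a (p + 1 + t) := by
    ext t; congr 1; omega
  have e3 : (-1 : k) ^ (p + q + 1) = (-1) ^ p * (-1) ^ (q + 1) := by rw [← pow_add]; ring_nf
  simp only [e1, e2, e3, pow_succ, add_mul, mul_add, smul_add, mul_smul, mul_smul_comm,
    smul_mul_assoc, mul_assoc, mul_neg, mul_one, neg_smul, neg_mul, add_zero, smul_neg]
  abel

theorem ev_curv_cup (W : A) {p q : ℕ} (φ : Cochain k A B p) (ψ : Cochain k A B q) (a : ℕ → A) :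
    ∑ i ∈ Finset.range (p + q), (-1 : k) ^ i • ev (cupAt p q φ ψ)
      (fun t => if t < i then a t else if t = i then W else a (t - 1)) =
    (∑ i ∈ Finset.range p, (-1 : k) ^ i • ev φ
      (fun t => if t < i then a t else if t = i then W else a (t - 1))) *
        ev ψ (fun t => a (p + t - 1)) +
    (-1 : k) ^ p • (ev φ a * ∑ i ∈ Finset.range q, (-1 : k) ^ i • ev ψ
      (fun t => if t < i then a (p + t) else if t = i then W else a (p + (t - 1)))) := by
  rw [Finset.sum_range_add, Finset.sum_mul, Finset.mul_sum, Finset.smul_sum]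
  simp only [ev_cup]
  congr 1
  · refine Finset.sum_congr rfl fun i hi => ?_
    rw [Finset.mem_range] at hi
    rw [smul_mul_assoc]
    congr 2
    refine ev_congr _ fun t _ => ?_
    rw [if_neg (by omega), if_neg (by omega)]
  · refine Finset.sum_congr rfl fun i _ => ?_
    rw [mul_smul_comm, smul_smul, ← pow_add]
    congr 1
    congr 1
    · exact ev_congr _ fun t ht => if_pos (by omega)
    · refine ev_congr _ fun t _ => ?_
      simp only [add_lt_add_iff_left, add_right_inj]
      split_ifs with h1 h2
      · rfl
      · rfl
      · congr 1; omega

theorem curv_cup_incl (W : A) (p q : ℕ) (φ : Cochain k A B p) (ψ : Cochain k A B q) :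
    curv W (incl (p + q) (cupAt p q φ ψ)) =
      cup (curv W (incl p φ))
        (incl q ψ) +
      (-1 : k) ^ p • cup (incl p φ)
        (curv W (incl q ψ)) := by
  rcases p with _ | p <;> rcases q with _ | q
  · simp only [curv_incl_zero, map_zero, LinearMap.zero_apply, smul_zero, add_zero]
    exact curv_incl_zero W _
  · simp only [curv_incl_zero, map_zero, LinearMap.zero_apply, zero_add, curv_incl_succ, cup_incl,
      pow_zero, one_smul]
    refine (curv_incl_succ W (0 + q) _).trans ?_
    refine incl_eq_incl rfl _ _ fun a => ?_
    rw [ev_curv, ev_cup, ev_curv]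
    have := ev_curv_cup W φ ψ a
    simpa using this
  · rw [curv_incl_zero, map_zero, smul_zero, curv_incl_succ W p φ, cup_incl]
    refine Eq.trans ?_ (add_zero _).symm
    refine (curv_incl_succ W p (cupAt (p + 1) 0 φ ψ)).trans ?_
    refine incl_eq_incl rfl _ _ fun a => ?_
    rw [ev_curv, ev_cup, ev_curv]
    have := ev_curv_cup W φ ψ a
    simp only [Finset.range_zero, Finset.sum_empty, mul_zero, smul_zero, add_zero] at this
    refine this.trans ?_
    congr 1
    refine ev_congr _ fun t _ => ?_
    congr 1; omega
  · simp only [curv_incl_succ, cup_incl]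
    rw [← map_smul]
    refine (curv_incl_succ W (p + 1 + q) _).trans ?_
    refine incl_eq_add (by omega) rfl _ _ _ fun a => ?_
    rw [ev_curv, ev_smul, ev_cup, ev_cup, ev_curv, ev_curv]
    refine (ev_curv_cup W φ ψ a).trans ?_
    congr 2
    refine ev_congr _ fun t _ => ?_
    congr 1; omega

/-- The graded Leibniz rule. -/
theorem curvedDiff_cup (j : A →ₐ[k] B) (W : A) (x y : CompactCochain k A B) :
    curvedDiff j W (cup x y) = cup (curvedDiff j W x) y + cup (signOp x) (curvedDiff j W y) := by
  induction x using CompactCochain.induction with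
  | zero => simp
  | add x x' hx hx' => simp only [map_add, LinearMap.add_apply, hx, hx']; abel
  | incl p φ =>
    induction y using CompactCochain.induction with
    | zero => simp
    | add y y' hy hy' => simp only [map_add, hy, hy']; abel
    | incl q ψ =>
      simp only [curvedDiff, LinearMap.add_apply, map_add, cup_incl, diff_incl, signOp_incl,
        map_smul, LinearMap.smul_apply, diff_cup_incl, curv_cup_incl]
      abel

theorem curvedDiff_signOp (j : A →ₐ[k] B) (W : A) (x : CompactCochain k A B) :
    curvedDiff j W (signOp x) = -signOp (curvedDiff j W x) := by
  induction x using CompactCochain.induction with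
  | zero => simp
  | add x x' hx hx' => simp only [map_add, hx, hx']; abel
  | incl p φ =>
    rcases p with _ | p
    · simp [curvedDiff, signOp_incl, diff_incl, curv_incl_zero]
    · simp [curvedDiff, signOp_incl, diff_incl, curv_incl_succ, pow_succ]
      abel

theorem signOp_signOp (x : CompactCochain k A B) : signOp (signOp x) = x := by
  induction x using CompactCochain.induction with
  | zero => simp
  | add x x' hx hx' => simp only [map_add, hx, hx']
  | incl p φ => simp [signOp_incl, smul_smul, ← mul_pow]

end Operations

section Cohomology

variable {k A B : Type*} [CommRing k] [Ring A] [Algebra k A] [Ring B] [Algebra k B]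

/-- The cocycles of `∂_H + d_W`. -/
noncomputable abbrev Cocycles (j : A →ₐ[k] B) (W : A) : Submodule k (CompactCochain k A B) :=
  LinearMap.ker (curvedDiff j W)

/-- The coboundaries of `∂_H + d_W`, among the cocycles. -/
noncomputable abbrev Coboundaries (j : A →ₐ[k] B) (W : A) : Submodule k (Cocycles j W) :=
  (LinearMap.range (curvedDiff j W)).submoduleOf (Cocycles j W)

/-- The compact type Hochschild cohomology of the curved algebra `(A, W)` with values in `B`. -/
abbrev HHc (j : A →ₐ[k] B) (W : A) : Type _ := Cocycles j W ⧸ Coboundaries j W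

/-- The class of a cocycle. -/
noncomputable def HHc.mk (j : A →ₐ[k] B) (W : A) : Cocycles j W →ₗ[k] HHc j W := (Coboundaries j W).mkQ

/-- The cup product of cocycles. -/
noncomputable def cupCocycles (j : A →ₐ[k] B) (W : A) :
    Cocycles j W →ₗ[k] Cocycles j W →ₗ[k] Cocycles j W :=
  LinearMap.mk₂ k
    (fun x y => ⟨cup x.1 y.1, by
      rw [LinearMap.mem_ker, curvedDiff_cup, LinearMap.mem_ker.1 x.2, LinearMap.mem_ker.1 y.2]
      simp⟩)
    (fun x x' y => by ext1; simp) (fun c x y => by ext1; simp)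
    (fun x y y' => by ext1; simp) (fun c x y => by ext1; simp)

/-- The cup product on cohomology: `[x] ∪ [y] = [x ∪ y]`. -/
noncomputable def HHc.cup (j : A →ₐ[k] B) (W : A) : HHc j W →ₗ[k] HHc j W →ₗ[k] HHc j W :=
  (Coboundaries j W).liftQ
    ((Coboundaries j W).liftQ ((cupCocycles j W).compr₂ (HHc.mk j W)).flip (by
      rintro ⟨_, hy⟩ ⟨z, rfl⟩
      rw [LinearMap.mem_ker]
      ext x
      refine (Submodule.Quotient.mk_eq_zero _).2 ⟨Hochschild.cup (signOp x.1) z, ?_⟩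
      rw [curvedDiff_cup, curvedDiff_signOp, LinearMap.mem_ker.1 x.2, signOp_signOp]
      simp [cupCocycles])).flip (by
    rintro ⟨_, hx⟩ ⟨z, rfl⟩
    rw [LinearMap.mem_ker]
    ext y
    refine (Submodule.Quotient.mk_eq_zero _).2 ⟨Hochschild.cup z y.1, ?_⟩
    rw [curvedDiff_cup, LinearMap.mem_ker.1 y.2]
    simp [cupCocycles])

theorem HHc.cup_mk (j : A →ₐ[k] B) (W : A) (x y : Cocycles j W) :
    HHc.cup j W (HHc.mk j W x) (HHc.mk j W y) = HHc.mk j W (cupCocycles j W x y) := rfl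

end Cohomology

end Hochschild

/-! ## Polynomials, the torus action and the crossed product -/

open MvPolynomial

/-- The torus `(ℂ^×)^N`, with coordinates indexed by `σ`. -/
abbrev Torus (σ : Type*) : Type _ := σ → ℂˣ

namespace Torus

/-- `f ↦ ᵍf`, the algebra endomorphism with `ᵍxᵢ = λᵢ xᵢ` for `g = (λᵢ)ᵢ`. -/
noncomputable def act {σ : Type*} (g : Torus σ) : MvPolynomial σ ℂ →ₐ[ℂ] MvPolynomial σ ℂ :=
  aeval fun i => C (g i : ℂ) * X i

noncomputable instance {σ : Type*} : MulSemiringAction (Torus σ) (MvPolynomial σ ℂ) where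
  smul g f := act g f
  one_smul f := by
    change act 1 f = f
    have : act (1 : Torus σ) = AlgHom.id ℂ (MvPolynomial σ ℂ) := by
      ext i; simp [act]
    rw [this]; rfl
  mul_smul g h f := by
    change act (g * h) f = act g (act h f)
    have : act (g * h) = (act g).comp (act h) := by
      apply MvPolynomial.algHom_ext
      intro i
      simp only [act, aeval_X, AlgHom.comp_apply, map_mul, algHom_C, algebraMap_eq, Pi.mul_apply,
        Units.val_mul]
      ring
    rw [this]; rfl
  smul_zero g := map_zero (act g)
  smul_add g := map_add (act g)
  smul_one g := map_one (act g)
  smul_mul g := map_mul (act g)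

theorem smul_def {σ : Type*} (g : Torus σ) (f : MvPolynomial σ ℂ) : g • f = act g f := rfl

instance {σ : Type*} : SMulCommClass (Torus σ) ℂ (MvPolynomial σ ℂ) where
  smul_comm g c f := map_smul (act g) c f

instance {σ : Type*} (G : Subgroup (Torus σ)) : SMulCommClass G ℂ (MvPolynomial σ ℂ) where
  smul_comm g c f := map_smul (act g.1) c f

end Torus

/-- `G_W`, the group of all diagonal symmetries of `W`. -/
noncomputable def symmetryGroup {σ : Type*} (W : MvPolynomial σ ℂ) : Subgroup (Torus σ) :=
  MulAction.stabilizer (Torus σ) W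

/-- The crossed product `A[G]`, with `(a₁ g₁)(a₂ g₂) = a₁ (ᵍ¹a₂) g₁g₂`; the element `a g` is
`SkewMonoidAlgebra.single g a`. -/
abbrev CrossedProduct {σ : Type*} (G : Subgroup (Torus σ)) : Type _ :=
  SkewMonoidAlgebra (MvPolynomial σ ℂ) G

/-- The inclusion `A → A[G]`, `a ↦ a e`. -/
noncomputable def unitSector {σ : Type*} (G : Subgroup (Torus σ)) :
    MvPolynomial σ ℂ →ₐ[ℂ] CrossedProduct G :=
  { SkewMonoidAlgebra.singleOneRingHom with commutes' := fun _ => rfl }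

/-- `HH_c(A_W, A_W[G])`. -/
abbrev OrbifoldHH {σ : Type*} (W : MvPolynomial σ ℂ) (G : Subgroup (Torus σ)) : Type _ :=
  Hochschild.HHc (unitSector G) W

/-- The cup product of `HH_c(A_W, A_W[G])`. -/
noncomputable abbrev orbifoldCup {σ : Type*} (W : MvPolynomial σ ℂ) (G : Subgroup (Torus σ)) :
    OrbifoldHH W G →ₗ[ℂ] OrbifoldHH W G →ₗ[ℂ] OrbifoldHH W G :=
  Hochschild.HHc.cup (unitSector G) W

/-- `f ↦ f e`, as a cocycle of degree `0`. -/
noncomputable def functionCocycle {σ : Type*} (W : MvPolynomial σ ℂ) (G : Subgroup (Torus σ))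
    (f : MvPolynomial σ ℂ) : Hochschild.Cocycles (unitSector G) W :=
  ⟨Hochschild.incl 0 (MultilinearMap.constOfIsEmpty ℂ _ (unitSector G f)), by
    rw [LinearMap.mem_ker, Hochschild.curvedDiff, LinearMap.add_apply, Hochschild.curv_incl_zero,
      Hochschild.diff_incl, add_zero]
    refine Eq.trans (congrArg _ ?_) (map_zero _)
    ext1 v
    simp [Hochschild.diffAt, Hochschild.leftMap, Hochschild.rightMap, ← map_mul, mul_comm]⟩

/-- The class of a polynomial `f` in the untwisted sector. -/
noncomputable def functionClass {σ : Type*} (W : MvPolynomial σ ℂ) (G : Subgroup (Torus σ))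
    (f : MvPolynomial σ ℂ) : OrbifoldHH W G :=
  Hochschild.HHc.mk _ _ (functionCocycle W G f)

/-! ## Quantum differential operators, the twisted Koszul complex and sector generators -/

section Koszul

variable {σ : Type*} [Fintype σ] [LinearOrder σ]

/-- The moving index `I_g` of `g`: the variables with `ᵍxᵢ ≠ xᵢ`. -/
noncomputable def movingIndex (g : Torus σ) : Finset σ :=
  open Classical in Finset.univ.filter fun i => g i ≠ 1

/-- `ρᵢ(g)`, which applies `g` to the variables that come before `xᵢ`. -/
noncomputable def rhoOp (g : Torus σ) (i : σ) : MvPolynomial σ ℂ →ₐ[ℂ] MvPolynomial σ ℂ :=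
  aeval fun l => if l < i then C (g l : ℂ) * X l else X l

/-- The quantum differential operator `∂^g_{xᵢ}`, with
`x^γ ↦ (1 + λᵢ + ⋯ + λᵢ^{γᵢ-1}) x^γ / xᵢ`, which is `0` if `γᵢ = 0`. -/
noncomputable def quantumDiff (g : Torus σ) (i : σ) : MvPolynomial σ ℂ →ₗ[ℂ] MvPolynomial σ ℂ :=
  (basisMonomials σ ℂ).constr ℂ fun γ =>
    monomial (γ - Finsupp.single i 1) (∑ s ∈ Finset.range (γ i), (g i : ℂ) ^ s)

/-- The `g`-sector of the twisted Koszul cochains: `κ` stands for `∑_I κ(I) e_I g`, where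
`e_I = e_{i₁} ⋯ e_{i_p}` for `I = {i₁ < ⋯ < i_p}`. -/
abbrev KoszulCochain (σ : Type*) : Type _ := Finset σ → MvPolynomial σ ℂ

/-- The sign of moving `eᵢ` past the `e_l`, `l ∈ I`, `l < i`. -/
def koszulSign (I : Finset σ) (i : σ) : ℤ := (-1) ^ (I.filter (· < i)).card

/-- The Koszul differential `∂_K(a e_I g) = ∑ᵢ (xᵢ - ᵍxᵢ) eᵢ a e_I g`. -/
noncomputable def koszulDiff (g : Torus σ) (κ : KoszulCochain σ) : KoszulCochain σ := fun J =>
  ∑ i ∈ J, koszulSign J i • ((X i - g • X i) * κ (J.erase i))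

/-- The curving differential
`a e_{i₁} ⋯ e_{i_p} g ↦ ∑ₘ (-1)^{m-1} a ρ_{iₘ}(g)(∂^g_{x_{iₘ}} W) e_{i₁} ⋯ ê_{iₘ} ⋯ e_{i_p} g`. -/
noncomputable def koszulCurv (W : MvPolynomial σ ℂ) (g : Torus σ) (κ : KoszulCochain σ) :
    KoszulCochain σ := fun J =>
  ∑ i ∈ Jᶜ, koszulSign J i • (κ (insert i J) * rhoOp g i (quantumDiff g i W))

/-- `Υ^*(a e_I g)`: for `I = {i₁ < ⋯ < i_p}` the Hochschild cochain
`(a₁, …, a_p) ↦ a ρ_{i₁}(g)(∂^g_{x_{i₁}} a₁) ⋯ ρ_{i_p}(g)(∂^g_{x_{i_p}} a_p) g`. -/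
noncomputable def upsilonTerm (G : Subgroup (Torus σ)) (g : G) (a : MvPolynomial σ ℂ)
    (I : Finset σ) :
    Hochschild.Cochain ℂ (MvPolynomial σ ℂ) (CrossedProduct G) I.card :=
  ((SkewMonoidAlgebra.lsingle (R := ℂ) g).comp (LinearMap.mulLeft ℂ a)).compMultilinearMap
    ((MultilinearMap.mkPiAlgebra ℂ (Fin I.card) (MvPolynomial σ ℂ)).compLinearMap fun m =>
      (rhoOp g.1 (I.orderEmbOfFin rfl m)).toLinearMap.comp
        (quantumDiff g.1 (I.orderEmbOfFin rfl m)))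

/-- The cochain map `Υ^*` from the `g`-sector of the Koszul cochains to Hochschild cochains. -/
noncomputable def upsilon (G : Subgroup (Torus σ)) (g : G) (κ : KoszulCochain σ) :
    Hochschild.CompactCochain ℂ (MvPolynomial σ ℂ) (CrossedProduct G) :=
  ∑ I : Finset σ, Hochschild.incl I.card (upsilonTerm G g (κ I) I)

/-- `κ = κ₀ + κ₋₂ + κ₋₄ + ⋯` is a Koszul cocycle with leading term `κ₀ = e_{I_g} g`, where
`κ₋₂ₘ` has degree `|I_g| - 2m`. -/
structure IsKoszulRepresentative (W : MvPolynomial σ ℂ) (g : Torus σ) (κ : KoszulCochain σ) :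
    Prop where
  leading : κ (movingIndex g) = 1
  lower : ∀ I, I ≠ movingIndex g → κ I ≠ 0 →
    ∃ m : ℕ, 0 < m ∧ I.card + 2 * m = (movingIndex g).card
  closed : koszulDiff g κ + koszulCurv W g κ = 0

/-- `c` is the generator `𝟙_g = Θ_g(1)` of the `g`-sector: the class of the Hochschild cocycle
`Υ^*(κ)` for a Koszul cocycle `κ` that extends `e_{I_g} g`. -/
def IsSectorGenerator (W : MvPolynomial σ ℂ) (G : Subgroup (Torus σ)) (g : G)
    (c : OrbifoldHH W G) : Prop :=
  ∃ κ : KoszulCochain σ, IsKoszulRepresentative W g.1 κ ∧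
    ∃ h : upsilon G g κ ∈ Hochschild.Cocycles (unitSector G) W,
      c = Hochschild.HHc.mk _ _ ⟨upsilon G g κ, h⟩

/-- The generator `𝟙_g` of the `g`-sector. -/
noncomputable def sectorGenerator (W : MvPolynomial σ ℂ) (G : Subgroup (Torus σ)) (g : G) :
    OrbifoldHH W G :=
  Classical.epsilon (IsSectorGenerator W G g)

end Koszul

/-! ## Invertible polynomials and twisted Hessians -/

/-- Elementary invertible polynomials. -/
inductive ElementaryInvertible : Type
  /-- `x₁ⁿ` -/
  | fermat (n : ℕ) (hn : 2 ≤ n)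
  /-- `x₁^{n₁} x₂ + x₂^{n₂} x₃ + ⋯ + x_N^{n_N} x₁` -/
  | loop (N : ℕ) (hN : 2 ≤ N) (n : Fin N → ℕ) (hn : ∀ i, 2 ≤ n i)
  /-- `x₁^{n₁} x₂ + x₂^{n₂} x₃ + ⋯ + x_N^{n_N}` -/
  | chain (N : ℕ) (hN : 2 ≤ N) (n : Fin N → ℕ) (hn : ∀ i, 2 ≤ n i)

namespace ElementaryInvertible

/-- The number of variables. -/
def dim : ElementaryInvertible → ℕ
  | fermat _ _ => 1
  | loop N _ _ _ => N
  | chain N _ _ _ => N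

/-- The polynomial. -/
noncomputable def poly : (E : ElementaryInvertible) → MvPolynomial (Fin E.dim) ℂ
  | fermat n _ => (X (0 : Fin 1) ^ n : MvPolynomial (Fin 1) ℂ)
  | loop N _ n _ => (∑ i : Fin N, X i ^ n i * X (finRotate N i) : MvPolynomial (Fin N) ℂ)
  | chain N _ n _ => (∑ i : Fin N, X i ^ n i *
      (if h : i.val + 1 < N then X ⟨i.val + 1, h⟩ else 1) : MvPolynomial (Fin N) ℂ)

/-- The `g`-twisted Hessian, for `g = (λᵢ)ᵢ ≠ e`.  In the chain case `l = l_g` is the number of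
moving variables, which are the first `l` variables. -/
noncomputable def hess : (E : ElementaryInvertible) → Torus (Fin E.dim) →
    MvPolynomial (Fin E.dim) ℂ
  | fermat n _, g =>
      (C ((n : ℂ) / (1 - (g (0 : Fin 1) : ℂ))) * X (0 : Fin 1) ^ (n - 2) :
        MvPolynomial (Fin 1) ℂ)
  | loop N _ n _, g =>
      (C (((-1) ^ (N + 1) + ∏ i : Fin N, (n i : ℂ)) / ∏ i : Fin N, (1 - (g i : ℂ))) *
        ∏ i : Fin N, X i ^ (n i - 1) : MvPolynomial (Fin N) ℂ)
  | chain N _ n _, g =>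
      let l : ℕ := (movingIndex (σ := Fin N) g).card
      (C (∏ i : Fin N with i.val < l, ((n i : ℂ) / (1 - (g i : ℂ)))) *
        (∏ i : Fin N with i.val < l, X i ^ (if i.val = 0 then n i - 2 else n i - 1)) *
        (if h : l < N then X ⟨l, h⟩ else 1) : MvPolynomial (Fin N) ℂ)

end ElementaryInvertible

/-- The index set of the variables of `W₁ ⊕ ⋯ ⊕ W_r`, block after block. -/
abbrev BlockIndex {r : ℕ} (E : Fin r → ElementaryInvertible) : Type :=
  Σₗ k : Fin r, Fin (E k).dim

/-- The position of the `i`-th variable of the `k`-th block. -/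
def blockVar {r : ℕ} (E : Fin r → ElementaryInvertible) (k : Fin r) (i : Fin (E k).dim) :
    BlockIndex E :=
  toLex ⟨k, i⟩

/-- The invertible polynomial `W₁ ⊕ ⋯ ⊕ W_r`: the sum of elementary ones in separate variables. -/
noncomputable def invertiblePoly {r : ℕ} (E : Fin r → ElementaryInvertible) :
    MvPolynomial (BlockIndex E) ℂ :=
  ∑ k, rename (blockVar E k) (E k).poly

/-- The `k`-th component of an element of the torus. -/
def blockPart {r : ℕ} (E : Fin r → ElementaryInvertible) (g : Torus (BlockIndex E)) (k : Fin r) :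
    Torus (Fin (E k).dim) :=
  fun i => g (blockVar E k i)

/-- The structure constant `s` in `𝟙_g ∪ 𝟙_h = s 𝟙_{gh}` for an elementary invertible polynomial:
`1` if `g = e` or `h = e`, the signed twisted Hessian if `h = g⁻¹ ≠ e`, and `0` otherwise. -/
noncomputable def structureConst (E : ElementaryInvertible) (g h : Torus (Fin E.dim)) :
    MvPolynomial (Fin E.dim) ℂ :=
  open Classical in
  if g = 1 ∨ h = 1 then 1
  else if h = g⁻¹ then
    (-1) ^ ((movingIndex g).card * ((movingIndex g).card - 1) / 2) * E.hess g
  else 0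

/-- The Koszul sign in `(⊗ₖ aₖ)(⊗ₖ bₖ) = ± ⊗ₖ aₖ bₖ` for `aₖ = 𝟙_{gₖ}` and `bₖ = 𝟙_{hₖ}`, whose
parities are the numbers of variables moved by `gₖ` and `hₖ`. -/
noncomputable def kunnethSign {r : ℕ} (E : Fin r → ElementaryInvertible)
    (g h : Torus (BlockIndex E)) : ℤ :=
  ∏ k, ∏ l with l < k,
    (-1) ^ ((movingIndex (blockPart E g k)).card * (movingIndex (blockPart E h l)).card)

open scoped DirectSum
open MvPolynomial
set_option linter.unusedSectionVars false
set_option linter.unusedSimpArgs false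
set_option autoImplicit false
open scoped TensorProduct

/-! ## Creation and annihilation operators -/

namespace Fermion

variable {σ : Type} [LinearOrder σ]

theorem koszulSign_mul_self (J : Finset σ) (i : σ) : koszulSign J i * koszulSign J i = 1 := by
  simp [koszulSign, ← mul_pow]

theorem koszulSign_insert {J : Finset σ} {j : σ} (hj : j ∉ J) (i : σ) :
    koszulSign (insert j J) i = (if j < i then -1 else 1) * koszulSign J i := by
  unfold koszulSign
  rw [Finset.filter_insert]
  split_ifs with h
  · rw [Finset.card_insert_of_notMem (by simp [hj]), pow_succ]; ring
  · simp

theorem koszulSign_erase {J : Finset σ} {j : σ} (hj : j ∈ J) (i : σ) :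
    koszulSign (J.erase j) i = (if j < i then -1 else 1) * koszulSign J i := by
  conv_rhs => rw [← Finset.insert_erase hj, koszulSign_insert (Finset.notMem_erase j J)]
  split_ifs <;> simp

theorem koszulSign_union {J K : Finset σ} (h : Disjoint J K) (i : σ) :
    koszulSign (J ∪ K) i = koszulSign J i * koszulSign K i := by
  unfold koszulSign
  rw [Finset.filter_union, Finset.card_union_of_disjoint (Finset.disjoint_filter_filter h), pow_add]

theorem koszulSign_of_forall_le {J : Finset σ} {i : σ} (h : ∀ j ∈ J, i ≤ j) :
    koszulSign J i = 1 := by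
  unfold koszulSign
  rw [Finset.filter_eq_empty_iff.2 fun j hj => (h j hj).not_gt]
  rfl

variable (R : Type) {M N : Type} [CommRing R] [AddCommGroup M] [Module R M] [AddCommGroup N]
  [Module R N]

/-- The creation operator `κ ↦ eᵢ κ`. -/
def create (i : σ) : (Finset σ → M) →ₗ[R] (Finset σ → M) where
  toFun κ J := if i ∈ J then koszulSign J i • κ (J.erase i) else 0
  map_add' κ κ' := by ext J; by_cases h : i ∈ J <;> simp [h]
  map_smul' c κ := by ext J; simp only [Pi.smul_apply, RingHom.id_apply]; split_ifs; all_goals simp [smul_comm c]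

/-- The annihilation operator `∂/∂eᵢ`. -/
def annihilate (i : σ) : (Finset σ → M) →ₗ[R] (Finset σ → M) where
  toFun κ J := if i ∈ J then 0 else koszulSign J i • κ (insert i J)
  map_add' κ κ' := by ext J; by_cases h : i ∈ J <;> simp [h]
  map_smul' c κ := by ext J; simp only [Pi.smul_apply, RingHom.id_apply]; split_ifs; all_goals simp [smul_comm c]

/-- The operator `κ ↦ ∑ κ(J) e_J`, the sum over the `J` all of whose elements exceed `i`. -/
def above (i : σ) : (Finset σ → M) →ₗ[R] (Finset σ → M) where
  toFun κ J := if ∀ j ∈ J, i < j then κ J else 0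
  map_add' κ κ' := by ext J; simp only [Pi.add_apply]; split_ifs <;> simp
  map_smul' c κ := by
    ext J; simp only [Pi.smul_apply, RingHom.id_apply]; split_ifs <;> simp

/-- `tail i κ` is the coefficient of `eᵢ` in the terms of `κ` that begin with `eᵢ`. -/
def tail (i : σ) : (Finset σ → M) →ₗ[R] (Finset σ → M) := above R i ∘ₗ annihilate R i

variable {R}

theorem create_apply (i : σ) (κ : Finset σ → M) (J : Finset σ) :
    create R i κ J = if i ∈ J then koszulSign J i • κ (J.erase i) else 0 := rfl

theorem annihilate_apply (i : σ) (κ : Finset σ → M) (J : Finset σ) :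
    annihilate R i κ J = if i ∈ J then 0 else koszulSign J i • κ (insert i J) := rfl

theorem above_apply (i : σ) (κ : Finset σ → M) (J : Finset σ) :
    above R i κ J = if ∀ j ∈ J, i < j then κ J else 0 := rfl

theorem tail_apply (i : σ) (κ : Finset σ → M) (J : Finset σ) :
    tail R i κ J = if ∀ j ∈ J, i < j then κ (insert i J) else 0 := by
  simp only [tail, LinearMap.comp_apply, above_apply, annihilate_apply]
  split_ifs with h h'
  · exact absurd (h i h') (lt_irrefl i)
  · rw [koszulSign_of_forall_le fun j hj => (h j hj).le, one_smul]
  · rfl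

theorem create_create (i j : σ) (κ : Finset σ → M) :
    create R i (create R j κ) = -create R j (create R i κ) := by
  ext J
  simp only [create_apply, Pi.neg_apply, Finset.mem_erase]
  rcases eq_or_ne i j with rfl | hij
  · simp
  by_cases hi : i ∈ J <;> by_cases hj : j ∈ J <;> simp only [hi, hj, hij, hij.symm, ne_eq,
    not_false_eq_true, and_self, and_true, and_false, if_true, if_false, smul_zero, neg_zero]
  rw [koszulSign_erase hi, koszulSign_erase hj, smul_smul, smul_smul, ← neg_smul,
    Finset.erase_right_comm]
  congr 1
  rcases lt_or_gt_of_ne hij with h | h <;> simp [h, h.not_gt] <;> ring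

theorem annihilate_annihilate (i j : σ) (κ : Finset σ → M) :
    annihilate R i (annihilate R j κ) = -annihilate R j (annihilate R i κ) := by
  ext J
  simp only [annihilate_apply, Pi.neg_apply, Finset.mem_insert]
  rcases eq_or_ne i j with rfl | hij
  · simp
  by_cases hi : i ∈ J <;> by_cases hj : j ∈ J <;> simp only [hi, hj, hij, hij.symm, or_true,
    or_false, if_true, if_false, smul_zero, neg_zero]
  rw [koszulSign_insert hi, koszulSign_insert hj, smul_smul, smul_smul, ← neg_smul,
    Finset.insert_comm]
  congr 1
  rcases lt_or_gt_of_ne hij with h | h <;> simp [h, h.not_gt] <;> ring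

theorem annihilate_create_self (i : σ) (κ : Finset σ → M) :
    annihilate R i (create R i κ) = κ - create R i (annihilate R i κ) := by
  ext J
  simp only [create_apply, annihilate_apply, Pi.sub_apply]
  by_cases hi : i ∈ J
  · simp [hi, koszulSign_erase, smul_smul, koszulSign_mul_self]
  · simp [hi, koszulSign_insert, smul_smul, koszulSign_mul_self]

theorem annihilate_create_of_ne {i j : σ} (hij : i ≠ j) (κ : Finset σ → M) :
    annihilate R i (create R j κ) = -create R j (annihilate R i κ) := by
  ext J
  simp only [create_apply, annihilate_apply, Pi.neg_apply, Finset.mem_insert, Finset.mem_erase]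
  by_cases hi : i ∈ J <;> by_cases hj : j ∈ J <;> simp only [hi, hj, hij, hij.symm, ne_eq,
    not_false_eq_true, and_self, or_true, true_or, or_false, and_true, and_false, if_true,
    if_false, smul_zero, neg_zero]
  rw [koszulSign_insert hi, koszulSign_erase hj, smul_smul, smul_smul, ← neg_smul,
    Finset.erase_insert_of_ne hij]
  congr 1
  rcases lt_or_gt_of_ne hij with h | h <;> simp [h, h.not_gt] <;> ring

theorem create_self (i : σ) (κ : Finset σ → M) : create R i (create R i κ) = 0 := by
  ext J; simp [create_apply]

theorem annihilate_self (i : σ) (κ : Finset σ → M) : annihilate R i (annihilate R i κ) = 0 := by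
  ext J; simp [annihilate_apply]

theorem above_create_of_lt {i j : σ} (h : i < j) (κ : Finset σ → M) :
    above R i (create R j κ) = create R j (above R i κ) := by
  ext J
  simp only [above_apply, create_apply]
  by_cases hj : j ∈ J
  · simp only [hj, if_true]
    by_cases hJ : ∀ l ∈ J, i < l
    · rw [if_pos hJ, if_pos fun l hl => hJ l (Finset.mem_of_mem_erase hl)]
    · rw [if_neg hJ, if_neg, smul_zero]
      refine fun H => hJ fun l hl => ?_
      rcases eq_or_ne l j with rfl | hl'
      · exact h
      · exact H l (Finset.mem_erase.2 ⟨hl', hl⟩)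
  · simp [hj]

theorem above_create_of_le {i j : σ} (h : j ≤ i) (κ : Finset σ → M) :
    above R i (create R j κ) = 0 := by
  ext J
  simp only [above_apply, create_apply, Pi.zero_apply]
  split_ifs with h1 h2
  · exact absurd (h1 j h2) h.not_gt
  · rfl
  · rfl

theorem above_annihilate_of_lt {i j : σ} (h : i < j) (κ : Finset σ → M) :
    above R i (annihilate R j κ) = annihilate R j (above R i κ) := by
  ext J
  simp only [above_apply, annihilate_apply]
  by_cases hj : j ∈ J
  · simp [hj]
  · by_cases hJ : ∀ l ∈ J, i < l
    · simp only [hj, if_false]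
      rw [if_pos hJ, if_pos]
      simpa [h] using hJ
    · simp only [hj, if_false]
      rw [if_neg hJ, if_neg, smul_zero]
      simpa [h] using hJ

theorem tail_create_self (i : σ) (κ : Finset σ → M) : tail R i (create R i κ) = above R i κ := by
  rw [tail, LinearMap.comp_apply, annihilate_create_self, map_sub, above_create_of_le le_rfl,
    sub_zero]

theorem tail_create_of_lt {i j : σ} (h : i < j) (κ : Finset σ → M) :
    tail R i (create R j κ) = -create R j (tail R i κ) := by
  rw [tail, LinearMap.comp_apply, annihilate_create_of_ne h.ne, map_neg, above_create_of_lt h]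
  rfl

theorem tail_create_of_gt {i j : σ} (h : j < i) (κ : Finset σ → M) :
    tail R i (create R j κ) = 0 := by
  rw [tail, LinearMap.comp_apply, annihilate_create_of_ne h.ne', map_neg, above_create_of_le h.le,
    neg_zero]

theorem tail_annihilate_self (i : σ) (κ : Finset σ → M) : tail R i (annihilate R i κ) = 0 := by
  rw [tail, LinearMap.comp_apply, annihilate_self, map_zero]

theorem tail_annihilate_of_lt {i j : σ} (h : i < j) (κ : Finset σ → M) :
    tail R i (annihilate R j κ) = -annihilate R j (tail R i κ) := by
  rw [tail, LinearMap.comp_apply, annihilate_annihilate, map_neg, above_annihilate_of_lt h]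
  rfl

theorem tail_annihilate_of_gt {i j : σ} (h : j < i) (κ : Finset σ → M) :
    tail R i (annihilate R j κ) = tail R i (tail R j κ) := by
  ext J
  rw [tail_apply, tail_apply, annihilate_apply, tail_apply]
  split_ifs with h1 h2 h3 h3
  · exact absurd (h3 j h2) (lt_irrefl j)
  · exact absurd (Finset.mem_insert.1 h2) (by
      rintro (rfl | h4)
      · exact lt_irrefl _ h
      · exact (h1 j h4).not_gt h)
  · rw [koszulSign_of_forall_le fun l hl => (h3 l hl).le, one_smul]
  · refine absurd (fun l hl => ?_) h3
    rcases Finset.mem_insert.1 hl with rfl | hl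
    · exact h
    · exact h.trans (h1 l hl)
  · rfl

theorem tail_above_of_lt {i j : σ} (h : j < i) (κ : Finset σ → M) :
    tail R i (above R j κ) = tail R i κ := by
  ext J
  rw [tail_apply, tail_apply, above_apply]
  split_ifs with h1 h2
  · rfl
  · refine absurd (fun l hl => ?_) h2
    rcases Finset.mem_insert.1 hl with rfl | hl
    · exact h
    · exact h.trans (h1 l hl)
  · rfl

theorem tail_above_of_ge {i j : σ} (h : i ≤ j) (κ : Finset σ → M) :
    tail R i (above R j κ) = 0 := by
  ext J
  rw [tail_apply, above_apply]
  split_ifs with h1 h2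
  · exact absurd (h2 i (Finset.mem_insert_self i J)) h.not_gt
  · rfl
  · rfl

theorem tail_tail_of_ge {i j : σ} (h : i ≤ j) (κ : Finset σ → M) :
    tail R i (tail R j κ) = 0 := by
  rw [tail, tail, LinearMap.comp_apply, ← LinearMap.comp_apply, LinearMap.comp_apply]
  exact tail_above_of_ge h _

/-- A linear map applied to all coefficients. -/
def mapCoeff (f : M →ₗ[R] N) : (Finset σ → M) →ₗ[R] (Finset σ → N) :=
  LinearMap.pi fun J => f ∘ₗ LinearMap.proj J

@[simp]
theorem mapCoeff_apply (f : M →ₗ[R] N) (κ : Finset σ → M) (J : Finset σ) :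
    mapCoeff f κ J = f (κ J) := rfl

theorem create_mapCoeff (f : M →ₗ[R] N) (i : σ) (κ : Finset σ → M) :
    create R i (mapCoeff f κ) = mapCoeff f (create R i κ) := by
  ext J; simp only [create_apply, mapCoeff_apply]; split_ifs <;> simp

theorem annihilate_mapCoeff (f : M →ₗ[R] N) (i : σ) (κ : Finset σ → M) :
    annihilate R i (mapCoeff f κ) = mapCoeff f (annihilate R i κ) := by
  ext J; simp only [annihilate_apply, mapCoeff_apply]; split_ifs <;> simp

theorem above_mapCoeff (f : M →ₗ[R] N) (i : σ) (κ : Finset σ → M) :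
    above R i (mapCoeff f κ) = mapCoeff f (above R i κ) := by
  ext J; simp only [above_apply, mapCoeff_apply]; split_ifs <;> simp

theorem tail_mapCoeff (f : M →ₗ[R] N) (i : σ) (κ : Finset σ → M) :
    tail R i (mapCoeff f κ) = mapCoeff f (tail R i κ) := by
  rw [tail, LinearMap.comp_apply, annihilate_mapCoeff, above_mapCoeff]; rfl

end Fermion

/-! ## Divided differences -/

namespace DividedDiff

variable {σ : Type} [Fintype σ] [LinearOrder σ]

variable (σ) in
/-- `A ⊗ A`, the polynomials in two sets of variables. -/
abbrev Env : Type := MvPolynomial σ ℂ ⊗[ℂ] MvPolynomial σ ℂ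

/-- The `i`-th variable of the first or, if `b` holds, of the second set. -/
noncomputable def var (b : Prop) [Decidable b] (i : σ) : Env σ :=
  if b then 1 ⊗ₜ X i else X i ⊗ₜ 1

/-- `xᵢ - yᵢ`. -/
noncomputable def gap (i : σ) : Env σ := X i ⊗ₜ 1 - 1 ⊗ₜ X i

/-- The substitution of `yⱼ` for `xⱼ`, `j ∈ S`. -/
noncomputable def subst (S : Finset σ) : MvPolynomial σ ℂ →ₐ[ℂ] Env σ :=
  aeval fun j => var (j ∈ S) j

/-- The indices before `i`. -/
def before (i : σ) : Finset σ := Finset.univ.filter (· < i)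

/-- The indices up to `i`. -/
def upto (i : σ) : Finset σ := Finset.univ.filter (· ≤ i)

@[simp] theorem mem_before {i j : σ} : j ∈ before i ↔ j < i := by simp [before]

@[simp] theorem mem_upto {i j : σ} : j ∈ upto i ↔ j ≤ i := by simp [upto]

/-- The value of the `i`-th divided difference on the monomial `x^γ`. -/
noncomputable def diffMonomial (i : σ) (γ : σ →₀ ℕ) : Env σ :=
  (∏ j ∈ Finset.univ.erase i, var (j < i) j ^ γ j) *
    ∑ s ∈ Finset.range (γ i), (X i ⊗ₜ[ℂ] (1 : MvPolynomial σ ℂ)) ^ s *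
      ((1 : MvPolynomial σ ℂ) ⊗ₜ[ℂ] X i) ^ (γ i - 1 - s)

/-- The divided difference
`(a(y₁, …, yᵢ₋₁, xᵢ, …) - a(y₁, …, yᵢ, xᵢ₊₁, …)) / (xᵢ - yᵢ)`. -/
noncomputable def ddiff (i : σ) : MvPolynomial σ ℂ →ₗ[ℂ] Env σ :=
  (basisMonomials σ ℂ).constr ℂ (diffMonomial i)

theorem ddiff_monomial (i : σ) (γ : σ →₀ ℕ) : ddiff i (monomial γ 1) = diffMonomial i γ := by
  have := (basisMonomials σ ℂ).constr_basis ℂ (diffMonomial i) γ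
  rwa [coe_basisMonomials] at this

theorem subst_monomial (S : Finset σ) (γ : σ →₀ ℕ) :
    subst S (monomial γ 1) = ∏ j, var (j ∈ S) j ^ γ j := by
  rw [subst, aeval_monomial, map_one, one_mul, Finsupp.prod_fintype _ _ (by simp)]

theorem subst_before_monomial (i : σ) (γ : σ →₀ ℕ) : subst (before i) (monomial γ 1) =
    (∏ j ∈ Finset.univ.erase i, var (j < i) j ^ γ j) * (X i ⊗ₜ 1) ^ γ i := by
  rw [subst_monomial, ← Finset.prod_erase_mul _ _ (Finset.mem_univ i)]
  congr 1
  · exact Finset.prod_congr rfl fun j _ => by simp only [var, mem_before]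
  · simp [var]

theorem subst_upto_monomial (i : σ) (γ : σ →₀ ℕ) : subst (upto i) (monomial γ 1) =
    (∏ j ∈ Finset.univ.erase i, var (j < i) j ^ γ j) * (1 ⊗ₜ X i) ^ γ i := by
  rw [subst_monomial, ← Finset.prod_erase_mul _ _ (Finset.mem_univ i)]
  congr 1
  · refine Finset.prod_congr rfl fun j hj => ?_
    simp only [var, mem_upto, ((Finset.mem_erase.1 hj).1).le_iff_lt]
  · simp [var]

theorem gap_mul_ddiff (i : σ) (a : MvPolynomial σ ℂ) :
    gap i * ddiff i a = subst (before i) a - subst (upto i) a := by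
  have key : (LinearMap.mulLeft ℂ (gap i)).comp (ddiff i) =
      (subst (before i)).toLinearMap - (subst (upto i)).toLinearMap := by
    refine (basisMonomials σ ℂ).ext fun γ => ?_
    simp only [coe_basisMonomials, LinearMap.comp_apply, LinearMap.mulLeft_apply,
      LinearMap.sub_apply, AlgHom.toLinearMap_apply, ddiff_monomial, subst_before_monomial,
      subst_upto_monomial, diffMonomial, gap]
    rw [mul_left_comm, mul_comm (_ - _), geom_sum₂_mul, mul_sub]
  exact LinearMap.congr_fun key a

theorem geom_sum_add {R : Type*} [CommRing R] (x y : R) (m n : ℕ) :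
    ∑ s ∈ Finset.range (m + n), x ^ s * y ^ (m + n - 1 - s) =
      (∑ s ∈ Finset.range m, x ^ s * y ^ (m - 1 - s)) * y ^ n +
        x ^ m * ∑ s ∈ Finset.range n, x ^ s * y ^ (n - 1 - s) := by
  rw [Finset.sum_range_add, Finset.sum_mul, Finset.mul_sum]
  congr 1
  · refine Finset.sum_congr rfl fun s hs => ?_
    have := Finset.mem_range.1 hs
    rw [mul_assoc, ← pow_add]
    congr 2; omega
  · refine Finset.sum_congr rfl fun s _ => ?_
    rw [← mul_assoc, ← pow_add]
    congr 2; omega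

theorem ddiff_mul (i : σ) (a b : MvPolynomial σ ℂ) :
    ddiff i (a * b) = ddiff i a * subst (upto i) b + subst (before i) a * ddiff i b := by
  have key : (LinearMap.mul ℂ (MvPolynomial σ ℂ)).compr₂ (ddiff i) =
      (LinearMap.mul ℂ (Env σ)).compl₁₂ (ddiff i) (subst (upto i)).toLinearMap +
      (LinearMap.mul ℂ (Env σ)).compl₁₂ (subst (before i)).toLinearMap (ddiff i) := by
    refine (basisMonomials σ ℂ).ext fun γ => (basisMonomials σ ℂ).ext fun δ => ?_
    simp only [coe_basisMonomials, LinearMap.compr₂_apply, LinearMap.mul_apply',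
      LinearMap.add_apply, LinearMap.compl₁₂_apply, AlgHom.toLinearMap_apply, monomial_mul,
      mul_one, ddiff_monomial, subst_before_monomial, subst_upto_monomial, diffMonomial,
      Finsupp.add_apply, geom_sum_add, pow_add, Finset.prod_mul_distrib]
    ring
  exact LinearMap.congr_fun₂ key a b

theorem ddiff_one (i : σ) : ddiff i (1 : MvPolynomial σ ℂ) = 0 := by
  have := ddiff_monomial i (0 : σ →₀ ℕ)
  rw [show (monomial 0 1 : MvPolynomial σ ℂ) = 1 from rfl] at this
  rw [this, diffMonomial]
  simp

theorem ddiff_X (i j : σ) : ddiff i (X j : MvPolynomial σ ℂ) = if i = j then 1 else 0 := by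
  rw [X, ddiff_monomial, diffMonomial]
  rcases eq_or_ne i j with rfl | h
  · rw [Finset.prod_eq_one]
    · simp [Algebra.TensorProduct.one_def]
    · intro l hl
      rw [Finsupp.single_eq_of_ne (Finset.mem_erase.1 hl).1, pow_zero]
  · rw [if_neg h, Finsupp.single_eq_of_ne h]
    simp

theorem subst_empty : subst (∅ : Finset σ) = Algebra.TensorProduct.includeLeft := by
  refine MvPolynomial.algHom_ext fun i => ?_
  simp [subst, var]

theorem subst_univ : subst (Finset.univ : Finset σ) = Algebra.TensorProduct.includeRight := by
  refine MvPolynomial.algHom_ext fun i => ?_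
  simp [subst, var]

theorem subst_sub_subst (a : MvPolynomial σ ℂ) (S T : Finset σ) (hST : S ⊆ T)
    (hS : ∀ i ∈ S, ∀ j ≤ i, j ∈ S) (hT : ∀ i ∈ T, ∀ j ≤ i, j ∈ T) :
    subst S a - subst T a = ∑ j ∈ T \ S, gap j * ddiff j a := by
  induction hn : (T \ S).card generalizing T with
  | zero =>
    rw [Finset.card_eq_zero] at hn
    have : T = S := (Finset.sdiff_eq_empty_iff_subset.1 hn).antisymm hST
    subst this
    simp
  | succ n ih =>
    have hne : (T \ S).Nonempty := Finset.card_pos.1 (by omega)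
    set m := (T \ S).max' hne with hm
    have hmT : m ∈ T \ S := Finset.max'_mem _ _
    rw [Finset.mem_sdiff] at hmT
    have hTm : T = upto m := by
      ext j
      rw [mem_upto]
      refine ⟨fun hj => ?_, fun hj => hT m hmT.1 j hj⟩
      by_contra hjm
      rw [not_le] at hjm
      by_cases hjS : j ∈ S
      · exact hmT.2 (hS j hjS m hjm.le)
      · exact absurd (Finset.le_max' _ j (Finset.mem_sdiff.2 ⟨hj, hjS⟩)) hjm.not_ge
    have hTe : T \ S = insert m (before m \ S) := by
      ext j
      rw [hTm]
      simp only [Finset.mem_sdiff, mem_upto, Finset.mem_insert, mem_before, le_iff_lt_or_eq]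
      constructor
      · rintro ⟨h | h, h'⟩
        · exact Or.inr ⟨h, h'⟩
        · exact Or.inl h
      · rintro (h | ⟨h, h'⟩)
        · exact ⟨Or.inr h, h ▸ hmT.2⟩
        · exact ⟨Or.inl h, h'⟩
    have hmem : m ∉ before m \ S := by simp
    have h1 := ih (before m) (fun j hj => by
        rw [mem_before]
        refine lt_of_le_of_ne (by simpa [hTm] using hST hj) ?_
        rintro rfl
        exact hmT.2 hj) (fun i hi j hj => by
        rw [mem_before] at hi ⊢
        exact hj.trans_lt hi) (by
        rw [hTe, Finset.card_insert_of_notMem hmem] at hn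
        omega)
    rw [hTe, Finset.sum_insert hmem, ← h1, gap_mul_ddiff, ← hTm]
    abel

end DividedDiff

/-! ## Hochschild cochains of a polynomial ring with values in a bimodule -/

/-- An `A`-bimodule structure on a vector space, `A = ℂ[xᵢ]`. -/
structure PolyBimod (σ M : Type) [AddCommGroup M] [Module ℂ M] where
  /-- the left action -/
  left : MvPolynomial σ ℂ →ₐ[ℂ] Module.End ℂ M
  /-- the right action -/
  right : MvPolynomial σ ℂ →ₐ[ℂ] Module.End ℂ M
  comm : ∀ a b, Commute (left a) (right b)

namespace PolyBimod

variable {σ M N : Type} [AddCommGroup M] [Module ℂ M] [AddCommGroup N] [Module ℂ N]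

theorem comm_apply (β : PolyBimod σ M) (a b : MvPolynomial σ ℂ) (m : M) :
    β.left a (β.right b m) = β.right b (β.left a m) :=
  LinearMap.congr_fun (β.comm a b) m

/-- The coinduced bimodule `Hom(A, M)`, with `(a f)(b) = f(b a)` and `(f a)(b) = f(b) a`. -/
noncomputable def coind (β : PolyBimod σ M) : PolyBimod σ (MvPolynomial σ ℂ →ₗ[ℂ] M) where
  left := AlgHom.ofLinearMap
    { toFun := fun a => LinearMap.lcomp ℂ M (LinearMap.mulRight ℂ a)
      map_add' := fun a b => by ext f c; simp [mul_add]
      map_smul' := fun a b => by ext f c; simp }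
    (by ext f c; simp) (fun a b => by
      refine LinearMap.ext fun f => LinearMap.ext fun c => ?_
      simp [mul_assoc])
  right := AlgHom.ofLinearMap
    { toFun := fun a => LinearMap.compRight ℂ (β.right a)
      map_add' := fun a b => by ext f c; simp
      map_smul' := fun a b => by ext f c; simp }
    (by ext f c; simp) (fun a b => by ext f c; simp)
  comm a b := by
    refine LinearMap.ext fun f => LinearMap.ext fun c => ?_
    simp

@[simp] theorem coind_left_apply (β : PolyBimod σ M) (a : MvPolynomial σ ℂ)
    (f : MvPolynomial σ ℂ →ₗ[ℂ] M) (b : MvPolynomial σ ℂ) :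
    β.coind.left a f b = f (b * a) := rfl

@[simp] theorem coind_right_apply (β : PolyBimod σ M) (a : MvPolynomial σ ℂ)
    (f : MvPolynomial σ ℂ →ₗ[ℂ] M) (b : MvPolynomial σ ℂ) :
    β.coind.right a f b = β.right a (f b) := rfl

/-- The action of `A ⊗ A`. -/
noncomputable def act (β : PolyBimod σ M) : DividedDiff.Env σ →ₐ[ℂ] Module.End ℂ M :=
  Algebra.TensorProduct.lift β.left β.right β.comm

theorem act_tmul (β : PolyBimod σ M) (a b : MvPolynomial σ ℂ) :
    β.act (a ⊗ₜ b) = β.left a * β.right b := rfl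

theorem act_comm (β : PolyBimod σ M) (x y : DividedDiff.Env σ) (m : M) :
    β.act x (β.act y m) = β.act y (β.act x m) := by
  rw [← Module.End.mul_apply, ← map_mul, mul_comm, map_mul, Module.End.mul_apply]

theorem act_gap (β : PolyBimod σ M) (i : σ) :
    β.act (DividedDiff.gap i) = β.left (X i) - β.right (X i) := by
  simp [DividedDiff.gap, act_tmul]

theorem act_subst_empty [Fintype σ] [LinearOrder σ] (β : PolyBimod σ M) (a : MvPolynomial σ ℂ) :
    β.act (DividedDiff.subst ∅ a) = β.left a := by
  rw [DividedDiff.subst_empty]; simp [act]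

theorem act_subst_univ [Fintype σ] [LinearOrder σ] (β : PolyBimod σ M) (a : MvPolynomial σ ℂ) :
    β.act (DividedDiff.subst Finset.univ a) = β.right a := by
  rw [DividedDiff.subst_univ]; simp [act]

/-- Maps of right modules. -/
def IsRightHom (β : PolyBimod σ M) (γ : PolyBimod σ N) (f : M →ₗ[ℂ] N) : Prop :=
  ∀ a m, f (β.right a m) = γ.right a (f m)

/-- Maps of bimodules. -/
structure IsHom (β : PolyBimod σ M) (γ : PolyBimod σ N) (f : M →ₗ[ℂ] N) : Prop where
  left : ∀ a m, f (β.left a m) = γ.left a (f m)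
  right : IsRightHom β γ f

theorem IsHom.act {β : PolyBimod σ M} {γ : PolyBimod σ N} {f : M →ₗ[ℂ] N} (hf : IsHom β γ f)
    (x : DividedDiff.Env σ) (m : M) : f (β.act x m) = γ.act x (f m) := by
  induction x using TensorProduct.induction_on with
  | zero => simp
  | tmul a b => simp [act_tmul, hf.left, hf.right a, hf.right b]
  | add x y hx hy => simp [hx, hy]

/-- Postcomposition with `f`. -/
noncomputable def push (f : M →ₗ[ℂ] N) :
    (MvPolynomial σ ℂ →ₗ[ℂ] M) →ₗ[ℂ] (MvPolynomial σ ℂ →ₗ[ℂ] N) :=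
  LinearMap.compRight ℂ f

@[simp] theorem push_apply (f : M →ₗ[ℂ] N) (m : MvPolynomial σ ℂ →ₗ[ℂ] M)
    (b : MvPolynomial σ ℂ) : push f m b = f (m b) := rfl

theorem IsRightHom.push {β : PolyBimod σ M} {γ : PolyBimod σ N} {f : M →ₗ[ℂ] N}
    (hf : IsRightHom β γ f) : IsHom β.coind γ.coind (push f) where
  left a m := rfl
  right a m := by ext b; exact congrArg _ rfl |>.trans (hf a _)

/-- Evaluation at `a`. -/
noncomputable def evAt (a : MvPolynomial σ ℂ) : (MvPolynomial σ ℂ →ₗ[ℂ] M) →ₗ[ℂ] M :=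
  LinearMap.applyₗ a

@[simp] theorem evAt_apply (a : MvPolynomial σ ℂ) (f : MvPolynomial σ ℂ →ₗ[ℂ] M) :
    evAt a f = f a := rfl

theorem isRightHom_evAt (β : PolyBimod σ M) (a : MvPolynomial σ ℂ) :
    IsRightHom β.coind β (evAt a) := fun _ _ => rfl

/-- `m ↦ (b ↦ b m)`. -/
noncomputable def iota (β : PolyBimod σ M) : M →ₗ[ℂ] (MvPolynomial σ ℂ →ₗ[ℂ] M) :=
  β.left.toLinearMap.flip

@[simp] theorem iota_apply (β : PolyBimod σ M) (m : M) (b : MvPolynomial σ ℂ) :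
    β.iota m b = β.left b m := rfl

/-- `m ↦ (b ↦ m b)`. -/
noncomputable def orbit (β : PolyBimod σ M) : M →ₗ[ℂ] (MvPolynomial σ ℂ →ₗ[ℂ] M) :=
  β.right.toLinearMap.flip

@[simp] theorem orbit_apply (β : PolyBimod σ M) (m : M) (b : MvPolynomial σ ℂ) :
    β.orbit m b = β.right b m := rfl

theorem isHom_iota (β : PolyBimod σ M) : IsHom β β.coind β.iota where
  left a m := by ext b; simp
  right a m := by ext b; simp [comm_apply]

theorem isHom_act (β : PolyBimod σ M) (x : DividedDiff.Env σ) : IsHom β β (β.act x) where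
  left a m := by
    have := β.act_comm x (a ⊗ₜ 1) m
    simpa [act_tmul] using this
  right a m := by
    have := β.act_comm x (1 ⊗ₜ a) m
    simpa [act_tmul] using this

end PolyBimod

namespace BarCochain

open PolyBimod DividedDiff

/-- `Hom(A^{⊗ p}, M)`. -/
abbrev Coch (σ M : Type) [AddCommGroup M] [Module ℂ M] (p : ℕ) : Type :=
  MultilinearMap ℂ (fun _ : Fin p => MvPolynomial σ ℂ) M

section Basic

variable {σ M N : Type} [AddCommGroup M] [Module ℂ M] [AddCommGroup N] [Module ℂ N]

/-- Postcomposition with `f`. -/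
noncomputable def post (f : M →ₗ[ℂ] N) {p : ℕ} : Coch σ M p →ₗ[ℂ] Coch σ N p :=
  f.compMultilinearMapₗ ℂ

@[simp] theorem post_apply (f : M →ₗ[ℂ] N) {p : ℕ} (φ : Coch σ M p)
    (v : Fin p → MvPolynomial σ ℂ) : post f φ v = f (φ v) := rfl

/-- Cochains of degree `p + 1` with values in `M` are cochains of degree `p` with values in
`Hom(A, M)`. -/
noncomputable def curry {p : ℕ} :
    Coch σ M (p + 1) ≃ₗ[ℂ] Coch σ (MvPolynomial σ ℂ →ₗ[ℂ] M) p where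
  toFun φ :=
    { toFun := fun v =>
        { toFun := fun b => φ.curryLeft b v
          map_add' := fun b c => by rw [map_add]; rfl
          map_smul' := fun t b => by rw [map_smul]; rfl }
      map_update_add' := fun v i x y => by
        refine LinearMap.ext fun b => ?_
        exact (φ.curryLeft b).map_update_add v i x y
      map_update_smul' := fun v i c x => by
        refine LinearMap.ext fun b => ?_
        exact (φ.curryLeft b).map_update_smul v i c x }
  map_add' φ ψ := rfl
  map_smul' c φ := rfl
  invFun ψ := LinearMap.uncurryLeft
    { toFun := fun b => post (evAt b) ψ
      map_add' := fun b c => by ext v; simp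
      map_smul' := fun t b => by ext v; simp }
  left_inv φ := by ext v; simp
  right_inv ψ := by ext v b; simp

@[simp] theorem curry_apply {p : ℕ} (φ : Coch σ M (p + 1)) (v : Fin p → MvPolynomial σ ℂ)
    (b : MvPolynomial σ ℂ) : curry φ v b = φ (Fin.cons b v) := rfl

theorem curry_post (f : M →ₗ[ℂ] N) {p : ℕ} (φ : Coch σ M (p + 1)) :
    curry (post f φ) = post (push f) (curry φ) := rfl

theorem post_curry_symm (f : M →ₗ[ℂ] N) {p : ℕ}
    (ψ : Coch σ (MvPolynomial σ ℂ →ₗ[ℂ] M) p) :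
    post f (curry.symm ψ) = curry.symm (post (push f) ψ) := rfl

theorem post_post {P : Type} [AddCommGroup P] [Module ℂ P] (f : N →ₗ[ℂ] P) (g : M →ₗ[ℂ] N)
    {p : ℕ} (φ : Coch σ M p) : post f (post g φ) = post (f ∘ₗ g) φ := rfl

theorem post_sub_fun (f g : M →ₗ[ℂ] N) {p : ℕ} (φ : Coch σ M p) :
    post (f - g) φ = post f φ - post g φ := rfl

theorem curry_injective {p : ℕ} : Function.Injective (curry (σ := σ) (M := M) (p := p)) :=
  curry.injective

end Basic

variable {σ : Type}

/-- The Hochschild differential. -/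
noncomputable def bdry : (p : ℕ) → {M : Type} → [AddCommGroup M] → [Module ℂ M] →
    PolyBimod σ M → Coch σ M p →ₗ[ℂ] Coch σ M (p + 1)
  | 0, _, _, _, β => curry.symm.toLinearMap ∘ₗ post (β.iota - β.orbit)
  | p + 1, _, _, _, β =>
      curry.symm.toLinearMap ∘ₗ (post β.iota - bdry p β.coind ∘ₗ curry.toLinearMap)

/-- The curving differential. -/
noncomputable def curve (W : MvPolynomial σ ℂ) : (p : ℕ) → {M : Type} → [AddCommGroup M] →
    [Module ℂ M] → Coch σ M (p + 1) →ₗ[ℂ] Coch σ M p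
  | 0, _, _, _ => post (evAt W) ∘ₗ curry.toLinearMap
  | p + 1, _, _, _ => post (evAt W) ∘ₗ curry.toLinearMap -
      curry.symm.toLinearMap ∘ₗ curve W p ∘ₗ curry.toLinearMap

section Laws

variable {M N : Type} [AddCommGroup M] [Module ℂ M] [AddCommGroup N] [Module ℂ N]

theorem curry_bdry_zero (β : PolyBimod σ M) (φ : Coch σ M 0) :
    curry (bdry 0 β φ) = post (β.iota - β.orbit) φ := by
  simp [bdry]

theorem curry_bdry_succ (β : PolyBimod σ M) (p : ℕ) (φ : Coch σ M (p + 1)) :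
    curry (bdry (p + 1) β φ) = post β.iota φ - bdry p β.coind (curry φ) := by
  simp [bdry]

theorem curve_zero (W : MvPolynomial σ ℂ) (φ : Coch σ M 1) :
    curve W 0 φ = post (evAt W) (curry φ) := rfl

theorem curve_succ (W : MvPolynomial σ ℂ) (p : ℕ) (φ : Coch σ M (p + 2)) :
    curve W (p + 1) φ = post (evAt W) (curry φ) - curry.symm (curve W p (curry φ)) := rfl

theorem curry_curve_succ (W : MvPolynomial σ ℂ) (p : ℕ) (φ : Coch σ M (p + 2)) :
    curry (curve W (p + 1) φ) = curry (post (evAt W) (curry φ)) - curve W p (curry φ) := by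
  simp [curve_succ]

theorem push_comp_iota {β : PolyBimod σ M} {γ : PolyBimod σ N} {f : M →ₗ[ℂ] N} (hf : IsHom β γ f) :
    push f ∘ₗ β.iota = γ.iota ∘ₗ f := by
  refine LinearMap.ext fun m => LinearMap.ext fun b => hf.left b m

theorem push_comp_orbit {β : PolyBimod σ M} {γ : PolyBimod σ N} {f : M →ₗ[ℂ] N}
    (hf : IsRightHom β γ f) : push f ∘ₗ β.orbit = γ.orbit ∘ₗ f := by
  refine LinearMap.ext fun m => LinearMap.ext fun b => hf b m

theorem bdry_post {β : PolyBimod σ M} {γ : PolyBimod σ N} {f : M →ₗ[ℂ] N} (hf : IsHom β γ f) (p : ℕ)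
    (φ : Coch σ M p) : bdry p γ (post f φ) = post f (bdry p β φ) := by
  induction p generalizing M N with
  | zero =>
    apply curry_injective
    rw [curry_bdry_zero, curry_post, curry_bdry_zero, post_post, post_post, LinearMap.sub_comp,
      LinearMap.comp_sub, push_comp_iota hf, push_comp_orbit hf.right]
  | succ p ih =>
    apply curry_injective
    rw [curry_bdry_succ, curry_post, curry_post, curry_bdry_succ, map_sub, post_post, post_post,
      push_comp_iota hf, ih hf.right.push]

theorem curve_post (W : MvPolynomial σ ℂ) (f : M →ₗ[ℂ] N) (p : ℕ) (φ : Coch σ M (p + 1)) :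
    curve W p (post f φ) = post f (curve W p φ) := by
  induction p generalizing M N with
  | zero => rfl
  | succ p ih =>
    rw [curve_succ, curve_succ, map_sub, curry_post, ih, post_curry_symm]
    rfl

theorem post_evAt_iota (β : PolyBimod σ M) {p : ℕ} (a : MvPolynomial σ ℂ) (φ : Coch σ M p) :
    post (evAt a) (post β.iota φ) = post (β.left a) φ := rfl

/-- The failure of a map of right modules to commute with the differential. -/
theorem curry_bdry_post_sub {β : PolyBimod σ M} {γ : PolyBimod σ N} {f : M →ₗ[ℂ] N}
    (hf : IsRightHom β γ f) (p : ℕ) (φ : Coch σ M p) :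
    curry (bdry p γ (post f φ) - post f (bdry p β φ)) =
      post (γ.iota ∘ₗ f - push f ∘ₗ β.iota) φ := by
  cases p with
  | zero =>
    rw [map_sub, curry_bdry_zero, curry_post, curry_bdry_zero, post_post, post_post,
      LinearMap.sub_comp, LinearMap.comp_sub, push_comp_orbit hf, ← post_sub_fun]
    congr 1
    abel_nf
  | succ p =>
    rw [map_sub, curry_bdry_succ, curry_post, curry_post, curry_bdry_succ, map_sub,
      bdry_post hf.push, post_post, post_post, post_sub_fun]
    abel

theorem bdry_bdry (β : PolyBimod σ M) (p : ℕ) (φ : Coch σ M p) :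
    bdry (p + 1) β (bdry p β φ) = 0 := by
  induction p generalizing M with
  | zero =>
    apply curry_injective
    rw [curry_bdry_succ, curry_bdry_zero, ← bdry_post β.isHom_iota, ← map_sub, ← post_sub_fun,
      map_zero]
    apply curry_injective
    rw [curry_bdry_zero, post_post, map_zero]
    refine MultilinearMap.ext fun v => LinearMap.ext fun b => LinearMap.ext fun c => ?_
    simp [map_mul, mul_comm]
  | succ p ih =>
    apply curry_injective
    rw [curry_bdry_succ, curry_bdry_succ, map_sub, ih, bdry_post β.isHom_iota, sub_zero, sub_self,
      map_zero]

theorem curve_curve (W : MvPolynomial σ ℂ) (p : ℕ) (φ : Coch σ M (p + 2)) :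
    curve W p (curve W (p + 1) φ) = 0 := by
  induction p generalizing M with
  | zero =>
    rw [curve_zero, curry_curve_succ, map_sub, curve_zero]
    exact sub_self _
  | succ p ih =>
    apply curry_injective
    have h := curry_curve_succ W p (post (evAt W) (curry φ))
    rw [curve_post] at h
    rw [curry_curve_succ, map_zero, curry_curve_succ, map_sub, map_sub, map_sub, ih, sub_zero, h]
    abel

theorem bdry_curve (W : MvPolynomial σ ℂ) (β : PolyBimod σ M) (p : ℕ) (φ : Coch σ M (p + 1)) :
    bdry p β (curve W p φ) + curve W (p + 1) (bdry (p + 1) β φ) =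
      post (β.left W - β.right W) φ := by
  induction p generalizing M with
  | zero =>
    apply curry_injective
    have h := curry_bdry_post_sub (β.isRightHom_evAt W) 0 (curry φ)
    rw [map_sub] at h
    rw [map_add, curry_curve_succ, curry_bdry_succ, map_sub (post (evAt W)), map_sub, map_sub,
      curve_zero W (bdry 0 β.coind (curry φ)), curry_bdry_zero β.coind, curve_zero,
      eq_add_of_sub_eq h]
    refine MultilinearMap.ext fun v => LinearMap.ext fun b => ?_
    simp [curve_zero, mul_comm]
    abel
  | succ p ih =>
    apply curry_injective
    have h := curry_bdry_post_sub (β.isRightHom_evAt W) (p + 1) (curry φ)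
    rw [map_sub, curry_bdry_succ] at h
    have h2 := ih β.coind (curry φ)
    have h3 : post (push (evAt W) ∘ₗ β.coind.iota) (curry φ) =
        post (β.coind.left W) (curry φ) := by
      refine MultilinearMap.ext fun v => LinearMap.ext fun b => ?_
      simp [mul_comm]
    have h4 : curry (post (β.right W) φ) = post (β.coind.right W) (curry φ) := rfl
    have h5 : post (β.iota ∘ₗ evAt W) (curry φ) = post β.iota (post (evAt W) (curry φ)) := rfl
    rw [post_sub_fun, h3, h5] at h
    rw [post_sub_fun] at h2
    rw [post_sub_fun, map_sub curry, h4, map_add, curry_bdry_succ, curry_curve_succ,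
      curry_curve_succ, curry_bdry_succ, map_sub (bdry p β.coind), map_sub (post (evAt W)),
      map_sub curry, map_sub (curve W (p + 1)), curve_post, post_evAt_iota]
    linear_combination (norm := module) h + h2

end Laws

end BarCochain

/-! ## The Koszul complex of a bimodule and its embedding into Hochschild cochains -/

namespace BarCochain

open PolyBimod DividedDiff Fermion

variable {σ : Type} [Fintype σ] [LinearOrder σ]
variable {M N : Type} [AddCommGroup M] [Module ℂ M] [AddCommGroup N] [Module ℂ N]

/-- The Koszul differential `∑ᵢ (xᵢ - yᵢ) eᵢ`. -/
noncomputable def kosz (β : PolyBimod σ M) : (Finset σ → M) →ₗ[ℂ] (Finset σ → M) :=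
  ∑ i, mapCoeff (β.act (gap i)) ∘ₗ create ℂ i

/-- The curving of the Koszul complex. -/
noncomputable def koszCurve (W : MvPolynomial σ ℂ) (β : PolyBimod σ M) :
    (Finset σ → M) →ₗ[ℂ] (Finset σ → M) :=
  ∑ i, mapCoeff (β.act (ddiff i W)) ∘ₗ annihilate ℂ i

theorem kosz_apply (β : PolyBimod σ M) (κ : Finset σ → M) :
    kosz β κ = ∑ i, mapCoeff (β.act (gap i)) (create ℂ i κ) := by
  simp [kosz]

theorem koszCurve_apply (W : MvPolynomial σ ℂ) (β : PolyBimod σ M) (κ : Finset σ → M) :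
    koszCurve W β κ = ∑ i, mapCoeff (β.act (ddiff i W)) (annihilate ℂ i κ) := by
  simp [koszCurve]

theorem mapCoeff_act_comm (β : PolyBimod σ M) (x y : Env σ) (κ : Finset σ → M) :
    mapCoeff (β.act x) (mapCoeff (β.act y) κ) = mapCoeff (β.act y) (mapCoeff (β.act x) κ) := by
  ext J
  exact β.act_comm x y _

theorem kosz_kosz (β : PolyBimod σ M) (κ : Finset σ → M) : kosz β (kosz β κ) = 0 := by
  have h : kosz β (kosz β κ) = -kosz β (kosz β κ) := by
    conv_lhs => rw [kosz_apply β κ, map_sum]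
    simp only [kosz_apply, map_sum, create_mapCoeff]
    conv_lhs => rw [Finset.sum_comm]
    rw [← Finset.sum_neg_distrib]
    refine Finset.sum_congr rfl fun i _ => ?_
    rw [← Finset.sum_neg_distrib]
    refine Finset.sum_congr rfl fun j _ => ?_
    conv_lhs => rw [mapCoeff_act_comm, create_create, map_neg, map_neg]
  have h2 : (2 : ℂ) • kosz β (kosz β κ) = 0 := by
    rw [two_smul]; nth_rewrite 1 [h]; exact neg_add_cancel _
  exact (smul_eq_zero.1 h2).resolve_left two_ne_zero

theorem kosz_mapCoeff {β : PolyBimod σ M} {γ : PolyBimod σ N} {f : M →ₗ[ℂ] N} (hf : IsHom β γ f)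
    (κ : Finset σ → M) : kosz γ (mapCoeff f κ) = mapCoeff f (kosz β κ) := by
  simp only [kosz_apply, map_sum, create_mapCoeff]
  refine Finset.sum_congr rfl fun i _ => ?_
  ext J
  exact (hf.act (gap i) (create ℂ i κ J)).symm

/-- `m ↦ (a ↦ Dᵢ(a) m)`, with the divided difference `Dᵢ`. -/
noncomputable def slope (β : PolyBimod σ M) (i : σ) : M →ₗ[ℂ] (MvPolynomial σ ℂ →ₗ[ℂ] M) :=
  (β.act.toLinearMap ∘ₗ ddiff i).flip

@[simp] theorem slope_apply (β : PolyBimod σ M) (i : σ) (m : M) (a : MvPolynomial σ ℂ) :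
    slope β i m a = β.act (ddiff i a) m := rfl

/-- The constant `0`-cochain. -/
noncomputable def const0 : M →ₗ[ℂ] Coch σ M 0 := 
  (MultilinearMap.constLinearEquivOfIsEmpty ℂ ℂ _ M).toLinearMap

@[simp] theorem const0_apply (m : M) (v : Fin 0 → MvPolynomial σ ℂ) : const0 m v = m := rfl

/-- The embedding of the Koszul cochains into the Hochschild cochains. -/
noncomputable def ups (β : PolyBimod σ M) : (p : ℕ) → (Finset σ → M) →ₗ[ℂ] Coch σ M p
  | 0 => const0 ∘ₗ LinearMap.proj ∅
  | p + 1 => ∑ i, curry.symm.toLinearMap ∘ₗ post (slope β i) ∘ₗ ups β p ∘ₗ tail ℂ i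

theorem ups_zero (β : PolyBimod σ M) (κ : Finset σ → M) : ups β 0 κ = const0 (κ ∅) := rfl

theorem curry_ups_succ (β : PolyBimod σ M) (p : ℕ) (κ : Finset σ → M) :
    curry (ups β (p + 1) κ) = ∑ i, post (slope β i) (ups β p (tail ℂ i κ)) := by
  simp [ups]

theorem ups_mapCoeff {β : PolyBimod σ M} {γ : PolyBimod σ N} {f : M →ₗ[ℂ] N} (hf : IsHom β γ f)
    (p : ℕ) (κ : Finset σ → M) : ups γ p (mapCoeff f κ) = post f (ups β p κ) := by
  induction p generalizing κ with
  | zero => rfl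
  | succ p ih =>
    apply curry_injective
    rw [curry_ups_succ, curry_post, curry_ups_succ, map_sum]
    refine Finset.sum_congr rfl fun i _ => ?_
    rw [tail_mapCoeff, ih]
    refine MultilinearMap.ext fun v => LinearMap.ext fun b => ?_
    exact (hf.act _ _).symm

theorem ups_act (β : PolyBimod σ M) (x : Env σ) (p : ℕ) (κ : Finset σ → M)
    (v : Fin p → MvPolynomial σ ℂ) :
    ups β p (mapCoeff (β.act x) κ) v = β.act x (ups β p κ v) := by
  rw [ups_mapCoeff (β.isHom_act x)]; rfl

theorem tail_kosz (β : PolyBimod σ M) (i : σ) (κ : Finset σ → M) :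
    tail ℂ i (kosz β κ) = mapCoeff (β.act (gap i)) (above ℂ i κ) - kosz β (tail ℂ i κ) +
      ∑ l ∈ upto i, mapCoeff (β.act (gap l)) (create ℂ l (tail ℂ i κ)) := by
  have h : ∀ l, tail ℂ i (mapCoeff (β.act (gap l)) (create ℂ l κ)) =
      (if i = l then mapCoeff (β.act (gap l)) (above ℂ i κ) else 0) -
      mapCoeff (β.act (gap l)) (create ℂ l (tail ℂ i κ)) +
      if l ≤ i then mapCoeff (β.act (gap l)) (create ℂ l (tail ℂ i κ)) else 0 := by
    intro l
    rw [tail_mapCoeff]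
    rcases lt_trichotomy i l with h | rfl | h
    · rw [tail_create_of_lt h, if_neg h.ne, if_neg h.not_ge]; simp
    · rw [tail_create_self, if_pos rfl, if_pos le_rfl]; simp
    · rw [tail_create_of_gt h, if_neg h.ne', if_pos h.le]; simp
  rw [kosz_apply, map_sum, Finset.sum_congr rfl fun l _ => h l, Finset.sum_add_distrib,
    Finset.sum_sub_distrib, Finset.sum_ite_eq, if_pos (Finset.mem_univ i), kosz_apply, upto,
    Finset.sum_filter]

theorem tail_tail_kosz (β : PolyBimod σ M) (i j : σ) (κ : Finset σ → M) :
    tail ℂ j (tail ℂ i (kosz β κ)) =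
      (if i < j then mapCoeff (β.act (gap i)) (tail ℂ j κ) else 0) -
      tail ℂ j (kosz β (tail ℂ i κ)) +
      if j ≤ i then mapCoeff (β.act (gap j)) (tail ℂ i κ) else 0 := by
  rw [tail_kosz, map_add, map_sub, tail_mapCoeff, map_sum]
  congr 1
  · congr 1
    split_ifs with h
    · rw [tail_above_of_lt h]
    · rw [tail_above_of_ge (not_lt.1 h), map_zero]
  · have h : ∀ l ∈ upto i, tail ℂ j (mapCoeff (β.act (gap l)) (create ℂ l (tail ℂ i κ))) =
        if j = l then mapCoeff (β.act (gap l)) (tail ℂ i κ) else 0 := by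
      intro l hl
      rw [mem_upto] at hl
      rw [tail_mapCoeff]
      rcases lt_trichotomy j l with h | rfl | h
      · rw [tail_create_of_lt h, if_neg h.ne, tail_tail_of_ge (h.le.trans hl)]; simp
      · rw [tail_create_self, if_pos rfl]
        congr 1
        rw [tail, LinearMap.comp_apply]
        ext J
        rw [above_apply]
        split_ifs with h1
        · rfl
        · rw [above_apply, if_neg]
          exact fun h2 => h1 fun l hl' => hl.trans_lt (h2 l hl')
      · rw [tail_create_of_gt h, if_neg h.ne', map_zero]
    rw [Finset.sum_congr rfl h, Finset.sum_ite_eq]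
    simp only [mem_upto]

theorem subst_empty_sub_before (a : MvPolynomial σ ℂ) (i : σ) :
    subst ∅ a - subst (before i) a = ∑ j ∈ before i, gap j * ddiff j a := by
  rw [subst_sub_subst a ∅ (before i) (Finset.empty_subset _) (by simp)
    (fun j hj l hl => mem_before.2 (hl.trans_lt (mem_before.1 hj))), Finset.sdiff_empty]

theorem subst_empty_sub_upto (a : MvPolynomial σ ℂ) (i : σ) :
    subst ∅ a - subst (upto i) a = ∑ j ∈ upto i, gap j * ddiff j a := by
  rw [subst_sub_subst a ∅ (upto i) (Finset.empty_subset _) (by simp)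
    (fun j hj l hl => mem_upto.2 (hl.trans (mem_upto.1 hj))), Finset.sdiff_empty]

theorem isRightHom_slope (β : PolyBimod σ M) (i : σ) : IsRightHom β β.coind (slope β i) := by
  intro a m
  refine LinearMap.ext fun b => ?_
  exact ((β.isHom_act _).right a m)

theorem ups_succ_apply (β : PolyBimod σ M) (p : ℕ) (κ : Finset σ → M) (a : MvPolynomial σ ℂ)
    (v : Fin p → MvPolynomial σ ℂ) :
    ups β (p + 1) κ (Fin.cons a v) = ∑ i, β.act (ddiff i a) (ups β p (tail ℂ i κ) v) := by
  have h := LinearMap.congr_fun (congrArg (fun φ => φ v) (curry_ups_succ β p κ)) a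
  simp only [curry_apply] at h
  rw [h]
  simp [_root_.sum_apply, LinearMap.sum_apply]

theorem bdry_ups (β : PolyBimod σ M) (p : ℕ) (κ : Finset σ → M) :
    bdry p β (ups β p κ) = ups β (p + 1) (kosz β κ) := by
  induction p generalizing κ with
  | zero =>
    apply curry_injective
    rw [curry_bdry_zero, curry_ups_succ]
    refine MultilinearMap.ext fun v => LinearMap.ext fun a => ?_
    have h := subst_sub_subst a ∅ Finset.univ (Finset.empty_subset _) (by simp) (by simp)
    have h2 := LinearMap.congr_fun (congrArg β.act h) (κ ∅)
    rw [map_sub, act_subst_empty, act_subst_univ, map_sum, Finset.sdiff_empty] at h2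
    simp only [_root_.sum_apply, LinearMap.sum_apply, post_apply, ups_zero, const0_apply,
      LinearMap.sub_apply, iota_apply, orbit_apply, slope_apply] at h2 ⊢
    rw [h2]
    refine Finset.sum_congr rfl fun i _ => ?_
    have h3 : tail ℂ i (kosz β κ) ∅ = β.act (gap i) (κ ∅) := by
      rw [tail_apply, if_pos (by simp), kosz_apply, Finset.sum_apply]
      rw [Finset.sum_eq_single i]
      · simp [create_apply, koszulSign, Finset.filter_singleton]
      · intro j _ hj; simp [create_apply, hj]
      · simp
    rw [h3, mul_comm, map_mul]; rfl
  | succ p ih =>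
    apply curry_injective
    apply curry_injective
    rw [curry_bdry_succ, curry_ups_succ, curry_ups_succ, map_sum, map_sub, map_sum, map_sum]
    have h1 : ∀ i, curry (bdry p β.coind (post (slope β i) (ups β p (tail ℂ i κ)))) =
        curry (post (slope β i) (ups β (p + 1) (kosz β (tail ℂ i κ)))) +
        post (β.coind.iota ∘ₗ slope β i - push (slope β i) ∘ₗ β.iota) (ups β p (tail ℂ i κ)) := by
      intro i
      rw [← ih, ← curry_bdry_post_sub (isRightHom_slope β i), map_sub]; abel
    rw [Finset.sum_congr rfl fun i _ => h1 i]
    refine MultilinearMap.ext fun v => LinearMap.ext fun b => LinearMap.ext fun a => ?_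
    simp only [_root_.sub_apply, _root_.sum_apply, _root_.add_apply,
      LinearMap.sub_apply, LinearMap.sum_apply, LinearMap.add_apply, curry_apply, post_apply,
      iota_apply, slope_apply, LinearMap.comp_apply, push, LinearMap.compRight_apply,
      coind_left_apply, ups_succ_apply, map_sum, tail_tail_kosz, map_add, map_sub]
    rw [← Finset.sum_sub_distrib]
    have e1 : ∀ i, β.left a (β.act (ddiff i b) (ups β p (tail ℂ i κ) v)) =
        β.act (subst (before i) a) (β.act (ddiff i b) (ups β p (tail ℂ i κ) v)) +
        ∑ j, β.act (ddiff j a) (β.act (ddiff i b)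
          (ups β p (if j < i then mapCoeff (β.act (gap j)) (tail ℂ i κ) else 0) v)) := by
      intro i
      have := congrArg (fun x => β.act x (β.act (ddiff i b) (ups β p (tail ℂ i κ) v)))
        (subst_empty_sub_before a i)
      simp only [map_sub, act_subst_empty, map_sum, LinearMap.sub_apply, LinearMap.sum_apply] at this
      rw [eq_add_of_sub_eq this, add_comm, before, Finset.sum_filter]
      congr 1
      refine Finset.sum_congr rfl fun j _ => ?_
      split_ifs
      · rw [ups_act, mul_comm, map_mul, Module.End.mul_apply, β.act_comm (gap j)]
      · simp
    have e2 : ∀ i, β.act (ddiff i (a * b)) (ups β p (tail ℂ i κ) v) -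
        β.act (ddiff i a) (β.left b (ups β p (tail ℂ i κ) v)) =
        β.act (subst (before i) a) (β.act (ddiff i b) (ups β p (tail ℂ i κ) v)) -
        ∑ j, β.act (ddiff i a) (β.act (ddiff j b)
          (ups β p (if j ≤ i then mapCoeff (β.act (gap j)) (tail ℂ i κ) else 0) v)) := by
      intro i
      have := congrArg (fun x => β.act (ddiff i a) (β.act x (ups β p (tail ℂ i κ) v)))
        (subst_empty_sub_upto b i)
      simp only [map_sub, act_subst_empty, map_sum, LinearMap.sub_apply, LinearMap.sum_apply] at this
      rw [ddiff_mul, map_add, LinearMap.add_apply, map_mul, map_mul, Module.End.mul_apply,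
        Module.End.mul_apply]
      have h3 : ∑ j, β.act (ddiff i a) (β.act (ddiff j b)
          (ups β p (if j ≤ i then mapCoeff (β.act (gap j)) (tail ℂ i κ) else 0) v)) =
          ∑ j ∈ upto i, β.act (ddiff i a) (β.act (gap j * ddiff j b) (ups β p (tail ℂ i κ) v)) := by
        rw [upto, Finset.sum_filter]
        refine Finset.sum_congr rfl fun j _ => ?_
        split_ifs
        · rw [ups_act, mul_comm (gap j), map_mul, Module.End.mul_apply]
        · simp
      rw [h3, ← this]
      abel
    simp only [Finset.sum_add_distrib, e1, e2, Finset.sum_sub_distrib, _root_.add_apply,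
      _root_.sub_apply, map_add, map_sub]
    rw [Finset.sum_comm (f := fun i j => β.act (ddiff j a) (β.act (ddiff i b)
          (ups β p (if j < i then mapCoeff (β.act (gap j)) (tail ℂ i κ) else 0) v)))]
    abel

theorem annihilate_tail_of_le {i j : σ} (h : j ≤ i) (κ : Finset σ → M) :
    annihilate ℂ j (tail ℂ i κ) = 0 := by
  ext J
  rw [annihilate_apply, tail_apply]
  split_ifs with h1 h2
  · rfl
  · exact absurd (h2 j (Finset.mem_insert_self j J)) h.not_gt
  · simp

theorem tail_koszCurve (W : MvPolynomial σ ℂ) (β : PolyBimod σ M) (i : σ) (κ : Finset σ → M) :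
    tail ℂ i (koszCurve W β κ) = ∑ j, mapCoeff (β.act (ddiff j W)) (tail ℂ i (tail ℂ j κ)) -
      koszCurve W β (tail ℂ i κ) := by
  rw [koszCurve_apply, koszCurve_apply, map_sum, ← Finset.sum_sub_distrib]
  refine Finset.sum_congr rfl fun j _ => ?_
  rw [tail_mapCoeff, ← map_sub]
  congr 1
  rcases lt_trichotomy i j with h | rfl | h
  · rw [tail_annihilate_of_lt h, tail_tail_of_ge h.le, zero_sub]
  · rw [tail_annihilate_self, tail_tail_of_ge le_rfl, annihilate_tail_of_le le_rfl, sub_zero]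
  · rw [tail_annihilate_of_gt h, annihilate_tail_of_le h.le, sub_zero]

theorem curve_ups (W : MvPolynomial σ ℂ) (β : PolyBimod σ M) (p : ℕ) (κ : Finset σ → M) :
    curve W p (ups β (p + 1) κ) = ups β p (koszCurve W β κ) := by
  induction p generalizing κ with
  | zero =>
    rw [curve_zero, curry_ups_succ, ups_zero, koszCurve_apply]
    refine MultilinearMap.ext fun v => ?_
    simp [_root_.sum_apply, LinearMap.sum_apply, ups_zero, tail_apply, annihilate_apply,
      koszulSign]
  | succ p ih =>
    apply curry_injective
    rw [curry_curve_succ, curry_ups_succ, map_sum, map_sum, map_sum, curry_ups_succ]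
    have h1 : ∀ i, post (evAt W) (post (slope β i) (ups β (p + 1) (tail ℂ i κ))) =
        ups β (p + 1) (mapCoeff (β.act (ddiff i W)) (tail ℂ i κ)) := by
      intro i
      rw [ups_mapCoeff (β.isHom_act _)]; rfl
    simp only [h1, curve_post, ih, curry_ups_succ, tail_koszCurve, map_sub, map_sum,
      Finset.sum_sub_distrib, tail_mapCoeff]
    rw [Finset.sum_comm]

end BarCochain

/-! ## The retraction onto the Koszul complex -/

namespace BarCochain

open PolyBimod DividedDiff Fermion

variable {σ : Type} [Fintype σ] [LinearOrder σ]

/-- The projection of the Hochschild cochains onto the Koszul cochains. -/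
noncomputable def psi : (p : ℕ) → {M : Type} → [AddCommGroup M] → [Module ℂ M] →
    PolyBimod σ M → Coch σ M p →ₗ[ℂ] (Finset σ → M)
  | 0, M, _, _, _ => LinearMap.single ℂ (fun _ => M) ∅ ∘ₗ
      (MultilinearMap.constLinearEquivOfIsEmpty ℂ ℂ _ M).symm.toLinearMap
  | p + 1, _, _, _, β =>
      mapCoeff (evAt 1) ∘ₗ kosz β.coind ∘ₗ psi p β.coind ∘ₗ curry.toLinearMap

/-- The homotopy between the identity and the projection onto the Koszul cochains. -/
noncomputable def htpy : (p : ℕ) → {M : Type} → [AddCommGroup M] → [Module ℂ M] →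
    PolyBimod σ M → Coch σ M (p + 1) →ₗ[ℂ] Coch σ M p
  | 0, _, _, _, _ => 0
  | p + 1, _, _, _, β => post (evAt 1) ∘ₗ
      (LinearMap.id - ups β.coind (p + 1) ∘ₗ psi (p + 1) β.coind - bdry p β.coind ∘ₗ htpy p β.coind)
        ∘ₗ curry.toLinearMap

variable {M N : Type} [AddCommGroup M] [Module ℂ M] [AddCommGroup N] [Module ℂ N]

theorem psi_zero (β : PolyBimod σ M) (φ : Coch σ M 0) :
    psi 0 β φ = Pi.single ∅ (φ 0) := rfl

theorem psi_const0 (β : PolyBimod σ M) (m : M) :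
    psi 0 β (const0 m) = Pi.single ∅ m := rfl

theorem psi_succ (β : PolyBimod σ M) (p : ℕ) (φ : Coch σ M (p + 1)) :
    psi (p + 1) β φ = mapCoeff (evAt 1) (kosz β.coind (psi p β.coind (curry φ))) := rfl

theorem htpy_succ (β : PolyBimod σ M) (p : ℕ) (φ : Coch σ M (p + 2)) :
    htpy (p + 1) β φ = post (evAt 1) (curry φ - ups β.coind (p + 1) (psi (p + 1) β.coind (curry φ)) -
      bdry p β.coind (htpy p β.coind (curry φ))) := rfl

theorem mapCoeff_single (f : M →ₗ[ℂ] N) (J : Finset σ) (m : M) :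
    mapCoeff f (Pi.single J m) = Pi.single J (f m) := by
  ext K
  rcases eq_or_ne K J with rfl | h
  · simp
  · simp [h]

theorem psi_post {β : PolyBimod σ M} {γ : PolyBimod σ N} {f : M →ₗ[ℂ] N} (hf : IsRightHom β γ f)
    (p : ℕ) (φ : Coch σ M p) : psi p γ (post f φ) = mapCoeff f (psi p β φ) := by
  induction p generalizing M N with
  | zero => rw [psi_zero, psi_zero, mapCoeff_single]; rfl
  | succ p ih =>
    rw [psi_succ, psi_succ, curry_post, ih hf.push.right, kosz_mapCoeff hf.push]
    rfl

theorem evAt_one_kosz_iota (β : PolyBimod σ M) (κ : Finset σ → M) :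
    mapCoeff (evAt 1) (kosz β.coind (mapCoeff β.iota κ)) = kosz β κ := by
  rw [kosz_mapCoeff β.isHom_iota]
  ext J
  simp

theorem evAt_one_kosz_orbit (β : PolyBimod σ M) (κ : Finset σ → M) :
    mapCoeff (evAt 1) (kosz β.coind (mapCoeff β.orbit κ)) = 0 := by
  rw [kosz_apply, map_sum]
  refine Finset.sum_eq_zero fun i _ => ?_
  rw [create_mapCoeff]
  ext J
  simp [act_gap]

theorem isRightHom_orbit (β : PolyBimod σ M) : IsRightHom β β.coind β.orbit := by
  intro a m
  refine LinearMap.ext fun b => ?_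
  simp only [orbit_apply, coind_right_apply]
  rw [← Module.End.mul_apply, ← map_mul, mul_comm, map_mul, Module.End.mul_apply]

theorem psi_bdry (β : PolyBimod σ M) (p : ℕ) (φ : Coch σ M p) :
    psi (p + 1) β (bdry p β φ) = kosz β (psi p β φ) := by
  induction p generalizing M with
  | zero =>
    rw [psi_succ, curry_bdry_zero, post_sub_fun, map_sub, psi_post β.isHom_iota.right,
      psi_post (isRightHom_orbit β), map_sub, map_sub, evAt_one_kosz_iota, evAt_one_kosz_orbit,
      sub_zero]
  | succ p ih =>
    rw [psi_succ, curry_bdry_succ, map_sub, psi_post β.isHom_iota.right, ih, map_sub, kosz_kosz,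
      sub_zero, evAt_one_kosz_iota]

/-- The component of degree `p`. -/
def degPart (p : ℕ) : (Finset σ → M) →ₗ[ℂ] (Finset σ → M) where
  toFun κ J := if J.card = p then κ J else 0
  map_add' κ κ' := by ext J; simp only [Pi.add_apply]; split_ifs <;> simp
  map_smul' c κ := by ext J; simp only [Pi.smul_apply, RingHom.id_apply]; split_ifs <;> simp

theorem degPart_apply (p : ℕ) (κ : Finset σ → M) (J : Finset σ) :
    degPart p κ J = if J.card = p then κ J else 0 := rfl

theorem tail_degPart (i : σ) (p : ℕ) (κ : Finset σ → M) :
    tail ℂ i (degPart (p + 1) κ) = degPart p (tail ℂ i κ) := by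
  ext J
  simp only [tail_apply, degPart_apply]
  by_cases h : ∀ j ∈ J, i < j
  · have hi : i ∉ J := fun hi => lt_irrefl i (h i hi)
    simp only [if_pos h, Finset.card_insert_of_notMem hi, add_left_inj]
  · simp [if_neg h]

theorem ups_degPart (β : PolyBimod σ M) (p : ℕ) (κ : Finset σ → M) :
    ups β p (degPart p κ) = ups β p κ := by
  induction p generalizing κ with
  | zero => rw [ups_zero, ups_zero]; rfl
  | succ p ih =>
    apply curry_injective
    rw [curry_ups_succ, curry_ups_succ]
    refine Finset.sum_congr rfl fun i _ => ?_
    rw [tail_degPart, ih]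

theorem sum_create_tail (p : ℕ) (κ : Finset σ → M) :
    ∑ i, create ℂ i (degPart p (tail ℂ i κ)) = degPart (p + 1) κ := by
  ext J
  rw [Finset.sum_apply]
  rcases J.eq_empty_or_nonempty with rfl | hJ
  · simp [create_apply, degPart_apply]
  · rw [Finset.sum_eq_single (J.min' hJ)]
    · have hm := J.min'_mem hJ
      have hl : ∀ j ∈ J.erase (J.min' hJ), J.min' hJ < j := fun j hj =>
        J.min'_lt_of_mem_erase_min' hJ hj
      rw [create_apply, if_pos hm, degPart_apply, tail_apply, if_pos hl, Finset.insert_erase hm,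
        koszulSign_of_forall_le (fun j hj => J.min'_le j hj), one_smul, degPart_apply,
        Finset.card_erase_of_mem hm]
      have := Finset.card_pos.2 hJ
      congr 1
      simp only [eq_iff_iff]; omega
    · intro i _ hi
      rw [create_apply]
      split_ifs with h
      · rw [degPart_apply, tail_apply]
        split_ifs with h1 h2
        · refine absurd (h2 _ (Finset.mem_erase.2 ⟨hi.symm, J.min'_mem hJ⟩)) ?_
          exact (J.min'_le i h).not_gt
        · simp
        · simp
      · rfl
    · simp

theorem evAt_one_kosz_slope (β : PolyBimod σ M) (i : σ) (κ : Finset σ → M) :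
    mapCoeff (evAt 1) (kosz β.coind (mapCoeff (slope β i) κ)) = create ℂ i κ := by
  rw [kosz_apply, map_sum, Finset.sum_eq_single i]
  · rw [create_mapCoeff]
    ext J
    simp [act_gap, ddiff_X, ddiff_one]
  · intro j _ hj
    rw [create_mapCoeff]
    ext J
    simp [act_gap, ddiff_X, ddiff_one, hj.symm]
  · simp

theorem psi_ups (β : PolyBimod σ M) (p : ℕ) (κ : Finset σ → M) :
    psi p β (ups β p κ) = degPart p κ := by
  induction p generalizing κ with
  | zero =>
    rw [ups_zero, psi_const0]
    ext J
    rw [degPart_apply]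
    rcases eq_or_ne J ∅ with rfl | h
    · simp
    · simp [h]
  | succ p ih =>
    rw [psi_succ, curry_ups_succ, map_sum, map_sum, map_sum, ← sum_create_tail]
    refine Finset.sum_congr rfl fun i _ => ?_
    rw [psi_post (isRightHom_slope β i), evAt_one_kosz_slope, ih]

theorem ups_psi_ups (β : PolyBimod σ M) (p : ℕ) (κ : Finset σ → M) :
    ups β p (psi p β (ups β p κ)) = ups β p κ := by
  rw [psi_ups, ups_degPart]

theorem degPart_psi (β : PolyBimod σ M) (p : ℕ) (φ : Coch σ M p) :
    degPart p (psi p β φ) = psi p β φ := by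
  induction p generalizing M with
  | zero =>
    rw [psi_zero]
    ext J
    rw [degPart_apply]
    rcases eq_or_ne J ∅ with rfl | h
    · simp
    · simp [h]
  | succ p ih =>
    rw [psi_succ, ← ih]
    ext J
    rw [degPart_apply]
    split_ifs with h
    · rfl
    · rw [kosz_apply, map_sum, Finset.sum_apply, eq_comm]
      refine Finset.sum_eq_zero fun i _ => ?_
      simp only [mapCoeff_apply, create_apply, degPart_apply]
      split_ifs with h1 h2
      · rw [Finset.card_erase_of_mem h1] at h2
        have := Finset.card_pos.2 ⟨i, h1⟩
        omega
      · simp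
      · simp

theorem htpy_post {β : PolyBimod σ M} {γ : PolyBimod σ N} {f : M →ₗ[ℂ] N} (hf : IsHom β γ f)
    (p : ℕ) (φ : Coch σ M (p + 1)) : htpy p γ (post f φ) = post f (htpy p β φ) := by
  induction p generalizing M N with
  | zero => simp [htpy]
  | succ p ih =>
    rw [htpy_succ, htpy_succ, curry_post, psi_post hf.right.push.right, ups_mapCoeff hf.right.push,
      ih hf.right.push, bdry_post hf.right.push, ← map_sub, ← map_sub]
    rfl

theorem ups_psi_post {β : PolyBimod σ M} {γ : PolyBimod σ N} {f : M →ₗ[ℂ] N} (hf : IsHom β γ f)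
    (p : ℕ) (φ : Coch σ M p) : ups γ p (psi p γ (post f φ)) = post f (ups β p (psi p β φ)) := by
  rw [psi_post hf.right, ups_mapCoeff hf]

theorem ups_psi_bdry (β : PolyBimod σ M) (p : ℕ) (φ : Coch σ M p) :
    ups β (p + 1) (psi (p + 1) β (bdry p β φ)) = bdry p β (ups β p (psi p β φ)) := by
  rw [psi_bdry, bdry_ups]

theorem ups_psi_zero (β : PolyBimod σ M) (φ : Coch σ M 0) : ups β 0 (psi 0 β φ) = φ := by
  rw [psi_zero, ups_zero]
  refine MultilinearMap.ext fun v => ?_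
  simp [Subsingleton.elim v 0]

theorem post_one {p : ℕ} (φ : Coch σ M p) : post (1 : M →ₗ[ℂ] M) φ = φ := rfl

theorem htpy_formula_of_aux (β : PolyBimod σ M) (p : ℕ)
    (aux : ∀ ψ : Coch σ (MvPolynomial σ ℂ →ₗ[ℂ] M) p,
      bdry p β.coind (htpy p β.coind (bdry p β.coind ψ)) =
      bdry p β.coind (ψ - ups β.coind p (psi p β.coind ψ))) (φ : Coch σ M (p + 1)) :
    bdry p β (htpy p β φ) + htpy (p + 1) β (bdry (p + 1) β φ) =
      φ - ups β (p + 1) (psi (p + 1) β φ) := by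
  rw [htpy_succ, curry_bdry_succ]
  simp only [map_sub, ups_psi_post β.isHom_iota, ups_psi_bdry, aux, htpy_post β.isHom_iota,
    bdry_post β.isHom_iota]
  simp only [post_evAt_iota, map_one, post_one]
  abel

theorem bdry_htpy_bdry (β : PolyBimod σ M) (p : ℕ) (φ : Coch σ M p) :
    bdry p β (htpy p β (bdry p β φ)) = bdry p β (φ - ups β p (psi p β φ)) := by
  induction p generalizing M with
  | zero => rw [ups_psi_zero, sub_self]; simp [htpy]
  | succ p ih =>
    rw [← htpy_formula_of_aux β p (fun ψ => ih β.coind ψ), map_add, bdry_bdry, zero_add]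

theorem htpy_formula (β : PolyBimod σ M) (p : ℕ) (φ : Coch σ M (p + 1)) :
    bdry p β (htpy p β φ) + htpy (p + 1) β (bdry (p + 1) β φ) =
      φ - ups β (p + 1) (psi (p + 1) β φ) :=
  htpy_formula_of_aux β p (fun ψ => bdry_htpy_bdry β.coind p ψ) φ

/-- The homotopy `h(1 - ΥΨ)`, which vanishes on the Koszul cochains. -/
noncomputable def redHtpy (p : ℕ) (β : PolyBimod σ M) : Coch σ M (p + 1) →ₗ[ℂ] Coch σ M p :=
  htpy p β ∘ₗ (LinearMap.id - ups β (p + 1) ∘ₗ psi (p + 1) β)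

theorem redHtpy_apply (p : ℕ) (β : PolyBimod σ M) (φ : Coch σ M (p + 1)) :
    redHtpy p β φ = htpy p β (φ - ups β (p + 1) (psi (p + 1) β φ)) := rfl

theorem redHtpy_ups (p : ℕ) (β : PolyBimod σ M) (κ : Finset σ → M) :
    redHtpy p β (ups β (p + 1) κ) = 0 := by
  rw [redHtpy_apply, ups_psi_ups, sub_self, map_zero]

theorem redHtpy_bdry_zero (β : PolyBimod σ M) (φ : Coch σ M 0) : redHtpy 0 β (bdry 0 β φ) = 0 := by
  rw [redHtpy_apply]; simp [htpy]

theorem redHtpy_formula (β : PolyBimod σ M) (p : ℕ) (φ : Coch σ M (p + 1)) :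
    bdry p β (redHtpy p β φ) + redHtpy (p + 1) β (bdry (p + 1) β φ) =
      φ - ups β (p + 1) (psi (p + 1) β φ) := by
  rw [redHtpy_apply, redHtpy_apply, ups_psi_bdry, ← map_sub, htpy_formula, map_sub, map_sub,
    ups_psi_ups, sub_self, sub_zero]

theorem redHtpy_post {β : PolyBimod σ M} {γ : PolyBimod σ N} {f : M →ₗ[ℂ] N} (hf : IsHom β γ f)
    (p : ℕ) (φ : Coch σ M (p + 1)) : redHtpy p γ (post f φ) = post f (redHtpy p β φ) := by
  rw [redHtpy_apply, redHtpy_apply, ups_psi_post hf, ← map_sub, htpy_post hf]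

end BarCochain

/-! ## Homological perturbation on cochains of compact type -/

namespace BarCochain

open PolyBimod DividedDiff Fermion Hochschild

section Total

variable {σ : Type} [Fintype σ] [LinearOrder σ]
variable {B : Type} [Ring B] [Algebra ℂ B]

/-- Cochains of compact type with values in `B`. -/
abbrev Tot (σ B : Type) [Ring B] [Algebra ℂ B] : Type := CompactCochain ℂ (MvPolynomial σ ℂ) B

/-- The Hochschild differential of a bimodule on cochains of compact type. -/
noncomputable def totBdry (β : PolyBimod σ B) : Tot σ B →ₗ[ℂ] Tot σ B :=
  lift fun p => incl (p + 1) ∘ₗ bdry p β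

/-- The curving on cochains of compact type. -/
noncomputable def totCurve (W : MvPolynomial σ ℂ) : Tot σ B →ₗ[ℂ] Tot σ B :=
  lift fun p => match p with
    | 0 => 0
    | p + 1 => incl p ∘ₗ curve W p

/-- The embedding of the Koszul cochains. -/
noncomputable def totUps (β : PolyBimod σ B) : (Finset σ → B) →ₗ[ℂ] Tot σ B :=
  ∑ p ∈ Finset.range (Fintype.card σ + 1), incl p ∘ₗ ups β p

/-- The projection to the Koszul cochains. -/
noncomputable def totPsi (β : PolyBimod σ B) : Tot σ B →ₗ[ℂ] (Finset σ → B) :=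
  lift fun p => psi p β

/-- The homotopy on cochains of compact type. -/
noncomputable def totHtpy (β : PolyBimod σ B) : Tot σ B →ₗ[ℂ] Tot σ B :=
  lift fun p => match p with
    | 0 => 0
    | p + 1 => incl p ∘ₗ redHtpy p β

/-- Postcomposition on cochains of compact type. -/
noncomputable def totPost (f : B →ₗ[ℂ] B) : Tot σ B →ₗ[ℂ] Tot σ B :=
  lift fun p => incl p ∘ₗ post f

variable (β : PolyBimod σ B) (W : MvPolynomial σ ℂ)

theorem tot_hom_ext {P : Type} [AddCommGroup P] [Module ℂ P] {f g : Tot σ B →ₗ[ℂ] P}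
    (h : ∀ p (φ : Coch σ B p), f (incl p φ) = g (incl p φ)) : f = g := by
  refine LinearMap.ext fun x => ?_
  induction x using CompactCochain.induction with
  | zero => simp
  | incl p φ => exact h p φ
  | add x y hx hy => rw [map_add, map_add, hx, hy]

@[simp] theorem totBdry_incl (p : ℕ) (φ : Coch σ B p) :
    totBdry β (incl p φ) = incl (p + 1) (bdry p β φ) := by
  rw [totBdry, lift_incl]; rfl

@[simp] theorem totCurve_incl_zero (φ : Coch σ B 0) : totCurve W (incl 0 φ) = 0 := by
  rw [totCurve, lift_incl]; rfl

@[simp] theorem totCurve_incl_succ (p : ℕ) (φ : Coch σ B (p + 1)) :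
    totCurve W (incl (p + 1) φ) = incl p (curve W p φ) := by
  rw [totCurve, lift_incl]; rfl

@[simp] theorem totPsi_incl (p : ℕ) (φ : Coch σ B p) : totPsi β (incl p φ) = psi p β φ := by
  rw [totPsi, lift_incl]

@[simp] theorem totHtpy_incl_zero (φ : Coch σ B 0) : totHtpy β (incl 0 φ) = 0 := by
  rw [totHtpy, lift_incl]; rfl

@[simp] theorem totHtpy_incl_succ (p : ℕ) (φ : Coch σ B (p + 1)) :
    totHtpy β (incl (p + 1) φ) = incl p (redHtpy p β φ) := by
  rw [totHtpy, lift_incl]; rfl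

@[simp] theorem totPost_incl (f : B →ₗ[ℂ] B) (p : ℕ) (φ : Coch σ B p) :
    totPost f (incl p φ) = incl p (post f φ) := by
  rw [totPost, lift_incl]; rfl

theorem ups_eq_zero (p : ℕ) (hp : Fintype.card σ < p) (κ : Finset σ → B) : ups β p κ = 0 := by
  rw [← ups_degPart]
  have : degPart p κ = 0 := by
    ext J
    rw [degPart_apply, if_neg (by have := J.card_le_univ; omega)]; rfl
  rw [this, map_zero]

theorem totUps_eq (n : ℕ) (hn : Fintype.card σ < n) (κ : Finset σ → B) :
    totUps β κ = ∑ p ∈ Finset.range n, incl p (ups β p κ) := by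
  rw [totUps, LinearMap.sum_apply]
  refine Finset.sum_subset (Finset.range_mono hn) fun p _ hp => ?_
  rw [LinearMap.comp_apply, ups_eq_zero β p (by simpa [Nat.lt_succ_iff] using hp), map_zero]

theorem ups_degPart_of_ne {p q : ℕ} (h : q ≠ p) (κ : Finset σ → B) :
    ups β q (degPart p κ) = 0 := by
  rw [← ups_degPart]
  have : degPart q (degPart p κ) = 0 := by
    ext J
    rw [degPart_apply, degPart_apply]
    split_ifs with h1 h2
    · exact absurd (h1.symm.trans h2) h
    · rfl
    · rfl
  rw [this, map_zero]

theorem totUps_degPart (p : ℕ) (κ : Finset σ → B) :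
    totUps β (degPart p κ) = incl p (ups β p κ) := by
  rw [totUps_eq β (Fintype.card σ + 1 + p) (by omega)]
  by_cases hp : p ∈ Finset.range (Fintype.card σ + 1 + p)
  · rw [Finset.sum_eq_single_of_mem p hp fun q _ hq => by rw [ups_degPart_of_ne β hq, map_zero],
      ups_degPart]
  · simp at hp

theorem totUps_psi (p : ℕ) (φ : Coch σ B p) :
    totUps β (psi p β φ) = incl p (ups β p (psi p β φ)) := by
  rw [← totUps_degPart, degPart_psi]

theorem totPsi_totUps (κ : Finset σ → B) : totPsi β (totUps β κ) = κ := by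
  rw [totUps, LinearMap.sum_apply, map_sum]
  ext J
  simp only [LinearMap.comp_apply, totPsi_incl, psi_ups, Finset.sum_apply, degPart_apply]
  rw [Finset.sum_ite_eq, if_pos]
  have := J.card_le_univ
  simp; omega

theorem totHtpy_totUps (κ : Finset σ → B) : totHtpy β (totUps β κ) = 0 := by
  rw [totUps, LinearMap.sum_apply, map_sum]
  refine Finset.sum_eq_zero fun p _ => ?_
  rw [LinearMap.comp_apply]
  cases p with
  | zero => exact totHtpy_incl_zero β _
  | succ p => rw [totHtpy_incl_succ, redHtpy_ups, map_zero]

theorem totBdry_totUps (κ : Finset σ → B) : totBdry β (totUps β κ) = totUps β (kosz β κ) := by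
  have h0 : ups β 0 (kosz β κ) = 0 := by
    rw [ups_zero, kosz_apply, Finset.sum_apply, Finset.sum_eq_zero, map_zero]
    intro i _
    simp [create_apply]
  rw [totUps_eq β (Fintype.card σ + 2) (by omega) (kosz β κ), Finset.sum_range_succ', h0, map_zero,
    add_zero, totUps, LinearMap.sum_apply, map_sum]
  refine Finset.sum_congr rfl fun p _ => ?_
  rw [LinearMap.comp_apply, totBdry_incl, bdry_ups]

theorem totCurve_totUps (κ : Finset σ → B) :
    totCurve W (totUps β κ) = totUps β (koszCurve W β κ) := by
  rw [totUps_eq β (Fintype.card σ + 2) (by omega) κ, Finset.sum_range_succ', map_add,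
    totCurve_incl_zero, add_zero, totUps, LinearMap.sum_apply, map_sum]
  refine Finset.sum_congr rfl fun p _ => ?_
  rw [LinearMap.comp_apply, totCurve_incl_succ, curve_ups]

theorem totPsi_totBdry (x : Tot σ B) : totPsi β (totBdry β x) = kosz β (totPsi β x) := by
  have : totPsi β ∘ₗ totBdry β = kosz β ∘ₗ totPsi β := tot_hom_ext fun p φ => by
    simp [psi_bdry]
  exact LinearMap.congr_fun this x

theorem totHtpy_formula (x : Tot σ B) :
    totBdry β (totHtpy β x) + totHtpy β (totBdry β x) = x - totUps β (totPsi β x) := by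
  have : totBdry β ∘ₗ totHtpy β + totHtpy β ∘ₗ totBdry β = LinearMap.id - totUps β ∘ₗ totPsi β := by
    refine tot_hom_ext fun p φ => ?_
    simp only [LinearMap.add_apply, LinearMap.comp_apply, LinearMap.sub_apply, LinearMap.id_apply,
      totPsi_incl, totUps_psi, totBdry_incl, totHtpy_incl_succ]
    cases p with
    | zero => rw [totHtpy_incl_zero, map_zero, redHtpy_bdry_zero, map_zero, ups_psi_zero]; simp
    | succ p => rw [totHtpy_incl_succ, totBdry_incl, ← map_add, redHtpy_formula, map_sub]
  exact LinearMap.congr_fun this x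

theorem totCurve_totCurve (x : Tot σ B) : totCurve W (totCurve W x) = 0 := by
  have : totCurve W ∘ₗ totCurve W = (0 : Tot σ B →ₗ[ℂ] Tot σ B) := by
    refine tot_hom_ext fun p φ => ?_
    rcases p with _ | _ | p <;> simp [curve_curve]
  exact LinearMap.congr_fun this x

theorem curve_bdry_zero (φ : Coch σ B 0) :
    curve W 0 (bdry 0 β φ) = post (β.left W - β.right W) φ := by
  rw [curve_zero, curry_bdry_zero]; rfl

variable {β W}

theorem totBdry_totCurve (hW : β.left W = β.right W) (x : Tot σ B) :
    totBdry β (totCurve W x) + totCurve W (totBdry β x) = 0 := by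
  have : totBdry β ∘ₗ totCurve W + totCurve W ∘ₗ totBdry β = 0 := by
    refine tot_hom_ext fun p φ => ?_
    simp only [LinearMap.add_apply, LinearMap.comp_apply, totBdry_incl, totCurve_incl_succ,
      LinearMap.zero_apply]
    cases p with
    | zero =>
      rw [totCurve_incl_zero, map_zero, zero_add, curve_bdry_zero, hW, sub_self]
      exact map_zero _
    | succ p =>
      rw [totCurve_incl_succ, totBdry_incl, ← map_add, bdry_curve, hW, sub_self]
      exact map_zero _
  exact LinearMap.congr_fun this x

variable (β W)

/-- The components of the inverse of `1 + d_W h`. -/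
noncomputable def resolventAt : (p : ℕ) → Coch σ B p →ₗ[ℂ] Tot σ B
  | 0 => incl 0
  | 1 => incl 1
  | p + 2 => incl (p + 2) - resolventAt p ∘ₗ curve W p ∘ₗ redHtpy (p + 1) β

/-- The inverse of `1 + d_W h`. -/
noncomputable def resolvent : Tot σ B →ₗ[ℂ] Tot σ B := lift (resolventAt β W)

theorem resolvent_apply_add (x : Tot σ B) :
    resolvent β W (x + totCurve W (totHtpy β x)) = x := by
  have : resolvent β W ∘ₗ (LinearMap.id + totCurve W ∘ₗ totHtpy β) = LinearMap.id := by
    refine tot_hom_ext fun p φ => ?_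
    rcases p with _ | _ | p
    · simp [resolvent, lift_incl, resolventAt]
    · rw [LinearMap.comp_apply, LinearMap.add_apply, LinearMap.comp_apply, totHtpy_incl_succ,
        totCurve_incl_zero]
      simp [resolvent, lift_incl, resolventAt]
    · rw [LinearMap.comp_apply, LinearMap.add_apply, LinearMap.comp_apply, totHtpy_incl_succ,
        totCurve_incl_succ]
      simp [resolvent, lift_incl, resolventAt]
  exact LinearMap.congr_fun this x

theorem resolvent_add (x : Tot σ B) :
    resolvent β W x + totCurve W (totHtpy β (resolvent β W x)) = x := by
  have h : ∀ p (φ : Coch σ B p), resolventAt β W p φ +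
      totCurve W (totHtpy β (resolventAt β W p φ)) = incl p φ := by
    intro p
    induction p using Nat.strong_induction_on with
    | _ p ih =>
      intro φ
      rcases p with _ | _ | p
      · simp [resolventAt]
      · change incl 1 φ + totCurve W (totHtpy β (incl (0 + 1) φ)) = incl 1 φ
        rw [totHtpy_incl_succ, totCurve_incl_zero, add_zero]
      · have := ih p (by omega) (curve W p (redHtpy (p + 1) β φ))
        have h2 : resolventAt β W (p + 2) φ = incl (p + 2) φ -
          resolventAt β W p (curve W p (redHtpy (p + 1) β φ)) := rfl
        rw [h2, map_sub, map_sub, totHtpy_incl_succ, totCurve_incl_succ, ← this]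
        abel
  have : (LinearMap.id + totCurve W ∘ₗ totHtpy β) ∘ₗ resolvent β W = LinearMap.id := by
    refine tot_hom_ext fun p φ => ?_
    simpa [resolvent, lift_incl] using h p φ
  exact LinearMap.congr_fun this x

/-- The perturbed projection to the Koszul cochains. -/
noncomputable def psiW : Tot σ B →ₗ[ℂ] (Finset σ → B) := totPsi β ∘ₗ resolvent β W

/-- The perturbed homotopy. -/
noncomputable def htpyW : Tot σ B →ₗ[ℂ] Tot σ B := totHtpy β ∘ₗ resolvent β W

theorem resolvent_totUps (κ : Finset σ → B) : resolvent β W (totUps β κ) = totUps β κ := by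
  have := resolvent_apply_add β W (totUps β κ)
  rwa [totHtpy_totUps, map_zero, add_zero] at this

theorem psiW_totUps (κ : Finset σ → B) : psiW β W (totUps β κ) = κ := by
  rw [psiW, LinearMap.comp_apply, resolvent_totUps, totPsi_totUps]

variable {β W}

theorem totDiff_add (hW : β.left W = β.right W) (x : Tot σ B) :
    totBdry β (x + totCurve W (totHtpy β x)) + totCurve W (x + totCurve W (totHtpy β x)) =
      (totBdry β x + totCurve W (totHtpy β (totBdry β x))) +
        totUps β (koszCurve W β (totPsi β x)) := by
  have h1 := totBdry_totCurve hW (totHtpy β x)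
  have h2 := congrArg (totCurve W) (totHtpy_formula β x)
  rw [map_add, map_sub, totCurve_totUps] at h2
  rw [map_add, map_add, totCurve_totCurve]
  linear_combination (norm := module) h1 - h2

theorem psiW_diff (hW : β.left W = β.right W) (y : Tot σ B) :
    psiW β W (totBdry β y + totCurve W y) =
      kosz β (psiW β W y) + koszCurve W β (psiW β W y) := by
  set x := resolvent β W y with hx
  have hy : y = x + totCurve W (totHtpy β x) := (resolvent_add β W y).symm
  have h : psiW β W y = totPsi β x := rfl
  rw [h]
  conv_lhs => rw [hy]
  rw [totDiff_add hW, psiW, LinearMap.comp_apply, map_add (resolvent β W), resolvent_apply_add,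
    resolvent_totUps, map_add, totPsi_totUps, totPsi_totBdry]

theorem htpyW_formula (hW : β.left W = β.right W) (y : Tot σ B) :
    (totBdry β (htpyW β W y) + totCurve W (htpyW β W y)) + htpyW β W (totBdry β y + totCurve W y) =
      y - totUps β (psiW β W y) := by
  set x := resolvent β W y with hx
  have hy : y = x + totCurve W (totHtpy β x) := (resolvent_add β W y).symm
  have h : psiW β W y = totPsi β x := rfl
  have h' : htpyW β W y = totHtpy β x := rfl
  rw [h, h']
  conv_lhs => rw [hy]
  rw [totDiff_add hW, htpyW, LinearMap.comp_apply, map_add (resolvent β W), resolvent_apply_add,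
    resolvent_totUps, map_add, totHtpy_totUps, hy]
  linear_combination (norm := module) totHtpy_formula β x

theorem totPost_totHtpy {f : B →ₗ[ℂ] B} (hf : IsHom β β f) (x : Tot σ B) :
    totHtpy β (totPost f x) = totPost f (totHtpy β x) := by
  have : totHtpy β ∘ₗ totPost f = totPost f ∘ₗ totHtpy β := by
    refine tot_hom_ext fun p φ => ?_
    cases p <;> simp [redHtpy_post hf]
  exact LinearMap.congr_fun this x

theorem totPost_totCurve (f : B →ₗ[ℂ] B) (x : Tot σ B) :
    totCurve W (totPost f x) = totPost f (totCurve W x) := by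
  have : totCurve W ∘ₗ totPost f = totPost f ∘ₗ totCurve W := by
    refine tot_hom_ext fun p φ => ?_
    cases p <;> simp [curve_post]
  exact LinearMap.congr_fun this x

theorem totPost_totPsi {f : B →ₗ[ℂ] B} (hf : IsHom β β f) (x : Tot σ B) :
    totPsi β (totPost f x) = mapCoeff f (totPsi β x) := by
  have : totPsi β ∘ₗ totPost f = mapCoeff f ∘ₗ totPsi β := by
    refine tot_hom_ext fun p φ => ?_
    simp [psi_post hf.right]
  exact LinearMap.congr_fun this x

theorem resolvent_totPost {f : B →ₗ[ℂ] B} (hf : IsHom β β f) (y : Tot σ B) :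
    resolvent β W (totPost f y) = totPost f (resolvent β W y) := by
  conv_lhs => rw [← resolvent_add β W y]
  rw [map_add, ← totPost_totCurve, ← totPost_totHtpy hf, resolvent_apply_add]

theorem psiW_totPost {f : B →ₗ[ℂ] B} (hf : IsHom β β f) (y : Tot σ B) :
    psiW β W (totPost f y) = mapCoeff f (psiW β W y) := by
  rw [psiW, LinearMap.comp_apply, resolvent_totPost hf, totPost_totPsi hf]; rfl

/-- The component of top degree of the projection does not see the curving. -/
theorem psiW_incl_top (p : ℕ) (φ : Coch σ B p) (J : Finset σ) (hJ : p ≤ J.card) :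
    psiW β W (incl p φ) J = psi p β φ J := by
  have h : ∀ q (ψ : Coch σ B q), ∀ J : Finset σ, q < J.card →
      totPsi β (resolventAt β W q ψ) J = 0 := by
    intro q
    induction q using Nat.strong_induction_on with
    | _ q ih =>
      intro ψ J hJ
      have h0 : psi q β ψ J = 0 := by
        rw [← degPart_psi, degPart_apply, if_neg (by omega)]
      rcases q with _ | _ | q
      · simpa [resolventAt] using h0
      · change totPsi β (incl 1 ψ) J = 0
        rw [totPsi_incl]; exact h0
      · have h2 : resolventAt β W (q + 2) ψ = incl (q + 2) ψ -
          resolventAt β W q (curve W q (redHtpy (q + 1) β ψ)) := rfl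
        rw [h2, map_sub, totPsi_incl, Pi.sub_apply, ih q (by omega) _ J (by omega), h0, sub_zero]
  rw [psiW, LinearMap.comp_apply, resolvent, lift_incl]
  rcases p with _ | _ | p
  · simp [resolventAt]
  · change totPsi β (incl 1 φ) J = _
    rw [totPsi_incl]
  · have h2 : resolventAt β W (p + 2) φ = incl (p + 2) φ -
      resolventAt β W p (curve W p (redHtpy (p + 1) β φ)) := rfl
    rw [h2, map_sub, totPsi_incl, Pi.sub_apply, h p _ J (by omega), sub_zero]

/-- The projection of a `p`-cochain lives in degrees of the parity of `p`. -/
theorem psiW_incl_parity (p : ℕ) (φ : Coch σ B p) (J : Finset σ)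
    (hJ : ¬ ∃ m, J.card + 2 * m = p) : psiW β W (incl p φ) J = 0 := by
  rw [psiW, LinearMap.comp_apply, resolvent, lift_incl]
  induction p using Nat.strong_induction_on with
  | _ p ih =>
    have h0 : psi p β φ J = 0 := by
      rw [← degPart_psi, degPart_apply, if_neg fun h => hJ ⟨0, by omega⟩]
    rcases p with _ | _ | p
    · simpa [resolventAt] using h0
    · change totPsi β (incl 1 φ) J = 0
      rw [totPsi_incl]; exact h0
    · have h2 : resolventAt β W (p + 2) φ = incl (p + 2) φ -
        resolventAt β W p (curve W p (redHtpy (p + 1) β φ)) := rfl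
      rw [h2, map_sub, totPsi_incl, Pi.sub_apply, h0,
        ih p (by omega) _ fun ⟨m, hm⟩ => hJ ⟨m + 1, by omega⟩, sub_zero]

end Total

end BarCochain

/-! ## The sectors of the crossed product -/

namespace BarCochain

open PolyBimod DividedDiff Fermion Hochschild

section Formulas

variable {σ M : Type} [AddCommGroup M] [Module ℂ M]

/-- The value of a cochain on the initial segment of a sequence. -/
noncomputable def evSeq {p : ℕ} (φ : Coch σ M p) (a : ℕ → MvPolynomial σ ℂ) : M := φ fun t => a t

theorem evSeq_curry {p : ℕ} (φ : Coch σ M (p + 1)) (a : ℕ → MvPolynomial σ ℂ)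
    (b : MvPolynomial σ ℂ) : evSeq (curry φ) a b = evSeq φ (fun t => if t = 0 then b else a (t - 1)) := by
  unfold evSeq
  rw [curry_apply]
  congr 1
  ext t
  refine Fin.cases ?_ (fun s => ?_) t <;> simp

theorem evSeq_eq_curry {p : ℕ} (φ : Coch σ M (p + 1)) (a : ℕ → MvPolynomial σ ℂ) :
    evSeq φ a = evSeq (curry φ) (fun t => a (t + 1)) (a 0) := by
  rw [evSeq_curry]
  unfold evSeq
  congr 1
  ext t
  refine Fin.cases ?_ (fun s => ?_) t <;> simp

theorem evSeq_ext {p : ℕ} {φ ψ : Coch σ M p} (h : ∀ a, evSeq φ a = evSeq ψ a) : φ = ψ := by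
  ext v
  have := h fun i => if h : i < p then v ⟨i, h⟩ else 0
  simpa [evSeq] using this

theorem evSeq_congr {p : ℕ} (φ : Coch σ M p) {a b : ℕ → MvPolynomial σ ℂ}
    (h : ∀ t < p, a t = b t) : evSeq φ a = evSeq φ b := by
  unfold evSeq
  congr 1
  ext t
  rw [h t t.2]

theorem evSeq_bdry (β : PolyBimod σ M) (p : ℕ) (φ : Coch σ M p) (a : ℕ → MvPolynomial σ ℂ) :
    evSeq (bdry p β φ) a = β.left (a 0) (evSeq φ fun t => a (t + 1)) +
      ∑ i ∈ Finset.range p, (-1 : ℂ) ^ (i + 1) •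
        evSeq φ (fun t => if t < i then a t else if t = i then a t * a (t + 1) else a (t + 1)) +
      (-1 : ℂ) ^ (p + 1) • β.right (a p) (evSeq φ a) := by
  induction p generalizing M a with
  | zero =>
    rw [evSeq_eq_curry, curry_bdry_zero]
    simp [evSeq, sub_eq_add_neg]
    exact congrArg _ (congrArg φ (Subsingleton.elim _ _))
  | succ p ih =>
    rw [evSeq_eq_curry, curry_bdry_succ]
    have h1 : evSeq (post β.iota φ - bdry p β.coind (curry φ)) (fun t => a (t + 1)) (a 0) =
      β.left (a 0) (evSeq φ fun t => a (t + 1)) -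
        evSeq (bdry p β.coind (curry φ)) (fun t => a (t + 1)) (a 0) := rfl
    rw [h1, ih]
    simp only [LinearMap.add_apply, LinearMap.sum_apply, LinearMap.smul_apply, coind_left_apply,
      coind_right_apply]
    rw [Finset.sum_range_succ', ← evSeq_eq_curry φ a]
    simp only [evSeq_curry]
    have h2 : ∀ i ∈ Finset.range p, (-1 : ℂ) ^ (i + 1) • evSeq φ (fun t => if t = 0 then a 0 else
          if t - 1 < i then a (t - 1 + 1) else if t - 1 = i then a (t - 1 + 1) * a (t - 1 + 1 + 1)
          else a (t - 1 + 1 + 1)) =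
        -((-1 : ℂ) ^ (i + 1 + 1) • evSeq φ (fun t => if t < i + 1 then a t else if t = i + 1 then
          a t * a (t + 1) else a (t + 1))) := by
      intro i _
      rw [pow_succ _ (i + 1), mul_neg_one, neg_smul, neg_neg]
      congr 1
      refine evSeq_congr φ fun t _ => ?_
      rcases t with _ | t
      · simp
      · simp
    rw [Finset.sum_congr rfl h2, Finset.sum_neg_distrib]
    have h3 : evSeq φ (fun t => if t = 0 then a 0 * a (0 + 1) else a (t - 1 + 1 + 1)) =
        evSeq φ (fun t => if t < 0 then a t else if t = 0 then a t * a (t + 1) else a (t + 1)) := by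
      refine evSeq_congr φ fun t _ => ?_
      rcases t with _ | t <;> simp
    rw [h3, pow_succ _ (p + 1), mul_neg_one, neg_smul]
    simp only [zero_add, pow_one, neg_smul, one_smul]
    abel

theorem evSeq_curve (W : MvPolynomial σ ℂ) (p : ℕ) (φ : Coch σ M (p + 1))
    (a : ℕ → MvPolynomial σ ℂ) :
    evSeq (curve W p φ) a = ∑ i ∈ Finset.range (p + 1), (-1 : ℂ) ^ i •
      evSeq φ (fun t => if t < i then a t else if t = i then W else a (t - 1)) := by
  induction p generalizing M a with
  | zero =>
    rw [curve_zero]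
    have : evSeq (post (evAt W) (curry φ)) a = evSeq (curry φ) a W := rfl
    rw [this, evSeq_curry]
    simp
  | succ p ih =>
    rw [curve_succ]
    have : evSeq (post (evAt W) (curry φ) - curry.symm (curve W p (curry φ))) a =
      evSeq (curry φ) a W - evSeq (curry.symm (curve W p (curry φ))) a := rfl
    rw [this, evSeq_curry, evSeq_eq_curry (curry.symm _), LinearEquiv.apply_symm_apply, ih,
      LinearMap.sum_apply, Finset.sum_range_succ' _ (p + 1)]
    simp only [LinearMap.smul_apply, evSeq_curry]
    have h2 : ∀ i ∈ Finset.range (p + 1), (-1 : ℂ) ^ i • evSeq φ (fun t => if t = 0 then a 0 else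
          if t - 1 < i then a (t - 1 + 1) else if t - 1 = i then W else a (t - 1 - 1 + 1)) =
        -((-1 : ℂ) ^ (i + 1) • evSeq φ (fun t => if t < i + 1 then a t else if t = i + 1 then
          W else a (t - 1))) := by
      intro i _
      rw [pow_succ, mul_neg_one, neg_smul, neg_neg]
      congr 1
      refine evSeq_congr φ fun t _ => ?_
      rcases t with _ | t
      · simp
      · simp only [Nat.add_eq_zero_iff, one_ne_zero, and_false, if_false, Nat.add_sub_cancel,
          add_lt_add_iff_right, add_left_inj]
        split_ifs with h1 h2
        · rfl
        · rfl
        · congr 1; omega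
    rw [Finset.sum_congr rfl h2, Finset.sum_neg_distrib]
    simp
    abel

end Formulas

section UpsSingle

variable {σ M : Type} [Fintype σ] [LinearOrder σ] [AddCommGroup M] [Module ℂ M]

theorem tail_single (i : σ) (I : Finset σ) (m : M) :
    tail ℂ i (Pi.single I m : Finset σ → M) =
      if i ∈ I ∧ ∀ j ∈ I.erase i, i < j then Pi.single (I.erase i) m else 0 := by
  ext J
  rw [tail_apply]
  split_ifs with h1 h2 h2
  · have hi : i ∉ J := fun hi => lt_irrefl i (h1 i hi)
    by_cases hJ : J = I.erase i
    · subst hJ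
      rw [Finset.insert_erase h2.1]; simp
    · rw [Pi.single_eq_of_ne hJ, Pi.single_eq_of_ne]
      rintro rfl
      exact hJ (Finset.erase_insert hi).symm
  · have hi : i ∉ J := fun hi => lt_irrefl i (h1 i hi)
    rw [Pi.single_eq_of_ne, Pi.zero_apply]
    rintro rfl
    refine h2 ⟨Finset.mem_insert_self _ _, ?_⟩
    rwa [Finset.erase_insert hi]
  · rw [Pi.single_eq_of_ne]
    rintro rfl
    exact h1 h2.2
  · rfl

theorem orderEmbOfFin_succ_eq {I : Finset σ} {p : ℕ} (h : I.card = p + 1) (m : Fin p)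
    (h' : (I.erase (I.orderEmbOfFin h 0)).card = p) :
    I.orderEmbOfFin h m.succ = (I.erase (I.orderEmbOfFin h 0)).orderEmbOfFin h' m := by
  have := Finset.orderEmbOfFin_unique h' (f := fun m => I.orderEmbOfFin h m.succ) ?_ ?_
  · exact congrFun this m
  · intro x
    refine Finset.mem_erase.2 ⟨fun h2 => ?_, Finset.orderEmbOfFin_mem _ _ _⟩
    exact Fin.succ_ne_zero x ((I.orderEmbOfFin h).injective h2)
  · intro x y hxy
    exact (I.orderEmbOfFin h).strictMono (Fin.succ_lt_succ_iff.2 hxy)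

theorem ups_single (β : PolyBimod σ M) (p : ℕ) (I : Finset σ) (h : I.card = p) (m : M)
    (v : Fin p → MvPolynomial σ ℂ) :
    ups β p (Pi.single I m) v = β.act (∏ t, ddiff (I.orderEmbOfFin h t) (v t)) m := by
  induction p generalizing I with
  | zero =>
    rw [Finset.card_eq_zero] at h
    subst h
    simp [ups_zero]
  | succ p ih =>
    set i₀ := I.orderEmbOfFin h 0 with hi₀
    have hmem : i₀ ∈ I := I.orderEmbOfFin_mem h 0
    have hlt : ∀ j ∈ I.erase i₀, i₀ < j := by
      intro j hj
      rw [Finset.mem_erase] at hj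
      refine lt_of_le_of_ne ?_ hj.1.symm
      have h1 : j ∈ Set.range (I.orderEmbOfFin h) := by
        rw [Finset.range_orderEmbOfFin]; exact hj.2
      obtain ⟨t, rfl⟩ := h1
      exact (I.orderEmbOfFin h).monotone (Fin.zero_le t)
    have hcard : (I.erase i₀).card = p := by rw [Finset.card_erase_of_mem hmem, h]; rfl
    rw [← Fin.cons_self_tail v, ups_succ_apply, Finset.sum_eq_single i₀]
    · have hp : ∏ t : Fin p, ddiff (I.orderEmbOfFin h t.succ) (Fin.tail v t) =
          ∏ t, ddiff ((I.erase i₀).orderEmbOfFin hcard t) (Fin.tail v t) :=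
        Finset.prod_congr rfl fun t _ => by rw [orderEmbOfFin_succ_eq h t hcard]
      rw [tail_single, if_pos ⟨hmem, hlt⟩, ih _ hcard, Fin.prod_univ_succ, map_mul,
        Module.End.mul_apply]
      simp only [Fin.cons_zero, Fin.cons_succ]
      rw [hp]
    · intro i _ hi
      rw [tail_single, if_neg, map_zero]
      · simp
      · rintro ⟨h1, h2⟩
        exact (hlt i (Finset.mem_erase.2 ⟨hi, h1⟩)).asymm (h2 i₀ (Finset.mem_erase.2 ⟨hi.symm, hmem⟩))
    · simp

theorem totUps_single {B : Type} [Ring B] [Algebra ℂ B] (β : PolyBimod σ B) (I : Finset σ) (m : B) :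
    totUps β (Pi.single I m) = incl I.card (ups β I.card (Pi.single I m)) := by
  rw [← totUps_degPart]
  congr 1
  ext J
  rw [degPart_apply]
  split_ifs with h
  · rfl
  · rw [Pi.single_eq_of_ne]
    rintro rfl
    exact h rfl

theorem totUps_eq_sum {B : Type} [Ring B] [Algebra ℂ B] (β : PolyBimod σ B) (κ : Finset σ → B) :
    totUps β κ = ∑ I, incl I.card (ups β I.card (Pi.single I (κ I))) := by
  conv_lhs => rw [← Finset.univ_sum_single κ, map_sum]
  exact Finset.sum_congr rfl fun I _ => totUps_single β I _

end UpsSingle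

end BarCochain

namespace Orbifold

open PolyBimod DividedDiff Fermion Hochschild BarCochain

section Sector

variable {σ : Type} [Fintype σ] [LinearOrder σ] (G : Subgroup (Torus σ))

/-- The crossed product as a bimodule. -/
noncomputable def bimod : PolyBimod σ (CrossedProduct G) where
  left := (Algebra.lmul ℂ (CrossedProduct G)).comp (unitSector G)
  right := AlgHom.ofLinearMap
    ((LinearMap.mul ℂ (CrossedProduct G)).flip ∘ₗ (unitSector G).toLinearMap)
    (by ext x; simp) (fun a b => by
      refine LinearMap.ext fun x => ?_
      have : unitSector G a * unitSector G b = unitSector G b * unitSector G a := by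
        rw [← map_mul, mul_comm, map_mul]
      simp [mul_assoc, this])
  comm a b := LinearMap.ext fun x => by simp [mul_assoc]

@[simp] theorem bimod_left_apply (a : MvPolynomial σ ℂ) (x : CrossedProduct G) :
    (bimod G).left a x = unitSector G a * x := rfl

@[simp] theorem bimod_right_apply (a : MvPolynomial σ ℂ) (x : CrossedProduct G) :
    (bimod G).right a x = x * unitSector G a := rfl

theorem unitSector_mul_single (a b : MvPolynomial σ ℂ) (g : G) :
    unitSector G a * SkewMonoidAlgebra.single g b = SkewMonoidAlgebra.single g (a * b) := by
  change SkewMonoidAlgebra.single 1 a * SkewMonoidAlgebra.single g b = _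
  rw [SkewMonoidAlgebra.single_mul_single, one_mul, one_smul]

theorem single_mul_unitSector (a b : MvPolynomial σ ℂ) (g : G) :
    SkewMonoidAlgebra.single g b * unitSector G a = SkewMonoidAlgebra.single g (b * g.1 • a) := by
  change SkewMonoidAlgebra.single g b * SkewMonoidAlgebra.single 1 a = _
  rw [SkewMonoidAlgebra.single_mul_single, mul_one]; rfl

/-- The coefficient of `u`. -/
noncomputable def coeffAt (u : G) : CrossedProduct G →ₗ[ℂ] MvPolynomial σ ℂ :=
  Finsupp.lapply u ∘ₗ
    (SkewMonoidAlgebra.coeffLinearEquiv : CrossedProduct G ≃ₗ[ℂ] (G →₀ _)).toLinearMap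

open Classical in
theorem coeffAt_single (u g : G) (b : MvPolynomial σ ℂ) :
    coeffAt G u (SkewMonoidAlgebra.single g b) = if g = u then b else 0 :=
  SkewMonoidAlgebra.coeff_single_apply

theorem coeffAt_unitSector_mul (u : G) (a : MvPolynomial σ ℂ) (x : CrossedProduct G) :
    coeffAt G u (unitSector G a * x) = a * coeffAt G u x := by
  classical
  induction x using SkewMonoidAlgebra.induction_on with
  | zero => simp
  | single g b =>
    rw [unitSector_mul_single, coeffAt_single, coeffAt_single]; split_ifs <;> simp
  | add x y hx hy => simp only [mul_add, map_add, hx, hy]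

theorem coeffAt_mul_unitSector (u : G) (a : MvPolynomial σ ℂ) (x : CrossedProduct G) :
    coeffAt G u (x * unitSector G a) = coeffAt G u x * u.1 • a := by
  classical
  induction x using SkewMonoidAlgebra.induction_on with
  | zero => simp
  | single g b =>
    rw [single_mul_unitSector, coeffAt_single, coeffAt_single]
    split_ifs with h
    · rw [h]
    · simp
  | add x y hx hy => simp only [add_mul, map_add, hx, hy]

variable {G}

/-- The action of `A ⊗ A` on the sector of `g`. -/
noncomputable def twist (g : Torus σ) : Env σ →ₐ[ℂ] MvPolynomial σ ℂ :=
  Algebra.TensorProduct.lift (AlgHom.id ℂ _) (Torus.act g) fun _ _ => Commute.all _ _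

@[simp] theorem twist_tmul (g : Torus σ) (a b : MvPolynomial σ ℂ) :
    twist g (a ⊗ₜ b) = a * g • b := rfl

@[simp] theorem smul_X (g : Torus σ) (i : σ) :
    g • (X i : MvPolynomial σ ℂ) = C (g i : ℂ) * X i := by
  rw [Torus.smul_def, Torus.act, aeval_X]

theorem act_single (g : G) (x : Env σ) (b : MvPolynomial σ ℂ) :
    (bimod G).act x (SkewMonoidAlgebra.single g b) =
      SkewMonoidAlgebra.single g (twist g.1 x * b) := by
  induction x using TensorProduct.induction_on with
  | zero => simp
  | tmul a c =>
    rw [act_tmul, Module.End.mul_apply, bimod_right_apply, bimod_left_apply,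
      single_mul_unitSector, unitSector_mul_single, twist_tmul]
    congr 1; ring
  | add x y hx hy => rw [map_add, map_add, LinearMap.add_apply, hx, hy, add_mul,
      SkewMonoidAlgebra.single_add]

theorem coeffAt_act (u : G) (x : Env σ) (y : CrossedProduct G) :
    coeffAt G u ((bimod G).act x y) = twist u.1 x * coeffAt G u y := by
  induction x using TensorProduct.induction_on with
  | zero => simp
  | tmul a c =>
    rw [act_tmul, Module.End.mul_apply, bimod_right_apply, bimod_left_apply,
      coeffAt_unitSector_mul, coeffAt_mul_unitSector, twist_tmul]
    ring
  | add x y hx hy => rw [map_add, map_add, LinearMap.add_apply, map_add, hx, hy, add_mul]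

theorem twist_gap (g : Torus σ) (i : σ) : twist g (gap i) = X i - g • X i := by
  simp [gap]

theorem twist_ddiff (g : Torus σ) (i : σ) (a : MvPolynomial σ ℂ) :
    twist g (ddiff i a) = rhoOp g i (quantumDiff g i a) := by
  have key : (twist g).toLinearMap ∘ₗ ddiff i = (rhoOp g i).toLinearMap ∘ₗ quantumDiff g i := by
    refine (basisMonomials σ ℂ).ext fun γ => ?_
    have hq : quantumDiff g i (monomial γ 1) =
        monomial (γ - Finsupp.single i 1) (∑ s ∈ Finset.range (γ i), (g i : ℂ) ^ s) := by
      have := (basisMonomials σ ℂ).constr_basis ℂ (fun γ =>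
        monomial (γ - Finsupp.single i 1) (∑ s ∈ Finset.range (γ i), (g i : ℂ) ^ s)) γ
      rwa [coe_basisMonomials] at this
    rw [coe_basisMonomials, LinearMap.comp_apply, LinearMap.comp_apply, ddiff_monomial, hq,
      AlgHom.toLinearMap_apply, AlgHom.toLinearMap_apply, diffMonomial, rhoOp, aeval_monomial,
      Finsupp.prod_fintype _ _ (by simp), ← Finset.prod_erase_mul _ _ (Finset.mem_univ i), map_mul,
      map_prod]
    have h1 : ∏ j ∈ Finset.univ.erase i, twist g (var (j < i) j ^ γ j) =
        ∏ j ∈ Finset.univ.erase i, (if j < i then C (g j : ℂ) * X j else X j :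
          MvPolynomial σ ℂ) ^ ((γ - Finsupp.single i 1 : σ →₀ ℕ) j) := by
      refine Finset.prod_congr rfl fun j hj => ?_
      have hj : i ≠ j := (Finset.ne_of_mem_erase hj).symm
      rw [map_pow, Finsupp.tsub_apply, Finsupp.single_eq_of_ne hj.symm, tsub_zero]
      congr 1
      unfold DividedDiff.var
      split_ifs <;> simp
    rw [h1, if_neg (lt_irrefl i), map_sum, Finsupp.tsub_apply, Finsupp.single_eq_same,
      algebraMap_eq, map_sum, mul_left_comm, Finset.sum_mul]
    congr 1
    rw [← Finset.sum_range_reflect (fun s => C ((g i : ℂ) ^ s) * X i ^ (γ i - 1))]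
    refine Finset.sum_congr rfl fun s hs => ?_
    rw [Finset.mem_range] at hs
    simp only [map_mul, map_pow, twist_tmul, one_mul, smul_one, mul_one, smul_X]
    rw [mul_pow, mul_left_comm, ← pow_add]
    congr 2
    omega
  exact LinearMap.congr_fun key a

/-- The coefficients of the Koszul differential. -/
noncomputable def kv (g : Torus σ) (i : σ) : MvPolynomial σ ℂ := X i - g • X i

/-- The coefficients of the curving. -/
noncomputable def kw (W : MvPolynomial σ ℂ) (g : Torus σ) (i : σ) : MvPolynomial σ ℂ :=
  rhoOp g i (quantumDiff g i W)

/-- The differential `∑ᵢ (vᵢ eᵢ + wᵢ ∂/∂eᵢ)`. -/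
noncomputable def cliff (v w : σ → MvPolynomial σ ℂ) :
    (Finset σ → MvPolynomial σ ℂ) →ₗ[MvPolynomial σ ℂ] (Finset σ → MvPolynomial σ ℂ) :=
  ∑ i, (v i • create (MvPolynomial σ ℂ) i + w i • annihilate (MvPolynomial σ ℂ) i)

theorem cliff_apply (v w : σ → MvPolynomial σ ℂ) (κ : Finset σ → MvPolynomial σ ℂ) :
    cliff v w κ = ∑ i, (v i • create (MvPolynomial σ ℂ) i κ +
      w i • annihilate (MvPolynomial σ ℂ) i κ) := by
  simp [cliff]

/-- The differential of the sector of `g`. -/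
noncomputable def sectorDiff (W : MvPolynomial σ ℂ) (g : Torus σ) :
    (Finset σ → MvPolynomial σ ℂ) →ₗ[MvPolynomial σ ℂ] (Finset σ → MvPolynomial σ ℂ) :=
  cliff (kv g) (kw W g)

theorem sectorDiff_eq (W : MvPolynomial σ ℂ) (g : Torus σ) (κ : KoszulCochain σ) :
    sectorDiff W g κ = koszulDiff g κ + koszulCurv W g κ := by
  ext1 J
  rw [sectorDiff, cliff_apply, Finset.sum_add_distrib, Pi.add_apply, Pi.add_apply,
    Finset.sum_apply, Finset.sum_apply]
  congr 1
  · rw [koszulDiff, ← Finset.sum_subset (Finset.subset_univ J)]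
    · refine Finset.sum_congr rfl fun i hi => ?_
      simp only [create_apply, hi, kv, if_true, Pi.smul_apply, smul_eq_mul, zsmul_eq_mul]
      ring
    · intro i _ hi; simp [create_apply, hi]
  · rw [koszulCurv, ← Finset.sum_subset (Finset.subset_univ Jᶜ)]
    · refine Finset.sum_congr rfl fun i hi => ?_
      simp only [annihilate_apply, Finset.mem_compl.1 hi, kw, if_false, Pi.smul_apply, smul_eq_mul,
        zsmul_eq_mul]
      ring
    · intro i _ hi
      simp [annihilate_apply, by simpa using hi]

theorem curvedDiff_eq (W : MvPolynomial σ ℂ) (x : Tot σ (CrossedProduct G)) :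
    curvedDiff (unitSector G) W x = totBdry (bimod G) x + totCurve W x := by
  have h1 : ∀ p, diffAt (unitSector G) p = bdry p (bimod G) := by
    intro p
    refine LinearMap.ext fun φ => evSeq_ext fun a => ?_
    rw [evSeq_bdry]
    exact ev_diff (unitSector G) φ a
  have h2 : ∀ p, (curvAt W p : _ →ₗ[ℂ] Coch σ (CrossedProduct G) p) = curve W p := by
    intro p
    refine LinearMap.ext fun φ => evSeq_ext fun a => ?_
    rw [evSeq_curve]
    exact ev_curv W φ a
  have : curvedDiff (unitSector G) W = totBdry (bimod G) + totCurve W := by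
    refine tot_hom_ext fun p φ => ?_
    rw [curvedDiff, LinearMap.add_apply, LinearMap.add_apply, diff_incl, totBdry_incl, h1]
    cases p with
    | zero => rw [curv_incl_zero, totCurve_incl_zero]
    | succ p => rw [curv_incl_succ, totCurve_incl_succ, h2]
  rw [this]; rfl

/-- The embedding of the Koszul cochains of the sector of `g`. -/
noncomputable def embed (G : Subgroup (Torus σ)) (g : G) :
    (Finset σ → MvPolynomial σ ℂ) →ₗ[ℂ] Tot σ (CrossedProduct G) :=
  totUps (bimod G) ∘ₗ mapCoeff (SkewMonoidAlgebra.lsingle ℂ g)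

theorem upsilon_eq (g : G) (κ : KoszulCochain σ) : upsilon G g κ = embed G g κ := by
  rw [upsilon, embed, LinearMap.comp_apply, totUps_eq_sum]
  refine Finset.sum_congr rfl fun I _ => ?_
  congr 1
  refine MultilinearMap.ext fun v => ?_
  rw [ups_single _ _ _ rfl, mapCoeff_apply, SkewMonoidAlgebra.lsingle_apply, act_single, map_prod]
  simp only [twist_ddiff, upsilonTerm]
  rw [mul_comm]
  rfl

theorem kosz_lsingle (g : G) (κ : Finset σ → MvPolynomial σ ℂ) :
    kosz (bimod G) (mapCoeff (SkewMonoidAlgebra.lsingle ℂ g) κ) =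
      mapCoeff (SkewMonoidAlgebra.lsingle ℂ g) (cliff (kv g.1) 0 κ) := by
  rw [kosz_apply, cliff_apply, map_sum]
  refine Finset.sum_congr rfl fun i _ => ?_
  ext1 J
  rw [create_mapCoeff, mapCoeff_apply, mapCoeff_apply, SkewMonoidAlgebra.lsingle_apply, act_single,
    twist_gap]
  simp [kv, create_apply, SkewMonoidAlgebra.lsingle_apply]

theorem koszCurve_lsingle (W : MvPolynomial σ ℂ) (g : G) (κ : Finset σ → MvPolynomial σ ℂ) :
    koszCurve W (bimod G) (mapCoeff (SkewMonoidAlgebra.lsingle ℂ g) κ) =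
      mapCoeff (SkewMonoidAlgebra.lsingle ℂ g) (cliff 0 (kw W g.1) κ) := by
  rw [koszCurve_apply, cliff_apply, map_sum]
  refine Finset.sum_congr rfl fun i _ => ?_
  ext1 J
  rw [annihilate_mapCoeff, mapCoeff_apply, mapCoeff_apply, SkewMonoidAlgebra.lsingle_apply,
    act_single, twist_ddiff]
  simp [kw, annihilate_apply, SkewMonoidAlgebra.lsingle_apply]

theorem cliff_add (v v' w w' : σ → MvPolynomial σ ℂ) (κ : Finset σ → MvPolynomial σ ℂ) :
    cliff v w κ + cliff v' w' κ = cliff (v + v') (w + w') κ := by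
  simp only [cliff_apply, ← Finset.sum_add_distrib, Pi.add_apply, add_smul]
  exact Finset.sum_congr rfl fun i _ => by abel

theorem curvedDiff_embed (W : MvPolynomial σ ℂ) (g : G) (κ : Finset σ → MvPolynomial σ ℂ) :
    curvedDiff (unitSector G) W (embed G g κ) = embed G g (sectorDiff W g.1 κ) := by
  rw [curvedDiff_eq, embed, LinearMap.comp_apply, LinearMap.comp_apply, totBdry_totUps,
    totCurve_totUps, kosz_lsingle, koszCurve_lsingle, ← map_add, ← map_add, cliff_add, add_zero,
    zero_add]
  rfl

/-- The projection to the Koszul cochains of the sector of `u`. -/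
noncomputable def project (W : MvPolynomial σ ℂ) (G : Subgroup (Torus σ)) (u : G) :
    Tot σ (CrossedProduct G) →ₗ[ℂ] (Finset σ → MvPolynomial σ ℂ) :=
  mapCoeff (coeffAt G u) ∘ₗ psiW (bimod G) W

open Classical in
theorem project_embed (W : MvPolynomial σ ℂ) (u g : G) (κ : Finset σ → MvPolynomial σ ℂ) :
    project W G u (embed G g κ) = if g = u then κ else 0 := by
  rw [project, embed, LinearMap.comp_apply, LinearMap.comp_apply, psiW_totUps]
  ext1 J
  rw [mapCoeff_apply, mapCoeff_apply, SkewMonoidAlgebra.lsingle_apply, coeffAt_single]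
  split_ifs <;> rfl

theorem left_eq_right {W : MvPolynomial σ ℂ} (hG : G ≤ symmetryGroup W) :
    (bimod G).left W = (bimod G).right W := by
  refine LinearMap.ext fun x => ?_
  induction x using SkewMonoidAlgebra.induction_on with
  | zero => simp
  | single g b =>
    have : g.1 • W = W := hG g.2
    rw [bimod_left_apply, bimod_right_apply, unitSector_mul_single, single_mul_unitSector, this,
      mul_comm]
  | add x y hx hy => rw [map_add, map_add, hx, hy]

theorem mapCoeff_coeffAt_diff (W : MvPolynomial σ ℂ) (u : G) (κ : Finset σ → CrossedProduct G) :
    mapCoeff (coeffAt G u) (kosz (bimod G) κ + koszCurve W (bimod G) κ) =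
      sectorDiff W u.1 (mapCoeff (coeffAt G u) κ) := by
  rw [sectorDiff, cliff_apply, kosz_apply, koszCurve_apply, ← Finset.sum_add_distrib, map_sum]
  refine Finset.sum_congr rfl fun i _ => ?_
  ext1 J
  simp only [map_add, mapCoeff_apply, Pi.add_apply, coeffAt_act, twist_gap, twist_ddiff,
    Pi.smul_apply, smul_eq_mul, kv, kw, create_apply, annihilate_apply]
  congr 2 <;> split_ifs <;> first | exact map_zero _ | exact map_zsmul _ _ _

theorem project_curvedDiff {W : MvPolynomial σ ℂ} (hG : G ≤ symmetryGroup W) (u : G)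
    (x : Tot σ (CrossedProduct G)) :
    project W G u (curvedDiff (unitSector G) W x) = sectorDiff W u.1 (project W G u x) := by
  rw [project, curvedDiff_eq, LinearMap.comp_apply, psiW_diff (left_eq_right hG),
    mapCoeff_coeffAt_diff]
  rfl

theorem exists_homotopy {W : MvPolynomial σ ℂ} (hG : G ≤ symmetryGroup W)
    (x : Tot σ (CrossedProduct G)) (hx : curvedDiff (unitSector G) W x = 0) :
    ∃ (s : Finset G) (y : Tot σ (CrossedProduct G)), (∀ u ∉ s, project W G u x = 0) ∧
      x = ∑ u ∈ s, embed G u (project W G u x) + curvedDiff (unitSector G) W y := by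
  classical
  set κ := psiW (bimod G) W x with hκ
  refine ⟨Finset.univ.biUnion fun J => (κ J).support, htpyW (bimod G) W x, ?_, ?_⟩
  · intro u hu
    ext1 J
    have : u ∉ (κ J).support := fun h => hu (Finset.mem_biUnion.2 ⟨J, Finset.mem_univ _, h⟩)
    exact SkewMonoidAlgebra.notMem_support_iff.1 this
  · have h := htpyW_formula (left_eq_right hG) x
    rw [← curvedDiff_eq, ← curvedDiff_eq, hx, map_zero, add_zero] at h
    rw [h, ← hκ]
    simp only [embed, LinearMap.comp_apply]
    rw [← map_sum]
    have h2 : ∑ u ∈ Finset.univ.biUnion fun J => (κ J).support,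
        mapCoeff (SkewMonoidAlgebra.lsingle ℂ u) (project W G u x) = κ := by
      ext1 J
      rw [Finset.sum_apply]
      simp only [mapCoeff_apply, SkewMonoidAlgebra.lsingle_apply]
      have h3 : ∀ u, project W G u x J = (κ J).coeff u := fun u => rfl
      simp only [h3]
      conv_rhs => rw [← SkewMonoidAlgebra.sum_single (κ J)]
      rw [SkewMonoidAlgebra.sum_def, Finsupp.sum, eq_comm]
      refine Finset.sum_subset ?_ ?_
      · exact Finset.subset_biUnion_of_mem (fun J => (κ J).support) (Finset.mem_univ J)
      · intro u _ hu
        rw [Finsupp.notMem_support_iff.1 hu, SkewMonoidAlgebra.single_zero]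
    rw [h2]; abel

end Sector

end Orbifold

/-! ## Ordered products of anticommuting operators -/

namespace Fermion

variable {σ : Type} [LinearOrder σ]

/-- The sign of the permutation that sorts `J` followed by `K`. -/
def invSign (J K : Finset σ) : ℤ := ∏ a ∈ J, koszulSign K a

/-- The sign of the reversal of `L`. -/
def revSign (L : Finset σ) : ℤ := (-1) ^ (L.card * (L.card - 1) / 2)

theorem revSign_mul_self (L : Finset σ) : revSign L * revSign L = 1 := by
  simp [revSign, ← mul_pow]

theorem invSign_mul_self (J K : Finset σ) : invSign J K * invSign J K = 1 := by
  rw [invSign, ← Finset.prod_mul_distrib]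
  exact Finset.prod_eq_one fun a _ => koszulSign_mul_self K a

theorem revSign_insert {a : σ} {L : Finset σ} (ha : a ∉ L) :
    revSign (insert a L) = (-1) ^ L.card * revSign L := by
  unfold revSign
  rw [Finset.card_insert_of_notMem ha, ← pow_add]
  congr 1
  have h := Nat.triangle_succ L.card
  rw [Nat.add_sub_cancel] at h ⊢
  rw [h, add_comm]

theorem invSign_insert_left {a : σ} {J : Finset σ} (ha : a ∉ J) (K : Finset σ) :
    invSign (insert a J) K = koszulSign K a * invSign J K := by
  rw [invSign, Finset.prod_insert ha]; rfl

theorem invSign_insert_right {a : σ} {K : Finset σ} (ha : a ∉ K) {J : Finset σ}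
    (h : ∀ b ∈ J, a < b) : invSign J (insert a K) = (-1) ^ J.card * invSign J K := by
  unfold invSign
  rw [← Finset.prod_const, ← Finset.prod_mul_distrib]
  refine Finset.prod_congr rfl fun b hb => ?_
  rw [koszulSign_insert ha, if_pos (h b hb)]

theorem invSign_union_left {J J' : Finset σ} (h : Disjoint J J') (K : Finset σ) :
    invSign (J ∪ J') K = invSign J K * invSign J' K :=
  Finset.prod_union h

theorem invSign_union_right {K K' : Finset σ} (h : Disjoint K K') (J : Finset σ) :
    invSign J (K ∪ K') = invSign J K * invSign J K' := by
  unfold invSign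
  rw [← Finset.prod_mul_distrib]
  exact Finset.prod_congr rfl fun a _ => koszulSign_union h a

theorem invSign_mul_invSign_swap {J K : Finset σ} (h : Disjoint J K) :
    invSign J K * invSign K J = (-1) ^ (J.card * K.card) := by
  have h1 : ∀ J K : Finset σ, invSign J K = ∏ a ∈ J, ∏ b ∈ K, if b < a then (-1 : ℤ) else 1 := by
    intro J K
    refine Finset.prod_congr rfl fun a _ => ?_
    rw [koszulSign, ← Finset.prod_const, Finset.prod_filter]
  rw [h1, h1, Finset.prod_comm (s := K), ← Finset.prod_mul_distrib]
  simp only [← Finset.prod_mul_distrib]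
  have h2 : ∀ a ∈ J, ∀ b ∈ K, ((if b < a then (-1 : ℤ) else 1) * if a < b then -1 else 1) = -1 := by
    intro a ha b hb
    rcases lt_trichotomy a b with h3 | rfl | h3
    · simp [h3, h3.not_gt]
    · exact absurd hb (Finset.disjoint_left.1 h ha)
    · simp [h3, h3.not_gt]
  rw [Finset.prod_congr rfl fun a ha => Finset.prod_congr rfl (h2 a ha)]
  simp [Finset.prod_const, ← pow_mul, mul_comm]

theorem invSign_self (J : Finset σ) : invSign J J = revSign J := by
  induction J using Finset.induction_on_min with
  | empty => simp [invSign, revSign]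
  | insert a J h ih =>
    have ha : a ∉ J := fun ha => lt_irrefl a (h a ha)
    rw [invSign_insert_left ha, invSign_insert_right ha h, ih, revSign_insert ha,
      koszulSign_of_forall_le, one_mul]
    intro j hj
    rcases Finset.mem_insert.1 hj with rfl | hj
    · exact le_rfl
    · exact (h j hj).le

section OrdProd

variable {R M : Type} [CommRing R] [AddCommGroup M] [Module R M]

/-- The product of the operators `T i`, `i ∈ L`, in increasing order, applied to `x`. -/
def ordProd (T : σ → M →ₗ[R] M) (L : Finset σ) (x : M) : M :=
  L.sort.foldr (fun i y => T i y) x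

@[simp] theorem ordProd_empty (T : σ → M →ₗ[R] M) (x : M) : ordProd T ∅ x = x := by
  simp [ordProd]

theorem ordProd_insert (T : σ → M →ₗ[R] M) {i : σ} {L : Finset σ} (h : ∀ j ∈ L, i < j) (x : M) :
    ordProd T (insert i L) x = T i (ordProd T L x) := by
  rw [ordProd, Finset.sort_insert _ (fun j hj => (h j hj).le) fun hi => lt_irrefl i (h i hi)]
  rfl

theorem ordProd_add (T : σ → M →ₗ[R] M) (L : Finset σ) (x y : M) :
    ordProd T L (x + y) = ordProd T L x + ordProd T L y := by
  induction L using Finset.induction_on_min with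
  | empty => simp
  | insert i L h ih => simp only [ordProd_insert T h, ih, map_add]

theorem ordProd_smul (T : σ → M →ₗ[R] M) (L : Finset σ) (c : R) (x : M) :
    ordProd T L (c • x) = c • ordProd T L x := by
  induction L using Finset.induction_on_min with
  | empty => simp
  | insert i L h ih => simp only [ordProd_insert T h, ih, map_smul]

/-- An ordered product as a linear map. -/
def ordProdₗ (T : σ → M →ₗ[R] M) (L : Finset σ) : M →ₗ[R] M where
  toFun := ordProd T L
  map_add' := ordProd_add T L
  map_smul' := ordProd_smul T L

@[simp] theorem ordProdₗ_apply (T : σ → M →ₗ[R] M) (L : Finset σ) (x : M) :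
    ordProdₗ T L x = ordProd T L x := rfl

theorem apply_ordProd (T : σ → M →ₗ[R] M) (anti : ∀ i j y, T i (T j y) = -T j (T i y))
    (sq : ∀ i y, T i (T i y) = 0) (i : σ) (L : Finset σ) (x : M) :
    T i (ordProd T L x) = if i ∈ L then 0 else koszulSign L i • ordProd T (insert i L) x := by
  induction L using Finset.induction_on_min with
  | empty =>
    rw [if_neg (by simp), ordProd_insert T (by simp)]
    simp [koszulSign]
  | insert a L h ih =>
    have ha : a ∉ L := fun ha => lt_irrefl a (h a ha)
    rcases lt_trichotomy i a with hi | rfl | hi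
    · have h' : ∀ j ∈ insert a L, i < j := by
        intro j hj
        rcases Finset.mem_insert.1 hj with rfl | hj
        · exact hi
        · exact hi.trans (h j hj)
      rw [if_neg fun hm => lt_irrefl i (h' i hm), ordProd_insert T h',
        koszulSign_of_forall_le fun j hj => (h' j hj).le, one_smul]
    · rw [if_pos (Finset.mem_insert_self _ _), ordProd_insert T h, sq]
    · rw [ordProd_insert T h, anti, ih]
      by_cases hm : i ∈ L
      · simp [hm]
      · have h' : ∀ j ∈ insert i L, a < j := by
          intro j hj
          rcases Finset.mem_insert.1 hj with rfl | hj
          · exact hi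
          · exact h j hj
        rw [if_neg hm, if_neg (by simp [hm, hi.ne']), Finset.insert_comm, ordProd_insert T h',
          koszulSign_insert ha, if_pos hi, neg_one_mul, neg_smul, map_zsmul]

theorem anticomm_ordProd (T : σ → M →ₗ[R] M) (D : M →ₗ[R] M) (v : σ → R)
    (hD : ∀ i y, D (T i y) = v i • y - T i (D y)) (L : Finset σ) (x : M) :
    D (ordProd T L x) = (-1 : ℤ) ^ L.card • ordProd T L (D x) +
      ∑ i ∈ L, koszulSign L i • v i • ordProd T (L.erase i) x := by
  induction L using Finset.induction_on_min with
  | empty => simp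
  | insert a L h ih =>
    have ha : a ∉ L := fun ha => lt_irrefl a (h a ha)
    rw [ordProd_insert T h, hD, ih, map_add, map_zsmul, map_sum, Finset.sum_insert ha,
      Finset.erase_insert ha, ordProd_insert T h, Finset.card_insert_of_notMem ha]
    have h1 : koszulSign (insert a L) a = 1 := by
      refine koszulSign_of_forall_le fun j hj => ?_
      rcases Finset.mem_insert.1 hj with rfl | hj
      · exact le_rfl
      · exact (h j hj).le
    have h2 : ∀ i ∈ L, koszulSign (insert a L) i • v i • ordProd T ((insert a L).erase i) x =
        -T a (koszulSign L i • v i • ordProd T (L.erase i) x) := by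
      intro i hi
      rw [koszulSign_insert ha, if_pos (h i hi), Finset.erase_insert_of_ne (h i hi).ne,
        ordProd_insert T fun j hj => h j (Finset.mem_of_mem_erase hj)]
      simp only [map_zsmul, map_smul, neg_one_mul, neg_smul]
    rw [h1, one_smul, Finset.sum_congr rfl h2, Finset.sum_neg_distrib, pow_succ, mul_neg_one,
      neg_smul]
    abel

theorem annihilate_ordProd (k : σ) (L : Finset σ) (κ : Finset σ → M) :
    annihilate R k (ordProd (annihilate R) L κ) =
      (-1 : ℤ) ^ L.card • ordProd (annihilate R) L (annihilate R k κ) := by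
  have := anticomm_ordProd (annihilate R) (annihilate R k) (fun _ => (0 : R))
    (fun i y => by rw [annihilate_annihilate, zero_smul, zero_sub]) L κ
  simpa using this

theorem ordProd_annihilate_apply (L : Finset σ) (κ : Finset σ → M) (J : Finset σ) :
    ordProd (annihilate R) L κ J =
      if Disjoint L J then (revSign L * invSign L J) • κ (L ∪ J) else 0 := by
  induction L using Finset.induction_on_min generalizing J with
  | empty => simp [revSign, invSign]
  | insert a L h ih =>
    have ha : a ∉ L := fun ha => lt_irrefl a (h a ha)
    rw [ordProd_insert _ h, annihilate_apply, ih]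
    by_cases haJ : a ∈ J
    · rw [if_pos haJ, if_neg]
      exact fun h' => Finset.disjoint_left.1 h' (Finset.mem_insert_self a L) haJ
    · rw [if_neg haJ]
      simp only [Finset.disjoint_insert_left, Finset.disjoint_insert_right, haJ, ha,
        not_false_eq_true, true_and]
      split_ifs with h'
      · rw [smul_smul, Finset.union_insert, Finset.insert_union, revSign_insert ha,
          invSign_insert_left ha, invSign_insert_right haJ h]
        congr 1
        ring
      · simp

theorem create_single (i : σ) (Z : Finset σ) (m : M) :
    create R i (Pi.single Z m : Finset σ → M) =
      if i ∈ Z then 0 else koszulSign Z i • Pi.single (insert i Z) m := by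
  ext J
  rw [create_apply]
  by_cases hi : i ∈ J
  · rw [if_pos hi]
    by_cases hZ : i ∈ Z
    · rw [if_pos hZ, Pi.single_eq_of_ne, smul_zero, Pi.zero_apply]
      rintro rfl
      simp at hZ
    · rw [if_neg hZ]
      by_cases hJ : J = insert i Z
      · subst hJ
        rw [Finset.erase_insert hZ, koszulSign_insert hZ, if_neg (lt_irrefl i)]
        simp
      · rw [Pi.single_eq_of_ne, Pi.smul_apply, Pi.single_eq_of_ne hJ, smul_zero, smul_zero]
        rintro rfl
        exact hJ (Finset.insert_erase hi).symm
  · rw [if_neg hi]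
    split_ifs with hZ
    · rfl
    · rw [Pi.smul_apply, Pi.single_eq_of_ne, smul_zero]
      rintro rfl
      simp at hi

theorem ordProd_create_single (L Z : Finset σ) (m : M) :
    ordProd (create R) L (Pi.single Z m : Finset σ → M) =
      if Disjoint L Z then invSign L Z • Pi.single (L ∪ Z) m else 0 := by
  induction L using Finset.induction_on_min with
  | empty => simp [invSign]
  | insert a L h ih =>
    have ha : a ∉ L := fun ha => lt_irrefl a (h a ha)
    rw [ordProd_insert _ h, ih]
    simp only [Finset.disjoint_insert_left]
    by_cases h' : Disjoint L Z
    · rw [if_pos h', map_zsmul, create_single]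
      by_cases haZ : a ∈ Z
      · simp [haZ]
      · rw [if_neg (by simp [ha, haZ]), if_pos ⟨haZ, h'⟩, koszulSign_union h',
          koszulSign_of_forall_le fun j hj => (h j hj).le, one_mul, smul_smul,
          invSign_insert_left ha, mul_comm, Finset.insert_union]
    · simp [h']

end OrdProd

end Fermion

/-! ## Killing and dividing by variables -/

namespace Orbifold

open Fermion

variable {σ : Type}

section Kill

variable [DecidableEq σ]

/-- The substitution `xᵢ = 0` for `i ∈ S`. -/
noncomputable def kill (S : Finset σ) : MvPolynomial σ ℂ →ₐ[ℂ] MvPolynomial σ ℂ :=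
  aeval fun i => if i ∈ S then 0 else X i

@[simp] theorem kill_X (S : Finset σ) (i : σ) :
    kill S (X i) = if i ∈ S then 0 else (X i : MvPolynomial σ ℂ) := by
  rw [kill, aeval_X]

@[simp] theorem kill_C (S : Finset σ) (c : ℂ) : kill S (C c) = C c := by
  rw [kill, aeval_C]; rfl

theorem kill_empty (a : MvPolynomial σ ℂ) : kill ∅ a = a := by
  have : kill (∅ : Finset σ) = AlgHom.id ℂ _ := by ext i; simp
  rw [this]; rfl

theorem kill_kill (S T : Finset σ) (a : MvPolynomial σ ℂ) : kill S (kill T a) = kill (S ∪ T) a := by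
  have : (kill S).comp (kill T) = kill (S ∪ T) := by
    apply MvPolynomial.algHom_ext
    intro i
    simp only [AlgHom.comp_apply, kill_X, Finset.mem_union]
    by_cases h1 : i ∈ T <;> by_cases h2 : i ∈ S <;> simp [h1, h2]
  rw [← this]; rfl

theorem kill_monomial (i : σ) (γ : σ →₀ ℕ) :
    kill {i} (monomial γ 1) = if γ i = 0 then monomial γ (1 : ℂ) else 0 := by
  rw [kill, aeval_monomial, map_one, one_mul, Finsupp.prod]
  split_ifs with h
  · rw [monomial_eq, C_1, one_mul, Finsupp.prod]
    refine Finset.prod_congr rfl fun j hj => ?_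
    rw [if_neg]
    rintro hj'
    rw [Finset.mem_singleton.1 hj'] at hj
    exact Finsupp.mem_support_iff.1 hj h
  · refine Finset.prod_eq_zero (Finsupp.mem_support_iff.2 h) ?_
    simp [h]

/-- Division by `xᵢ`. -/
noncomputable def divX (i : σ) : MvPolynomial σ ℂ →ₗ[ℂ] MvPolynomial σ ℂ :=
  (basisMonomials σ ℂ).constr ℂ fun γ =>
    if γ i = 0 then 0 else monomial (γ - Finsupp.single i 1) 1

theorem X_mul_divX (i : σ) (a : MvPolynomial σ ℂ) : X i * divX i a = a - kill {i} a := by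
  have : LinearMap.mulLeft ℂ (X i) ∘ₗ divX i = LinearMap.id - (kill {i}).toLinearMap := by
    refine (basisMonomials σ ℂ).ext fun γ => ?_
    have h := (basisMonomials σ ℂ).constr_basis ℂ (fun γ =>
      if γ i = 0 then 0 else (monomial (γ - Finsupp.single i 1) 1 : MvPolynomial σ ℂ)) γ
    rw [LinearMap.comp_apply, divX, h, coe_basisMonomials, LinearMap.sub_apply,
      AlgHom.toLinearMap_apply, kill_monomial]
    split_ifs with h0
    · simp
    · rw [LinearMap.mulLeft_apply, X, monomial_mul, one_mul, LinearMap.id_apply, sub_zero,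
        add_tsub_cancel_of_le]
      rw [Finsupp.single_le_iff]; omega
  exact LinearMap.congr_fun this a

theorem divX_X_mul_of_ne {i j : σ} (h : j ≠ i) (a : MvPolynomial σ ℂ) :
    divX i (X j * a) = X j * divX i a := by
  apply mul_left_cancel₀ (X_ne_zero (R := ℂ) i)
  rw [X_mul_divX, mul_left_comm, X_mul_divX, map_mul, kill_X, if_neg (by simp [h])]
  ring

theorem divX_X_mul_self (i : σ) (a : MvPolynomial σ ℂ) : divX i (X i * a) = a := by
  apply mul_left_cancel₀ (X_ne_zero (R := ℂ) i)
  rw [X_mul_divX, map_mul, kill_X, if_pos (by simp)]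
  ring

theorem sub_kill_mem (S : Finset σ) (a : MvPolynomial σ ℂ) :
    a - kill S a ∈ Ideal.span ((X : σ → MvPolynomial σ ℂ) '' S) := by
  induction S using Finset.induction_on with
  | empty => simp [kill_empty]
  | insert i S _ ih =>
    have h1 : a - kill (insert i S) a = (a - kill S a) + X i * divX i (kill S a) := by
      rw [X_mul_divX, kill_kill, ← Finset.insert_eq]; ring
    rw [h1]
    refine Ideal.add_mem _ (Ideal.span_mono (Set.image_mono (by simp)) ih)
      (Ideal.mul_mem_right _ _ (Ideal.subset_span ⟨i, by simp, rfl⟩))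

end Kill

end Orbifold

/-! ## The cohomology of a sector -/

namespace Orbifold

open Fermion BarCochain

variable {σ : Type} [Fintype σ] [LinearOrder σ]

/-- `κ` vanishes outside `Q`. -/
def SuppOn (Q : Finset σ → Prop) (κ : Finset σ → MvPolynomial σ ℂ) : Prop := ∀ J, ¬ Q J → κ J = 0

theorem SuppOn.mono {Q Q' : Finset σ → Prop} {κ : Finset σ → MvPolynomial σ ℂ} (h : SuppOn Q κ)
    (hQ : ∀ J, Q J → Q' J) : SuppOn Q' κ := fun J hJ => h J fun h' => hJ (hQ J h')

theorem SuppOn.sub {Q : Finset σ → Prop} {κ κ' : Finset σ → MvPolynomial σ ℂ} (h : SuppOn Q κ)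
    (h' : SuppOn Q κ') : SuppOn Q (κ - κ') := fun J hJ => by
  rw [Pi.sub_apply, h J hJ, h' J hJ, sub_zero]

theorem SuppOn.smul {Q : Finset σ → Prop} {κ : Finset σ → MvPolynomial σ ℂ} (h : SuppOn Q κ)
    (f : MvPolynomial σ ℂ) : SuppOn Q (f • κ) := fun J hJ => by
  rw [Pi.smul_apply, h J hJ, smul_zero]

section Cliff

variable (v w : σ → MvPolynomial σ ℂ)

theorem cliff_apply_apply (κ : Finset σ → MvPolynomial σ ℂ) (J : Finset σ) :
    cliff v w κ J = ∑ i, (v i * (if i ∈ J then koszulSign J i • κ (J.erase i) else 0) +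
      w i * (if i ∈ J then 0 else koszulSign J i • κ (insert i J))) := by
  rw [cliff_apply, Finset.sum_apply]
  rfl

theorem cliff_create (i : σ) (κ : Finset σ → MvPolynomial σ ℂ) :
    cliff v w (create (MvPolynomial σ ℂ) i κ) =
      w i • κ - create (MvPolynomial σ ℂ) i (cliff v w κ) := by
  rw [cliff_apply, cliff_apply, map_sum, eq_sub_iff_add_eq, ← Finset.sum_add_distrib,
    Finset.sum_eq_single i]
  · rw [create_self, annihilate_create_self]
    simp only [map_add, map_smul, create_self, smul_sub, smul_zero]
    abel
  · intro j _ hj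
    rw [annihilate_create_of_ne hj, create_create j i]
    simp only [map_add, map_smul, smul_neg]
    abel
  · simp

theorem cliff_annihilate (i : σ) (κ : Finset σ → MvPolynomial σ ℂ) :
    cliff v w (annihilate (MvPolynomial σ ℂ) i κ) =
      v i • κ - annihilate (MvPolynomial σ ℂ) i (cliff v w κ) := by
  rw [cliff_apply, cliff_apply, map_sum, eq_sub_iff_add_eq, ← Finset.sum_add_distrib,
    Finset.sum_eq_single i]
  · simp only [map_add, map_smul, annihilate_self, annihilate_create_self, smul_sub, smul_zero]
    abel
  · intro j _ hj
    rw [annihilate_annihilate j i]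
    simp only [map_add, map_smul, annihilate_create_of_ne hj.symm, smul_neg]
    abel
  · simp

theorem cliff_cliff (κ : Finset σ → MvPolynomial σ ℂ) :
    cliff v w (cliff v w κ) = (∑ i, v i * w i) • κ := by
  have h : cliff v w (cliff v w κ) = (∑ i, v i * w i) • κ + (∑ i, v i * w i) • κ -
      cliff v w (cliff v w κ) := by
    conv_lhs => rw [cliff_apply v w κ, map_sum]
    rw [cliff_apply v w (cliff v w κ), Finset.sum_smul, ← Finset.sum_add_distrib,
      ← Finset.sum_sub_distrib]
    refine Finset.sum_congr rfl fun i _ => ?_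
    rw [map_add, map_smul, map_smul, cliff_create, cliff_annihilate]
    simp only [smul_sub, smul_smul, mul_comm (w i)]
    abel
  have h2 : (2 : ℂ) • (cliff v w (cliff v w κ) - (∑ i, v i * w i) • κ) = 0 := by
    rw [two_smul]; nth_rewrite 1 [h]; abel
  exact sub_eq_zero.1 ((smul_eq_zero.1 h2).resolve_left two_ne_zero)

theorem cliff_zero_cliff_zero (κ : Finset σ → MvPolynomial σ ℂ) :
    cliff v 0 (cliff 0 w κ) + cliff 0 w (cliff v 0 κ) = (∑ i, v i * w i) • κ := by
  rw [cliff_apply v 0 κ, map_sum, cliff_apply v 0 (cliff 0 w κ), ← Finset.sum_add_distrib,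
    Finset.sum_smul]
  refine Finset.sum_congr rfl fun i _ => ?_
  rw [map_add, map_smul, cliff_create]
  simp only [Pi.zero_apply, zero_smul, add_zero, map_zero, smul_sub, smul_smul]
  abel

theorem cliff_split (κ : Finset σ → MvPolynomial σ ℂ) :
    cliff v w κ = cliff v 0 κ + cliff 0 w κ := by
  rw [cliff_add, add_zero, zero_add]

theorem cliff_left_suppOn {p : ℕ} {κ : Finset σ → MvPolynomial σ ℂ}
    (h : SuppOn (fun J => J.card + 1 = p) κ) : SuppOn (fun J => J.card = p) (cliff v 0 κ) := by
  intro J hJ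
  rw [cliff_apply_apply]
  refine Finset.sum_eq_zero fun i _ => ?_
  by_cases hi : i ∈ J
  · have := Finset.card_pos.2 ⟨i, hi⟩
    simp [hi, h (J.erase i) (by dsimp only at *; rw [Finset.card_erase_of_mem hi]; omega)]
  · simp [hi]

theorem cliff_right_suppOn {p : ℕ} {κ : Finset σ → MvPolynomial σ ℂ}
    (h : SuppOn (fun J => J.card = p + 1) κ) : SuppOn (fun J => J.card = p) (cliff 0 w κ) := by
  intro J hJ
  rw [cliff_apply_apply]
  refine Finset.sum_eq_zero fun i _ => ?_
  by_cases hi : i ∈ J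
  · simp [hi]
  · simp [hi, h (insert i J) (by dsimp only at *; rw [Finset.card_insert_of_notMem hi]; omega)]

end Cliff

section Primitive

variable (c : σ → ℂ)

/-- The coefficients `cᵢ xᵢ`. -/
noncomputable def scaled (i : σ) : MvPolynomial σ ℂ := C (c i) * X i

/-- The contraction in the direction of `xᵢ`. -/
noncomputable def contraction (i : σ) :
    (Finset σ → MvPolynomial σ ℂ) →ₗ[ℂ] (Finset σ → MvPolynomial σ ℂ) :=
  mapCoeff (divX i) ∘ₗ annihilate ℂ i

theorem contraction_apply (i : σ) (κ : Finset σ → MvPolynomial σ ℂ) (J : Finset σ) :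
    contraction i κ J = divX i (annihilate (MvPolynomial σ ℂ) i κ J) := rfl

theorem divX_scaled_of_ne {i j : σ} (h : j ≠ i) (a : MvPolynomial σ ℂ) :
    divX i (scaled c j * a) = scaled c j * divX i a := by
  rw [scaled, mul_assoc, ← smul_eq_C_mul, map_smul, divX_X_mul_of_ne h, smul_eq_C_mul, mul_assoc]

theorem divX_scaled_self (i : σ) (a : MvPolynomial σ ℂ) :
    divX i (scaled c i * a) = C (c i) * a := by
  rw [scaled, mul_assoc, ← smul_eq_C_mul, map_smul, divX_X_mul_self, smul_eq_C_mul]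

theorem contraction_formula (i : σ) (κ : Finset σ → MvPolynomial σ ℂ) (J : Finset σ) :
    cliff (scaled c) 0 (contraction i κ) J + contraction i (cliff (scaled c) 0 κ) J =
      C (c i) * (κ J - if i ∈ J then kill {i} (κ J) else 0) := by
  have e : ∀ j, create (MvPolynomial σ ℂ) j (contraction i κ) J =
      divX i (create (MvPolynomial σ ℂ) j (annihilate (MvPolynomial σ ℂ) i κ) J) := fun j =>
    congrFun (create_mapCoeff (R := ℂ) (divX i) j (annihilate ℂ i κ)) J
  rw [contraction_apply, cliff_apply, cliff_apply, map_sum, Finset.sum_apply, Finset.sum_apply,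
    map_sum, ← Finset.sum_add_distrib, Finset.sum_eq_single i]
  · simp only [Pi.zero_apply, zero_smul, add_zero, map_smul, Pi.smul_apply, smul_eq_mul, e,
      annihilate_create_self, divX_scaled_self, Pi.sub_apply]
    have h1 : create (MvPolynomial σ ℂ) i (annihilate (MvPolynomial σ ℂ) i κ) J =
        if i ∈ J then κ J else 0 := by
      rw [create_apply]
      split_ifs with hi
      · rw [annihilate_apply, if_neg (Finset.notMem_erase i J), smul_smul, Finset.insert_erase hi,
          koszulSign_erase hi, if_neg (lt_irrefl i), one_mul, koszulSign_mul_self, one_smul]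
      · rfl
    rw [h1]
    split_ifs with hi
    · rw [scaled, mul_assoc, X_mul_divX]; ring
    · simp
  · intro j _ hj
    simp only [Pi.zero_apply, zero_smul, add_zero, map_smul, Pi.smul_apply, smul_eq_mul, e,
      annihilate_create_of_ne hj.symm, divX_scaled_of_ne c hj, Pi.neg_apply, map_neg]
    ring
  · simp

/-- The part of `κ` that represents its cohomology class. -/
noncomputable def collapse (I : Finset σ) (κ : Finset σ → MvPolynomial σ ℂ) :
    Finset σ → MvPolynomial σ ℂ := fun J => if I ⊆ J then kill I (κ J) else 0

theorem exists_primitive (I : Finset σ) (hI : ∀ i ∈ I, c i ≠ 0) {Q : Finset σ → Prop}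
    {κ : Finset σ → MvPolynomial σ ℂ} (hQ : SuppOn Q κ) (hκ : cliff (scaled c) 0 κ = 0) :
    ∃ ζ, SuppOn (fun J => ∃ i ∉ J, Q (insert i J)) ζ ∧
      κ = collapse I κ + cliff (scaled c) 0 ζ := by
  induction I using Finset.induction_on with
  | empty =>
    refine ⟨0, fun J _ => rfl, ?_⟩
    ext1 J
    simp [collapse, kill_empty]
  | insert i S hi ih =>
    obtain ⟨ζ, hζ, h⟩ := ih fun j hj => hI j (Finset.mem_insert_of_mem hj)
    have hc : c i ≠ 0 := hI i (Finset.mem_insert_self i S)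
    have hcl : cliff (scaled c) 0 (collapse S κ) = 0 := by
      have : collapse S κ = κ - cliff (scaled c) 0 ζ := by rw [eq_sub_iff_add_eq]; exact h.symm
      rw [this, map_sub, hκ, cliff_cliff]
      simp
    refine ⟨ζ + (C (c i)⁻¹ : MvPolynomial σ ℂ) • contraction i (collapse S κ), ?_, ?_⟩
    · intro J hJ
      rw [Pi.add_apply, hζ J hJ, Pi.smul_apply, contraction_apply, annihilate_apply]
      split_ifs with hiJ
      · simp
      · have : collapse S κ (insert i J) = 0 := by
          rw [collapse, hQ _ fun h' => hJ ⟨i, hiJ, h'⟩, map_zero, ite_self]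
        rw [this]; simp
    · ext1 J
      have hf := contraction_formula c i (collapse S κ) J
      rw [hcl, map_zero, Pi.zero_apply, add_zero] at hf
      rw [Pi.add_apply, map_add, map_smul, Pi.add_apply, Pi.smul_apply, hf, smul_eq_mul,
        ← mul_assoc, ← C_mul, inv_mul_cancel₀ hc, C_1, one_mul]
      have h1 := congrFun h J
      rw [Pi.add_apply] at h1
      have h2 : (if i ∈ J then kill {i} (collapse S κ J) else 0) = collapse (insert i S) κ J := by
        simp only [collapse, Finset.insert_subset_iff]
        by_cases h3 : i ∈ J <;> by_cases h4 : S ⊆ J <;> simp [h3, h4, kill_kill]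
      rw [h2]
      conv_lhs => rw [h1]
      ring

end Primitive

section Exactness

variable (c : σ → ℂ) (w : σ → MvPolynomial σ ℂ) (I : Finset σ)

theorem cliff_degPart {p : ℕ} {η : Finset σ → MvPolynomial σ ℂ}
    (hη : SuppOn (fun J => J.card < p + 1) η) (v : σ → MvPolynomial σ ℂ) :
    cliff v 0 (degPart p η) = degPart (p + 1) (cliff v w η) := by
  ext1 J
  rw [degPart_apply, cliff_apply_apply]
  split_ifs with hJ
  · rw [cliff_apply_apply]
    refine Finset.sum_congr rfl fun i _ => ?_
    by_cases hi : i ∈ J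
    · simp [hi, degPart_apply, Finset.card_erase_of_mem hi, hJ]
    · simp [hi, hη (insert i J) (by dsimp only at *; rw [Finset.card_insert_of_notMem hi]; omega)]
  · refine Finset.sum_eq_zero fun i _ => ?_
    by_cases hi : i ∈ J
    · have := Finset.card_pos.2 ⟨i, hi⟩
      simp only [hi, if_true, degPart_apply, Finset.card_erase_of_mem hi]
      rw [if_neg (by omega)]; simp
    · simp [hi]

/-- The top component of a cocycle with trivial collapse can be removed. -/
theorem exists_lower (hI : ∀ i ∈ I, c i ≠ 0) {p : ℕ} {η : Finset σ → MvPolynomial σ ℂ}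
    (hη : cliff (scaled c) w η = 0) (hs : SuppOn (fun J => J.card < p + 1) η)
    (hcol : ∀ J, J.card = p → I ⊆ J → kill I (η J) = 0) :
    ∃ ζ, SuppOn (fun J => J.card + 1 = p) ζ ∧
      SuppOn (fun J => J.card < p) (η - cliff (scaled c) w ζ) := by
  have h0 : cliff (scaled c) 0 (degPart p η) = 0 := by
    rw [cliff_degPart w hs, hη, map_zero]
  have hQ : SuppOn (fun J => J.card = p) (degPart p η) := fun J hJ => by
    rw [degPart_apply, if_neg hJ]
  obtain ⟨ζ, hζ, h⟩ := exists_primitive c I hI hQ h0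
  have hζ' : SuppOn (fun J => J.card + 1 = p) ζ := hζ.mono fun J ⟨i, hi, h⟩ => by
    rwa [Finset.card_insert_of_notMem hi] at h
  have hc : collapse I (degPart p η) = 0 := by
    ext1 J
    simp only [collapse, degPart_apply]
    split_ifs with h1 h2
    · exact hcol J h2 h1
    · exact map_zero _
    · rfl
  rw [hc, zero_add] at h
  refine ⟨ζ, hζ', fun J hJ => ?_⟩
  rw [cliff_split, ← h, Pi.sub_apply, Pi.add_apply, degPart_apply]
  have h3 : cliff 0 w ζ J = 0 := by
    rw [cliff_apply_apply]
    refine Finset.sum_eq_zero fun i _ => ?_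
    by_cases hi : i ∈ J
    · simp [hi]
    · simp [hi, hζ' (insert i J) (by dsimp only at *; rw [Finset.card_insert_of_notMem hi]; omega)]
  rw [h3, add_zero]
  split_ifs with h4
  · exact sub_self _
  · rw [sub_zero, hs J (by dsimp only at *; omega)]

theorem exists_of_card_lt (hI : ∀ i ∈ I, c i ≠ 0) (hvw : ∑ i, scaled c i * w i = 0) (p : ℕ)
    (hp : p ≤ I.card) (η : Finset σ → MvPolynomial σ ℂ) (hη : cliff (scaled c) w η = 0)
    (hs : SuppOn (fun J => J.card < p) η) :
    ∃ ζ, SuppOn (fun J => J.card + 1 < p) ζ ∧ η = cliff (scaled c) w ζ := by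
  induction p generalizing η with
  | zero => exact ⟨0, fun J _ => rfl, by rw [map_zero]; ext1 J; exact hs J (Nat.not_lt_zero _)⟩
  | succ p ih =>
    obtain ⟨ζ, hζ, h⟩ := exists_lower c w I hI hη hs fun J hJ hIJ => by
      have := Finset.card_le_card hIJ
      omega
    obtain ⟨ζ', hζ', h'⟩ := ih (by omega) _ (by rw [map_sub, hη, cliff_cliff, hvw]; simp) h
    refine ⟨ζ + ζ', fun J hJ => ?_, ?_⟩
    · rw [Pi.add_apply, hζ J (by dsimp only at *; omega), hζ' J (by dsimp only at *; omega), add_zero]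
    · rw [map_add, ← h']; abel

/-- The cochains whose degree has the parity of `n`. -/
noncomputable def parityPart (n : ℕ) (κ : Finset σ → MvPolynomial σ ℂ) : Finset σ → MvPolynomial σ ℂ := fun J =>
  if Even (J.card + n) then κ J else 0

theorem cliff_parityPart (v : σ → MvPolynomial σ ℂ) (n : ℕ) (κ : Finset σ → MvPolynomial σ ℂ) :
    cliff v w (parityPart n κ) = parityPart (n + 1) (cliff v w κ) := by
  ext1 J
  rw [parityPart]
  simp only [cliff_apply_apply, parityPart]
  have h1 : ∀ i ∈ J, (Even ((J.erase i).card + n) ↔ Even (J.card + (n + 1))) := by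
    intro i hi
    have := Finset.card_pos.2 ⟨i, hi⟩
    rw [Finset.card_erase_of_mem hi, show J.card + (n + 1) = (J.card - 1 + n) + 2 by omega]
    simp [Nat.even_add]
  have h2 : ∀ i ∉ J, (Even ((insert i J).card + n) ↔ Even (J.card + (n + 1))) := by
    intro i hi
    rw [Finset.card_insert_of_notMem hi, show J.card + 1 + n = J.card + (n + 1) by omega]
  split_ifs with h
  · refine Finset.sum_congr rfl fun i _ => ?_
    by_cases hi : i ∈ J
    · simp only [hi, if_true, if_false, if_pos ((h1 i hi).2 h)]
    · simp only [hi, if_true, if_false, if_pos ((h2 i hi).2 h)]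
  · refine Finset.sum_eq_zero fun i _ => ?_
    by_cases hi : i ∈ J
    · simp only [hi, if_true, if_false, if_neg (mt (h1 i hi).1 h), smul_zero, mul_zero, add_zero]
    · simp only [hi, if_true, if_false, if_neg (mt (h2 i hi).1 h), smul_zero, mul_zero, add_zero]

/-- The cocycle that extends `e_I`. -/
theorem exists_representative (hI : ∀ i, i ∈ I ↔ c i ≠ 0) (hvw : ∑ i, scaled c i * w i = 0) :
    ∃ κ : Finset σ → MvPolynomial σ ℂ, κ I = 1 ∧
      (∀ J, J ≠ I → κ J ≠ 0 → ∃ m : ℕ, 0 < m ∧ J.card + 2 * m = I.card) ∧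
      cliff (scaled c) w κ = 0 := by
  set e : Finset σ → MvPolynomial σ ℂ := Pi.single I 1 with he
  have hP : cliff (scaled c) 0 e = 0 := by
    rw [cliff_apply]
    refine Finset.sum_eq_zero fun i _ => ?_
    rw [Pi.zero_apply, zero_smul, add_zero, he, create_single]
    split_ifs with hi
    · simp
    · have : c i = 0 := by simpa using mt (hI i).2 hi
      simp [scaled, this]
  have hs : SuppOn (fun J => J.card < I.card) (cliff (scaled c) w e) := by
    rw [cliff_split, hP, zero_add]
    intro J hJ
    rw [cliff_apply_apply]
    refine Finset.sum_eq_zero fun i _ => ?_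
    by_cases hi : i ∈ J
    · simp [hi]
    · have : insert i J ≠ I := by
        rintro rfl
        rw [Finset.card_insert_of_notMem hi] at hJ
        omega
      simp [hi, he, this]
  obtain ⟨ζ, hζ, h⟩ := exists_of_card_lt c w I (fun i hi => (hI i).1 hi) hvw I.card le_rfl _
    (by rw [cliff_cliff, hvw, zero_smul]) hs
  have he' : parityPart I.card e = e := by
    ext1 J
    rw [parityPart]
    split_ifs with h1
    · rfl
    · rw [he, Pi.single_eq_of_ne]
      rintro rfl
      simp at h1
  refine ⟨e - parityPart I.card ζ, ?_, ?_, ?_⟩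
  · rw [Pi.sub_apply, he, Pi.single_eq_same, parityPart, hζ I (by dsimp only at *; omega), ite_self, sub_zero]
  · intro J hJ hne
    rw [Pi.sub_apply, he, Pi.single_eq_of_ne hJ, zero_sub, neg_ne_zero, parityPart] at hne
    have h1 : Even (J.card + I.card) := by
      by_contra h2
      rw [if_neg h2] at hne
      exact hne rfl
    have h3 : J.card + 1 < I.card := by
      by_contra h2
      rw [hζ J h2, ite_self] at hne
      exact hne rfl
    obtain ⟨m, hm⟩ := h1
    exact ⟨m - J.card, by omega, by omega⟩
  · rw [map_sub, cliff_parityPart, ← h, ← cliff_parityPart, he', sub_self]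

end Exactness

end Orbifold

namespace Orbifold

open Fermion BarCochain

variable {σ : Type} [Fintype σ] [LinearOrder σ]

section Regular

/-- The ideal generated by the `M`-th powers of the variables in `S`. -/
noncomputable def powIdeal (M : ℕ) (S : Finset σ) : Ideal (MvPolynomial σ ℂ) :=
  Ideal.span ((fun k => X k ^ M) '' (S : Set σ))

theorem mem_powIdeal {M : ℕ} {S : Finset σ} {a : MvPolynomial σ ℂ} :
    a ∈ powIdeal M S ↔ ∀ m ∈ a.support, ∃ k ∈ S, M ≤ m k := by
  have h : (fun k => X k ^ M : σ → MvPolynomial σ ℂ) '' (S : Set σ) =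
      (fun s => monomial s (1 : ℂ)) '' ((fun k => Finsupp.single k M) '' (S : Set σ)) := by
    rw [Set.image_image]
    simp only [X_pow_eq_monomial]
  rw [powIdeal, h, mem_ideal_span_monomial_image]
  simp

theorem mem_powIdeal_of_pow_mul {M : ℕ} {S : Finset σ} {k : σ} (hk : k ∉ S)
    {a : MvPolynomial σ ℂ} (h : X k ^ M * a ∈ powIdeal M S) : a ∈ powIdeal M S := by
  rw [mem_powIdeal] at h ⊢
  intro m hm
  have h1 : Finsupp.single k M + m ∈ (X k ^ M * a).support := by
    rw [mem_support_iff, X_pow_eq_monomial, coeff_monomial_mul, one_mul]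
    exact mem_support_iff.1 hm
  obtain ⟨i, hi, hle⟩ := h _ h1
  refine ⟨i, hi, ?_⟩
  have : k ≠ i := by rintro rfl; exact hk hi
  rwa [Finsupp.add_apply, Finsupp.single_eq_of_ne this.symm, zero_add] at hle

/-- A Koszul complex whose ideal contains powers of all variables is exact in positive degrees,
modulo some of these powers. -/
theorem koszul_exact_mod (F : σ → MvPolynomial σ ℂ) (M : ℕ)
    (hF : ∀ k, X k ^ M ∈ Ideal.span (Set.range F)) (n : ℕ) (S : Finset σ)
    (hn : S.card + n = Fintype.card σ) (p : ℕ) (hp : S.card < p)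
    (φ : Finset σ → MvPolynomial σ ℂ) (hs : SuppOn (fun J => J.card = p) φ)
    (hφ : ∀ J, cliff 0 F φ J ∈ powIdeal M S) :
    ∃ ψ, SuppOn (fun J => J.card = p + 1) ψ ∧ ∀ J, (φ - cliff 0 F ψ) J ∈ powIdeal M S := by
  induction n generalizing S p φ with
  | zero =>
    refine ⟨0, fun _ _ => rfl, fun J => ?_⟩
    have := J.card_le_univ
    rw [map_zero, sub_zero, hs J (by dsimp only; omega)]
    exact Ideal.zero_mem _
  | succ n ih =>
    obtain ⟨k, hk⟩ : ∃ k, k ∉ S := by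
      by_contra! h
      have : S = Finset.univ := Finset.eq_univ_of_forall h
      rw [this, Finset.card_univ] at hn
      omega
    have hFk := hF k
    rw [Ideal.span, Submodule.mem_span_range_iff_exists_fun] at hFk
    obtain ⟨a, ha⟩ := hFk
    simp only [smul_eq_mul] at ha
    have hcard : (insert k S).card = S.card + 1 := Finset.card_insert_of_notMem hk
    have hle : powIdeal M S ≤ powIdeal M (insert k S) :=
      Ideal.span_mono (Set.image_mono (Finset.coe_subset.2 (Finset.subset_insert k S)))
    have hk' : (X k ^ M : MvPolynomial σ ℂ) ∈ powIdeal M (insert k S) :=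
      Ideal.subset_span ⟨k, by simp, rfl⟩
    have hmem : ∀ (v w : σ → MvPolynomial σ ℂ) (κ : Finset σ → MvPolynomial σ ℂ),
        (∀ J, κ J ∈ powIdeal M S) → ∀ J, cliff v w κ J ∈ powIdeal M S := by
      intro v w κ hκ J
      rw [cliff_apply_apply]
      refine Ideal.sum_mem _ fun i _ => Ideal.add_mem _ (Ideal.mul_mem_left _ _ ?_)
        (Ideal.mul_mem_left _ _ ?_)
      · split_ifs
        · exact zsmul_mem (hκ _) _
        · exact Ideal.zero_mem _
      · split_ifs
        · exact Ideal.zero_mem _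
        · exact zsmul_mem (hκ _) _
    set χ := cliff a 0 φ with hχ
    have hχ1 : cliff 0 F χ = (X k ^ M : MvPolynomial σ ℂ) • φ - cliff a 0 (cliff 0 F φ) := by
      rw [← ha, hχ, ← cliff_zero_cliff_zero]; abel
    have hχs : SuppOn (fun J => J.card = p + 1) χ :=
      cliff_left_suppOn a (hs.mono fun J hJ => by omega)
    obtain ⟨ψ, hψ, h⟩ := ih (insert k S) (by omega) (p + 1) (by omega) χ hχs (fun J => by
      rw [hχ1, Pi.sub_apply, Pi.smul_apply, smul_eq_mul]
      exact Ideal.sub_mem _ (Ideal.mul_mem_right _ _ hk') (hle (hmem _ _ _ hφ J)))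
    have hdec : ∀ J, ∃ b, (χ - cliff 0 F ψ) J - X k ^ M * b ∈ powIdeal M S ∧
        (J.card ≠ p + 1 → b = 0) := by
      intro J
      by_cases hJ : J.card = p + 1
      · have h2 := h J
        rw [powIdeal, Finset.coe_insert, Set.image_insert_eq, Ideal.mem_span_insert] at h2
        obtain ⟨b, z, hz, hb⟩ := h2
        refine ⟨b, ?_, fun h3 => absurd hJ h3⟩
        rw [hb, mul_comm, add_sub_cancel_left]
        exact hz
      · refine ⟨0, ?_, fun _ => rfl⟩
        rw [Pi.sub_apply, hχs J hJ, cliff_right_suppOn F hψ J hJ]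
        simp
    choose ρ hρ hρs using hdec
    refine ⟨ρ, fun J hJ => hρs J hJ, fun J => mem_powIdeal_of_pow_mul hk ?_⟩
    have h4 := hmem 0 F (χ - cliff 0 F ψ - (X k ^ M : MvPolynomial σ ℂ) • ρ) hρ J
    rw [map_sub, map_sub, cliff_cliff, map_smul, hχ1] at h4
    simp only [Pi.zero_apply, zero_mul, Finset.sum_const_zero, zero_smul, sub_zero] at h4
    have h5 := Ideal.add_mem _ h4 (hmem a 0 _ hφ J)
    have h6 : ((X k ^ M : MvPolynomial σ ℂ) • φ - cliff a 0 (cliff 0 F φ) - (X k ^ M : MvPolynomial σ ℂ) • cliff 0 F ρ) J +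
        cliff a 0 (cliff 0 F φ) J = X k ^ M * (φ - cliff 0 F ρ) J := by
      simp only [Pi.sub_apply, Pi.smul_apply, smul_eq_mul]; ring
    rwa [h6] at h5

theorem koszul_exact (F : σ → MvPolynomial σ ℂ) (M : ℕ)
    (hF : ∀ k, X k ^ M ∈ Ideal.span (Set.range F)) (p : ℕ) (hp : 0 < p)
    (φ : Finset σ → MvPolynomial σ ℂ) (hs : SuppOn (fun J => J.card = p) φ)
    (hφ : cliff 0 F φ = 0) :
    ∃ ψ, SuppOn (fun J => J.card = p + 1) ψ ∧ φ = cliff 0 F ψ := by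
  have h0 : ∀ a : MvPolynomial σ ℂ, a ∈ powIdeal M ∅ ↔ a = 0 := fun a => by
    simp [powIdeal]
  obtain ⟨ψ, hψ, h⟩ := koszul_exact_mod F M hF (Fintype.card σ) ∅ (by simp) p (by simpa) φ hs
    (fun J => by rw [hφ]; exact Ideal.zero_mem _)
  refine ⟨ψ, hψ, sub_eq_zero.1 ?_⟩
  ext1 J
  exact (h0 _).1 (h J)

end Regular

section Spanning

variable (c : σ → ℂ) (w : σ → MvPolynomial σ ℂ) (I : Finset σ)

/-- The sequence `xᵢ`, `i ∈ I`, and `wₖ` restricted to `x_I = 0`, `k ∉ I`. -/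
noncomputable def mixedSeq (k : σ) : MvPolynomial σ ℂ := if k ∈ I then X k else kill I (w k)

theorem kill_ordProd_cliff (hI : ∀ i, i ∈ I ↔ c i ≠ 0) (κ : Finset σ → MvPolynomial σ ℂ)
    (K : Finset σ) :
    kill I (ordProd (annihilate (MvPolynomial σ ℂ)) I (cliff (scaled c) w κ) K) =
      (-1 : ℤ) ^ I.card • ∑ k, kill I (w k) *
        kill I (annihilate (MvPolynomial σ ℂ) k (ordProd (annihilate (MvPolynomial σ ℂ)) I κ) K) := by
  have h : ordProdₗ (annihilate (MvPolynomial σ ℂ)) I (cliff (scaled c) w κ) =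
      ∑ k, (scaled c k • ordProd (annihilate (MvPolynomial σ ℂ)) I
        (create (MvPolynomial σ ℂ) k κ) + w k • (-1 : ℤ) ^ I.card •
          annihilate (MvPolynomial σ ℂ) k (ordProd (annihilate (MvPolynomial σ ℂ)) I κ)) := by
    rw [cliff_apply, map_sum]
    refine Finset.sum_congr rfl fun k _ => ?_
    rw [map_add, map_smul, map_smul, annihilate_ordProd, smul_smul ((-1 : ℤ) ^ I.card), ← pow_add,
      Even.neg_one_pow ⟨_, rfl⟩, one_smul]
    rfl
  rw [ordProdₗ_apply] at h
  rw [h, Finset.sum_apply, map_sum, Finset.smul_sum]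
  refine Finset.sum_congr rfl fun k _ => ?_
  have h1 : kill I (scaled c k) = 0 := by
    rw [scaled, map_mul, kill_X, kill_C]
    split_ifs with hk
    · simp
    · have : c k = 0 := by simpa using mt (hI k).2 hk
      simp [this]
  simp only [Pi.add_apply, Pi.smul_apply, smul_eq_mul, map_add, map_mul, h1, zero_mul, zero_add,
    map_zsmul, mul_smul_comm]

theorem annihilate_ordProd_mem {k : σ} (hk : k ∈ I) (κ : Finset σ → MvPolynomial σ ℂ) :
    annihilate (MvPolynomial σ ℂ) k (ordProd (annihilate (MvPolynomial σ ℂ)) I κ) = 0 := by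
  rw [apply_ordProd _ annihilate_annihilate annihilate_self, if_pos hk]

/-- The class of a cocycle is determined by its component at `I`. -/
theorem exists_decomposition (hI : ∀ i, i ∈ I ↔ c i ≠ 0) (hvw : ∑ i, scaled c i * w i = 0) (M : ℕ)
    (hreg : ∀ k, X k ^ M ∈ Ideal.span (Set.range (mixedSeq w I)))
    {κ₀ : Finset σ → MvPolynomial σ ℂ} (hκ₀ : cliff (scaled c) w κ₀ = 0) (h1 : κ₀ I = 1)
    (hs₀ : SuppOn (fun J => J = I ∨ J.card < I.card) κ₀) (p : ℕ)
    (η : Finset σ → MvPolynomial σ ℂ) (hη : cliff (scaled c) w η = 0)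
    (hs : SuppOn (fun J => J.card < p) η) :
    ∃ (f : MvPolynomial σ ℂ) (ζ : Finset σ → MvPolynomial σ ℂ),
      η = f • κ₀ + cliff (scaled c) w ζ := by
  have hI' : ∀ i ∈ I, c i ≠ 0 := fun i hi => (hI i).1 hi
  induction p generalizing η with
  | zero =>
    refine ⟨0, 0, ?_⟩
    rw [map_zero, zero_smul, add_zero]
    ext1 J
    exact hs J (Nat.not_lt_zero _)
  | succ p ih =>
    suffices h : ∃ (f : MvPolynomial σ ℂ) (ζ : Finset σ → MvPolynomial σ ℂ),
        SuppOn (fun J => J.card < p + 1) (η - f • κ₀ - cliff (scaled c) w ζ) ∧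
        ∀ J, J.card = p → I ⊆ J → kill I ((η - f • κ₀ - cliff (scaled c) w ζ) J) = 0 by
      obtain ⟨f, ζ, h2, h3⟩ := h
      have hcl : cliff (scaled c) w (η - f • κ₀ - cliff (scaled c) w ζ) = 0 := by
        rw [map_sub, map_sub, map_smul, hη, hκ₀, cliff_cliff, hvw]; simp
      obtain ⟨ζ', -, h4⟩ := exists_lower c w I hI' hcl h2 h3
      obtain ⟨f', ζ'', h5⟩ := ih _ (by rw [map_sub, hcl, cliff_cliff, hvw]; simp) h4
      refine ⟨f + f', ζ + ζ' + ζ'', ?_⟩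
      rw [map_add, map_add, add_smul]
      linear_combination (norm := module) h5
    rcases lt_trichotomy p I.card with hp | hp | hp
    · refine ⟨0, 0, by simpa using hs, fun J hJ hIJ => ?_⟩
      have := Finset.card_le_card hIJ
      omega
    · refine ⟨η I, 0, ?_, ?_⟩
      · rw [map_zero, sub_zero]
        refine hs.sub ((hs₀.smul _).mono fun J hJ => ?_)
        rcases hJ with rfl | hJ <;> omega
      · intro J hJ hIJ
        have : J = I := (Finset.eq_of_subset_of_card_le hIJ (by omega)).symm
        simp [this, h1]
    · obtain ⟨q, hq, rfl⟩ : ∃ q, 0 < q ∧ p = I.card + q := ⟨p - I.card, by omega, by omega⟩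
      set N : (Finset σ → MvPolynomial σ ℂ) → Finset σ → MvPolynomial σ ℂ :=
        ordProd (annihilate (MvPolynomial σ ℂ)) I with hN
      set φ : Finset σ → MvPolynomial σ ℂ := fun K => if K.card = q then kill I (N η K) else 0 with hφ
      have hNdisj : ∀ κ K, ¬ Disjoint I K → N κ K = 0 := fun κ K hK => by
        rw [hN, ordProd_annihilate_apply, if_neg hK]
      have hφcl : cliff 0 (mixedSeq w I) φ = 0 := by
        ext1 K
        rw [cliff_apply_apply, Pi.zero_apply]
        simp only [Pi.zero_apply, zero_mul, zero_add]
        by_cases hK : K.card + 1 = q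
        · have h2 := kill_ordProd_cliff c w I hI η K
          rw [hη] at h2
          have h20 : ordProd (annihilate (MvPolynomial σ ℂ)) I
              (0 : Finset σ → MvPolynomial σ ℂ) = 0 :=
            map_zero (ordProdₗ (R := MvPolynomial σ ℂ) (M := Finset σ → MvPolynomial σ ℂ)
              (annihilate (MvPolynomial σ ℂ)) I)
          rw [h20, Pi.zero_apply, map_zero, eq_comm] at h2
          have h3 : (∑ k, kill I (w k) *
              kill I (annihilate (MvPolynomial σ ℂ) k (N η) K)) = 0 := by
            rcases neg_one_pow_eq_or ℤ I.card with h4 | h4 <;> rw [h4] at h2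
            · simpa using h2
            · simpa using h2
          refine Eq.trans ?_ h3
          refine Finset.sum_congr rfl fun k _ => ?_
          rw [mixedSeq]
          by_cases hkK : k ∈ K
          · rw [annihilate_apply, if_pos hkK, if_pos hkK]; simp
          rw [if_neg hkK]
          split_ifs with hkI
          · have : φ (insert k K) = 0 := by
              simp only [hφ]
              split_ifs
              · rw [hNdisj, map_zero]
                exact fun h => Finset.disjoint_left.1 h hkI (Finset.mem_insert_self _ _)
              · rfl
            rw [this, hN, annihilate_ordProd_mem I hkI]; simp
          · rw [annihilate_apply, if_neg hkK]
            simp only [hφ]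
            rw [if_pos (by rw [Finset.card_insert_of_notMem hkK, hK]), map_zsmul]
        · refine Finset.sum_eq_zero fun k _ => ?_
          split_ifs with hkK
          · simp
          · have : φ (insert k K) = 0 := by
              simp only [hφ]
              rw [if_neg (by rw [Finset.card_insert_of_notMem hkK]; exact hK)]
            rw [this]; simp
      obtain ⟨ψ, hψ, h2⟩ := koszul_exact (mixedSeq w I) M hreg q hq φ
        (fun K hK => if_neg hK) hφcl
      set ζ : Finset σ → MvPolynomial σ ℂ := fun J => if I ⊆ J then
        ((-1) ^ I.card * (revSign I * invSign I (J \ I))) • ψ (J \ I) else 0 with hζ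
      have hζs : SuppOn (fun J => J.card = I.card + q + 1) ζ := by
        intro J hJ
        simp only [hζ]
        split_ifs with hIJ
        · have := Finset.card_sdiff_add_card_eq_card hIJ
          rw [hψ (J \ I) (by dsimp only at *; omega), smul_zero]
        · rfl
      have hPζ : cliff (scaled c) 0 ζ = 0 := by
        ext1 J
        rw [cliff_apply_apply]
        refine Finset.sum_eq_zero fun i _ => ?_
        by_cases hc : c i = 0
        · simp [scaled, hc]
        · have : ¬ I ⊆ J.erase i := fun h => Finset.notMem_erase i J (h ((hI i).2 hc))
          simp [hζ, this]
      have hNζ : ∀ K, Disjoint I K → N ζ K = (-1 : ℤ) ^ I.card • ψ K := by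
        intro K hK
        rw [hN, ordProd_annihilate_apply, if_pos hK]
        simp only [hζ]
        rw [if_pos Finset.subset_union_left, Finset.union_sdiff_cancel_left hK, smul_smul]
        congr 1
        linear_combination (-1 : ℤ) ^ I.card * (revSign I * revSign I) * invSign_mul_self I K +
          (-1 : ℤ) ^ I.card * revSign_mul_self I
      refine ⟨0, ζ, ?_, ?_⟩
      · rw [zero_smul, sub_zero, cliff_split, hPζ, zero_add]
        refine hs.sub ((cliff_right_suppOn w hζs).mono fun J hJ => by omega)
      · intro J hJ hIJ
        set K := J \ I with hK
        have hdisj : Disjoint I K := Finset.disjoint_sdiff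
        have hJK : I ∪ K = J := Finset.union_sdiff_of_subset hIJ
        have hKc : K.card = q := by
          have := Finset.card_sdiff_add_card_eq_card hIJ
          rw [← hK] at this
          omega
        have h3 : kill I (N η K) = kill I (N (cliff (scaled c) w ζ) K) := by
          have h4 : φ K = kill I (N η K) := if_pos hKc
          have h5 : kill I (φ K) = φ K := by rw [h4, kill_kill, Finset.union_self]
          rw [← h4, ← h5, congrFun h2 K, hN, kill_ordProd_cliff c w I hI, cliff_apply_apply, map_sum,
            Finset.smul_sum]
          refine Finset.sum_congr rfl fun k _ => ?_
          simp only [Pi.zero_apply, zero_mul, zero_add]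
          rw [mixedSeq]
          by_cases hkI : k ∈ I
          · rw [annihilate_ordProd_mem I hkI, if_pos hkI, map_mul, kill_X, if_pos hkI]; simp
          · rw [if_neg hkI, annihilate_apply, map_mul, kill_kill, Finset.union_self]
            by_cases hkK : k ∈ K
            · simp [hkK]
            · rw [if_neg hkK, if_neg hkK]
              have := hNζ (insert k K) (by
                rw [Finset.disjoint_insert_right]; exact ⟨hkI, hdisj⟩)
              rw [hN] at this
              rw [this, smul_comm (koszulSign K k), map_zsmul _ _ (koszulSign K k • _),
                mul_smul_comm, smul_smul, ← pow_add, Even.neg_one_pow ⟨_, rfl⟩, one_smul]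
        have h6 : ∀ κ, N κ K = (revSign I * invSign I K) • κ J := fun κ => by
          rw [hN, ordProd_annihilate_apply, if_pos hdisj, hJK]
        rw [h6, h6, map_zsmul, map_zsmul] at h3
        have h7 := congrArg (fun x => (revSign I * invSign I K) • x) h3
        simp only [smul_smul] at h7
        have h8 : revSign I * invSign I K * (revSign I * invSign I K) = 1 := by
          linear_combination revSign I * revSign I * invSign_mul_self I K + revSign_mul_self I
        rw [h8, one_smul, one_smul] at h7
        rw [zero_smul, sub_zero, Pi.sub_apply, map_sub, h7, sub_self]

end Spanning

end Orbifold

namespace BarCochain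

open PolyBimod Fermion Hochschild

variable {σ : Type} [Fintype σ] [LinearOrder σ] {B : Type} [Ring B] [Algebra ℂ B]
  {β : PolyBimod σ B}

theorem totPost_totUps {f : B →ₗ[ℂ] B} (hf : IsHom β β f) (κ : Finset σ → B) :
    totPost f (totUps β κ) = totUps β (mapCoeff f κ) := by
  rw [totUps_eq_sum, totUps_eq_sum, map_sum]
  refine Finset.sum_congr rfl fun I _ => ?_
  rw [totPost_incl, mapCoeff_apply, ← mapCoeff_single, ups_mapCoeff hf]

end BarCochain

theorem PolyBimod.isHom_left {σ M : Type} [AddCommGroup M] [Module ℂ M] (β : PolyBimod σ M)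
    (a : MvPolynomial σ ℂ) : IsHom β β (β.left a) := by
  have := β.isHom_act (a ⊗ₜ 1)
  rwa [act_tmul, map_one, mul_one] at this

theorem PolyBimod.isHom_right {σ M : Type} [AddCommGroup M] [Module ℂ M] (β : PolyBimod σ M)
    (a : MvPolynomial σ ℂ) : IsHom β β (β.right a) := by
  have := β.isHom_act (1 ⊗ₜ a)
  rwa [act_tmul, map_one, one_mul] at this

namespace Orbifold

open PolyBimod DividedDiff Fermion Hochschild BarCochain

variable {σ : Type} [Fintype σ] [LinearOrder σ] {W : MvPolynomial σ ℂ}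

section Representative

variable {g : Torus σ}

/-- The eigenvalues of `1 - g`. -/
noncomputable def weight (g : Torus σ) (i : σ) : ℂ := 1 - (g i : ℂ)

theorem mem_movingIndex {i : σ} : i ∈ movingIndex g ↔ g i ≠ 1 := by simp [movingIndex]

theorem mem_movingIndex_iff (g : Torus σ) (i : σ) : i ∈ movingIndex g ↔ weight g i ≠ 0 := by
  rw [mem_movingIndex, weight, sub_ne_zero, Ne, Ne, ← Units.val_eq_one, eq_comm]

theorem kv_eq (g : Torus σ) : kv g = scaled (weight g) := by
  ext1 i
  rw [kv, scaled, weight, smul_X, map_sub, map_one]; ring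

theorem sectorDiff_eq_cliff (W : MvPolynomial σ ℂ) (g : Torus σ) :
    sectorDiff W g = cliff (scaled (weight g)) (kw W g) := by rw [sectorDiff, kv_eq]

theorem sum_scaled_mul_kw (hg : g • W = W) : ∑ i, scaled (weight g) i * kw W g i = 0 := by
  have h := congrArg (twist g) (subst_sub_subst W ∅ Finset.univ (Finset.empty_subset _)
    (by simp) (by simp))
  rw [subst_empty, subst_univ, map_sub, map_sum, Finset.sdiff_empty,
    Algebra.TensorProduct.includeLeft_apply, Algebra.TensorProduct.includeRight_apply, twist_tmul,
    twist_tmul, one_mul, smul_one, mul_one, hg, sub_self] at h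
  rw [h, ← kv_eq]
  exact Finset.sum_congr rfl fun i _ => by rw [map_mul, twist_gap, twist_ddiff]; rfl

theorem exists_koszulRepresentative (hg : g • W = W) : ∃ κ, IsKoszulRepresentative W g κ := by
  obtain ⟨κ, h1, h2, h3⟩ := exists_representative (weight g) (kw W g) (movingIndex g)
    (mem_movingIndex_iff g) (sum_scaled_mul_kw hg)
  exact ⟨κ, h1, h2, by rw [← sectorDiff_eq, sectorDiff_eq_cliff, h3]⟩

theorem _root_.IsKoszulRepresentative.sectorDiff_eq_zero {κ : KoszulCochain σ}
    (h : IsKoszulRepresentative W g κ) : sectorDiff W g κ = 0 := by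
  rw [sectorDiff_eq, h.closed]

theorem _root_.IsKoszulRepresentative.suppOn {κ : KoszulCochain σ} (h : IsKoszulRepresentative W g κ) :
    SuppOn (fun J => J = movingIndex g ∨ J.card < (movingIndex g).card) κ := by
  intro J hJ
  by_contra h0
  push Not at hJ
  obtain ⟨m, hm, h2⟩ := h.lower J hJ.1 h0
  omega

theorem _root_.IsKoszulRepresentative.exists_sub_eq (hg : g • W = W) {κ κ' : KoszulCochain σ}
    (h : IsKoszulRepresentative W g κ) (h' : IsKoszulRepresentative W g κ') :
    ∃ ζ, κ - κ' = sectorDiff W g ζ := by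
  obtain ⟨ζ, -, h2⟩ := exists_of_card_lt (weight g) (kw W g) (movingIndex g)
    (fun i hi => (mem_movingIndex_iff g i).1 hi) (sum_scaled_mul_kw hg) _ le_rfl (κ - κ')
    (by rw [← sectorDiff_eq_cliff, map_sub, h.sectorDiff_eq_zero, h'.sectorDiff_eq_zero, sub_zero])
    (by
      intro J hJ
      by_cases hJ' : J = movingIndex g
      · rw [hJ', Pi.sub_apply, h.leading, h'.leading, sub_self]
      · rw [Pi.sub_apply, h.suppOn J (by simp_all), h'.suppOn J (by simp_all), sub_zero])
  exact ⟨ζ, by rw [h2, sectorDiff_eq_cliff]⟩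

/-- The ideal that acts trivially on the cohomology of the sector of `g`. -/
noncomputable def sectorIdeal (W : MvPolynomial σ ℂ) (g : Torus σ) : Ideal (MvPolynomial σ ℂ) :=
  Ideal.span (X '' (movingIndex g : Set σ)) ⊔ Ideal.span (Set.range (kw W g))

theorem exists_smul_eq {κ : Finset σ → MvPolynomial σ ℂ} (hκ : sectorDiff W g κ = 0)
    {f : MvPolynomial σ ℂ} (hf : f ∈ sectorIdeal W g) : ∃ ζ, f • κ = sectorDiff W g ζ := by
  have hle : sectorIdeal W g ≤ (LinearMap.range (sectorDiff W g)).comap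
      (LinearMap.toSpanSingleton (MvPolynomial σ ℂ) _ κ) := by
    refine sup_le (Ideal.span_le.2 ?_) (Ideal.span_le.2 ?_)
    · rintro _ ⟨i, hi, rfl⟩
      refine ⟨(C (weight g i)⁻¹ : MvPolynomial σ ℂ) • annihilate (MvPolynomial σ ℂ) i κ, ?_⟩
      rw [map_smul, sectorDiff_eq_cliff, cliff_annihilate, ← sectorDiff_eq_cliff, hκ, map_zero,
        sub_zero, smul_smul, scaled, ← mul_assoc, ← map_mul,
        inv_mul_cancel₀ ((mem_movingIndex_iff g i).1 hi), map_one, one_mul]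
      rfl
    · rintro _ ⟨i, rfl⟩
      refine ⟨create (MvPolynomial σ ℂ) i κ, ?_⟩
      rw [sectorDiff_eq_cliff, cliff_create, ← sectorDiff_eq_cliff, hκ, map_zero, sub_zero]
      rfl
  obtain ⟨ζ, hζ⟩ := hle hf
  exact ⟨ζ, hζ.symm⟩

theorem smul_sub_mem_sectorIdeal (a : MvPolynomial σ ℂ) : g • a - a ∈ sectorIdeal W g := by
  refine Ideal.mem_sup_left ?_
  have h : kill (movingIndex g) (g • a) = kill (movingIndex g) a := by
    have : (kill (movingIndex g)).comp (Torus.act g) = kill (movingIndex g) := by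
      refine MvPolynomial.algHom_ext fun i => ?_
      rw [AlgHom.comp_apply, ← Torus.smul_def, smul_X, map_mul, kill_X, kill_C]
      split_ifs with hi
      · simp
      · have : g i = 1 := by simpa [mem_movingIndex] using hi
        simp [this]
    exact DFunLike.congr_fun this a
  have h1 := Ideal.sub_mem _ (sub_kill_mem (movingIndex g) (g • a)) (sub_kill_mem (movingIndex g) a)
  rw [h] at h1
  convert h1 using 1
  abel

end Representative

section Classes

variable {G : Subgroup (Torus σ)}

variable (W) in
/-- The cocycles of the sector of `u`. -/
noncomputable abbrev sectorCocycles (u : Torus σ) : Submodule ℂ (Finset σ → MvPolynomial σ ℂ) :=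
  (LinearMap.ker (sectorDiff W u)).restrictScalars ℂ

variable (W) in
/-- The class of a Koszul cocycle of the sector of `u`. -/
noncomputable def sectorClass (u : G) : sectorCocycles W u.1 →ₗ[ℂ] OrbifoldHH W G :=
  HHc.mk (unitSector G) W ∘ₗ LinearMap.codRestrict (Cocycles (unitSector G) W)
    (embed G u ∘ₗ (sectorCocycles W u.1).subtype) fun κ => by
      have h : sectorDiff W u.1 κ.1 = 0 := κ.2
      rw [LinearMap.mem_ker, LinearMap.comp_apply, curvedDiff_embed]
      exact (congrArg _ h).trans (map_zero _)

theorem mk_eq_mk_iff (x y : Cocycles (unitSector G) W) :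
    HHc.mk (unitSector G) W x = HHc.mk (unitSector G) W y ↔
      ∃ z, curvedDiff (unitSector G) W z = x.1 - y.1 := by
  rw [HHc.mk, Submodule.mkQ_apply, Submodule.mkQ_apply, Submodule.Quotient.eq]
  exact Iff.rfl

theorem sectorClass_eq (u : G) (κ κ' : sectorCocycles W u.1) (ζ : Finset σ → MvPolynomial σ ℂ)
    (h : κ.1 - κ'.1 = sectorDiff W u.1 ζ) : sectorClass W u κ = sectorClass W u κ' := by
  refine (mk_eq_mk_iff _ _).2 ⟨embed G u ζ, ?_⟩
  rw [curvedDiff_embed, ← h, map_sub]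
  rfl

theorem existsUnique_isSectorGenerator (hG : G ≤ symmetryGroup W) (g : G) :
    ∃! c, IsSectorGenerator W G g c := by
  have hg : g.1 • W = W := hG g.2
  obtain ⟨κ, hκ⟩ := exists_koszulRepresentative hg
  have hcl : ∀ {κ}, IsKoszulRepresentative W g.1 κ →
      upsilon G g κ ∈ Cocycles (unitSector G) W := by
    intro κ hκ
    rw [LinearMap.mem_ker, upsilon_eq, curvedDiff_embed, hκ.sectorDiff_eq_zero, map_zero]
  refine ⟨_, ⟨κ, hκ, hcl hκ, rfl⟩, ?_⟩
  rintro _ ⟨κ', hκ', h', rfl⟩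
  obtain ⟨ζ, hζ⟩ := hκ'.exists_sub_eq hg hκ
  refine (mk_eq_mk_iff _ _).2 ⟨embed G g ζ, ?_⟩
  rw [curvedDiff_embed, ← hζ, map_sub, ← upsilon_eq, ← upsilon_eq]

theorem sectorGenerator_eq (hG : G ≤ symmetryGroup W) (g : G) {κ : KoszulCochain σ}
    (hκ : IsKoszulRepresentative W g.1 κ) :
    sectorGenerator W G g = sectorClass W g ⟨κ, hκ.sectorDiff_eq_zero⟩ := by
  have h := existsUnique_isSectorGenerator hG g
  refine h.unique (Classical.epsilon_spec h.exists) ⟨κ, hκ, ?_, ?_⟩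
  · rw [LinearMap.mem_ker, upsilon_eq, curvedDiff_embed, hκ.sectorDiff_eq_zero, map_zero]
  · refine congrArg (HHc.mk (unitSector G) W) (Subtype.ext ?_)
    exact (upsilon_eq g κ).symm

theorem ev_post (f : CrossedProduct G →ₗ[ℂ] CrossedProduct G) {p : ℕ}
    (φ : Coch σ (CrossedProduct G) p) (a : ℕ → MvPolynomial σ ℂ) :
    ev (post f φ : Cochain ℂ (MvPolynomial σ ℂ) (CrossedProduct G) p) a = f (ev φ a) := rfl

theorem cup_totPost_left (a : MvPolynomial σ ℂ) (x y : Tot σ (CrossedProduct G)) :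
    cup (totPost ((bimod G).left a) x) y = totPost ((bimod G).left a) (cup x y) := by
  induction x using CompactCochain.induction with
  | zero => simp
  | add x x' hx hx' => simp only [map_add, LinearMap.add_apply, hx, hx']
  | incl p φ =>
    induction y using CompactCochain.induction with
    | zero => simp
    | add y y' hy hy' => simp only [map_add, hy, hy']
    | incl q ψ =>
      rw [totPost_incl, cup_incl, cup_incl, totPost_incl]
      refine incl_eq_incl rfl _ _ fun b => ?_
      rw [ev_cup, ev_post, ev_post, ev_cup, bimod_left_apply, bimod_left_apply, mul_assoc]

theorem cup_totPost_right (b : MvPolynomial σ ℂ) (x y : Tot σ (CrossedProduct G)) :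
    cup x (totPost ((bimod G).left b) y) = cup (totPost ((bimod G).right b) x) y := by
  induction x using CompactCochain.induction with
  | zero => simp
  | add x x' hx hx' => simp only [map_add, LinearMap.add_apply, hx, hx']
  | incl p φ =>
    induction y using CompactCochain.induction with
    | zero => simp
    | add y y' hy hy' => simp only [map_add, hy, hy']
    | incl q ψ =>
      rw [totPost_incl, totPost_incl, cup_incl, cup_incl]
      refine incl_eq_incl rfl _ _ fun a => ?_
      rw [ev_cup, ev_cup, ev_post, ev_post, bimod_left_apply, bimod_right_apply, mul_assoc]

theorem cup_functionCocycle (a : MvPolynomial σ ℂ) (y : Tot σ (CrossedProduct G)) :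
    cup (functionCocycle W G a).1 y = totPost ((bimod G).left a) y := by
  induction y using CompactCochain.induction with
  | zero => simp
  | add y y' hy hy' => simp only [map_add, hy, hy']
  | incl q ψ =>
    rw [totPost_incl, functionCocycle, cup_incl]
    refine incl_eq_incl (zero_add q) _ _ fun b => ?_
    rw [ev_cup, ev_post, bimod_left_apply]
    simp [ev]

theorem totPost_left_embed (a : MvPolynomial σ ℂ) (g : G) (κ : Finset σ → MvPolynomial σ ℂ) :
    totPost ((bimod G).left a) (embed G g κ) = embed G g (a • κ) := by
  rw [embed, LinearMap.comp_apply, LinearMap.comp_apply, totPost_totUps (isHom_left _ a)]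
  congr 1
  ext1 J
  exact unitSector_mul_single G a (κ J) g

theorem totPost_right_embed (a : MvPolynomial σ ℂ) (g : G) (κ : Finset σ → MvPolynomial σ ℂ) :
    totPost ((bimod G).right a) (embed G g κ) = embed G g ((g.1 • a) • κ) := by
  rw [embed, LinearMap.comp_apply, LinearMap.comp_apply, totPost_totUps (isHom_right _ a)]
  congr 1
  ext1 J
  refine (single_mul_unitSector G a (κ J) g).trans ?_
  rw [mul_comm]
  rfl

theorem project_totPost_left (a : MvPolynomial σ ℂ) (u : G) (x : Tot σ (CrossedProduct G)) :
    project W G u (totPost ((bimod G).left a) x) = a • project W G u x := by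
  rw [project, LinearMap.comp_apply, psiW_totPost (isHom_left _ a)]
  ext1 J
  exact coeffAt_unitSector_mul G u a _

/-- The product of a cocycle with a polynomial. -/
noncomputable def smulCocycle {u : Torus σ} (f : MvPolynomial σ ℂ) (κ : sectorCocycles W u) :
    sectorCocycles W u :=
  ⟨f • κ.1, (LinearMap.ker (sectorDiff W u)).smul_mem f κ.2⟩

theorem functionClass_cup_sectorClass (f : MvPolynomial σ ℂ) (u : G) (κ : sectorCocycles W u.1) :
    orbifoldCup W G (functionClass W G f) (sectorClass W u κ) =
      sectorClass W u (smulCocycle f κ) := by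
  refine (HHc.cup_mk _ _ _ _).trans (congrArg _ (Subtype.ext ?_))
  change cup (functionCocycle W G f).1 (embed G u κ.1) = embed G u (f • κ.1)
  rw [cup_functionCocycle, totPost_left_embed]

theorem isHom_sectorProjection (u : G) : IsHom (bimod G) (bimod G)
    (SkewMonoidAlgebra.lsingle ℂ u ∘ₗ coeffAt G u) where
  left a m := by
    simp only [LinearMap.comp_apply, bimod_left_apply, coeffAt_unitSector_mul,
      SkewMonoidAlgebra.lsingle_apply, unitSector_mul_single]
  right a m := by
    simp only [LinearMap.comp_apply, bimod_right_apply, coeffAt_mul_unitSector,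
      SkewMonoidAlgebra.lsingle_apply, single_mul_unitSector]

theorem ups_lsingle_apply (g : G) (p : ℕ) (κ : Finset σ → MvPolynomial σ ℂ)
    (v : Fin p → MvPolynomial σ ℂ) :
    ∃ b, ups (bimod G) p (mapCoeff (SkewMonoidAlgebra.lsingle ℂ g) κ) v =
      SkewMonoidAlgebra.single g b := by
  have h : mapCoeff (SkewMonoidAlgebra.lsingle ℂ g) κ =
      mapCoeff (SkewMonoidAlgebra.lsingle ℂ g ∘ₗ coeffAt G g)
        (mapCoeff (SkewMonoidAlgebra.lsingle ℂ g) κ) := by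
    ext1 J
    simp only [mapCoeff_apply, LinearMap.comp_apply, SkewMonoidAlgebra.lsingle_apply,
      coeffAt_single, if_true]
  rw [h, ups_mapCoeff (isHom_sectorProjection g)]
  exact ⟨_, rfl⟩

theorem project_cup_eq_zero {g h u : G} (hu : g * h ≠ u) (κ μ : Finset σ → MvPolynomial σ ℂ) :
    project W G u (cup (embed G g κ) (embed G h μ)) = 0 := by
  classical
  have h1 : totPost (SkewMonoidAlgebra.lsingle ℂ u ∘ₗ coeffAt G u)
      (cup (embed G g κ) (embed G h μ)) = 0 := by
    rw [embed, embed, LinearMap.comp_apply, LinearMap.comp_apply,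
      totUps_eq _ (Fintype.card σ + 1) (by omega), totUps_eq _ (Fintype.card σ + 1) (by omega)]
    simp only [map_sum, LinearMap.sum_apply, cup_incl, totPost_incl]
    refine Finset.sum_eq_zero fun p _ => Finset.sum_eq_zero fun q _ => ?_
    refine Eq.trans (congrArg _ ?_) (map_zero _)
    refine evSeq_ext fun a => ?_
    change (SkewMonoidAlgebra.lsingle ℂ u ∘ₗ coeffAt G u) (ev (cupAt _ _ _ _) a) = 0
    rw [ev_cup]
    obtain ⟨b, hb⟩ := ups_lsingle_apply g q κ (fun t => a t)
    obtain ⟨b', hb'⟩ := ups_lsingle_apply h p μ (fun t => a (q + t))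
    simp only [ev, hb, hb']
    rw [SkewMonoidAlgebra.single_mul_single, LinearMap.comp_apply, coeffAt_single, if_neg hu,
      map_zero]
  have h2 : project W G u (totPost (SkewMonoidAlgebra.lsingle ℂ u ∘ₗ coeffAt G u)
      (cup (embed G g κ) (embed G h μ))) = project W G u (cup (embed G g κ) (embed G h μ)) := by
    rw [project, LinearMap.comp_apply, psiW_totPost (isHom_sectorProjection u)]
    ext1 J
    simp only [LinearMap.comp_apply, mapCoeff_apply, SkewMonoidAlgebra.lsingle_apply,
      coeffAt_single, if_true]
  rw [← h2, h1, map_zero]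

variable (W) in
/-- The product with `μ e_h`, followed by the projection to Koszul cochains. -/
noncomputable def product (g h : G) (μ : Finset σ → MvPolynomial σ ℂ) :
    (Finset σ → MvPolynomial σ ℂ) →ₗ[MvPolynomial σ ℂ] (Finset σ → MvPolynomial σ ℂ) where
  toFun κ := project W G (g * h) (cup (embed G g κ) (embed G h μ))
  map_add' κ κ' := by simp only [map_add, LinearMap.add_apply]
  map_smul' a κ := by
    rw [← totPost_left_embed, cup_totPost_left, project_totPost_left, RingHom.id_apply]

theorem product_apply (g h : G) (κ μ : Finset σ → MvPolynomial σ ℂ) :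
    product W g h μ κ = project W G (g * h) (cup (embed G g κ) (embed G h μ)) := rfl

theorem product_smul_right (g h : G) (κ μ : Finset σ → MvPolynomial σ ℂ) (b : MvPolynomial σ ℂ) :
    product W g h (b • μ) κ = (g.1 • b) • product W g h μ κ := by
  rw [← map_smul, product_apply, product_apply, ← totPost_left_embed, cup_totPost_right,
    totPost_right_embed]

theorem sectorDiff_product (hG : G ≤ symmetryGroup W) (g h : G)
    (κ μ : Finset σ → MvPolynomial σ ℂ) (hμ : sectorDiff W h.1 μ = 0) :
    sectorDiff W (g * h : G).1 (product W g h μ κ) = product W g h μ (sectorDiff W g.1 κ) := by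
  rw [product_apply, ← project_curvedDiff hG, curvedDiff_cup, curvedDiff_embed, curvedDiff_embed,
    hμ, map_zero, map_zero, add_zero, product_apply]

/-- The product of cocycles. -/
noncomputable def productCocycle (hG : G ≤ symmetryGroup W) {g h : G} (κ : sectorCocycles W g.1)
    (μ : sectorCocycles W h.1) : sectorCocycles W (g * h : G).1 :=
  ⟨product W g h μ.1 κ.1, by
    change sectorDiff W _ _ = 0
    rw [sectorDiff_product hG _ _ _ _ μ.2]
    exact (congrArg _ κ.2).trans (map_zero _)⟩

theorem cup_sectorClass (hG : G ≤ symmetryGroup W) {g h : G} (κ : sectorCocycles W g.1)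
    (μ : sectorCocycles W h.1) :
    orbifoldCup W G (sectorClass W g κ) (sectorClass W h μ) =
      sectorClass W (g * h) (productCocycle hG κ μ) := by
  refine (HHc.cup_mk _ _ _ _).trans ((mk_eq_mk_iff _ _).2 ?_)
  obtain ⟨s, y, h1, h2⟩ := exists_homotopy hG (cup (embed G g κ.1) (embed G h μ.1)) (by
    have hκ : sectorDiff W g.1 κ.1 = 0 := κ.2
    have hμ : sectorDiff W h.1 μ.1 = 0 := μ.2
    rw [curvedDiff_cup, curvedDiff_embed, curvedDiff_embed, hκ, hμ]
    simp)
  refine ⟨y, ?_⟩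
  change _ = cup (embed G g κ.1) (embed G h μ.1) - embed G (g * h) (product W g h μ.1 κ.1)
  rw [eq_sub_iff_add_eq, add_comm]
  conv_rhs => rw [h2]
  congr 1
  rw [Finset.sum_eq_single (g * h)]
  · rfl
  · intro u _ hu
    rw [project_cup_eq_zero hu.symm, map_zero]
  · intro hu
    rw [h1 _ hu, map_zero]

theorem cup_smulCocycle (hG : G ≤ symmetryGroup W) {g h : G} (κ : sectorCocycles W g.1)
    (μ : sectorCocycles W h.1) (a b : MvPolynomial σ ℂ) :
    orbifoldCup W G (sectorClass W g (smulCocycle a κ)) (sectorClass W h (smulCocycle b μ)) =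
      sectorClass W (g * h) (smulCocycle (a * b) (productCocycle hG κ μ)) := by
  have hκ : sectorDiff W g.1 κ.1 = 0 := κ.2
  rw [cup_sectorClass hG]
  obtain ⟨ζ, hζ⟩ := exists_smul_eq hκ (Ideal.mul_mem_left _ a
    (smul_sub_mem_sectorIdeal (W := W) (g := g.1) b))
  refine sectorClass_eq _ _ _ (product W g h μ.1 ζ) ?_
  rw [sectorDiff_product hG _ _ _ _ μ.2, ← hζ]
  change product W g h (b • μ.1) (a • κ.1) - (a * b) • product W g h μ.1 κ.1 = _
  rw [product_smul_right, map_smul, map_smul, smul_smul, ← sub_smul]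
  congr 1
  ring

theorem exists_sum_eq (hG : G ≤ symmetryGroup W)
    (hreg : ∀ u ∈ G, ∃ M : ℕ, ∀ k, X k ^ M ∈
      Ideal.span (Set.range (mixedSeq (kw W u) (movingIndex u)))) (c : OrbifoldHH W G) :
    ∃ f : G →₀ MvPolynomial σ ℂ,
      c = f.sum fun g a => orbifoldCup W G (functionClass W G a) (sectorGenerator W G g) := by
  classical
  obtain ⟨x, rfl⟩ := Submodule.mkQ_surjective _ c
  have hx : curvedDiff (unitSector G) W x.1 = 0 := x.2
  obtain ⟨s, y, -, h2⟩ := exists_homotopy hG x.1 hx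
  choose κ hκ using fun u : G => exists_koszulRepresentative (W := W) (g := u.1) (hG u.2)
  have hcl : ∀ u, sectorDiff W u.1 (project W G u x.1) = 0 := fun u => by
    rw [← project_curvedDiff hG, hx, map_zero]
  have hdec : ∀ u : G, ∃ (f : MvPolynomial σ ℂ) (ζ : Finset σ → MvPolynomial σ ℂ),
      project W G u x.1 = f • κ u + sectorDiff W u.1 ζ := by
    intro u
    obtain ⟨M, hM⟩ := hreg u.1 u.2
    rw [sectorDiff_eq_cliff]
    refine exists_decomposition (weight u.1) (kw W u.1) (movingIndex u.1) (mem_movingIndex_iff u.1)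
      (sum_scaled_mul_kw (hG u.2)) M hM (by
        rw [← sectorDiff_eq_cliff]; exact (hκ u).sectorDiff_eq_zero) (hκ u).leading (hκ u).suppOn
      (Fintype.card σ + 1) _ (by rw [← sectorDiff_eq_cliff]; exact hcl u) fun J hJ => ?_
    have := J.card_le_univ
    omega
  choose f ζ hf using hdec
  have hcls : ∀ u a, orbifoldCup W G (functionClass W G a) (sectorGenerator W G u) =
      sectorClass W u (smulCocycle a ⟨κ u, (hκ u).sectorDiff_eq_zero⟩) := fun u a => by
    rw [sectorGenerator_eq hG u (hκ u), functionClass_cup_sectorClass]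
  refine ⟨∑ u ∈ s, Finsupp.single u (f u), ?_⟩
  rw [← Finsupp.sum_finsetSum_index]
  · have hsum : ∀ u ∈ s, ((Finsupp.single u (f u)).sum fun g a =>
        orbifoldCup W G (functionClass W G a) (sectorGenerator W G g)) =
        sectorClass W u ⟨project W G u x.1, hcl u⟩ := by
      intro u _
      rw [Finsupp.sum_single_index, hcls]
      · refine (sectorClass_eq _ _ _ (ζ u) ?_).symm
        change project W G u x.1 - f u • κ u = _
        rw [hf u]; abel
      · rw [hcls, show smulCocycle (0 : MvPolynomial σ ℂ) (⟨κ u, (hκ u).sectorDiff_eq_zero⟩ :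
          sectorCocycles W u.1) = 0 from Subtype.ext (zero_smul _ _), map_zero]
    rw [Finset.sum_congr rfl hsum]
    have h3 : ∑ u ∈ s, sectorClass W u ⟨project W G u x.1, hcl u⟩ =
        HHc.mk (unitSector G) W (∑ u ∈ s, ⟨embed G u (project W G u x.1), by
          rw [LinearMap.mem_ker, curvedDiff_embed, hcl u, map_zero]⟩) := by
      rw [map_sum]; rfl
    rw [h3]
    refine (mk_eq_mk_iff _ _).2 ⟨y, ?_⟩
    rw [Submodule.coe_sum]
    exact eq_sub_of_add_eq' h2.symm
  · intro u
    rw [hcls, show smulCocycle (0 : MvPolynomial σ ℂ) (⟨κ u, (hκ u).sectorDiff_eq_zero⟩ :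
      sectorCocycles W u.1) = 0 from Subtype.ext (zero_smul _ _), map_zero]
  · intro u a b
    rw [hcls, hcls, hcls, ← map_add]
    exact congrArg _ (Subtype.ext (add_smul _ _ _))

end Classes

end Orbifold

namespace BarCochain

open PolyBimod DividedDiff Fermion Hochschild

section LeadingTerm

variable {σ M : Type} [Fintype σ] [LinearOrder σ] [AddCommGroup M] [Module ℂ M]

theorem psi_succ_eq_sum (β : PolyBimod σ M) (p : ℕ) (φ : Coch σ M (p + 1)) :
    psi (p + 1) β φ = ∑ i, create ℂ i (psi p β (post (evAt (X i)) (curry φ)) -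
      mapCoeff (β.right (X i)) (psi p β (post (evAt 1) (curry φ)))) := by
  rw [psi_succ, kosz_apply, map_sum]
  refine Finset.sum_congr rfl fun i _ => ?_
  rw [psi_post (isRightHom_evAt β _), psi_post (isRightHom_evAt β _), ← create_mapCoeff,
    ← create_mapCoeff]
  congr 1
  ext J
  simp [act_gap]

theorem evSeq_ups_succ (β : PolyBimod σ M) (p : ℕ) (κ : Finset σ → M) (b : MvPolynomial σ ℂ)
    (a : ℕ → MvPolynomial σ ℂ) :
    evSeq (ups β (p + 1) κ) (fun t => if t = 0 then b else a (t - 1)) =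
      ∑ i, β.act (ddiff i b) (evSeq (ups β p (tail ℂ i κ)) a) := by
  rw [← evSeq_curry]
  exact ups_succ_apply β p κ b _

/-- The leading term of a cup product with the cochain of `m e_J`. -/
theorem psi_of_evSeq {β : PolyBimod σ M} {N : Type} [AddCommGroup N] [Module ℂ N]
    {γ : PolyBimod σ N} (B : M →ₗ[ℂ] N →ₗ[ℂ] N) (hB : ∀ m, IsRightHom γ γ (B m))
    (m : M) {q : ℕ} (ψ : Coch σ N q) (p : ℕ) (J : Finset σ) (hJ : J.card = p) (n : ℕ)
    (hn : n = p + q) (φ : Coch σ N n)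
    (h : ∀ a, evSeq φ a =
      B (evSeq (ups β p (Pi.single J m)) a) (evSeq ψ fun t => a (p + t))) :
    psi n γ φ = ordProd (create ℂ) J (mapCoeff (B m) (psi q γ ψ)) := by
  induction p generalizing J n with
  | zero =>
    rw [Finset.card_eq_zero] at hJ
    subst hJ
    obtain rfl : n = q := by omega
    rw [ordProd_empty, ← psi_post (hB m)]
    congr 1
    refine evSeq_ext fun a => ?_
    rw [h a, ups_zero]
    simp [evSeq]
  | succ p ih =>
    obtain ⟨n, rfl⟩ : ∃ n', n = n' + 1 := ⟨p + q, by omega⟩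
    have hne : J.Nonempty := Finset.card_pos.1 (by omega)
    set i := J.min' hne with hi
    have himem : i ∈ J := J.min'_mem hne
    have hlt : ∀ j ∈ J.erase i, i < j := fun j hj => by
      rw [Finset.mem_erase] at hj
      exact lt_of_le_of_ne (J.min'_le j hj.2) hj.1.symm
    have hval : ∀ (b : MvPolynomial σ ℂ) (a : ℕ → MvPolynomial σ ℂ),
        evSeq (post (evAt b) (curry φ)) a =
          B (∑ k, β.act (ddiff k b) (evSeq (ups β p (tail ℂ k (Pi.single J m))) a))
            (evSeq ψ fun t => a (p + t)) := by
      intro b a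
      rw [← evSeq_ups_succ]
      refine (evSeq_curry φ a b).trans ((h _).trans ?_)
      congr 2
      ext1 t
      rw [if_neg (by omega)]
      congr 1; omega
    have h1 : post (evAt 1) (curry φ) = 0 := evSeq_ext fun a => by
      rw [hval]
      simp only [ddiff_one, map_zero, LinearMap.zero_apply, Finset.sum_const_zero]
      rfl
    have hX : ∀ k, k ≠ i → post (evAt (X k)) (curry φ) = 0 := fun k hk => evSeq_ext fun a => by
      rw [hval, Finset.sum_eq_zero, map_zero]
      · rfl
      · intro j _
        rw [ddiff_X]
        split_ifs with hjk
        · subst hjk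
          rw [tail_single, if_neg]
          · rw [map_zero, map_one]; rfl
          · rintro ⟨h2, h3⟩
            exact (hlt j (Finset.mem_erase.2 ⟨hk, h2⟩)).asymm
              (h3 i (Finset.mem_erase.2 ⟨hk.symm, himem⟩))
        · simp
    rw [psi_succ_eq_sum, Finset.sum_eq_single i]
    · rw [h1, map_zero, map_zero, sub_zero, ih (J.erase i) (by
        rw [Finset.card_erase_of_mem himem]; omega) n (by omega)]
      · conv_rhs => rw [← Finset.insert_erase himem]
        rw [ordProd_insert _ hlt]
      · intro a
        rw [hval, Finset.sum_eq_single i]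
        · rw [ddiff_X, if_pos rfl, map_one, tail_single, if_pos ⟨himem, hlt⟩]; rfl
        · intro j _ hj
          rw [ddiff_X, if_neg hj]; simp
        · simp
    · intro k _ hk
      rw [h1, hX k hk, map_zero, map_zero, sub_zero, map_zero]
    · simp

end LeadingTerm

end BarCochain

namespace Orbifold

open PolyBimod DividedDiff Fermion Hochschild BarCochain

variable {σ : Type} [Fintype σ] [LinearOrder σ] {W : MvPolynomial σ ℂ} {G : Subgroup (Torus σ)}

theorem embed_single (g : G) (J : Finset σ) (a : MvPolynomial σ ℂ) :
    embed G g (Pi.single J a) =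
      incl J.card (ups (bimod G) J.card (Pi.single J (SkewMonoidAlgebra.single g a))) := by
  rw [embed, LinearMap.comp_apply, mapCoeff_single, totUps_single]; rfl

theorem product_single_single_eq_zero (g h : G) (J Z K : Finset σ) (a b : MvPolynomial σ ℂ)
    (hK : ¬ ∃ m, K.card + 2 * m = J.card + Z.card) :
    product W g h (Pi.single Z b) (Pi.single J a) K = 0 := by
  rw [product_apply, embed_single, embed_single, cup_incl, project, LinearMap.comp_apply,
    mapCoeff_apply, psiW_incl_parity _ _ _ hK, map_zero]

theorem product_single_single_top (g h : G) (J Z K : Finset σ) (a b : MvPolynomial σ ℂ)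
    (hK : J.card + Z.card ≤ K.card) :
    product W g h (Pi.single Z b) (Pi.single J a) K =
      ordProd (create (MvPolynomial σ ℂ)) J (Pi.single Z (a * g.1 • b) :
        Finset σ → MvPolynomial σ ℂ) K := by
  rw [product_apply, embed_single, embed_single, cup_incl, project, LinearMap.comp_apply,
    mapCoeff_apply, psiW_incl_top _ _ _ hK,
    psi_of_evSeq (β := bimod G) (γ := bimod G) (LinearMap.mul ℂ (CrossedProduct G))
      (fun m a n => (mul_assoc m n _).symm) (SkewMonoidAlgebra.single g a)
      (ups (bimod G) Z.card (Pi.single Z (SkewMonoidAlgebra.single h b))) J.card J rfl _ rfl _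
      (fun a => ev_cup _ _ a), psi_ups]
  have h1 : degPart Z.card (Pi.single Z (SkewMonoidAlgebra.single h b) :
      Finset σ → CrossedProduct G) = Pi.single Z (SkewMonoidAlgebra.single h b) := by
    ext1 L
    rw [degPart_apply]
    split_ifs with hL
    · rfl
    · rw [Pi.single_eq_of_ne]
      rintro rfl
      exact hL rfl
  have h2 : (LinearMap.mul ℂ (CrossedProduct G)) (SkewMonoidAlgebra.single g a)
      (SkewMonoidAlgebra.single h b) = SkewMonoidAlgebra.single (g * h) (a * g.1 • b) :=
    SkewMonoidAlgebra.single_mul_single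
  rw [h1, mapCoeff_single, h2, ordProd_create_single, ordProd_create_single]
  split_ifs with hd
  · simp only [Pi.smul_apply, map_zsmul]
    congr 1
    by_cases hJ : K = J ∪ Z
    · rw [hJ, Pi.single_eq_same, Pi.single_eq_same, coeffAt_single, if_pos rfl]
    · rw [Pi.single_eq_of_ne hJ, Pi.single_eq_of_ne hJ, map_zero]
  · simp

/-- The top component of a product. -/
theorem product_top (g h : G) {κ μ : Finset σ → MvPolynomial σ ℂ} {p : ℕ}
    (hκ : SuppOn (fun J => J.card ≤ p) κ) (Z : Finset σ) (hZ : μ Z = 1)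
    (hμ : SuppOn (fun J => J = Z ∨ J.card < Z.card) μ) (K : Finset σ) (hK : p + Z.card ≤ K.card) :
    product W g h μ κ K = ∑ J, κ J * ordProd (create (MvPolynomial σ ℂ)) J
      (Pi.single Z 1 : Finset σ → MvPolynomial σ ℂ) K := by
  have hadd : ∀ κ, product W g h μ κ = ∑ L, product W g h (Pi.single L (μ L)) κ := fun κ => by
    conv_lhs => rw [product_apply, ← Finset.univ_sum_single μ, map_sum, map_sum, map_sum]
    rfl
  rw [← Finset.univ_sum_single κ, map_sum, Finset.sum_apply]
  refine Finset.sum_congr rfl fun J _ => ?_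
  rw [Finset.univ_sum_single]
  by_cases hJ : J.card ≤ p
  · rw [hadd, Finset.sum_apply, Finset.sum_eq_single Z]
    · rw [product_single_single_top _ _ _ _ _ _ _ (by omega), hZ, smul_one, mul_one,
        ordProd_create_single, ordProd_create_single]
      split_ifs with hd
      · simp only [Pi.smul_apply, mul_smul_comm]
        congr 1
        by_cases hJ : K = J ∪ Z
        · rw [hJ, Pi.single_eq_same, Pi.single_eq_same, mul_one]
        · rw [Pi.single_eq_of_ne hJ, Pi.single_eq_of_ne hJ, mul_zero]
      · simp
    · intro L _ hL
      by_cases hL' : L.card < Z.card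
      · rw [product_single_single_eq_zero _ _ _ _ _ _ _ (by rintro ⟨m, hm⟩; omega)]
      · rw [hμ L (by simp [hL, hL']), Pi.single_zero, product_apply, map_zero, map_zero, map_zero]
        rfl
    · simp
  · rw [hκ J hJ, Pi.single_zero, map_zero, zero_mul]; rfl

end Orbifold

namespace Fermion

variable {σ : Type} [LinearOrder σ]

theorem ordProd_congr {R M : Type} [CommRing R] [AddCommGroup M] [Module R M]
    {T T' : σ → M →ₗ[R] M} (L : Finset σ) (h : ∀ i ∈ L, T i = T' i) (x : M) :
    ordProd T L x = ordProd T' L x := by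
  induction L using Finset.induction_on_min with
  | empty => simp
  | insert a L ha ih =>
    rw [ordProd_insert T ha, ordProd_insert T' ha, h a (Finset.mem_insert_self _ _),
      ih fun i hi => h i (Finset.mem_insert_of_mem hi)]

theorem ordProd_eq_apply_erase {R M : Type} [CommRing R] [AddCommGroup M] [Module R M]
    (T : σ → M →ₗ[R] M) (anti : ∀ i j y, T i (T j y) = -T j (T i y))
    (sq : ∀ i y, T i (T i y) = 0) {j : σ} {L : Finset σ} (hj : j ∈ L) (x : M) :
    ordProd T L x = koszulSign (L.erase j) j • T j (ordProd T (L.erase j) x) := by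
  rw [apply_ordProd T anti sq, if_neg (Finset.notMem_erase j L), Finset.insert_erase hj, smul_smul,
    koszulSign_mul_self, one_smul]

section Combination

variable {R : Type} [CommRing R]

/-- The derivation `∑ₖ aₖ ∂/∂eₖ`, the sum over `S`. -/
def contractVec (S : Finset σ) : (S → R) →ₗ[R] (Finset σ → R) →ₗ[R] (Finset σ → R) :=
  ∑ k : S, (LinearMap.proj k : (S → R) →ₗ[R] R).smulRight (annihilate R k.1)

theorem contractVec_apply (S : Finset σ) (a : S → R) (x : Finset σ → R) :
    contractVec S a x = ∑ k : S, a k • annihilate R k.1 x := by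
  simp [contractVec, LinearMap.sum_apply]

theorem contractVec_anticomm (S : Finset σ) (a b : S → R) (x : Finset σ → R) :
    contractVec S a (contractVec S b x) = -contractVec S b (contractVec S a x) := by
  simp only [contractVec_apply, map_sum, map_smul, Finset.smul_sum]
  rw [Finset.sum_comm, ← Finset.sum_neg_distrib]
  refine Finset.sum_congr rfl fun i _ => ?_
  rw [← Finset.sum_neg_distrib]
  refine Finset.sum_congr rfl fun j _ => ?_
  rw [annihilate_annihilate, smul_neg, smul_neg, smul_comm]

theorem contractVec_self (S : Finset σ) (a : S → R) (x : Finset σ → R) :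
    contractVec S a (contractVec S a x) = 0 := by
  simp only [contractVec_apply, map_sum, map_smul, Finset.smul_sum]
  rw [← Finset.sum_product']
  refine Finset.sum_involution (fun p _ => (p.2, p.1)) ?_ ?_ (by simp) (by simp)
  · intro p _
    simp only
    rw [annihilate_annihilate p.2.1, smul_neg, smul_neg, smul_comm, neg_add_cancel]
  · rintro ⟨p, q⟩ _ h h2
    simp only [Prod.mk.injEq] at h2
    obtain ⟨rfl, -⟩ := h2
    simp [annihilate_self] at h

/-- The operators `contractVec (b j)`, extended by zero. -/
def contractFamily (S : Finset σ) (b : S → S → R) (j : σ) : (Finset σ → R) →ₗ[R] (Finset σ → R) :=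
  if h : j ∈ S then contractVec S (b ⟨j, h⟩) else 0

theorem contractFamily_mem (S : Finset σ) (b : S → S → R) (j : S) :
    contractFamily S b j.1 = contractVec S (b j) := dif_pos j.2

theorem contractFamily_anticomm (S : Finset σ) (b : S → S → R) (i j : σ) (x : Finset σ → R) :
    contractFamily S b i (contractFamily S b j x) =
      -contractFamily S b j (contractFamily S b i x) := by
  unfold contractFamily
  split_ifs
  · exact contractVec_anticomm _ _ _ _
  all_goals simp

theorem contractFamily_self (S : Finset σ) (b : S → S → R) (i : σ) (x : Finset σ → R) :
    contractFamily S b i (contractFamily S b i x) = 0 := by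
  unfold contractFamily
  split_ifs
  · exact contractVec_self _ _ _
  · simp

theorem ordProd_contractFamily_eq (S : Finset σ) (b : S → S → R) (j : S) (x : Finset σ → R) :
    ordProd (contractFamily S b) S x = koszulSign (S.erase j.1) j.1 •
      contractVec S (b j) (ordProd (contractFamily S b) (S.erase j.1) x) := by
  rw [ordProd_eq_apply_erase _ (contractFamily_anticomm S b) (contractFamily_self S b) j.2,
    contractFamily_mem]

theorem ordProd_contractFamily_update (S : Finset σ) [DecidableEq S] (b : S → S → R) (j : S) (a : S → R)
    (x : Finset σ → R) :
    ordProd (contractFamily S (Function.update b j a)) S x = koszulSign (S.erase j.1) j.1 •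
      contractVec S a (ordProd (contractFamily S b) (S.erase j.1) x) := by
  rw [ordProd_contractFamily_eq S _ j, Function.update_self]
  congr 2
  refine ordProd_congr _ (fun i hi => ?_) x
  rw [Finset.mem_erase] at hi
  unfold contractFamily
  rw [dif_pos hi.2, dif_pos hi.2, Function.update_of_ne]
  exact fun h => hi.1 (congrArg Subtype.val h)

/-- The coefficient of `1` in the contraction of `a e_S` with vectors, as an alternating map. -/
def contractAlternating (S : Finset σ) (a : R) : (S → R) [⋀^S]→ₗ[R] R where
  toFun b := ordProd (contractFamily S b) S (Pi.single S a) ∅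
  map_update_add' := by
    intro inst b j y z
    simp only [ordProd_contractFamily_update, map_add, LinearMap.add_apply, smul_add, Pi.add_apply]
  map_update_smul' := by
    intro inst b j c y
    simp only [ordProd_contractFamily_update, map_smul, LinearMap.smul_apply, Pi.smul_apply]
    rw [smul_comm]
  map_eq_zero_of_eq' := by
    intro b i j hb hij
    rw [ordProd_contractFamily_eq S b i, ordProd_eq_apply_erase _ (contractFamily_anticomm S b)
      (contractFamily_self S b) (j := j.1) (Finset.mem_erase.2
        ⟨fun h => hij (Subtype.ext h.symm), j.2⟩), contractFamily_mem, map_zsmul, hb,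
      contractVec_self]
    simp

theorem ordProd_contractFamily_single (S : Finset σ) (b : S → S → R) (a : R) :
    ordProd (contractFamily S b) S (Pi.single S a : Finset σ → R) ∅ =
      revSign S • ((Matrix.of b).det * a) := by
  have h := AlternatingMap.eq_smul_basis_det (Pi.basisFun R S) (contractAlternating S a)
  have h2 := congrArg (fun f => f b) h
  simp only [AlternatingMap.smul_apply, Pi.basisFun_det_apply, smul_eq_mul] at h2
  have h3 : contractAlternating S a (Pi.basisFun R S) = revSign S • a := by
    change ordProd (contractFamily S _) S (Pi.single S a : Finset σ → R) ∅ = _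
    rw [ordProd_congr (T' := annihilate R) S, ordProd_annihilate_apply]
    · simp [invSign, koszulSign]
    · intro i hi
      rw [contractFamily, dif_pos hi]
      refine LinearMap.ext fun x => ?_
      rw [contractVec_apply, Finset.sum_eq_single ⟨i, hi⟩]
      · simp
      · intro k _ hk
        simp [hk]
      · simp
  refine h2.trans ?_
  rw [h3, smul_mul_assoc, mul_comm]

end Combination

end Fermion

namespace Orbifold

open PolyBimod DividedDiff Fermion Hochschild BarCochain

variable {σ : Type} [Fintype σ] [LinearOrder σ]

section Staircase

variable (c : σ → ℂ) (f : σ → MvPolynomial σ ℂ) (S : Finset σ)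

theorem cliff_left_eq_sum (v : σ → MvPolynomial σ ℂ) (κ : Finset σ → MvPolynomial σ ℂ)
    (L : Finset σ) :
    cliff v 0 κ L = ∑ i ∈ L, koszulSign L i • (v i * κ (L.erase i)) := by
  rw [cliff_apply_apply, ← Finset.sum_subset (Finset.subset_univ L)]
  · refine Finset.sum_congr rfl fun i hi => ?_
    rw [if_pos hi, if_pos hi, mul_zero, add_zero, mul_smul_comm]
  · intro i _ hi
    simp [hi]

theorem cliff_right_eq_sum (x : Finset σ → MvPolynomial σ ℂ) (K : Finset σ) :
    cliff 0 f x K = ∑ k, f k * (if k ∈ K then 0 else koszulSign K k • x (insert k K)) := by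
  rw [cliff_apply_apply]; simp

theorem cliff_right_cliff_left (v : σ → MvPolynomial σ ℂ)
    (Z : Finset σ → Finset σ → MvPolynomial σ ℂ) (L K : Finset σ) :
    cliff 0 f (fun K' => cliff v 0 (Z K') L) K = cliff v 0 (fun L' => cliff 0 f (fun K' => Z K' L') K) L := by
  simp only [cliff_right_eq_sum, cliff_left_eq_sum, Finset.mul_sum, Finset.smul_sum]
  rw [Finset.sum_comm]
  refine Finset.sum_congr rfl fun k _ => ?_
  split_ifs
  · simp
  · rw [Finset.mul_sum]
    refine Finset.sum_congr rfl fun i _ => ?_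
    simp only [mul_smul_comm, smul_comm (koszulSign L i)]
    congr 2
    ring

/-- A double complex argument: a solution of the staircase equations with trivial top component
has its bottom component in the ideal of the `fₖ`. -/
theorem staircase (hc : ∀ i ∈ S, c i ≠ 0) (Δ : Finset σ → Finset σ → MvPolynomial σ ℂ)
    (hrel : ∀ L ⊆ S, ∀ K, K.card + 1 = L.card → cliff (scaled c) 0 (fun L => Δ L K) L =
      cliff 0 f (Δ L) K)
    (htop : ∀ K, K.card = S.card → Δ S K = 0) :
    Δ ∅ ∅ ∈ Ideal.span (Set.range f) := by
  classical
  set c' : σ → ℂ := fun i => if i ∈ S then c i else 0 with hc'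
  have hc'S : ∀ i ∈ S, c' i = c i := fun i hi => if_pos hi
  have hsq : ∀ x : Finset σ → MvPolynomial σ ℂ, cliff 0 f (cliff 0 f x) = 0 := fun x => by
    rw [cliff_cliff]; simp
  have key : ∀ b a, a + b = S.card → ∃ Y Z : Finset σ → Finset σ → MvPolynomial σ ℂ,
      ∀ L ⊆ S, L.card = a → ∀ K, K.card = a →
        Δ L K = cliff 0 f (Y L) K + cliff (scaled c') 0 (Z K) L := by
    intro b
    induction b with
    | zero =>
      intro a ha
      refine ⟨0, 0, fun L hL hLa K hK => ?_⟩
      have : L = S := Finset.eq_of_subset_of_card_le hL (by omega)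
      rw [this, htop K (by omega)]
      simp
    | succ b ih =>
      intro a ha
      obtain ⟨Y, Z, h⟩ := ih (a + 1) (by omega)
      have hprim : ∀ K : Finset σ, K.card = a → ∃ ζ : Finset σ → MvPolynomial σ ℂ,
          ∀ L ⊆ S, L.card = a → Δ L K = cliff 0 f (fun K' => Z K' L) K +
            cliff (scaled c') 0 ζ L := by
        intro K hK
        set κ : Finset σ → MvPolynomial σ ℂ := fun L => if L ⊆ S ∧ L.card = a then
          Δ L K - cliff 0 f (fun K' => Z K' L) K else 0 with hκ
        have hκ0 : cliff (scaled c') 0 κ = 0 := by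
          ext1 L
          rw [Pi.zero_apply]
          by_cases hL : L ⊆ S ∧ L.card = a + 1
          · have e1 : cliff (scaled c') 0 κ L = cliff (scaled c') 0 (fun L => Δ L K) L -
                cliff (scaled c') 0 (fun L => cliff 0 f (fun K' => Z K' L) K) L := by
              rw [cliff_left_eq_sum, cliff_left_eq_sum, cliff_left_eq_sum, ← Finset.sum_sub_distrib]
              refine Finset.sum_congr rfl fun i hi => ?_
              simp only [hκ]
              rw [if_pos ⟨(Finset.erase_subset _ _).trans hL.1, by
                rw [Finset.card_erase_of_mem hi]; omega⟩, mul_sub, smul_sub]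
            have e2 : cliff (scaled c') 0 (fun L => Δ L K) L = cliff 0 f (Δ L) K := by
              rw [← hrel L hL.1 K (by omega), cliff_left_eq_sum, cliff_left_eq_sum]
              refine Finset.sum_congr rfl fun i hi => ?_
              rw [scaled, scaled, hc'S i (hL.1 hi)]
            have e3 : cliff 0 f (Δ L) K = cliff 0 f (cliff 0 f (Y L) +
                fun K' => cliff (scaled c') 0 (Z K') L) K := by
              rw [cliff_right_eq_sum, cliff_right_eq_sum]
              refine Finset.sum_congr rfl fun i _ => ?_
              split_ifs with hi
              · rfl
              · rw [h L hL.1 hL.2 _ (by rw [Finset.card_insert_of_notMem hi]; omega)]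
                rfl
            rw [e1, e2, e3, map_add, hsq, zero_add, cliff_right_cliff_left, sub_self]
          · rw [cliff_left_eq_sum]
            refine Finset.sum_eq_zero fun i hi => ?_
            by_cases hiS : i ∈ S
            · have : κ (L.erase i) = 0 := by
                simp only [hκ]
                rw [if_neg]
                rintro ⟨h1, h2⟩
                refine hL ⟨?_, ?_⟩
                · rw [← Finset.insert_erase hi]
                  exact Finset.insert_subset hiS h1
                · rw [Finset.card_erase_of_mem hi] at h2
                  have := Finset.card_pos.2 ⟨i, hi⟩
                  omega
              rw [this]; simp
            · have : scaled c' i = 0 := by simp [scaled, hc', hiS]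
              rw [this]; simp
        obtain ⟨ζ, -, hζ⟩ := exists_primitive c' S (fun i hi => by rw [hc'S i hi]; exact hc i hi)
          (Q := fun L => L.card = a) (κ := κ) (fun L hL => if_neg fun h' => hL h'.2) hκ0
        refine ⟨ζ, fun L hL hLa => ?_⟩
        have h1 := congrFun hζ L
        have h2 : ¬ S ⊆ L := fun h' => by
          have := Finset.card_le_card h'
          omega
        rw [Pi.add_apply, collapse, if_neg h2, zero_add] at h1
        have h3 : κ L = Δ L K - cliff 0 f (fun K' => Z K' L) K := if_pos ⟨hL, hLa⟩
        rw [← h1, h3]; abel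
      choose! ζ hζ using hprim
      exact ⟨fun L K => Z K L, ζ, fun L hL hLa K hK => hζ K hK L hL hLa⟩
  obtain ⟨Y, Z, h⟩ := key S.card 0 (by omega)
  rw [h ∅ (Finset.empty_subset _) rfl ∅ rfl, cliff_left_eq_sum, Finset.sum_empty, add_zero,
    cliff_apply_apply]
  refine Ideal.sum_mem _ fun k _ => ?_
  simp only [Pi.zero_apply, zero_mul, zero_add]
  exact Ideal.mul_mem_right _ _ (Ideal.subset_span ⟨k, rfl⟩)

end Staircase

end Orbifold

namespace Orbifold

open PolyBimod DividedDiff Fermion Hochschild BarCochain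

variable {σ : Type} [Fintype σ] [LinearOrder σ]

section Reference

variable (c : σ → ℂ) (f : σ → MvPolynomial σ ℂ) (S : Finset σ) (H : σ → σ → MvPolynomial σ ℂ)

/-- The operators `∑ₖ Hₖⱼ ∂/∂eₖ`. -/
noncomputable def hessOp : σ → (Finset σ → MvPolynomial σ ℂ) →ₗ[MvPolynomial σ ℂ]
    (Finset σ → MvPolynomial σ ℂ) :=
  contractFamily S fun j k => H k.1 j.1

theorem annihilate_hessOp_eq_zero {k : σ} (hk : k ∉ S) (a : MvPolynomial σ ℂ) (L : Finset σ) :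
    annihilate (MvPolynomial σ ℂ) k (ordProd (hessOp S H) L (Pi.single S a)) = 0 := by
  have h1 : ∀ j y, annihilate (MvPolynomial σ ℂ) k (hessOp S H j y) =
      -hessOp S H j (annihilate (MvPolynomial σ ℂ) k y) := by
    intro j y
    rw [hessOp, contractFamily]
    split_ifs with hj
    · rw [contractVec_apply, contractVec_apply, map_sum, ← Finset.sum_neg_distrib]
      refine Finset.sum_congr rfl fun i _ => ?_
      rw [map_smul, annihilate_annihilate, smul_neg]
    · simp
  induction L using Finset.induction_on_min with
  | empty =>
    rw [ordProd_empty]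
    ext1 J
    rw [annihilate_apply, Pi.zero_apply]
    split_ifs
    · rfl
    · rw [Pi.single_eq_of_ne, smul_zero]
      rintro rfl
      exact hk (Finset.mem_insert_self _ _)
  | insert i L h ih => rw [ordProd_insert _ h, h1, ih, map_zero, neg_zero]

theorem cliff_right_hessOp (hH : ∀ k ∈ S, f k = ∑ j ∈ S, H k j * scaled c j)
    (a : MvPolynomial σ ℂ) (L : Finset σ) :
    cliff 0 f (ordProd (hessOp S H) L (Pi.single S a)) =
      ∑ j ∈ S, scaled c j • hessOp S H j (ordProd (hessOp S H) L (Pi.single S a)) := by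
  set x := ordProd (hessOp S H) L (Pi.single S a : Finset σ → MvPolynomial σ ℂ) with hx
  have h1 : cliff 0 f x = ∑ k ∈ S, f k • annihilate (MvPolynomial σ ℂ) k x := by
    rw [cliff_apply, eq_comm]
    refine Finset.sum_subset_zero_on_sdiff (Finset.subset_univ S) ?_ fun k _ => by simp
    intro k hk
    rw [hx, annihilate_hessOp_eq_zero S H (Finset.mem_sdiff.1 hk).2]; simp
  have h2 : ∀ j ∈ S, hessOp S H j x = ∑ k ∈ S, H k j • annihilate (MvPolynomial σ ℂ) k x := by
    intro j hj
    rw [hessOp, contractFamily, dif_pos hj, contractVec_apply]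
    exact Finset.sum_coe_sort S fun k => H k j • annihilate (MvPolynomial σ ℂ) k x
  have h3 : ∑ j ∈ S, scaled c j • hessOp S H j x =
      ∑ j ∈ S, ∑ k ∈ S, scaled c j • H k j • annihilate (MvPolynomial σ ℂ) k x :=
    Finset.sum_congr rfl fun j hj => by rw [h2 j hj, Finset.smul_sum]
  rw [h1, h3, Finset.sum_comm]
  refine Finset.sum_congr rfl fun k hk => ?_
  rw [hH k hk, Finset.sum_smul]
  refine Finset.sum_congr rfl fun j _ => ?_
  rw [smul_smul, mul_comm]

/-- A solution of the staircase equations. -/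
noncomputable def reference (a : MvPolynomial σ ℂ) (L : Finset σ) : Finset σ → MvPolynomial σ ℂ :=
  invSign L S • ordProd (hessOp S H) (S \ L) (Pi.single S a)

theorem reference_rel (hH : ∀ k ∈ S, f k = ∑ j ∈ S, H k j * scaled c j) (a : MvPolynomial σ ℂ)
    (L : Finset σ) (hL : L ⊆ S) (K : Finset σ) :
    cliff (scaled c) 0 (fun L => reference S H a L K) L = cliff 0 f (reference S H a L) K := by
  rw [reference, map_zsmul, cliff_right_hessOp c f S H hH, cliff_left_eq_sum, Pi.smul_apply,
    Finset.sum_apply, Finset.smul_sum, ← Finset.sum_subset hL]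
  · refine Finset.sum_congr rfl fun j hj => ?_
    have hjS := hL hj
    rw [hessOp, apply_ordProd _ (contractFamily_anticomm S _) (contractFamily_self S _),
      if_neg (fun h => (Finset.mem_sdiff.1 h).2 hj)]
    have h1 : insert j (S \ L) = S \ L.erase j := by
      ext i
      simp only [Finset.mem_insert, Finset.mem_sdiff, Finset.mem_erase]
      constructor
      · rintro (rfl | h)
        · exact ⟨hjS, fun h => h.1 rfl⟩
        · exact ⟨h.1, fun h' => h.2 h'.2⟩
      · rintro ⟨h2, h3⟩
        by_cases hij : i = j
        · exact Or.inl hij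
        · exact Or.inr ⟨h2, fun h => h3 ⟨hij, h⟩⟩
    have h2 : invSign L S = koszulSign S j * invSign (L.erase j) S := by
      conv_lhs => rw [← Finset.insert_erase hj, invSign_insert_left (Finset.notMem_erase j L)]
    have h3 : koszulSign S j = koszulSign (S \ L) j * koszulSign L j := by
      rw [← koszulSign_union Finset.sdiff_disjoint, Finset.sdiff_union_of_subset hL]
    rw [h1, reference, hessOp, h2, h3]
    simp only [Pi.smul_apply, smul_eq_mul, mul_smul_comm, smul_smul]
    congr 1
    linear_combination (-(koszulSign L j * invSign (L.erase j) S)) *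
      koszulSign_mul_self (S \ L) j
  · intro j hjS hj
    rw [hessOp, apply_ordProd _ (contractFamily_anticomm S _) (contractFamily_self S _),
      if_pos (Finset.mem_sdiff.2 ⟨hjS, hj⟩)]
    simp

theorem reference_top (a : MvPolynomial σ ℂ) : reference S H a S = revSign S • Pi.single S a := by
  rw [reference, Finset.sdiff_self, ordProd_empty, invSign_self]

theorem reference_bottom (a : MvPolynomial σ ℂ) :
    reference S H a ∅ ∅ = revSign S • ((Matrix.of fun j k : S => H k.1 j.1).det * a) := by
  rw [reference, Finset.sdiff_empty, hessOp, Pi.smul_apply, ordProd_contractFamily_single]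
  simp [invSign]

end Reference

section ProductFormula

variable {W : MvPolynomial σ ℂ} {G : Subgroup (Torus σ)}

theorem cliff_apply_mem_sectorIdeal (u : Torus σ) (ζ : Finset σ → MvPolynomial σ ℂ) :
    sectorDiff W u ζ (movingIndex u) ∈ sectorIdeal W u := by
  rw [sectorDiff_eq_cliff, cliff_apply_apply]
  refine Ideal.sum_mem _ fun i _ => Ideal.add_mem _ ?_ ?_
  · split_ifs with hi
    · refine Ideal.mem_sup_left (Ideal.mul_mem_right _ _ (Ideal.mul_mem_left _ _
        (Ideal.subset_span ⟨i, hi, rfl⟩)))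
    · rw [mul_zero]; exact Ideal.zero_mem _
  · exact Ideal.mem_sup_right (Ideal.mul_mem_right _ _ (Ideal.subset_span ⟨i, rfl⟩))

theorem sub_kill_mem_sectorIdeal (u : Torus σ) (a : MvPolynomial σ ℂ) :
    a - kill (movingIndex u) a ∈ sectorIdeal W u := Ideal.mem_sup_left (sub_kill_mem _ _)

theorem kill_kw_mem_sectorIdeal (u : Torus σ) (k : σ) :
    kill (movingIndex u) (kw W u k) ∈ sectorIdeal W u := by
  have h1 := sub_kill_mem_sectorIdeal (W := W) u (kw W u k)
  have h2 : kw W u k ∈ sectorIdeal W u := Ideal.mem_sup_right (Ideal.subset_span ⟨k, rfl⟩)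
  have := Ideal.sub_mem _ h2 h1
  rwa [sub_sub_cancel] at this

/-- The class of a cocycle in terms of the generator. -/
theorem sectorClass_eq_smul (hG : G ≤ symmetryGroup W) (u : G) {M : ℕ}
    (hreg : ∀ k, X k ^ M ∈ Ideal.span (Set.range (mixedSeq (kw W u.1) (movingIndex u.1))))
    (η : sectorCocycles W u.1) (f : MvPolynomial σ ℂ)
    (hf : η.1 (movingIndex u.1) - f ∈ sectorIdeal W u.1) :
    sectorClass W u η = orbifoldCup W G (functionClass W G f) (sectorGenerator W G u) := by
  have hu : u.1 • W = W := hG u.2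
  obtain ⟨κ, hκ⟩ := exists_koszulRepresentative (W := W) (g := u.1) hu
  have hη : sectorDiff W u.1 η.1 = 0 := η.2
  rw [sectorGenerator_eq hG u hκ, functionClass_cup_sectorClass]
  obtain ⟨f', ζ, h⟩ := exists_decomposition (weight u.1) (kw W u.1) (movingIndex u.1)
    (mem_movingIndex_iff u.1) (sum_scaled_mul_kw hu) M hreg (by
      rw [← sectorDiff_eq_cliff]; exact hκ.sectorDiff_eq_zero) hκ.leading hκ.suppOn
    (Fintype.card σ + 1) η.1 (by rw [← sectorDiff_eq_cliff]; exact hη) (fun J hJ => by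
      have := J.card_le_univ
      omega)
  rw [← sectorDiff_eq_cliff] at h
  have h1 := congrFun h (movingIndex u.1)
  rw [Pi.add_apply, Pi.smul_apply, hκ.leading, smul_eq_mul, mul_one] at h1
  have h2 : f' - f ∈ sectorIdeal W u.1 := by
    have := Ideal.sub_mem _ hf (cliff_apply_mem_sectorIdeal (W := W) u.1 ζ)
    rw [h1] at this
    convert this using 1
    abel
  obtain ⟨ζ', h3⟩ := exists_smul_eq hκ.sectorDiff_eq_zero h2
  refine sectorClass_eq _ _ _ (ζ + ζ') ?_
  change η.1 - f • κ = _
  rw [map_add, ← h3, h, sub_smul]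
  abel

variable {g h : G} (κ μ : Finset σ → MvPolynomial σ ℂ)

variable (W g h) in
/-- The reduced components of the product of the contractions of `κ` with `μ`. -/
noncomputable def reduced (L : Finset σ) : Finset σ → MvPolynomial σ ℂ := fun K =>
  kill (movingIndex (g * h : G).1) (ordProd (annihilate (MvPolynomial σ ℂ))
    (movingIndex (g * h : G).1)
    (product W g h μ (ordProd (annihilate (MvPolynomial σ ℂ)) L κ)) K)

theorem reduced_rel (hG : G ≤ symmetryGroup W) (hκ : sectorDiff W g.1 κ = 0)
    (hμ : sectorDiff W h.1 μ = 0) (L : Finset σ) (hL : Disjoint L (movingIndex (g * h : G).1))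
    (K : Finset σ) :
    cliff (scaled (weight g.1)) 0 (fun L => reduced W g h κ μ L K) L =
      cliff 0 (fun k => (-1 : ℤ) ^ (movingIndex (g * h : G).1).card •
        kill (movingIndex (g * h : G).1) (kw W (g * h : G).1 k)) (reduced W g h κ μ L) K := by
  set u : G := g * h with hu
  have h1 := kill_ordProd_cliff (weight u.1) (kw W u.1) (movingIndex u.1) (mem_movingIndex_iff u.1)
    (product W g h μ (ordProd (annihilate (MvPolynomial σ ℂ)) L κ)) K
  rw [← sectorDiff_eq_cliff, sectorDiff_product hG _ _ _ _ hμ, sectorDiff_eq_cliff W g.1,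
    anticomm_ordProd _ _ _ (cliff_annihilate _ _), ← sectorDiff_eq_cliff, hκ] at h1
  have h0 : ordProd (annihilate (MvPolynomial σ ℂ)) L (0 : Finset σ → MvPolynomial σ ℂ) = 0 :=
    map_zero (ordProdₗ (R := MvPolynomial σ ℂ) (M := Finset σ → MvPolynomial σ ℂ)
      (annihilate (MvPolynomial σ ℂ)) L)
  rw [h0, smul_zero, zero_add, map_sum, ← ordProdₗ_apply, map_sum, Finset.sum_apply, map_sum] at h1
  rw [cliff_left_eq_sum, cliff_right_eq_sum]
  refine Eq.trans (Finset.sum_congr rfl fun i hi => ?_) (h1.trans ?_)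
  · have hiu : i ∉ movingIndex u.1 := Finset.disjoint_left.1 hL hi
    have hk : kill (movingIndex u.1) (scaled (weight g.1) i) = scaled (weight g.1) i := by
      rw [scaled, map_mul, kill_X, kill_C, if_neg hiu]
    simp only [map_zsmul, map_smul, Pi.smul_apply, smul_eq_mul, map_mul, hk, ordProdₗ_apply]
    rfl
  · rw [Finset.smul_sum]
    refine Finset.sum_congr rfl fun k _ => ?_
    rw [smul_mul_assoc, annihilate_apply]
    congr 2
    split_ifs
    · exact map_zero _
    · rw [map_zsmul]; rfl

theorem movingIndex_mul {a b : Torus σ} (hab : ∀ i, a i = 1 ∨ b i = 1 ∨ a i * b i = 1) :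
    movingIndex (a * b) = (movingIndex a \ movingIndex b) ∪ (movingIndex b \ movingIndex a) := by
  ext i
  simp only [Finset.mem_union, Finset.mem_sdiff, mem_movingIndex, Pi.mul_apply, not_not]
  rcases hab i with h | h | h
  · simp [h]
  · simp [h]
  · by_cases ha : a i = 1
    · simp [ha]
    · have hb : b i ≠ 1 := fun hb => ha (by simpa [hb] using h)
      simp [h, ha, hb]

theorem sign_identity {I₀ I₁ I₂ : Finset σ} (h₀₁ : Disjoint I₀ I₁) (h₀₂ : Disjoint I₀ I₂)
    (h₁₂ : Disjoint I₁ I₂) :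
    revSign (I₁ ∪ I₂) * (revSign (I₁ ∪ I₂) * invSign (I₁ ∪ I₂) I₀ * (revSign I₀ * invSign I₀ I₁) *
      invSign I₁ (I₀ ∪ I₂)) * (-1) ^ ((I₁ ∪ I₂).card * I₀.card) = invSign (I₀ ∪ I₁) (I₀ ∪ I₂) := by
  rw [← invSign_mul_invSign_swap (Finset.disjoint_union_left.2 ⟨h₀₁.symm, h₀₂.symm⟩),
    invSign_union_left h₀₁, invSign_union_right h₀₂ I₀, invSign_union_right h₁₂ I₀, invSign_self]
  have h1 := revSign_mul_self (I₁ ∪ I₂)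
  have h2 := invSign_mul_self (I₁ ∪ I₂) I₀
  have h3 := invSign_mul_self I₀ I₁
  calc _ = (revSign (I₁ ∪ I₂) * revSign (I₁ ∪ I₂)) *
        (invSign (I₁ ∪ I₂) I₀ * invSign (I₁ ∪ I₂) I₀) * (invSign I₀ I₁ * invSign I₀ I₁) *
        (revSign I₀ * invSign I₀ I₂ * invSign I₁ (I₀ ∪ I₂)) := by ring
    _ = _ := by rw [h1, h2, h3]; ring

theorem reduced_top (hgh : ∀ i, g.1 i = 1 ∨ h.1 i = 1 ∨ g.1 i * h.1 i = 1)
    (hκ : IsKoszulRepresentative W g.1 κ) (hμ : IsKoszulRepresentative W h.1 μ)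
    {I₀ I₁ I₂ : Finset σ} (h₀ : I₀ = movingIndex g.1 ∩ movingIndex h.1)
    (h₁ : I₁ = movingIndex g.1 \ movingIndex h.1) (h₂ : I₂ = movingIndex h.1 \ movingIndex g.1)
    (K : Finset σ) (hK : K.card = I₀.card) :
    reduced W g h κ μ I₀ K = if K = I₀ then ((revSign (I₁ ∪ I₂) * invSign (I₁ ∪ I₂) I₀ *
      (revSign I₀ * invSign I₀ I₁) * invSign I₁ (I₀ ∪ I₂) : ℤ) : MvPolynomial σ ℂ) else 0 := by
  have hu : movingIndex (g * h : G).1 = I₁ ∪ I₂ := by rw [h₁, h₂]; exact movingIndex_mul hgh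
  have h01 : Disjoint I₀ I₁ := by
    rw [h₀, h₁, Finset.disjoint_left]; intro i hi hi'
    exact (Finset.mem_sdiff.1 hi').2 (Finset.mem_inter.1 hi).2
  have h02 : Disjoint I₀ I₂ := by
    rw [h₀, h₂, Finset.disjoint_left]; intro i hi hi'
    exact (Finset.mem_sdiff.1 hi').2 (Finset.mem_inter.1 hi).1
  have h12 : Disjoint I₁ I₂ := by
    rw [h₁, h₂, Finset.disjoint_left]; intro i hi hi'
    exact (Finset.mem_sdiff.1 hi').2 (Finset.mem_sdiff.1 hi).1
  have hg : movingIndex g.1 = I₀ ∪ I₁ := by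
    rw [h₀, h₁, Finset.union_comm]; exact (Finset.sdiff_union_inter _ _).symm
  have hh : movingIndex h.1 = I₀ ∪ I₂ := by
    rw [h₀, h₂, Finset.inter_comm, Finset.union_comm]; exact (Finset.sdiff_union_inter _ _).symm
  have cg := Finset.card_union_of_disjoint h01
  have ch := Finset.card_union_of_disjoint h02
  have cu := Finset.card_union_of_disjoint h12
  have h1h : Disjoint I₁ (I₀ ∪ I₂) := Finset.disjoint_union_right.2 ⟨h01.symm, h12⟩
  have hu0 : Disjoint (I₁ ∪ I₂) I₀ := Finset.disjoint_union_left.2 ⟨h01.symm, h02.symm⟩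
  rw [reduced, hu, ordProd_annihilate_apply]
  by_cases hd : Disjoint (I₁ ∪ I₂) K
  swap
  · rw [if_neg hd, map_zero, if_neg]
    rintro rfl
    exact hd hu0
  have cK := Finset.card_union_of_disjoint hd
  have hsupp : SuppOn (fun J => J.card ≤ I₁.card)
      (ordProd (annihilate (MvPolynomial σ ℂ)) I₀ κ) := by
    intro J hJ
    rw [ordProd_annihilate_apply]
    split_ifs with h'
    · have := Finset.card_union_of_disjoint h'
      rw [hκ.suppOn (I₀ ∪ J), smul_zero]
      rintro (h3 | h3)
      · rw [h3, hg] at this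
        omega
      · rw [hg] at h3
        omega
    · rfl
  rw [if_pos hd, product_top g h hsupp (I₀ ∪ I₂) (by rw [← hh]; exact hμ.leading)
    (by rw [← hh]; exact hμ.suppOn) _ (by omega), Finset.sum_eq_single I₁]
  · rw [ordProd_annihilate_apply, if_pos h01, ← hg, hκ.leading, ordProd_create_single,
      if_pos h1h, Pi.smul_apply]
    have hiff : (I₁ ∪ I₂) ∪ K = I₁ ∪ (I₀ ∪ I₂) ↔ K = I₀ := by
      constructor
      · intro h3
        have h4 : (I₁ ∪ I₂) ∪ K = (I₁ ∪ I₂) ∪ I₀ := by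
          rw [h3, Finset.union_assoc, Finset.union_comm I₀]
        rw [← Finset.union_sdiff_cancel_left hd, h4, Finset.union_sdiff_cancel_left hu0]
      · rintro rfl
        rw [Finset.union_assoc, Finset.union_comm I₂]
    by_cases hKI : K = I₀
    · rw [if_pos hKI, hiff.2 hKI, Pi.single_eq_same, hKI, map_zsmul]
      simp only [zsmul_eq_mul, mul_one, map_mul, map_intCast]
      push_cast
      ring
    · rw [if_neg hKI, Pi.single_eq_of_ne (mt hiff.1 hKI)]
      simp
  · intro J _ hJ
    rw [ordProd_annihilate_apply]
    split_ifs with h'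
    · have h3 := Finset.card_union_of_disjoint h'
      by_cases h4 : I₀ ∪ J = movingIndex g.1
      · exfalso
        apply hJ
        rw [← Finset.union_sdiff_cancel_left h', h4, hg, Finset.union_sdiff_cancel_left h01]
      by_cases h5 : (I₀ ∪ J).card < (movingIndex g.1).card
      · rw [ordProd_create_single]
        split_ifs with h6
        · rw [Pi.smul_apply, Pi.single_eq_of_ne]
          · simp
          · intro h7
            have h8 := Finset.card_union_of_disjoint h6
            rw [← h7] at h8
            rw [hg] at h5
            omega
        · simp
      · rw [hκ.suppOn (I₀ ∪ J) (by rintro (h6 | h6); exacts [h4 h6, h5 h6])]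
        simp
    · simp
  · simp

/-- The product of two generators whose components are trivial or inverse to each other. -/
theorem cup_sectorGenerator (hG : G ≤ symmetryGroup W)
    (hgh : ∀ i, g.1 i = 1 ∨ h.1 i = 1 ∨ g.1 i * h.1 i = 1) {M : ℕ}
    (hreg : ∀ k, X k ^ M ∈ Ideal.span
      (Set.range (mixedSeq (kw W (g * h : G).1) (movingIndex (g * h : G).1))))
    (H : σ → σ → MvPolynomial σ ℂ)
    (hH : ∀ k ∈ movingIndex g.1 ∩ movingIndex h.1,
      kill (movingIndex (g * h : G).1) (kw W (g * h : G).1 k) =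
        ∑ j ∈ movingIndex g.1 ∩ movingIndex h.1, H k j * scaled (weight g.1) j) :
    orbifoldCup W G (sectorGenerator W G g) (sectorGenerator W G h) =
      orbifoldCup W G (functionClass W G (invSign (movingIndex g.1) (movingIndex h.1) •
        (Matrix.of fun k j : (movingIndex g.1 ∩ movingIndex h.1 : Finset σ) => H k.1 j.1).det))
        (sectorGenerator W G (g * h)) := by
  obtain ⟨κ, hκ⟩ := exists_koszulRepresentative (W := W) (g := g.1) (hG g.2)
  obtain ⟨μ, hμ⟩ := exists_koszulRepresentative (W := W) (g := h.1) (hG h.2)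
  rw [sectorGenerator_eq hG g hκ, sectorGenerator_eq hG h hμ, cup_sectorClass hG]
  refine sectorClass_eq_smul hG (g * h) hreg _ _ ?_
  change product W g h μ κ (movingIndex (g * h : G).1) - _ ∈ _
  obtain ⟨I₀, h₀⟩ : ∃ I, I = movingIndex g.1 ∩ movingIndex h.1 := ⟨_, rfl⟩
  obtain ⟨I₁, h₁⟩ : ∃ I, I = movingIndex g.1 \ movingIndex h.1 := ⟨_, rfl⟩
  obtain ⟨I₂, h₂⟩ : ∃ I, I = movingIndex h.1 \ movingIndex g.1 := ⟨_, rfl⟩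
  have hu : movingIndex (g * h : G).1 = I₁ ∪ I₂ := by rw [h₁, h₂]; exact movingIndex_mul hgh
  have h01 : Disjoint I₀ I₁ := by
    rw [h₀, h₁, Finset.disjoint_left]; intro i hi hi'
    exact (Finset.mem_sdiff.1 hi').2 (Finset.mem_inter.1 hi).2
  have h02 : Disjoint I₀ I₂ := by
    rw [h₀, h₂, Finset.disjoint_left]; intro i hi hi'
    exact (Finset.mem_sdiff.1 hi').2 (Finset.mem_inter.1 hi).1
  have h12 : Disjoint I₁ I₂ := by
    rw [h₁, h₂, Finset.disjoint_left]; intro i hi hi'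
    exact (Finset.mem_sdiff.1 hi').2 (Finset.mem_sdiff.1 hi).1
  have hg : movingIndex g.1 = I₀ ∪ I₁ := by
    rw [h₀, h₁, Finset.union_comm]; exact (Finset.sdiff_union_inter _ _).symm
  have hh : movingIndex h.1 = I₀ ∪ I₂ := by
    rw [h₀, h₂, Finset.inter_comm, Finset.union_comm]; exact (Finset.sdiff_union_inter _ _).symm
  have htop := reduced_top (W := W) κ μ hgh hκ hμ h₀ h₁ h₂
  have hrel := reduced_rel κ μ hG hκ.sectorDiff_eq_zero hμ.sectorDiff_eq_zero
  rw [← h₀] at hH ⊢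
  set n := (movingIndex (g * h : G).1).card with hn
  set c₀ : ℤ := revSign (I₁ ∪ I₂) * invSign (I₁ ∪ I₂) I₀ * (revSign I₀ * invSign I₀ I₁) *
    invSign I₁ (I₀ ∪ I₂) with hc₀
  set f : σ → MvPolynomial σ ℂ := fun k => (-1 : ℤ) ^ n •
    kill (movingIndex (g * h : G).1) (kw W (g * h : G).1 k) with hf
  set H' : σ → σ → MvPolynomial σ ℂ := fun k j => (-1) ^ n * H k j with hH'
  have hfH : ∀ k ∈ I₀, f k = ∑ j ∈ I₀, H' k j * scaled (weight g.1) j := by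
    intro k hk
    simp only [hf, hH']
    rw [hH k hk, zsmul_eq_mul, Finset.mul_sum]
    refine Finset.sum_congr rfl fun j _ => ?_
    push_cast
    ring
  have hst := staircase (weight g.1) f I₀ (fun i hi => (mem_movingIndex_iff g.1 i).1
    (Finset.mem_inter.1 (h₀ ▸ hi)).1)
    (fun L => reduced W g h κ μ L - reference I₀ H' (revSign I₀ * c₀ : ℤ) L) (by
      intro L hL K _
      have e : (fun L => (reduced W g h κ μ L - reference I₀ H' (revSign I₀ * c₀ : ℤ) L) K) =
        (fun L => reduced W g h κ μ L K) -
          fun L => reference I₀ H' (revSign I₀ * c₀ : ℤ) L K := rfl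
      rw [e, map_sub, map_sub, Pi.sub_apply, Pi.sub_apply, hrel L (by
        rw [hu]
        exact (Finset.disjoint_union_right.2 ⟨h01, h02⟩).mono_left hL) K,
        reference_rel _ _ _ _ hfH _ _ hL]) (by
      intro K hK
      rw [Pi.sub_apply, htop K hK, reference_top, Pi.smul_apply]
      by_cases hKI : K = I₀
      · rw [if_pos hKI, hKI, Pi.single_eq_same, zsmul_eq_mul, ← Int.cast_mul, ← mul_assoc,
          revSign_mul_self, one_mul, sub_self]
      · rw [if_neg hKI, Pi.single_eq_of_ne hKI, smul_zero, sub_zero])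
  have hle : Ideal.span (Set.range f) ≤ sectorIdeal W (g * h : G).1 := by
    refine Ideal.span_le.2 ?_
    rintro _ ⟨k, rfl⟩
    exact zsmul_mem (kill_kw_mem_sectorIdeal _ k) _
  have h3 := hle hst
  have hdet : (Matrix.of fun j k : I₀ => H' k.1 j.1).det =
      (-1) ^ (n * I₀.card) * (Matrix.of fun k j : I₀ => H k.1 j.1).det := by
    have : (Matrix.of fun j k : I₀ => H' k.1 j.1) =
        ((-1 : MvPolynomial σ ℂ) ^ n • Matrix.of fun k j : I₀ => H k.1 j.1).transpose := rfl
    rw [this, Matrix.det_transpose, Matrix.det_smul, Fintype.card_coe, ← pow_mul]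
  rw [Pi.sub_apply, reference_bottom, reduced, ordProd_annihilate_apply,
    if_pos (Finset.disjoint_empty_right _), Finset.union_empty, ordProd_empty, hdet] at h3
  have h4 := Ideal.add_mem _ (sub_kill_mem_sectorIdeal (W := W) (g * h : G).1
    (product W g h μ κ (movingIndex (g * h : G).1)))
    (Ideal.mul_mem_left _ ((revSign (movingIndex (g * h : G).1) : ℤ) : MvPolynomial σ ℂ) h3)
  convert h4 using 1
  have hsign : revSign (movingIndex (g * h : G).1) * c₀ * (-1) ^ (n * I₀.card) =
      invSign (movingIndex g.1) (movingIndex h.1) := by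
    rw [hn, hu, hc₀, hg, hh]
    exact sign_identity h01 h02 h12
  have hr1 : ((revSign (movingIndex (g * h : G).1) : ℤ) : MvPolynomial σ ℂ) *
      (revSign (movingIndex (g * h : G).1) : ℤ) = 1 := by
    rw [← Int.cast_mul, revSign_mul_self, Int.cast_one]
  have hr2 : ((revSign I₀ : ℤ) : MvPolynomial σ ℂ) * (revSign I₀ : ℤ) = 1 := by
    rw [← Int.cast_mul, revSign_mul_self, Int.cast_one]
  have hinv : invSign (movingIndex (g * h : G).1) ∅ = 1 := by simp [invSign, koszulSign]
  rw [← hsign, hinv, mul_one, map_zsmul, zsmul_eq_mul, zsmul_eq_mul, zsmul_eq_mul]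
  push_cast
  generalize kill (movingIndex (g * h : G).1)
    (product W g h μ κ (movingIndex (g * h : G).1)) = P
  generalize (Matrix.of fun k j : I₀ => H k.1 j.1).det = d
  linear_combination (-P) * hr1 + (((revSign (movingIndex (g * h : G).1) : ℤ) : MvPolynomial σ ℂ) *
    c₀ * (-1) ^ (n * I₀.card) * d) * hr2

end ProductFormula

end Orbifold

namespace Orbifold

open PolyBimod DividedDiff Fermion Hochschild BarCochain

variable {σ : Type} [Fintype σ] [LinearOrder σ]

section TorusAction

theorem torus_smul_mul (t : Torus σ) (a b : MvPolynomial σ ℂ) : t • (a * b) = t • a * t • b :=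
  map_mul (Torus.act t) a b

theorem torus_smul_monomial (t : Torus σ) (γ : σ →₀ ℕ) (c : ℂ) :
    t • (monomial γ c : MvPolynomial σ ℂ) = monomial γ ((γ.prod fun i n => (t i : ℂ) ^ n) * c) := by
  rw [Torus.smul_def, Torus.act, aeval_monomial, monomial_eq, map_mul, algebraMap_eq]
  simp only [Finsupp.prod, mul_pow, Finset.prod_mul_distrib, map_prod, map_pow]
  ring

theorem quantumDiff_monomial (g : Torus σ) (i : σ) (γ : σ →₀ ℕ) (c : ℂ) :
    quantumDiff g i (monomial γ c) =
      monomial (γ - Finsupp.single i 1) (c * ∑ s ∈ Finset.range (γ i), (g i : ℂ) ^ s) := by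
  have h := (basisMonomials σ ℂ).constr_basis ℂ (fun γ : σ →₀ ℕ =>
    (monomial (γ - Finsupp.single i 1) (∑ s ∈ Finset.range (γ i), (g i : ℂ) ^ s) :
      MvPolynomial σ ℂ)) γ
  rw [coe_basisMonomials] at h
  have h2 : (monomial γ c : MvPolynomial σ ℂ) = c • monomial γ 1 := by
    rw [MvPolynomial.smul_monomial, smul_eq_mul, mul_one]
  rw [h2, map_smul, quantumDiff, h, MvPolynomial.smul_monomial, smul_eq_mul]

theorem quantumDiff_smul (g t : Torus σ) (i : σ) (a : MvPolynomial σ ℂ) :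
    quantumDiff g i (t • a) = (t i : ℂ) • t • quantumDiff g i a := by
  induction a using MvPolynomial.induction_on' with
  | monomial γ c =>
    rw [torus_smul_monomial, quantumDiff_monomial, quantumDiff_monomial, torus_smul_monomial,
      MvPolynomial.smul_monomial, smul_eq_mul]
    congr 1
    rcases Nat.eq_zero_or_pos (γ i) with h | h
    · simp [h]
    · have h2 : γ.prod (fun i n => (t i : ℂ) ^ n) =
          (γ - Finsupp.single i 1).prod (fun i n => (t i : ℂ) ^ n) * t i := by
        have h3 : γ = (γ - Finsupp.single i 1) + Finsupp.single i 1 :=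
          (tsub_add_cancel_of_le (Finsupp.single_le_iff.2 h)).symm
        conv_lhs => rw [h3]
        rw [Finsupp.prod_add_index' (by simp) (fun _ _ _ => pow_add _ _ _),
          Finsupp.prod_single_index (by simp), pow_one]
      rw [h2]; ring
  | add p q hp hq => rw [smul_add, map_add, hp, hq, map_add, smul_add, smul_add]

theorem rhoOp_smul (g t : Torus σ) (i : σ) (a : MvPolynomial σ ℂ) :
    rhoOp g i (t • a) = t • rhoOp g i a := by
  have : (rhoOp g i).comp (Torus.act t) = (Torus.act t).comp (rhoOp g i) := by
    refine MvPolynomial.algHom_ext fun j => ?_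
    simp only [AlgHom.comp_apply, Torus.act, rhoOp, aeval_X, map_mul, algHom_C, algebraMap_eq]
    split_ifs
    · simp only [map_mul, aeval_X, algHom_C, algebraMap_eq]; ring
    · simp only [aeval_X]
  exact DFunLike.congr_fun this a

theorem smul_rhoOp_quantumDiff (g t : Torus σ) (i : σ) (a : MvPolynomial σ ℂ) :
    t • rhoOp g i (quantumDiff g i (t⁻¹ • a)) = (t i : ℂ)⁻¹ • rhoOp g i (quantumDiff g i a) := by
  have h := quantumDiff_smul g t i (t⁻¹ • a)
  rw [smul_inv_smul] at h
  rw [h, map_smul (rhoOp g i) (t i : ℂ), inv_smul_smul₀ (t i).ne_zero, rhoOp_smul]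

variable {G : Subgroup (Torus σ)} (t : Torus σ)

variable (G) in
/-- The action of the torus on the coefficients of the crossed product. -/
noncomputable def torusCross : CrossedProduct G →ₗ[ℂ] CrossedProduct G :=
  (SkewMonoidAlgebra.coeffLinearEquiv : CrossedProduct G ≃ₗ[ℂ] (G →₀ _)).symm.toLinearMap ∘ₗ
    Finsupp.mapRange.linearMap (Torus.act t).toLinearMap ∘ₗ
      (SkewMonoidAlgebra.coeffLinearEquiv : CrossedProduct G ≃ₗ[ℂ] (G →₀ _)).toLinearMap

theorem torusCross_single (g : G) (a : MvPolynomial σ ℂ) :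
    torusCross G t (SkewMonoidAlgebra.single g a) = SkewMonoidAlgebra.single g (t • a) := by
  rw [torusCross, LinearMap.comp_apply, LinearMap.comp_apply, LinearEquiv.coe_coe,
    LinearEquiv.coe_coe, LinearEquiv.symm_apply_eq]
  exact Finsupp.mapRange_single (hf := map_zero _)

theorem torusCross_mul (x y : CrossedProduct G) :
    torusCross G t (x * y) = torusCross G t x * torusCross G t y := by
  induction x using SkewMonoidAlgebra.induction_on with
  | zero => simp
  | add x x' hx hx' => simp only [add_mul, map_add, hx, hx']
  | single g a =>
    induction y using SkewMonoidAlgebra.induction_on with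
    | zero => simp
    | add y y' hy hy' => simp only [mul_add, map_add, hy, hy']
    | single h b =>
      rw [SkewMonoidAlgebra.single_mul_single, torusCross_single, torusCross_single,
        torusCross_single, SkewMonoidAlgebra.single_mul_single]
      congr 1
      change t • (a * g.1 • b) = t • a * g.1 • t • b
      rw [torus_smul_mul, smul_smul, smul_smul, mul_comm t]

theorem torusCross_unitSector (a : MvPolynomial σ ℂ) :
    torusCross G t (unitSector G a) = unitSector G (t • a) := torusCross_single t 1 a

variable (G) in
/-- The action of the torus on cochains. -/
noncomputable def torusTot : Tot σ (CrossedProduct G) →ₗ[ℂ] Tot σ (CrossedProduct G) :=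
  lift fun p => incl p ∘ₗ post (torusCross G t) ∘ₗ
    MultilinearMap.compLinearMapₗ fun _ => (Torus.act t⁻¹).toLinearMap

theorem torusTot_incl (p : ℕ) (φ : Cochain ℂ (MvPolynomial σ ℂ) (CrossedProduct G) p) :
    torusTot G t (incl p φ) = incl p (post (torusCross G t)
      (φ.compLinearMap fun _ => (Torus.act t⁻¹).toLinearMap)) := by
  rw [torusTot, lift_incl]; rfl

theorem ev_torus {p : ℕ} (φ : Cochain ℂ (MvPolynomial σ ℂ) (CrossedProduct G) p)
    (a : ℕ → MvPolynomial σ ℂ) :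
    ev (post (torusCross G t) (φ.compLinearMap fun _ => (Torus.act t⁻¹).toLinearMap) :
      Cochain ℂ (MvPolynomial σ ℂ) (CrossedProduct G) p) a =
      torusCross G t (ev φ fun i => t⁻¹ • a i) := rfl

theorem torusTot_cup (x y : Tot σ (CrossedProduct G)) :
    torusTot G t (cup x y) = cup (torusTot G t x) (torusTot G t y) := by
  induction x using CompactCochain.induction with
  | zero => simp
  | add x x' hx hx' => simp only [map_add, LinearMap.add_apply, hx, hx']
  | incl p φ =>
    induction y using CompactCochain.induction with
    | zero => simp
    | add y y' hy hy' => simp only [map_add, hy, hy']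
    | incl q ψ =>
      rw [cup_incl, torusTot_incl, torusTot_incl, torusTot_incl, cup_incl]
      refine incl_eq_incl rfl _ _ fun a => ?_
      rw [ev_cup, ev_torus, ev_torus, ev_torus, ev_cup, torusCross_mul]

variable {W : MvPolynomial σ ℂ}

theorem torusTot_curvedDiff (ht : t • W = W) (x : Tot σ (CrossedProduct G)) :
    torusTot G t (curvedDiff (unitSector G) W x) = curvedDiff (unitSector G) W (torusTot G t x) := by
  have hW : t⁻¹ • W = W := by rw [inv_smul_eq_iff, ht]
  induction x using CompactCochain.induction with
  | zero => simp
  | add x x' hx hx' => simp only [map_add, hx, hx']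
  | incl p φ =>
    rw [torusTot_incl, curvedDiff, LinearMap.add_apply, LinearMap.add_apply, map_add, diff_incl,
      diff_incl, torusTot_incl]
    congr 1
    · refine incl_eq_incl rfl _ _ fun a => ?_
      rw [ev_torus, ev_diff, ev_diff, map_add (torusCross G t), map_add (torusCross G t),
        map_sum (torusCross G t), map_smul (torusCross G t), torusCross_mul, torusCross_mul,
        torusCross_unitSector, torusCross_unitSector, smul_inv_smul, smul_inv_smul, ev_torus,
        ev_torus]
      congr 2
      refine Finset.sum_congr rfl fun i _ => ?_
      rw [map_smul (torusCross G t), ev_torus]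
      congr 3
      ext1 s
      split_ifs
      · rfl
      · exact (torus_smul_mul _ _ _).symm
      · rfl
    · cases p with
      | zero => rw [curv_incl_zero, curv_incl_zero, map_zero]
      | succ p =>
        rw [curv_incl_succ, curv_incl_succ, torusTot_incl]
        refine incl_eq_incl rfl _ _ fun a => ?_
        rw [ev_torus, ev_curv, ev_curv]
        rw [map_sum (torusCross G t)]
        refine Finset.sum_congr rfl fun i _ => ?_
        rw [map_smul (torusCross G t), ev_torus]
        congr 3
        ext1 s
        split_ifs
        · rfl
        · rw [hW]
        · rfl

/-- The action of the torus on Koszul cochains. -/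
noncomputable def torusKoszul (κ : Finset σ → MvPolynomial σ ℂ) : Finset σ → MvPolynomial σ ℂ :=
  fun J => (∏ i ∈ J, (t i : ℂ)⁻¹) • t • κ J

theorem torusKoszul_smul (f : MvPolynomial σ ℂ) (κ : Finset σ → MvPolynomial σ ℂ) :
    torusKoszul t (f • κ) = (t • f) • torusKoszul t κ := by
  ext1 J
  simp only [torusKoszul, Pi.smul_apply, smul_eq_mul, torus_smul_mul, mul_smul_comm]

theorem torusTot_embed (g : G) (κ : Finset σ → MvPolynomial σ ℂ) :
    torusTot G t (embed G g κ) = embed G g (torusKoszul t κ) := by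
  have h : ∀ J a, torusTot G t (embed G g (Pi.single J a)) =
      embed G g (Pi.single J ((∏ i ∈ J, (t i : ℂ)⁻¹) • t • a)) := by
    intro J a
    have hprod : ∀ F : Fin J.card → MvPolynomial σ ℂ, t • ∏ s, F s = ∏ s, t • F s := fun F =>
      map_prod (Torus.act t) F _
    rw [embed_single, embed_single, torusTot_incl]
    refine incl_eq_incl rfl _ _ fun b => ?_
    rw [ev_torus, ev, ev, ups_single _ _ _ rfl, ups_single _ _ _ rfl, act_single, act_single,
      torusCross_single, torus_smul_mul, map_prod, map_prod, hprod]
    congr 1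
    simp only [twist_ddiff, smul_rhoOp_quantumDiff]
    rw [Finset.prod_smul, smul_mul_assoc, mul_smul_comm (∏ i ∈ J, (t i : ℂ)⁻¹)]
    congr 1
    rw [← Finset.prod_coe_sort J]
    refine Fintype.prod_equiv (J.orderIsoOfFin rfl).toEquiv _ _ fun s => ?_
    rfl
  conv_lhs => rw [← Finset.univ_sum_single κ, map_sum, map_sum]
  conv_rhs => rw [← Finset.univ_sum_single (torusKoszul t κ), map_sum]
  exact Finset.sum_congr rfl fun J _ => h J _

theorem sectorDiff_torusKoszul (ht : t • W = W) (g : G) {κ : Finset σ → MvPolynomial σ ℂ}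
    (hκ : sectorDiff W g.1 κ = 0) : sectorDiff W g.1 (torusKoszul t κ) = 0 := by
  classical
  have h : embed G g (sectorDiff W g.1 (torusKoszul t κ)) = 0 := by
    rw [← curvedDiff_embed, ← torusTot_embed, ← torusTot_curvedDiff t ht, curvedDiff_embed, hκ,
      map_zero, map_zero]
  have h2 := project_embed W g g (sectorDiff W g.1 (torusKoszul t κ))
  rwa [h, map_zero, if_pos rfl, eq_comm] at h2

theorem isKoszulRepresentative_torusKoszul (ht : t • W = W) (g : G) {κ : KoszulCochain σ}
    (hκ : IsKoszulRepresentative W g.1 κ) :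
    IsKoszulRepresentative W g.1 ((∏ i ∈ movingIndex g.1, (t i : ℂ)) • torusKoszul t κ) := by
  refine ⟨?_, fun J hJ h => hκ.lower J hJ fun h0 => h ?_, ?_⟩
  · rw [Pi.smul_apply, torusKoszul, hκ.leading, smul_one, smul_smul, ← Finset.prod_mul_distrib,
      Finset.prod_eq_one fun i _ => mul_inv_cancel₀ (t i).ne_zero, one_smul]
  · rw [Pi.smul_apply, torusKoszul, h0, smul_zero, smul_zero, smul_zero]
  · rw [← sectorDiff_eq]
    have := sectorDiff_torusKoszul t ht g hκ.sectorDiff_eq_zero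
    rw [← algebraMap_smul (MvPolynomial σ ℂ), map_smul, this, smul_zero]

theorem sectorClass_torusKoszul (hG : G ≤ symmetryGroup W) (ht : t • W = W) (g : G)
    {κ : KoszulCochain σ} (hκ : IsKoszulRepresentative W g.1 κ) :
    sectorClass W g ⟨torusKoszul t κ, sectorDiff_torusKoszul t ht g hκ.sectorDiff_eq_zero⟩ =
      (∏ i ∈ movingIndex g.1, (t i : ℂ))⁻¹ • sectorGenerator W G g := by
  have hne : ∏ i ∈ movingIndex g.1, (t i : ℂ) ≠ 0 := Finset.prod_ne_zero_iff.2 fun i _ => (t i).ne_zero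
  rw [sectorGenerator_eq hG g (isKoszulRepresentative_torusKoszul t ht g hκ), ← map_smul]
  refine congrArg _ (Subtype.ext ?_)
  exact (inv_smul_smul₀ hne _).symm

/-- Products of generators vanish if the weights of a symmetry do not match. -/
theorem cup_sectorGenerator_eq_zero (hG : G ≤ symmetryGroup W) (ht : t • W = W) (g h : G) {M : ℕ}
    (hreg : ∀ k, X k ^ M ∈ Ideal.span
      (Set.range (mixedSeq (kw W (g * h : G).1) (movingIndex (g * h : G).1))))
    (hsub : movingIndex t ⊆ movingIndex (g * h : G).1)
    (hne : ∏ i ∈ movingIndex (g * h : G).1, (t i : ℂ) ≠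
      (∏ i ∈ movingIndex g.1, (t i : ℂ)) * ∏ i ∈ movingIndex h.1, (t i : ℂ)) :
    orbifoldCup W G (sectorGenerator W G g) (sectorGenerator W G h) = 0 := by
  obtain ⟨κ, hκ⟩ := exists_koszulRepresentative (W := W) (g := g.1) (hG g.2)
  obtain ⟨μ, hμ⟩ := exists_koszulRepresentative (W := W) (g := h.1) (hG h.2)
  obtain ⟨ν, hν⟩ := exists_koszulRepresentative (W := W) (g := (g * h : G).1) (hG (g * h : G).2)
  set P := orbifoldCup W G (sectorGenerator W G g) (sectorGenerator W G h) with hP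
  obtain ⟨f, hf⟩ : ∃ f, f = kill (movingIndex (g * h : G).1)
    (product W g h μ κ (movingIndex (g * h : G).1)) := ⟨_, rfl⟩
  have htf : t • f = f := by
    have : (Torus.act t).comp (kill (movingIndex (g * h : G).1)) =
        kill (movingIndex (g * h : G).1) := by
      refine MvPolynomial.algHom_ext fun i => ?_
      rw [AlgHom.comp_apply, kill_X]
      split_ifs with hi
      · exact map_zero _
      · have : t i = 1 := by simpa [mem_movingIndex] using fun h' => hi (hsub h')
        rw [← Torus.smul_def, smul_X, this]; simp
    rw [hf]
    exact DFunLike.congr_fun this _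
  have h1 : P = sectorClass W (g * h) (smulCocycle f ⟨ν, hν.sectorDiff_eq_zero⟩) := by
    have hmem : (productCocycle hG ⟨κ, hκ.sectorDiff_eq_zero⟩ ⟨μ, hμ.sectorDiff_eq_zero⟩).1
        (movingIndex (g * h : G).1) - f ∈ sectorIdeal W (g * h : G).1 :=
      hf ▸ sub_kill_mem_sectorIdeal _ _
    have hcl := sectorClass_eq_smul hG (g * h) hreg
      (productCocycle hG ⟨κ, hκ.sectorDiff_eq_zero⟩ ⟨μ, hμ.sectorDiff_eq_zero⟩) f hmem
    rw [hP, sectorGenerator_eq hG g hκ, sectorGenerator_eq hG h hμ, cup_sectorClass hG, hcl,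
      sectorGenerator_eq hG _ hν, functionClass_cup_sectorClass]
  have h2 : P = HHc.mk (unitSector G) W (cupCocycles (unitSector G) W
      ⟨embed G g κ, by rw [LinearMap.mem_ker, curvedDiff_embed, hκ.sectorDiff_eq_zero, map_zero]⟩
      ⟨embed G h μ, by rw [LinearMap.mem_ker, curvedDiff_embed, hμ.sectorDiff_eq_zero, map_zero]⟩) := by
    rw [hP, sectorGenerator_eq hG g hκ, sectorGenerator_eq hG h hμ]; rfl
  obtain ⟨z, hz⟩ := (mk_eq_mk_iff _ _).1 (h2.symm.trans h1)
  have hz' := congrArg (torusTot G t) hz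
  rw [torusTot_curvedDiff t ht, map_sub] at hz'
  have h3 : orbifoldCup W G
      (sectorClass W g ⟨torusKoszul t κ, sectorDiff_torusKoszul t ht g hκ.sectorDiff_eq_zero⟩)
      (sectorClass W h ⟨torusKoszul t μ, sectorDiff_torusKoszul t ht h hμ.sectorDiff_eq_zero⟩) =
      sectorClass W (g * h) (smulCocycle f
        ⟨torusKoszul t ν, sectorDiff_torusKoszul t ht _ hν.sectorDiff_eq_zero⟩) := by
    refine (HHc.cup_mk _ _ _ _).trans ((mk_eq_mk_iff _ _).2 ⟨torusTot G t z, hz'.trans ?_⟩)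
    congr 1
    · change torusTot G t (cup (embed G g κ) (embed G h μ)) = cup _ _
      rw [torusTot_cup, torusTot_embed, torusTot_embed]
      rfl
    · change torusTot G t (embed G (g * h) (f • ν)) = embed G (g * h) (f • torusKoszul t ν)
      rw [torusTot_embed, torusKoszul_smul, htf]
  rw [sectorClass_torusKoszul t hG ht g hκ, sectorClass_torusKoszul t hG ht h hμ, map_smul,
    LinearMap.map_smul₂, ← hP, ← functionClass_cup_sectorClass,
    sectorClass_torusKoszul t hG ht _ hν, map_smul, sectorGenerator_eq hG _ hν,
    functionClass_cup_sectorClass, ← h1, smul_smul, ← sub_eq_zero, ← sub_smul] at h3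
  refine (smul_eq_zero.1 h3).resolve_left fun h4 => hne ?_
  rw [sub_eq_zero, ← mul_inv, inv_inj] at h4
  rw [← h4, mul_comm]

end TorusAction

end Orbifold

namespace Orbifold

open PolyBimod DividedDiff Fermion Hochschild BarCochain

variable {σ : Type} [Fintype σ] [LinearOrder σ]

/-- The exponents `n` and the partial successor map `next` of the polynomial
`∑ₐ xₐ^{nₐ} x_{next a}`, where the factor `x_{next a}` is absent if `next a = none`. -/
structure IsLink {σ : Type} (n : σ → ℕ) (next : σ → Option σ) : Prop where
  two_le : ∀ a, 2 ≤ n a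
  injective : ∀ a b c, next a = some c → next b = some c → a = b
  irrefl : ∀ a, next a ≠ some a

section Link

/-- The factor `x_{next a}`. -/
noncomputable def linkTail {σ : Type} (next : σ → Option σ) (a : σ) : MvPolynomial σ ℂ :=
  (next a).elim 1 X

/-- The polynomial `∑ₐ xₐ^{nₐ} x_{next a}`. -/
noncomputable def linkPoly {σ : Type} [Fintype σ] (n : σ → ℕ) (next : σ → Option σ) :
    MvPolynomial σ ℂ :=
  ∑ a, X a ^ n a * linkTail next a

/-- The exponent of the monomial `xₐ^{nₐ} x_{next a}`. -/
noncomputable def linkExponent {σ : Type} (n : σ → ℕ) (next : σ → Option σ) (a : σ) : σ →₀ ℕ :=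
  Finsupp.single a (n a) + (next a).elim 0 fun b => Finsupp.single b 1

variable {n : σ → ℕ} {next : σ → Option σ}

theorem linkTail_eq_monomial (a : σ) :
    linkTail next a = monomial ((next a).elim 0 fun b => Finsupp.single b 1) (1 : ℂ) := by
  unfold linkTail
  cases next a <;> rfl

theorem link_term_eq_monomial (a : σ) :
    X a ^ n a * linkTail next a = monomial (linkExponent n next a) (1 : ℂ) := by
  rw [linkTail_eq_monomial, X_pow_eq_monomial, monomial_mul, one_mul, linkExponent]

theorem IsLink.linkExponent_injective (hl : IsLink n next) :
    Function.Injective (linkExponent n next) := by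
  intro a b hab
  by_contra hne
  have h := DFunLike.congr_fun hab a
  have h1 : n a ≤ linkExponent n next a a := by simp [linkExponent]
  have h2 : linkExponent n next b a ≤ 1 := by
    simp only [linkExponent, Finsupp.add_apply, Finsupp.single_apply, if_neg (Ne.symm hne)]
    cases next b with
    | none => simp
    | some c => simp only [Option.elim, Finsupp.single_apply]; split_ifs <;> simp
  have := hl.two_le a
  omega

theorem linkExponent_prod (t : Torus σ) (a : σ) :
    (linkExponent n next a).prod (fun i m => (t i : ℂ) ^ m) =
      ((t a ^ n a * (next a).elim 1 t : ℂˣ) : ℂ) := by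
  rw [linkExponent, Finsupp.prod_add_index' (by simp) (fun _ _ _ => pow_add _ _ _),
    Finsupp.prod_single_index (by simp)]
  cases next a with
  | none => simp
  | some b => simp [Finsupp.prod_single_index]

theorem IsLink.smul_linkPoly (hl : IsLink n next) (t : Torus σ) :
    t • linkPoly n next = linkPoly n next ↔ ∀ a, t a ^ n a * (next a).elim 1 t = 1 := by
  have h : t • linkPoly n next = ∑ a, monomial (linkExponent n next a)
      ((t a ^ n a * (next a).elim 1 t : ℂˣ) : ℂ) := by
    rw [linkPoly, Finset.smul_sum]
    refine Finset.sum_congr rfl fun a _ => ?_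
    rw [link_term_eq_monomial, torus_smul_monomial, linkExponent_prod, mul_one]
  have h2 : linkPoly n next = ∑ a, monomial (linkExponent n next a) (1 : ℂ) :=
    Finset.sum_congr rfl fun a _ => link_term_eq_monomial a
  have hco : ∀ (c : σ → ℂ) (a : σ),
      coeff (linkExponent n next a) (∑ b, monomial (linkExponent n next b) (c b)) = c a := by
    intro c a
    rw [coeff_sum, Finset.sum_eq_single a]
    · rw [coeff_monomial, if_pos rfl]
    · intro b _ hb
      rw [coeff_monomial, if_neg fun h => hb (hl.linkExponent_injective h)]
    · simp
  constructor
  · intro H a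
    rw [h, h2] at H
    have := congrArg (coeff (linkExponent n next a)) H
    rw [hco, hco] at this
    exact Units.val_eq_one.1 this
  · intro H
    rw [h, h2]
    exact Finset.sum_congr rfl fun a _ => by rw [H a, Units.val_one]

theorem IsLink.mem_symmetryGroup (hl : IsLink n next) (t : Torus σ) :
    t ∈ symmetryGroup (linkPoly n next) ↔ ∀ a, t a ^ n a * (next a).elim 1 t = 1 :=
  hl.smul_linkPoly t

theorem IsLink.mem_movingIndex_of_next (hl : IsLink n next) {g : Torus σ}
    (hg : g ∈ symmetryGroup (linkPoly n next)) {a b : σ} (hab : next a = some b)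
    (hb : b ∈ movingIndex g) : a ∈ movingIndex g := by
  rw [mem_movingIndex] at hb ⊢
  intro ha
  have := (hl.mem_symmetryGroup g).1 hg a
  rw [ha, hab, one_pow, one_mul] at this
  exact hb this

/-- On the fixed locus the quantum derivative along a fixed variable is the derivative. -/
theorem kill_kw (W : MvPolynomial σ ℂ) (u : Torus σ) {k : σ} (hk : k ∉ movingIndex u) :
    kill (movingIndex u) (kw W u k) = kill (movingIndex u) (pderiv k W) := by
  have hu : u k = 1 := by simpa [mem_movingIndex] using hk
  have h1 : quantumDiff u k W = pderiv k W := by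
    induction W using MvPolynomial.induction_on' with
    | monomial γ c => rw [quantumDiff_monomial, pderiv_monomial, hu]; simp
    | add p q hp hq => rw [map_add, map_add, hp, hq]
  have h2 : (kill (movingIndex u)).comp (rhoOp u k) = kill (movingIndex u) := by
    refine MvPolynomial.algHom_ext fun i => ?_
    rw [AlgHom.comp_apply, rhoOp, aeval_X]
    split_ifs
    · rw [map_mul, kill_C, kill_X]
      split_ifs with hi
      · rw [mul_zero]
      · have : u i = 1 := by simpa [mem_movingIndex] using hi
        rw [this]; simp
    · rfl
  rw [kw, h1]
  exact DFunLike.congr_fun h2 _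

theorem pderiv_linkPoly (k : σ) :
    pderiv k (linkPoly n next) = C (n k : ℂ) * X k ^ (n k - 1) * linkTail next k +
      ∑ a with next a = some k, X a ^ n a := by
  classical
  have h : ∀ a, pderiv k (X a ^ n a * linkTail next a : MvPolynomial σ ℂ) =
      (if a = k then C (n k : ℂ) * X k ^ (n k - 1) * linkTail next k else 0) +
      if next a = some k then X a ^ n a else 0 := by
    intro a
    have h1 : pderiv k (linkTail next a) = if next a = some k then 1 else 0 := by
      unfold linkTail
      cases hb : next a with
      | none => simp
      | some b =>
        simp only [Option.elim, pderiv_X, Pi.single_apply, Option.some.injEq, eq_comm]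
    rw [pderiv_mul, h1, pderiv_pow, pderiv_X, Pi.single_apply]
    congr 1
    · by_cases h2 : a = k
      · subst h2; simp
      · rw [if_neg h2, if_neg (by simpa [eq_comm] using h2), mul_zero, zero_mul]
    · rw [mul_ite, mul_one, mul_zero]
  rw [linkPoly, map_sum, Finset.sum_congr rfl fun a _ => h a, Finset.sum_add_distrib,
    Finset.sum_ite_eq' Finset.univ k, if_pos (Finset.mem_univ _), Finset.sum_filter]

/-- The ideal of the fixed locus of the critical points. -/
theorem IsLink.exists_X_pow_mem (hl : IsLink n next) {u : Torus σ}
    (hu : u ∈ symmetryGroup (linkPoly n next)) :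
    ∃ M : ℕ, ∀ k, X k ^ M ∈ Ideal.span
      (Set.range (mixedSeq (kw (linkPoly n next) u) (movingIndex u))) := by
  classical
  set J := Ideal.span (Set.range (mixedSeq (kw (linkPoly n next) u) (movingIndex u))) with hJ
  have hX : ∀ k ∈ movingIndex u, (X k : MvPolynomial σ ℂ) ∈ J := fun k hk =>
    Ideal.subset_span ⟨k, by rw [mixedSeq, if_pos hk]⟩
  have hkill : ∀ a, a - kill (movingIndex u) a ∈ J := fun a => by
    refine Ideal.span_mono ?_ (sub_kill_mem (movingIndex u) a)
    rintro _ ⟨k, hk, rfl⟩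
    exact ⟨k, by rw [mixedSeq, if_pos (Finset.mem_coe.1 hk)]⟩
  have hD : ∀ k ∉ movingIndex u, pderiv k (linkPoly n next) ∈ J := fun k hk => by
    have h1 : kill (movingIndex u) (pderiv k (linkPoly n next)) ∈ J :=
      Ideal.subset_span ⟨k, by rw [mixedSeq, if_neg hk, kill_kw _ _ hk]⟩
    have := J.add_mem (hkill (pderiv k (linkPoly n next))) h1
    rwa [sub_add_cancel] at this
  set m : σ → MvPolynomial σ ℂ := fun a => X a ^ n a * linkTail next a with hm
  have hn0 : ∀ a, n a ≠ 0 := fun a => by have := hl.two_le a; omega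
  have hE : ∀ k, C (n k : ℂ) * m k + ∑ a with next a = some k, m a ∈ J := by
    intro k
    by_cases hk : k ∈ movingIndex u
    · refine J.add_mem (J.mul_mem_left _ (J.mul_mem_right _ (J.pow_mem_of_mem (hX k hk) _
        (Nat.pos_of_ne_zero (hn0 k))))) (J.sum_mem fun a ha => J.mul_mem_left _ ?_)
      rw [linkTail, (Finset.mem_filter.1 ha).2]
      exact hX k hk
    · have h1 := J.mul_mem_left (X k) (hD k hk)
      rw [pderiv_linkPoly, mul_add, Finset.mul_sum] at h1
      convert h1 using 2
      · have : (X k : MvPolynomial σ ℂ) ^ n k = X k * X k ^ (n k - 1) := by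
          rw [← pow_succ', Nat.sub_add_cancel (Nat.pos_of_ne_zero (hn0 k))]
        rw [hm]; dsimp only; rw [this]; ring
      · refine Finset.sum_congr rfl fun a ha => ?_
        rw [hm]; dsimp only
        rw [linkTail, (Finset.mem_filter.1 ha).2, mul_comm]
        rfl
  have hmJ : ∀ a, m a ∈ J := by
    let A : Matrix σ σ ℂ := Matrix.of fun k a =>
      (if a = k then (n k : ℂ) else 0) + if next a = some k then 1 else 0
    have hAd : ∀ k, A k k = n k := fun k => by
      simp [A, hl.irrefl k]
    have hA : A.det ≠ 0 := by
      refine det_ne_zero_of_sum_row_lt_diag fun k => ?_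
      rw [hAd, RCLike.norm_natCast]
      refine lt_of_le_of_lt (b := 1) ?_ (by exact_mod_cast hl.two_le k)
      have h1 : ∀ a ∈ Finset.univ.erase k, ‖A k a‖ = if next a = some k then 1 else 0 := by
        intro a ha
        simp only [A, Matrix.of_apply, if_neg (Finset.ne_of_mem_erase ha), zero_add]
        split_ifs <;> simp
      rw [Finset.sum_congr rfl h1, ← Finset.sum_filter, Finset.sum_const, nsmul_eq_mul, mul_one]
      have h2 : ((Finset.univ.erase k).filter fun a => next a = some k).card ≤ 1 :=
        Finset.card_le_one.2 fun a ha b hb =>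
          hl.injective a b k (Finset.mem_filter.1 ha).2 (Finset.mem_filter.1 hb).2
      exact_mod_cast h2
    have hsum : ∀ k, ∑ a, C (A k a) * m a ∈ J := fun k => by
      convert hE k using 1
      simp only [A, Matrix.of_apply, map_add, add_mul, Finset.sum_add_distrib]
      congr 1
      · rw [Finset.sum_eq_single k] <;> simp +contextual
      · rw [Finset.sum_filter]
        exact Finset.sum_congr rfl fun a _ => by split_ifs <;> simp
    intro b
    have h1 : ∑ k, C (A⁻¹ b k) * ∑ a, C (A k a) * m a ∈ J :=
      J.sum_mem fun k _ => J.mul_mem_left _ (hsum k)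
    convert h1 using 1
    simp only [Finset.mul_sum, ← mul_assoc, ← C_mul]
    rw [Finset.sum_comm]
    simp only [← Finset.sum_mul, ← map_sum, ← Matrix.mul_apply]
    rw [Matrix.nonsing_inv_mul _ (isUnit_iff_ne_zero.2 hA), Finset.sum_eq_single b]
    · simp
    · intro a _ ha; simp [Matrix.one_apply_ne (Ne.symm ha)]
    · simp
  have hrad : ∀ a, (X a : MvPolynomial σ ℂ) ∈ J.radical := by
    intro a
    rw [Ideal.radical_eq_sInf, Submodule.mem_sInf]
    rintro P ⟨hJP, hP⟩
    by_contra ha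
    have h1 : linkTail next a ∈ P :=
      (hP.mem_or_mem (hJP (hmJ a))).resolve_left fun h => ha (hP.mem_of_pow_mem _ h)
    cases hb : next a with
    | none =>
      rw [linkTail, hb] at h1
      exact hP.ne_top ((Ideal.eq_top_iff_one _).2 h1)
    | some b =>
      rw [linkTail, hb] at h1
      by_cases hbm : b ∈ movingIndex u
      · exact ha (hJP (hX a (hl.mem_movingIndex_of_next hu hb hbm)))
      · have h2 := hJP (hD b hbm)
        have h3 : ∑ c with next c = some b, (X c : MvPolynomial σ ℂ) ^ n c = X a ^ n a := by
          rw [Finset.sum_eq_single a]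
          · intro c hc hca
            exact absurd (hl.injective c a b (Finset.mem_filter.1 hc).2 hb) hca
          · intro h; exact absurd hb (by simpa using h)
        rw [pderiv_linkPoly, h3] at h2
        have h4 : C (n b : ℂ) * X b ^ (n b - 1) * linkTail next b ∈ P :=
          Ideal.mul_mem_right _ P (Ideal.mul_mem_left P _ (Ideal.pow_mem_of_mem P h1 _
            (by have := hl.two_le b; omega)))
        exact ha (hP.mem_of_pow_mem _ ((Submodule.add_mem_iff_right P h4).1 h2))
  choose N hN using hrad
  exact ⟨∑ k, N k, fun k => J.mem_of_dvd (pow_dvd_pow _ (Finset.single_le_sum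
    (fun _ _ => Nat.zero_le _) (Finset.mem_univ k))) (hN k)⟩

/-- The twisted Hessian matrix. -/
noncomputable def linkHessian (n : σ → ℕ) (next : σ → Option σ) (g : Torus σ) (k j : σ) :
    MvPolynomial σ ℂ :=
  (if j = k then C ((n k : ℂ) / (1 - (g k : ℂ))) * X k ^ (n k - 2) * linkTail next k else 0) +
    if next j = some k then C (1 / (1 - (g j : ℂ))) * X j ^ (n j - 1) else 0

theorem IsLink.kill_kw_eq_sum (hl : IsLink n next) {g h : Torus σ}
    (hg : g ∈ symmetryGroup (linkPoly n next)) (hh : h ∈ symmetryGroup (linkPoly n next))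
    (hgh : ∀ i, g i = 1 ∨ h i = 1 ∨ g i * h i = 1) {k : σ}
    (hk : k ∈ movingIndex g ∩ movingIndex h) :
    kill (movingIndex (g * h)) (kw (linkPoly n next) (g * h) k) =
      ∑ j ∈ movingIndex g ∩ movingIndex h, linkHessian n next g k j * scaled (weight g) j := by
  classical
  have hout : ∀ i ∈ movingIndex g ∩ movingIndex h, i ∉ movingIndex (g * h) := by
    intro i hi
    rw [Finset.mem_inter, mem_movingIndex, mem_movingIndex] at hi
    rw [mem_movingIndex, not_not]
    exact ((hgh i).resolve_left hi.1).resolve_left hi.2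
  have hweight : ∀ i ∈ movingIndex g ∩ movingIndex h, (1 - (g i : ℂ)) ≠ 0 := fun i hi =>
    (mem_movingIndex_iff g i).1 (Finset.mem_inter.1 hi).1
  have hprev : ∀ a, next a = some k → a ∈ movingIndex g ∩ movingIndex h := fun a ha =>
    Finset.mem_inter.2 ⟨hl.mem_movingIndex_of_next hg ha (Finset.mem_inter.1 hk).1,
      hl.mem_movingIndex_of_next hh ha (Finset.mem_inter.1 hk).2⟩
  have htail : kill (movingIndex (g * h)) (linkTail next k) = linkTail next k := by
    unfold linkTail
    cases hb : next k with
    | none => exact map_one _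
    | some b =>
      rw [Option.elim, kill_X, if_neg]
      exact fun hb' => hout k hk (hl.mem_movingIndex_of_next (mul_mem hg hh) hb hb')
  have h1 : kill (movingIndex (g * h)) (pderiv k (linkPoly n next)) =
      pderiv k (linkPoly n next) := by
    rw [pderiv_linkPoly, map_add, map_mul, map_mul, map_pow, kill_C, kill_X, if_neg (hout k hk),
      htail, map_sum]
    congr 1
    refine Finset.sum_congr rfl fun a ha => ?_
    rw [map_pow, kill_X, if_neg (hout a (hprev a (Finset.mem_filter.1 ha).2))]
  rw [kill_kw _ _ (hout k hk), h1, pderiv_linkPoly]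
  simp only [linkHessian, add_mul, ite_mul, zero_mul, Finset.sum_add_distrib]
  congr 1
  · rw [Finset.sum_ite_eq', if_pos hk, scaled, weight]
    have h2 : (X k : MvPolynomial σ ℂ) ^ (n k - 1) = X k ^ (n k - 2) * X k := by
      rw [← pow_succ]; congr 1; have := hl.two_le k; omega
    have h3 : (C (n k : ℂ) : MvPolynomial σ ℂ) =
        C ((n k : ℂ) / (1 - (g k : ℂ))) * C (1 - (g k : ℂ)) := by
      rw [← C_mul, div_mul_cancel₀ _ (hweight k hk)]
    rw [h2, h3]; ring
  · rw [← Finset.sum_filter]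
    refine Finset.sum_congr_of_eq_on_inter ?_ ?_ ?_
    · intro a ha ha'
      exact absurd (Finset.mem_filter.2 ⟨hprev a (Finset.mem_filter.1 ha).2,
        (Finset.mem_filter.1 ha).2⟩) ha'
    · intro a ha ha'
      exact absurd (Finset.mem_filter.2 ⟨Finset.mem_univ a, (Finset.mem_filter.1 ha).2⟩) ha'
    · intro a ha ha'
      have haI := (Finset.mem_filter.1 ha').1
      have h2 : (X a : MvPolynomial σ ℂ) ^ n a = X a ^ (n a - 1) * X a := by
        rw [← pow_succ]; congr 1; have := hl.two_le a; omega
      rw [scaled, weight, h2]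
      have h3 : (1 : MvPolynomial σ ℂ) = C (1 / (1 - (g a : ℂ))) * C (1 - (g a : ℂ)) := by
        rw [← C_mul, div_mul_cancel₀ _ (hweight a haI), C_1]
      linear_combination (X a ^ (n a - 1) * X a) * h3

variable {G : Subgroup (Torus σ)}

theorem IsLink.cup_sectorGenerator (hl : IsLink n next) (hG : G ≤ symmetryGroup (linkPoly n next))
    {g h : G} (hgh : ∀ i, g.1 i = 1 ∨ h.1 i = 1 ∨ g.1 i * h.1 i = 1) :
    orbifoldCup (linkPoly n next) G (sectorGenerator _ G g) (sectorGenerator _ G h) =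
      orbifoldCup (linkPoly n next) G
        (functionClass _ G (invSign (movingIndex g.1) (movingIndex h.1) •
          (Matrix.of fun k j : (movingIndex g.1 ∩ movingIndex h.1 : Finset σ) =>
            linkHessian n next g.1 k.1 j.1).det))
        (sectorGenerator _ G (g * h)) := by
  obtain ⟨M, hM⟩ := hl.exists_X_pow_mem (hG (g * h).2)
  exact Orbifold.cup_sectorGenerator hG hgh hM _ fun k hk =>
    hl.kill_kw_eq_sum (hG g.2) (hG h.2) hgh hk

theorem IsLink.cup_sectorGenerator_eq_zero (hl : IsLink n next)
    (hG : G ≤ symmetryGroup (linkPoly n next)) {t : Torus σ}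
    (ht : t ∈ symmetryGroup (linkPoly n next)) {g h : G}
    (hsub : movingIndex t ⊆ movingIndex (g * h : G).1)
    (hne : ∏ i ∈ movingIndex (g * h : G).1, (t i : ℂ) ≠
      (∏ i ∈ movingIndex g.1, (t i : ℂ)) * ∏ i ∈ movingIndex h.1, (t i : ℂ)) :
    orbifoldCup (linkPoly n next) G (sectorGenerator _ G g) (sectorGenerator _ G h) = 0 := by
  obtain ⟨M, hM⟩ := hl.exists_X_pow_mem (hG (g * h).2)
  exact Orbifold.cup_sectorGenerator_eq_zero t hG ht g h hM hsub hne

end Link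

end Orbifold

namespace Orbifold

open PolyBimod DividedDiff Fermion Hochschild BarCochain

/-- The successor map of a chain. -/
def chainNext (N : ℕ) (i : Fin N) : Option (Fin N) :=
  if h : i.val + 1 < N then some ⟨i.val + 1, h⟩ else none

/-- The successor map of a loop. -/
def loopNext (N : ℕ) (i : Fin N) : Option (Fin N) := some (finRotate N i)

theorem chainNext_eq_some {N : ℕ} {i j : Fin N} : chainNext N i = some j ↔ i.val + 1 = j.val := by
  unfold chainNext
  split_ifs with h
  · simp [Fin.ext_iff]
  · simp; omega

theorem isLink_chain {N : ℕ} {n : Fin N → ℕ} (hn : ∀ i, 2 ≤ n i) : IsLink n (chainNext N) where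
  two_le := hn
  injective a b c ha hb := by
    rw [chainNext_eq_some] at ha hb
    exact Fin.ext (by omega)
  irrefl a := by rw [Ne, chainNext_eq_some]; omega

theorem finRotate_ne {N : ℕ} (hN : 2 ≤ N) (i : Fin N) : finRotate N i ≠ i := by
  obtain ⟨m, rfl⟩ := Nat.exists_eq_add_of_le' hN
  have : i ∈ (finRotate (m + 2)).support := by rw [support_finRotate]; exact Finset.mem_univ _
  exact Equiv.Perm.mem_support.1 this

theorem isLink_loop {N : ℕ} (hN : 2 ≤ N) {n : Fin N → ℕ} (hn : ∀ i, 2 ≤ n i) :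
    IsLink n (loopNext N) where
  two_le := hn
  injective _ _ _ ha hb := (finRotate N).injective (Option.some_injective _ (ha.trans hb.symm))
  irrefl a h := finRotate_ne hN a (Option.some_injective _ h)

/-- A property that is inherited by the successor in a loop holds everywhere. -/
theorem forall_of_finRotate {N : ℕ} (hN : 2 ≤ N) {p : Fin N → Prop}
    (hp : ∀ i, p i → p (finRotate N i)) {i : Fin N} (hi : p i) (j : Fin N) : p j := by
  obtain ⟨m, rfl⟩ := Nat.exists_eq_add_of_le' hN
  obtain ⟨k, rfl⟩ := (isCycle_finRotate (n := m)).exists_pow_eq (finRotate_ne hN i)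
    (finRotate_ne hN j)
  induction k with
  | zero => exact hi
  | succ k ih => rw [pow_succ', Equiv.Perm.mul_apply]; exact hp _ ih

theorem movingIndex_loop {N : ℕ} (hN : 2 ≤ N) {n : Fin N → ℕ} (hn : ∀ i, 2 ≤ n i)
    {g : Torus (Fin N)} (hg : g ∈ symmetryGroup (linkPoly n (loopNext N))) (hg1 : g ≠ 1) :
    movingIndex g = Finset.univ := by
  refine Finset.eq_univ_of_forall fun i => ?_
  by_contra hi
  refine hg1 (funext fun j => ?_)
  have := forall_of_finRotate hN (p := fun i => i ∉ movingIndex g)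
    (fun i hi h => hi ((isLink_loop hN hn).mem_movingIndex_of_next hg rfl h)) hi j
  simpa [mem_movingIndex] using this

theorem movingIndex_chain {N : ℕ} {n : Fin N → ℕ} (hn : ∀ i, 2 ≤ n i) {g : Torus (Fin N)}
    (hg : g ∈ symmetryGroup (linkPoly n (chainNext N))) (i : Fin N) :
    i ∈ movingIndex g ↔ i.val < (movingIndex g).card := by
  have hstep : ∀ d (i j : Fin N), i.val + d = j.val → j ∈ movingIndex g → i ∈ movingIndex g := by
    intro d
    induction d with
    | zero => intro i j hij hj; rwa [Fin.ext (hij : i.val = j.val)]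
    | succ d ih =>
      intro i j hij hj
      refine ih i ⟨i.val + d, by omega⟩ rfl ?_
      exact (isLink_chain hn).mem_movingIndex_of_next hg
        (chainNext_eq_some.2 (show i.val + d + 1 = j.val by omega)) hj
  constructor
  · intro hi
    have h1 : Finset.Iic i ⊆ movingIndex g := fun j hj =>
      hstep (i.val - j.val) j i (by have := Fin.le_def.1 (Finset.mem_Iic.1 hj); omega) hi
    have := Finset.card_le_card h1
    rw [Fin.card_Iic] at this
    omega
  · intro hi
    by_contra hi'
    have h1 : movingIndex g ⊆ Finset.Iio i := fun j hj => by
      rw [Finset.mem_Iio]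
      by_contra hij
      exact hi' (hstep (j.val - i.val) i j (by have := Fin.le_def.1 (not_lt.1 hij); omega) hj)
    have := Finset.card_le_card h1
    rw [Fin.card_Iio] at this
    omega

theorem movingIndex_nonempty {σ : Type} [Fintype σ] [LinearOrder σ] {g : Torus σ} (hg : g ≠ 1) :
    (movingIndex g).Nonempty := by
  by_contra h
  refine hg (funext fun i => ?_)
  by_contra hi
  exact h ⟨i, mem_movingIndex.2 hi⟩

theorem prod_range_telescope {R : Type} [CommRing R] (m : ℕ → ℕ) (hm : ∀ i, 2 ≤ m i) (Y : ℕ → R) (l : ℕ) :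
    ∏ i ∈ Finset.range (l + 1), Y i ^ (m i - 2) * Y (i + 1) =
      (∏ i ∈ Finset.range (l + 1), Y i ^ (if i = 0 then m i - 2 else m i - 1)) * Y (l + 1) := by
  induction l with
  | zero => simp
  | succ l ih =>
    rw [Finset.prod_range_succ, ih, Finset.prod_range_succ _ (l + 1), if_neg (by omega)]
    have : Y (l + 1) ^ (m (l + 1) - 1) = Y (l + 1) * Y (l + 1) ^ (m (l + 1) - 2) := by
      rw [← pow_succ']; congr 1; have := hm (l + 1); omega
    rw [this]; ring

theorem prod_fin_eq_prod_range {R : Type} [CommRing R] {N l : ℕ} (hl : l ≤ N) (F : Fin N → R)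
    (F' : ℕ → R) (h : ∀ i : Fin N, F i = F' i) :
    ∏ i : Fin N with i.val < l, F i = ∏ i ∈ Finset.range l, F' i := by
  refine Finset.prod_bij' (fun i _ => i.val) (fun i hi => ⟨i, by
    have := Finset.mem_range.1 hi; omega⟩) ?_ ?_ ?_ ?_ ?_ <;> simp +contextual [h]

/-- The twisted Hessian of a chain. -/
theorem det_linkHessian_chain {N : ℕ} {n : Fin N → ℕ} (hn : ∀ i, 2 ≤ n i) {g : Torus (Fin N)}
    (hg : g ∈ symmetryGroup (linkPoly n (chainNext N))) (hg1 : g ≠ 1) :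
    (Matrix.of fun k j : movingIndex g => linkHessian n (chainNext N) g k.1 j.1).det =
      C (∏ i : Fin N with i.val < (movingIndex g).card, ((n i : ℂ) / (1 - (g i : ℂ)))) *
        (∏ i : Fin N with i.val < (movingIndex g).card,
          X i ^ (if i.val = 0 then n i - 2 else n i - 1)) *
        (if h : (movingIndex g).card < N then X ⟨(movingIndex g).card, h⟩ else 1) := by
  rw [Matrix.det_of_isLowerTriangular]
  swap
  · intro k j hkj
    have hkj' : k.1 < j.1 := hkj
    rw [Matrix.of_apply, linkHessian, if_neg hkj'.ne', if_neg, add_zero]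
    rw [chainNext_eq_some]
    have := Fin.lt_def.1 hkj'
    omega
  simp only [Matrix.of_apply]
  rw [Finset.prod_coe_sort (movingIndex g) (fun k => linkHessian n (chainNext N) g k k)]
  have hI : movingIndex g = Finset.univ.filter fun i : Fin N => i.val < (movingIndex g).card := by
    ext i; rw [movingIndex_chain hn hg]; simp
  obtain ⟨l, hl⟩ : ∃ l, (movingIndex g).card = l + 1 :=
    Nat.exists_eq_succ_of_ne_zero (Finset.card_ne_zero.2 (movingIndex_nonempty hg1))
  have hlN : l + 1 ≤ N := by
    have := Finset.card_le_univ (movingIndex g)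
    rw [hl, Fintype.card_fin] at this
    exact this
  rw [hl] at hI ⊢
  rw [hI]
  let Y : ℕ → MvPolynomial (Fin N) ℂ := fun i => if h : i < N then X ⟨i, h⟩ else 1
  let m : ℕ → ℕ := fun i => if h : i < N then n ⟨i, h⟩ else 2
  have hY : ∀ i : Fin N, (X i : MvPolynomial (Fin N) ℂ) = Y i := fun i => by simp [Y]
  have hm : ∀ i : Fin N, n i = m i := fun i => by simp [m]
  have hdiag : ∀ i : Fin N, linkHessian n (chainNext N) g i i =
      C ((n i : ℂ) / (1 - (g i : ℂ))) * (Y i ^ (m i - 2) * Y (i + 1)) := by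
    intro i
    rw [linkHessian, if_pos rfl, if_neg ((isLink_chain hn).irrefl i), add_zero, hY, hm, mul_assoc]
    congr 2
    simp only [linkTail, chainNext, Y]
    split_ifs <;> rfl
  rw [Finset.prod_congr rfl fun i _ => hdiag i, Finset.prod_mul_distrib, ← map_prod, mul_assoc,
    prod_fin_eq_prod_range hlN _ (fun i => Y i ^ (m i - 2) * Y (i + 1)) fun i => rfl,
    prod_range_telescope m (fun i => by simp only [m]; split_ifs <;> simp [hn]) Y l]
  congr 2
  exact (prod_fin_eq_prod_range hlN _ _ fun i => by rw [hY, hm]).symm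

/-- The determinant of a cyclic bidiagonal matrix. -/
theorem det_cyclic_bidiagonal {R : Type} [CommRing R] {N : ℕ} (hN : 2 ≤ N) (d c : Fin N → R) :
    (Matrix.of fun k j : Fin N => (if j = k then d k else 0) +
      if finRotate N j = k then c j else 0).det = ∏ i, d i + (-1) ^ (N + 1) * ∏ i, c i := by
  classical
  have hrot := finRotate_ne hN
  rw [Matrix.det_apply', ← Finset.sum_subset (Finset.subset_univ {1, finRotate N}),
    Finset.sum_pair]
  · congr 1
    · rw [Equiv.Perm.sign_one, Units.val_one, Int.cast_one, one_mul]
      refine Finset.prod_congr rfl fun i _ => ?_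
      rw [Equiv.Perm.one_apply, Matrix.of_apply, if_pos rfl, if_neg (hrot i), add_zero]
    · congr 1
      · obtain ⟨m, rfl⟩ := Nat.exists_eq_add_of_le' hN
        rw [sign_finRotate]
        push_cast
        rw [pow_add (-1 : R) (m + 2) 1, pow_add (-1 : R) m 2, pow_add (-1 : R) m 1]
        simp
      · refine Finset.prod_congr rfl fun i _ => ?_
        rw [Matrix.of_apply, if_neg (hrot i).symm, if_pos rfl, zero_add]
  · intro h
    exact hrot ⟨0, by omega⟩ (Equiv.ext_iff.1 h ⟨0, by omega⟩).symm
  · intro τ _ hτ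
    rw [Finset.mem_insert, Finset.mem_singleton, not_or] at hτ
    have hex : ∃ i, τ i ≠ i ∧ τ i ≠ finRotate N i := by
      by_contra! hcon
      by_cases h1 : ∃ i, τ i ≠ i
      · obtain ⟨i, hi⟩ := h1
        refine hτ.2 (Equiv.ext fun j => hcon j ?_)
        refine forall_of_finRotate hN (p := fun j => τ j ≠ j) (fun j hj h => ?_) hi j
        exact hrot j (τ.injective (h.trans (hcon j hj).symm))
      · exact hτ.1 (Equiv.ext fun j => by simpa using not_exists.1 h1 j)
    obtain ⟨i, hi1, hi2⟩ := hex
    rw [Finset.prod_eq_zero (Finset.mem_univ i), mul_zero]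
    rw [Matrix.of_apply, if_neg hi1.symm, if_neg hi2.symm, add_zero]

/-- The twisted Hessian of a loop. -/
theorem det_linkHessian_loop {N : ℕ} (hN : 2 ≤ N) {n : Fin N → ℕ} (hn : ∀ i, 2 ≤ n i)
    {g : Torus (Fin N)} (hg : g ∈ symmetryGroup (linkPoly n (loopNext N))) (hg1 : g ≠ 1) :
    (Matrix.of fun k j : movingIndex g => linkHessian n (loopNext N) g k.1 j.1).det =
      C (((-1) ^ (N + 1) + ∏ i : Fin N, (n i : ℂ)) / ∏ i : Fin N, (1 - (g i : ℂ))) *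
        ∏ i : Fin N, X i ^ (n i - 1) := by
  have hI := movingIndex_loop hN hn hg hg1
  let e : Fin N ≃ movingIndex g := (Equiv.subtypeUnivEquiv fun i => by rw [hI]; simp).symm
  rw [← Matrix.det_submatrix_equiv_self e]
  have h1 : (Matrix.of fun k j : movingIndex g =>
        linkHessian n (loopNext N) g k.1 j.1).submatrix e e =
      Matrix.of fun k j : Fin N =>
        (if j = k then C ((n k : ℂ) / (1 - (g k : ℂ))) * X k ^ (n k - 2) * X (finRotate N k) else 0) +
        if finRotate N j = k then C (1 / (1 - (g j : ℂ))) * X j ^ (n j - 1) else 0 := by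
    ext1 k j
    simp only [Matrix.submatrix_apply, Matrix.of_apply, linkHessian, loopNext, Option.some.injEq]
    rfl
  have h2 : ∏ i : Fin N, (X i : MvPolynomial (Fin N) ℂ) ^ (n i - 1) =
      (∏ i, X i ^ (n i - 2)) * ∏ i, X (finRotate N i) := by
    rw [Equiv.prod_comp (finRotate N) fun i => (X i : MvPolynomial (Fin N) ℂ),
      ← Finset.prod_mul_distrib]
    refine Finset.prod_congr rfl fun i _ => ?_
    rw [← pow_succ]; congr 1; have := hn i; omega
  rw [h1, det_cyclic_bidiagonal hN]
  simp only [Finset.prod_mul_distrib, ← map_prod]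
  rw [mul_assoc, ← h2, ← mul_assoc, ← add_mul, ← C_1, ← C_neg, ← C_pow, ← C_mul, ← C_add]
  congr 2
  rw [Finset.prod_div_distrib, Finset.prod_div_distrib, Finset.prod_const_one]
  ring

end Orbifold

namespace Orbifold

open PolyBimod DividedDiff Fermion Hochschild BarCochain

/-- A chain has a symmetry of nontrivial weight that moves the first variable only. -/
theorem exists_symmetry_chain {N : ℕ} (hN : 0 < N) {n : Fin N → ℕ} (hn : ∀ i, 2 ≤ n i) :
    ∃ t ∈ symmetryGroup (linkPoly n (chainNext N)), ∃ c : ℂ, c ≠ 1 ∧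
      ∀ g ∈ symmetryGroup (linkPoly n (chainNext N)), g ≠ 1 →
        movingIndex t ⊆ movingIndex g ∧ ∏ i ∈ movingIndex g, (t i : ℂ) = c := by
  classical
  have hζ := Complex.isPrimitiveRoot_exp (n ⟨0, hN⟩) (by have := hn ⟨0, hN⟩; omega)
  obtain ⟨ζ, hζ'⟩ := hζ.isUnit (by have := hn ⟨0, hN⟩; omega)
  rw [← hζ'] at hζ
  refine ⟨Pi.mulSingle ⟨0, hN⟩ ζ, ?_, ζ, hζ.ne_one (hn _), fun g hg hg1 => ?_⟩
  · rw [(isLink_chain hn).mem_symmetryGroup]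
    intro a
    have h1 : (chainNext N a).elim 1 (Pi.mulSingle (M := fun _ => ℂˣ) ⟨0, hN⟩ ζ) = 1 := by
      cases h : chainNext N a with
      | none => rfl
      | some b =>
        rw [chainNext_eq_some] at h
        refine Pi.mulSingle_eq_of_ne (fun hb => ?_) _
        rw [hb] at h
        exact absurd h (Nat.succ_ne_zero _)
    rw [h1, mul_one]
    by_cases ha : a = ⟨0, hN⟩
    · subst ha
      rw [Pi.mulSingle_eq_same]
      exact Units.ext (by push_cast; exact hζ.pow_eq_one)
    · rw [Pi.mulSingle_eq_of_ne ha, one_pow]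
  · have h0 : (⟨0, hN⟩ : Fin N) ∈ movingIndex g :=
      (movingIndex_chain hn hg _).2 (Finset.card_pos.2 (movingIndex_nonempty hg1))
    constructor
    · intro i hi
      rw [mem_movingIndex] at hi
      by_cases hi0 : i = ⟨0, hN⟩
      · rwa [hi0]
      · exact absurd (Pi.mulSingle_eq_of_ne hi0 _) hi
    · rw [Finset.prod_eq_single_of_mem _ h0, Pi.mulSingle_eq_same]
      intro i _ hi
      rw [Pi.mulSingle_eq_of_ne hi, Units.val_one]

/-- Bounds for alternating sums of partial products. -/
theorem alternating_sum_bounds (m : ℕ → ℤ) (hm : ∀ i, 2 ≤ m i) (l : ℕ) :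
    let p : ℕ → ℤ := fun i => ∏ j ∈ Finset.range i, m j
    0 < p l ∧ 0 < (-1) ^ l * ∑ i ∈ Finset.range (l + 1), (-1) ^ i * p i ∧
      (-1) ^ l * ∑ i ∈ Finset.range (l + 1), (-1) ^ i * p i ≤ p l := by
  intro p
  induction l with
  | zero => simp [p]
  | succ l ih =>
    have hp : p (l + 1) = p l * m l := Finset.prod_range_succ _ _
    have h1 : ((-1 : ℤ) ^ (l + 1)) * (-1) ^ (l + 1) = 1 := by rw [← mul_pow]; simp
    have h2 : (-1) ^ (l + 1) * ∑ i ∈ Finset.range (l + 1 + 1), (-1) ^ i * p i =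
        p (l + 1) - (-1) ^ l * ∑ i ∈ Finset.range (l + 1), (-1) ^ i * p i := by
      rw [Finset.sum_range_succ, mul_add, ← mul_assoc, h1]; ring
    obtain ⟨h3, h4, h5⟩ := ih
    have h6 : 2 * p l ≤ p (l + 1) := by rw [hp]; nlinarith [hm l]
    rw [h2]
    exact ⟨by linarith, by linarith, by linarith⟩

theorem prod_zpow_eq {α ι : Type} [CommGroup α] (a : α) (f : ι → ℤ) (s : Finset ι) :
    ∏ i ∈ s, a ^ f i = a ^ ∑ i ∈ s, f i := by
  classical
  induction s using Finset.induction_on with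
  | empty => simp
  | insert i s hi ih => rw [Finset.prod_insert hi, Finset.sum_insert hi, ih, zpow_add]

/-- A loop has a symmetry of nontrivial weight. -/
theorem exists_symmetry_loop {N : ℕ} (hN : 2 ≤ N) {n : Fin N → ℕ} (hn : ∀ i, 2 ≤ n i) :
    ∃ t ∈ symmetryGroup (linkPoly n (loopNext N)), ∏ i, (t i : ℂ) ≠ 1 := by
  obtain ⟨l, rfl⟩ := Nat.exists_eq_add_of_le' hN
  let m : ℕ → ℤ := fun i => if h : i < l + 2 then n ⟨i, h⟩ else 2
  have hm : ∀ i, 2 ≤ m i := fun i => by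
    simp only [m]; split_ifs
    · exact_mod_cast hn _
    · exact le_rfl
  let p : ℕ → ℤ := fun i => ∏ j ∈ Finset.range i, m j
  let e : ℕ → ℤ := fun i => (-1) ^ i * p i
  have he : ∀ i, e i * m i + e (i + 1) = 0 := fun i => by
    have : p (i + 1) = p i * m i := Finset.prod_range_succ _ _
    simp only [e, this, pow_succ]; ring
  obtain ⟨hp0, hs0, hs1⟩ := alternating_sum_bounds m hm (l + 1)
  change 0 < p (l + 1) at hp0
  change 0 < (-1) ^ (l + 1) * ∑ i ∈ Finset.range (l + 2), e i at hs0
  change (-1) ^ (l + 1) * ∑ i ∈ Finset.range (l + 2), e i ≤ p (l + 1) at hs1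
  obtain ⟨hq0, -, -⟩ := alternating_sum_bounds m hm l
  change 0 < p l at hq0
  have hp1 : p (l + 1) = p l * m l := Finset.prod_range_succ _ _
  have hp2 : p (l + 2) = p (l + 1) * m (l + 1) := Finset.prod_range_succ _ _
  have hpl : 2 ≤ p (l + 1) := by rw [hp1]; nlinarith [hm l]
  have hpl2 : 2 * p (l + 1) ≤ p (l + 2) := by rw [hp2]; nlinarith [hm (l + 1)]
  set S := ∑ i ∈ Finset.range (l + 2), e i with hS
  have hSabs : 0 < |S| ∧ |S| ≤ p (l + 1) := by
    rcases neg_one_pow_eq_or ℤ (l + 1) with h | h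
    · rw [h, one_mul] at hs0 hs1
      rw [abs_of_pos hs0]; exact ⟨hs0, hs1⟩
    · rw [h, neg_one_mul] at hs0 hs1
      rw [abs_of_neg (by linarith)]; exact ⟨hs0, hs1⟩
  have hD : p (l + 1) < |e (l + 2) - 1| := by
    rcases neg_one_pow_eq_or ℤ (l + 2) with h | h
    · have : e (l + 2) = p (l + 2) := by simp only [e, h, one_mul]
      rw [this, lt_abs]; left; linarith
    · have : e (l + 2) = -p (l + 2) := by simp only [e, h, neg_one_mul]
      rw [this, lt_abs]; right; linarith
  have hD0 : (e (l + 2) - 1).natAbs ≠ 0 := by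
    rw [Int.natAbs_ne_zero]
    intro h
    rw [h, abs_zero] at hD
    linarith
  have hζ := Complex.isPrimitiveRoot_exp _ hD0
  obtain ⟨ζ, hζ'⟩ := hζ.isUnit hD0
  rw [← hζ', IsPrimitiveRoot.coe_units_iff] at hζ
  refine ⟨fun i => ζ ^ e i.val, ?_, ?_⟩
  · rw [(isLink_loop hN hn).mem_symmetryGroup]
    intro i
    have hmi : (n i : ℤ) = m i := by simp [m]
    change (ζ ^ e i.val) ^ n i * ζ ^ e (finRotate (l + 2) i).val = 1
    rw [← zpow_natCast, ← zpow_mul, ← zpow_add, hmi]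
    by_cases hi : i = Fin.last (l + 1)
    · subst hi
      rw [finRotate_last, hζ.zpow_eq_one_iff_dvd, Int.natAbs_dvd]
      refine ⟨-1, ?_⟩
      have := he (l + 1)
      have h0 : e 0 = 1 := by simp [e, p]
      rw [Fin.val_last, Fin.val_zero, h0]
      linarith
    · have hlt : i.val < l + 1 := by
        have := Fin.val_lt_last hi
        exact this
      rw [coe_finRotate_of_ne_last hi, he, zpow_zero]
  · intro h
    have h1 : ∏ i : Fin (l + 2), ζ ^ e i.val = 1 := Units.ext (by push_cast at h ⊢; exact h)
    rw [Fin.prod_univ_eq_prod_range (fun i => ζ ^ e i),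
      prod_zpow_eq] at h1
    rw [hζ.zpow_eq_one_iff_dvd, Int.natAbs_dvd] at h1
    have h2 := Int.le_of_dvd hSabs.1 ((dvd_abs _ _).2 ((abs_dvd _ _).2 h1))
    linarith [hSabs.2]

theorem linkPoly_chain {N : ℕ} (n : Fin N → ℕ) :
    linkPoly n (chainNext N) =
      ∑ i : Fin N, X i ^ n i * (if h : i.val + 1 < N then X ⟨i.val + 1, h⟩ else 1) := by
  refine Finset.sum_congr rfl fun i _ => congrArg (X i ^ n i * ·) ?_
  unfold linkTail chainNext
  split_ifs <;> rfl

end Orbifold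

namespace ElementaryInvertible

open Orbifold

/-- The exponents `n₁, …, n_N`. -/
def exponent : (E : ElementaryInvertible) → Fin E.dim → ℕ
  | fermat n _ => fun _ => n
  | loop _ _ n _ => n
  | chain _ _ n _ => n

/-- The successor map of the variables. -/
def next : (E : ElementaryInvertible) → Fin E.dim → Option (Fin E.dim)
  | fermat _ _ => chainNext 1
  | loop N _ _ _ => loopNext N
  | chain N _ _ _ => chainNext N

theorem isLink : (E : ElementaryInvertible) → IsLink E.exponent E.next
  | fermat _ hn => isLink_chain fun _ => hn
  | loop _ hN _ hn => isLink_loop hN hn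
  | chain _ _ _ hn => isLink_chain hn

theorem poly_eq_linkPoly (E : ElementaryInvertible) : E.poly = linkPoly E.exponent E.next := by
  cases E with
  | fermat n hn =>
    change (X (0 : Fin 1) ^ n : MvPolynomial (Fin 1) ℂ) = linkPoly (fun _ : Fin 1 => n) (chainNext 1)
    rw [linkPoly, Fin.sum_univ_one]
    simp [linkTail, chainNext]
  | loop N hN n hn => rfl
  | chain N hN n hn =>
    exact (linkPoly_chain n).symm

theorem exists_symmetry (E : ElementaryInvertible) :
    ∃ t ∈ symmetryGroup (linkPoly E.exponent E.next), ∃ c : ℂ, c ≠ 1 ∧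
      ∀ g ∈ symmetryGroup (linkPoly E.exponent E.next), g ≠ 1 →
        movingIndex t ⊆ movingIndex g ∧ ∏ i ∈ movingIndex g, (t i : ℂ) = c := by
  cases E with
  | fermat n hn => exact exists_symmetry_chain (N := 1) one_pos (n := fun _ => n) fun _ => hn
  | loop N hN n hn =>
    obtain ⟨t, ht, h⟩ := exists_symmetry_loop hN hn
    refine ⟨t, ht, _, h, fun g hg hg1 => ?_⟩
    have := movingIndex_loop hN hn hg hg1
    exact ⟨fun i _ => this ▸ Finset.mem_univ i, Finset.prod_congr this fun _ _ => rfl⟩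
  | chain N hN n hn => exact exists_symmetry_chain (zero_lt_two.trans_le hN) hn

theorem det_linkHessian (E : ElementaryInvertible) {g : Torus (Fin E.dim)}
    (hg : g ∈ symmetryGroup (linkPoly E.exponent E.next)) (hg1 : g ≠ 1) :
    (Matrix.of fun k j : movingIndex g => linkHessian E.exponent E.next g k.1 j.1).det =
      E.hess g := by
  cases E with
  | fermat n hn =>
    refine (det_linkHessian_chain (N := 1) (n := fun _ => n) (fun _ => hn) hg hg1).trans ?_
    have hc : (movingIndex (σ := Fin 1) g).card = 1 :=
      le_antisymm (Finset.card_le_univ _) (Finset.card_pos.2 (movingIndex_nonempty hg1))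
    rw [hc]
    change _ = (C ((n : ℂ) / (1 - (g (0 : Fin 1) : ℂ))) * X (0 : Fin 1) ^ (n - 2) :
        MvPolynomial (Fin 1) ℂ)
    simp
  | loop N hN n hn => exact det_linkHessian_loop hN hn hg hg1
  | chain N hN n hn => exact det_linkHessian_chain hn hg hg1

end ElementaryInvertible

namespace Orbifold

open PolyBimod DividedDiff Fermion Hochschild BarCochain

section Blocks

variable {r : ℕ} (E : Fin r → ElementaryInvertible)

theorem blockVar_injective (k : Fin r) : Function.Injective (blockVar E k) := fun _ _ h =>
  eq_of_heq (Sigma.mk.inj (toLex.injective h)).2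

theorem block_eq_of_blockVar_eq {k l : Fin r} {i : Fin (E k).dim} {j : Fin (E l).dim}
    (h : blockVar E k i = blockVar E l j) : k = l :=
  congrArg Sigma.fst (toLex.injective h)

@[elab_as_elim]
theorem blockVar_cases {motive : BlockIndex E → Prop}
    (h : ∀ k i, motive (blockVar E k i)) (x : BlockIndex E) : motive x :=
  h (ofLex x).1 (ofLex x).2

theorem blockVar_lt_blockVar_of_lt {k l : Fin r} (h : k < l) (i : Fin (E k).dim)
    (j : Fin (E l).dim) : blockVar E k i < blockVar E l j :=
  Sigma.Lex.lt_def.2 (Or.inl h)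

theorem blockVar_lt_blockVar {k : Fin r} {i j : Fin (E k).dim} :
    blockVar E k i < blockVar E k j ↔ i < j := by
  refine Sigma.Lex.lt_def.trans ⟨?_, fun h => Or.inr ⟨rfl, h⟩⟩
  rintro (h | ⟨_, h⟩)
  · exact absurd h (lt_irrefl k)
  · exact h

@[to_additive]
theorem prod_block {M : Type} [CommMonoid M] (F : BlockIndex E → M) :
    ∏ x, F x = ∏ k, ∏ i, F (blockVar E k i) := by
  rw [← Fintype.prod_sigma']
  exact (Equiv.prod_comp (toLex : (Σ k, Fin (E k).dim) ≃ BlockIndex E) F).symm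

theorem prod_finset_block {M : Type} [CommMonoid M] (F : BlockIndex E → M)
    {I : Finset (BlockIndex E)} {J : ∀ k, Finset (Fin (E k).dim)}
    (hI : ∀ k i, blockVar E k i ∈ I ↔ i ∈ J k) :
    ∏ x ∈ I, F x = ∏ k, ∏ i ∈ J k, F (blockVar E k i) := by
  rw [← Fintype.prod_ite_mem, prod_block]
  refine Finset.prod_congr rfl fun k _ => ?_
  rw [← Fintype.prod_ite_mem (J k)]
  exact Finset.prod_congr rfl fun i _ => if_congr (hI k i) rfl rfl

/-- The exponents of an invertible polynomial. -/
def blockExponent (x : BlockIndex E) : ℕ := (E (ofLex x).1).exponent (ofLex x).2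

/-- The successor map of the variables of an invertible polynomial. -/
def blockNext (x : BlockIndex E) : Option (BlockIndex E) :=
  ((E (ofLex x).1).next (ofLex x).2).map (blockVar E _)

theorem blockNext_blockVar_eq {k : Fin r} {i j : Fin (E k).dim} :
    blockNext E (blockVar E k i) = some (blockVar E k j) ↔ (E k).next i = some j := by
  change ((E k).next i).map (blockVar E k) = _ ↔ _
  rw [← Option.map_some (f := blockVar E k), (Option.map_injective (blockVar_injective E k)).eq_iff]

theorem block_eq_of_blockNext {k l : Fin r} {i : Fin (E k).dim} {j : Fin (E l).dim}
    (h : blockNext E (blockVar E k i) = some (blockVar E l j)) : k = l := by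
  change ((E k).next i).map (blockVar E k) = _ at h
  obtain ⟨j', -, hj'⟩ := Option.map_eq_some_iff.1 h
  exact block_eq_of_blockVar_eq E hj'

theorem isLink_block : IsLink (blockExponent E) (blockNext E) where
  two_le x := (E (ofLex x).1).isLink.two_le (ofLex x).2
  injective x y z hx hy := by
    induction x using blockVar_cases with | _ k i
    induction y using blockVar_cases with | _ l j
    induction z using blockVar_cases with | _ m a
    obtain rfl := block_eq_of_blockNext E hx
    obtain rfl := block_eq_of_blockNext E hy
    rw [blockNext_blockVar_eq] at hx hy
    rw [(E _).isLink.injective _ _ _ hx hy]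
  irrefl x := by
    induction x using blockVar_cases with | _ k i
    rw [Ne, blockNext_blockVar_eq]
    exact (E k).isLink.irrefl i

theorem linkTail_blockVar (k : Fin r) (i : Fin (E k).dim) :
    linkTail (blockNext E) (blockVar E k i) = rename (blockVar E k) (linkTail (E k).next i) := by
  change (((E k).next i).map (blockVar E k)).elim 1 X = rename (blockVar E k) (((E k).next i).elim 1 X)
  cases (E k).next i with
  | none => exact (map_one _).symm
  | some j => exact (rename_X _ _).symm

theorem invertiblePoly_eq_linkPoly :
    invertiblePoly E = linkPoly (blockExponent E) (blockNext E) := by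
  rw [invertiblePoly, linkPoly, sum_block]
  refine Finset.sum_congr rfl fun k _ => ?_
  rw [ElementaryInvertible.poly_eq_linkPoly, linkPoly, map_sum]
  refine Finset.sum_congr rfl fun i _ => ?_
  rw [map_mul, map_pow, rename_X, linkTail_blockVar]
  rfl

theorem mem_symmetryGroup_block (g : Torus (BlockIndex E)) :
    g ∈ symmetryGroup (linkPoly (blockExponent E) (blockNext E)) ↔
      ∀ k, blockPart E g k ∈ symmetryGroup (linkPoly (E k).exponent (E k).next) := by
  simp only [(isLink_block E).mem_symmetryGroup, (E _).isLink.mem_symmetryGroup]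
  have h : ∀ k i, g (blockVar E k i) ^ blockExponent E (blockVar E k i) *
      (blockNext E (blockVar E k i)).elim 1 g =
      blockPart E g k i ^ (E k).exponent i * ((E k).next i).elim 1 (blockPart E g k) := by
    intro k i
    congr 1
    change (((E k).next i).map (blockVar E k)).elim 1 g = _
    cases (E k).next i <;> rfl
  constructor
  · intro H k i
    rw [← h]; exact H _
  · intro H x
    induction x using blockVar_cases with | _ k i
    rw [h]; exact H k i

theorem blockVar_mem_movingIndex (g : Torus (BlockIndex E)) (k : Fin r) (i : Fin (E k).dim) :
    blockVar E k i ∈ movingIndex g ↔ i ∈ movingIndex (blockPart E g k) := by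
  rw [mem_movingIndex, mem_movingIndex]; rfl

theorem linkHessian_blockVar (g : Torus (BlockIndex E)) (k : Fin r) (i j : Fin (E k).dim) :
    linkHessian (blockExponent E) (blockNext E) g (blockVar E k i) (blockVar E k j) =
      rename (blockVar E k) (linkHessian (E k).exponent (E k).next (blockPart E g k) i j) := by
  simp only [linkHessian, map_add, blockNext_blockVar_eq, (blockVar_injective E k).eq_iff]
  congr 1
  · split_ifs
    · rw [map_mul, map_mul, map_pow, rename_X, rename_C, linkTail_blockVar]
      rfl
    · exact (map_zero _).symm
  · split_ifs
    · rw [map_mul, map_pow, rename_X, rename_C]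
      rfl
    · exact (map_zero _).symm

theorem linkHessian_blockVar_of_ne (g : Torus (BlockIndex E)) {k l : Fin r} (hkl : k ≠ l)
    (i : Fin (E k).dim) (j : Fin (E l).dim) :
    linkHessian (blockExponent E) (blockNext E) g (blockVar E k i) (blockVar E l j) = 0 := by
  rw [linkHessian, if_neg fun h => hkl (block_eq_of_blockVar_eq E h).symm,
    if_neg fun h => hkl (block_eq_of_blockNext E h).symm, add_zero]

theorem det_linkHessian_block (g : Torus (BlockIndex E)) {I : Finset (BlockIndex E)}
    [DecidableEq I] {J : ∀ k, Finset (Fin (E k).dim)}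
    (hI : ∀ k i, blockVar E k i ∈ I ↔ i ∈ J k) :
    (Matrix.of fun x y : I => linkHessian (blockExponent E) (blockNext E) g x.1 y.1).det =
      ∏ k, rename (blockVar E k) (Matrix.of fun i j : J k =>
        linkHessian (E k).exponent (E k).next (blockPart E g k) i.1 j.1).det := by
  rw [Matrix.BlockTriangular.det_fintype (b := fun x : I => (ofLex x.1).1)]
  · refine Finset.prod_congr rfl fun k _ => ?_
    let e : J k → {x : I // (ofLex x.1).1 = k} := fun i =>
      ⟨⟨blockVar E k i.1, (hI k i.1).2 i.2⟩, rfl⟩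
    have he : Function.Bijective e := by
      constructor
      · intro i j hij
        exact Subtype.ext (blockVar_injective E k (congrArg (fun x => x.1.1) hij))
      · rintro ⟨⟨x, hx⟩, hk⟩
        induction x using blockVar_cases with | _ l i
        obtain rfl : l = k := hk
        exact ⟨⟨i, (hI l i).1 hx⟩, rfl⟩
    rw [← Matrix.det_submatrix_equiv_self (Equiv.ofBijective e he), AlgHom.map_det]
    congr 1
    ext1 i j
    exact linkHessian_blockVar E g k i.1 j.1
  · rintro ⟨x, hx⟩ ⟨y, hy⟩ hxy
    induction x using blockVar_cases with | _ k i
    induction y using blockVar_cases with | _ l j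
    exact linkHessian_blockVar_of_ne E g (ne_of_gt hxy) i j

theorem invSign_eq_prod {σ : Type} [LinearOrder σ] (J K : Finset σ) :
    invSign J K = ∏ a ∈ J, ∏ b ∈ K, if b < a then (-1 : ℤ) else 1 := by
  refine Finset.prod_congr rfl fun a _ => ?_
  rw [koszulSign, ← Finset.prod_const, Finset.prod_filter]

theorem invSign_block (g h : Torus (BlockIndex E)) :
    invSign (movingIndex g) (movingIndex h) = kunnethSign E g h *
      ∏ k, invSign (movingIndex (blockPart E g k)) (movingIndex (blockPart E h k)) := by
  classical
  rw [invSign_eq_prod, prod_finset_block E _ (blockVar_mem_movingIndex E g), kunnethSign,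
    ← Finset.prod_mul_distrib]
  refine Finset.prod_congr rfl fun k _ => ?_
  rw [invSign_eq_prod]
  simp only [prod_finset_block E _ (blockVar_mem_movingIndex E h)]
  rw [Finset.prod_comm, ← Finset.prod_filter_mul_prod_filter_not Finset.univ (fun l => l < k)]
  congr 1
  · refine Finset.prod_congr rfl fun l hl => ?_
    have hlk := (Finset.mem_filter.1 hl).2
    simp only [if_pos (blockVar_lt_blockVar_of_lt E hlk _ _), Finset.prod_const, ← pow_mul, mul_comm]
  · rw [Finset.prod_eq_single_of_mem k (by simp)]
    · simp only [blockVar_lt_blockVar]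
    · intro l hl hlk
      have hkl : k < l := lt_of_le_of_ne (not_lt.1 (Finset.mem_filter.1 hl).2) (Ne.symm hlk)
      simp only [if_neg (blockVar_lt_blockVar_of_lt E hkl _ _).not_gt, Finset.prod_const_one]

end Blocks

end Orbifold

namespace Orbifold

open PolyBimod DividedDiff Fermion Hochschild BarCochain

section Final

variable {σ : Type} [Fintype σ] [LinearOrder σ] {G : Subgroup (Torus σ)} {W : MvPolynomial σ ℂ}

theorem functionClass_zsmul_cup (hG : G ≤ symmetryGroup W) (s : ℤ) (f : MvPolynomial σ ℂ) (u : G) :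
    orbifoldCup W G (functionClass W G (s • f)) (sectorGenerator W G u) =
      s • orbifoldCup W G (functionClass W G f) (sectorGenerator W G u) := by
  obtain ⟨κ, hκ⟩ := exists_koszulRepresentative (W := W) (g := u.1) (hG u.2)
  rw [sectorGenerator_eq hG u hκ, functionClass_cup_sectorClass, functionClass_cup_sectorClass,
    ← map_zsmul]
  exact congrArg _ (Subtype.ext (smul_assoc s f κ))

theorem cup_smulCocycle_eq (hG : G ≤ symmetryGroup W) {g h : G} {κ : sectorCocycles W g.1}
    {μ : sectorCocycles W h.1} {ν : sectorCocycles W (g * h : G).1} {x y z : OrbifoldHH W G}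
    (hx : x = sectorClass W g κ) (hy : y = sectorClass W h μ) (hz : z = sectorClass W (g * h) ν)
    {F : MvPolynomial σ ℂ} (hF : orbifoldCup W G x y = orbifoldCup W G (functionClass W G F) z)
    (a b : MvPolynomial σ ℂ) :
    orbifoldCup W G (orbifoldCup W G (functionClass W G a) x)
        (orbifoldCup W G (functionClass W G b) y) =
      orbifoldCup W G (functionClass W G (a * b * F)) z := by
  subst hx hy hz
  have h1 : smulCocycle (a * b) (smulCocycle F ν) = smulCocycle (a * b * F) ν :=
    Subtype.ext (smul_smul (a * b) F ν.1)
  have h2 := functionClass_cup_sectorClass (a * b) (g * h) (productCocycle hG κ μ)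
  rw [cup_sectorClass hG, functionClass_cup_sectorClass] at hF
  rw [functionClass_cup_sectorClass, functionClass_cup_sectorClass, functionClass_cup_sectorClass,
    cup_smulCocycle hG, ← h2, hF, functionClass_cup_sectorClass, h1]

theorem exists_sectorGenerator_eq (hG : G ≤ symmetryGroup W) (u : G) :
    ∃ κ : sectorCocycles W u.1, sectorGenerator W G u = sectorClass W u κ := by
  obtain ⟨κ, hκ⟩ := exists_koszulRepresentative (W := W) (g := u.1) (hG u.2)
  exact ⟨_, sectorGenerator_eq hG u hκ⟩

/-- The cup product is determined by the products of generators. -/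
theorem cup_smul_sectorGenerator (hG : G ≤ symmetryGroup W) {g h : G} {F : MvPolynomial σ ℂ}
    (hF : orbifoldCup W G (sectorGenerator W G g) (sectorGenerator W G h) =
      orbifoldCup W G (functionClass W G F) (sectorGenerator W G (g * h)))
    (a b : MvPolynomial σ ℂ) :
    orbifoldCup W G (orbifoldCup W G (functionClass W G a) (sectorGenerator W G g))
        (orbifoldCup W G (functionClass W G b) (sectorGenerator W G h)) =
      orbifoldCup W G (functionClass W G (a * b * F)) (sectorGenerator W G (g * h)) := by
  obtain ⟨κ, hκ⟩ := exists_sectorGenerator_eq hG g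
  obtain ⟨μ, hμ⟩ := exists_sectorGenerator_eq hG h
  obtain ⟨ν, hν⟩ := exists_sectorGenerator_eq hG (g * h)
  exact cup_smulCocycle_eq hG hκ hμ hν hF a b

theorem movingIndex_inv (g : Torus σ) : movingIndex g⁻¹ = movingIndex g := by
  ext i
  rw [mem_movingIndex, mem_movingIndex, Pi.inv_apply, Ne, inv_eq_one]

theorem det_linkHessian_congr (n : σ → ℕ) (next : σ → Option σ) (g : Torus σ) {I J : Finset σ}
    (h : I = J) : (Matrix.of fun k j : I => linkHessian n next g k.1 j.1).det =
      (Matrix.of fun k j : J => linkHessian n next g k.1 j.1).det := by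
  subst h; rfl

/-- The structure constants of an elementary invertible polynomial. -/
theorem invSign_smul_det_linkHessian (E : ElementaryInvertible) {g h : Torus (Fin E.dim)}
    (hg : g ∈ symmetryGroup (linkPoly E.exponent E.next)) (hgh : g = 1 ∨ h = 1 ∨ h = g⁻¹) :
    invSign (movingIndex g) (movingIndex h) •
      (Matrix.of fun k j : (movingIndex g ∩ movingIndex h : Finset _) =>
        linkHessian E.exponent E.next g k.1 j.1).det = structureConst E g h := by
  have h1 : movingIndex (1 : Torus (Fin E.dim)) = ∅ := by
    ext i; simp [mem_movingIndex]
  have hempty : ∀ I : Finset (Fin E.dim), I = ∅ →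
      (Matrix.of fun k j : I => linkHessian E.exponent E.next g k.1 j.1).det = 1 := by
    rintro _ rfl
    exact Matrix.det_isEmpty
  by_cases hg1 : g = 1 ∨ h = 1
  · rw [structureConst, if_pos hg1]
    rcases hg1 with rfl | rfl
    · rw [hempty _ (by rw [h1, Finset.empty_inter]), h1]
      simp [invSign]
    · rw [hempty _ (by rw [h1, Finset.inter_empty]), h1]
      simp [invSign, koszulSign]
  · rw [structureConst, if_neg hg1]
    push Not at hg1
    obtain rfl : h = g⁻¹ := by tauto
    rw [if_pos rfl, movingIndex_inv, det_linkHessian_congr _ _ g (Finset.inter_self _),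
      invSign_self, E.det_linkHessian hg hg1.1, revSign, zsmul_eq_mul]
    push_cast
    rfl

end Final

section Blocks

variable {r : ℕ} (E : Fin r → ElementaryInvertible) {G : Subgroup (Torus (BlockIndex E))}

/-- The element of the torus with given components. -/
def ofBlocks (t : ∀ k, Torus (Fin (E k).dim)) : Torus (BlockIndex E) :=
  fun x => t (ofLex x).1 (ofLex x).2

theorem blockPart_ofBlocks (t : ∀ k, Torus (Fin (E k).dim)) (k : Fin r) :
    blockPart E (ofBlocks E t) k = t k := rfl

theorem cup_sectorGenerator_block
    (hG : G ≤ symmetryGroup (linkPoly (blockExponent E) (blockNext E))) (g h : G) :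
    orbifoldCup (linkPoly (blockExponent E) (blockNext E)) G
        (sectorGenerator _ G g) (sectorGenerator _ G h) =
      orbifoldCup (linkPoly (blockExponent E) (blockNext E)) G
        (functionClass _ G (kunnethSign E g.1 h.1 • ∏ k, rename (blockVar E k)
          (structureConst (E k) (blockPart E g.1 k) (blockPart E h.1 k))))
        (sectorGenerator _ G (g * h)) := by
  classical
  have hgk := (mem_symmetryGroup_block E g.1).1 (hG g.2)
  by_cases hgh : ∀ k, blockPart E g.1 k = 1 ∨ blockPart E h.1 k = 1 ∨
      blockPart E h.1 k = (blockPart E g.1 k)⁻¹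
  · rw [(isLink_block E).cup_sectorGenerator hG]
    · congr 3
      have hJ : ∀ k i, blockVar E k i ∈ movingIndex g.1 ∩ movingIndex h.1 ↔
          i ∈ movingIndex (blockPart E g.1 k) ∩ movingIndex (blockPart E h.1 k) := fun k i => by
        rw [Finset.mem_inter, Finset.mem_inter, blockVar_mem_movingIndex, blockVar_mem_movingIndex]
      have hdet := det_linkHessian_block E g.1 hJ
      rw [invSign_block, mul_smul]
      refine congrArg _ (Eq.trans (congrArg _ (Eq.trans ?_ hdet)) ?_)
      · congr!
      rw [zsmul_eq_mul, Int.cast_prod, ← Finset.prod_mul_distrib]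
      refine Finset.prod_congr rfl fun k _ => ?_
      rw [← invSign_smul_det_linkHessian (E k) (hgk k) (hgh k), map_zsmul, zsmul_eq_mul]
    · intro x
      induction x using blockVar_cases with | _ k i
      change blockPart E g.1 k i = 1 ∨ blockPart E h.1 k i = 1 ∨
        blockPart E g.1 k i * blockPart E h.1 k i = 1
      rcases hgh k with h1 | h1 | h1
      · exact Or.inl (by rw [h1]; rfl)
      · exact Or.inr (Or.inl (by rw [h1]; rfl))
      · exact Or.inr (Or.inr (by rw [h1]; exact mul_inv_cancel _))
  · push Not at hgh
    obtain ⟨k, hk1, hk2, hk3⟩ := hgh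
    have hzero : ∏ k, rename (blockVar E k)
        (structureConst (E k) (blockPart E g.1 k) (blockPart E h.1 k)) = 0 := by
      refine Finset.prod_eq_zero (Finset.mem_univ k) ?_
      rw [structureConst, if_neg (by tauto), if_neg hk3, map_zero]
    have hk4 : blockPart E (g * h : G).1 k ≠ 1 := fun h1 => hk3 (eq_inv_of_mul_eq_one_right h1)
    rw [hzero, functionClass_zsmul_cup hG]
    have hf0 := functionClass_zsmul_cup hG 0 0 (g * h)
    rw [zero_smul, zero_smul] at hf0
    rw [hf0, smul_zero]
    obtain ⟨t, ht, c, hc, htc⟩ := (E k).exists_symmetry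
    let T : Torus (BlockIndex E) := ofBlocks E (Pi.mulSingle k t)
    have hTk : blockPart E T k = t := by
      rw [blockPart_ofBlocks, Pi.mulSingle_eq_same]
    have hTl : ∀ l, l ≠ k → blockPart E T l = 1 := fun l hl => by
      rw [blockPart_ofBlocks, Pi.mulSingle_eq_of_ne hl]
    have hprod : ∀ u : G, blockPart E u.1 k ≠ 1 → ∏ x ∈ movingIndex u.1, (T x : ℂ) = c := by
      intro u hu
      rw [prod_finset_block E _ (blockVar_mem_movingIndex E u.1),
        Finset.prod_eq_single_of_mem k (Finset.mem_univ k)]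
      · rw [← (htc _ ((mem_symmetryGroup_block E u.1).1 (hG u.2) k) hu).2]
        refine Finset.prod_congr rfl fun i _ => ?_
        rw [← hTk]; rfl
      · intro l _ hl
        refine Finset.prod_eq_one fun i _ => ?_
        change ((blockPart E T l i : ℂˣ) : ℂ) = 1
        rw [hTl l hl]; rfl
    refine (isLink_block E).cup_sectorGenerator_eq_zero hG (t := T) ?_ ?_ ?_
    · rw [mem_symmetryGroup_block]
      intro l
      by_cases hl : l = k
      · subst hl; rw [hTk]; exact ht
      · rw [hTl l hl]; exact one_mem _
    · intro x hx
      induction x using blockVar_cases with | _ l i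
      rw [blockVar_mem_movingIndex] at hx ⊢
      by_cases hl : l = k
      · subst hl
        rw [hTk] at hx
        exact (htc _ ((mem_symmetryGroup_block E _).1 (hG (g * h).2) l) hk4).1 hx
      · rw [hTl l hl, mem_movingIndex] at hx
        exact absurd rfl hx
    · rw [hprod _ hk1, hprod _ hk2, hprod _ hk4]
      intro hcc
      have hc0 : c ≠ 0 := by
        rw [← hprod _ hk4]
        exact Finset.prod_ne_zero_iff.2 fun x _ => (T x).ne_zero
      exact hc (mul_left_cancel₀ hc0 (by rw [mul_one]; exact hcc.symm))

end Blocks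

section Elementary

variable (E : ElementaryInvertible) {G : Subgroup (Torus (Fin E.dim))}

theorem cup_sectorGenerator_elementary_eq_zero
    (hG : G ≤ symmetryGroup (linkPoly E.exponent E.next)) {g h : G} (hg : g ≠ 1) (hh : h ≠ 1)
    (hgh : h ≠ g⁻¹) :
    orbifoldCup (linkPoly E.exponent E.next) G (sectorGenerator _ G g) (sectorGenerator _ G h) =
      0 := by
  obtain ⟨t, ht, c, hc, htc⟩ := E.exists_symmetry
  have hne : ∀ u : G, u ≠ 1 → u.1 ≠ 1 := fun u hu h1 => hu (Subtype.ext h1)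
  have hgh1 : g * h ≠ 1 := fun h1 => hgh (eq_inv_of_mul_eq_one_right h1)
  refine E.isLink.cup_sectorGenerator_eq_zero hG ht (htc _ (hG (g * h).2) (hne _ hgh1)).1 ?_
  rw [(htc _ (hG (g * h).2) (hne _ hgh1)).2, (htc _ (hG g.2) (hne _ hg)).2,
    (htc _ (hG h.2) (hne _ hh)).2]
  intro hcc
  have hc0 : c ≠ 0 := by
    rw [← (htc _ (hG g.2) (hne _ hg)).2]
    exact Finset.prod_ne_zero_iff.2 fun x _ => (t x).ne_zero
  exact hc (mul_left_cancel₀ hc0 (by rw [mul_one]; exact hcc.symm))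

theorem cup_sectorGenerator_elementary_inv
    (hG : G ≤ symmetryGroup (linkPoly E.exponent E.next)) {g : G} (hg : g ≠ 1) :
    orbifoldCup (linkPoly E.exponent E.next) G (sectorGenerator _ G g) (sectorGenerator _ G g⁻¹) =
      ((-1 : ℤ) ^ ((movingIndex g.1).card * ((movingIndex g.1).card - 1) / 2)) •
        orbifoldCup (linkPoly E.exponent E.next) G (functionClass _ G (E.hess g.1))
          (sectorGenerator _ G 1) := by
  have hg1 : g.1 ≠ 1 := fun h1 => hg (Subtype.ext h1)
  rw [E.isLink.cup_sectorGenerator hG (g := g) (h := g⁻¹)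
    fun i => Or.inr (Or.inr (mul_inv_cancel _)), mul_inv_cancel,
    invSign_smul_det_linkHessian E (hG g.2) (h := (g⁻¹ : G).1) (Or.inr (Or.inr rfl)),
    ← functionClass_zsmul_cup hG, structureConst, if_neg,
    if_pos (show (g⁻¹ : G).1 = g.1⁻¹ from rfl), zsmul_eq_mul]
  · push_cast
    rfl
  · rintro (h1 | h1)
    · exact hg1 h1
    · exact hg1 (inv_eq_one.1 h1)

end Elementary

end Orbifold

open Orbifold

theorem mainTheorem1 :
    (∀ (E : ElementaryInvertible) (G : Subgroup (Torus (Fin E.dim))),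
      G ≤ symmetryGroup E.poly →
      (∀ g : G, ∃! c, IsSectorGenerator E.poly G g c) ∧
      (∀ g₁ g₂ : G, g₁ ≠ 1 → g₂ ≠ 1 → g₂ ≠ g₁⁻¹ →
        orbifoldCup E.poly G (sectorGenerator E.poly G g₁) (sectorGenerator E.poly G g₂) = 0) ∧
      (∀ g : G, g ≠ 1 →
        orbifoldCup E.poly G (sectorGenerator E.poly G g) (sectorGenerator E.poly G g⁻¹) =
          ((-1 : ℤ) ^ ((movingIndex g.1).card * ((movingIndex g.1).card - 1) / 2)) •
            orbifoldCup E.poly G (functionClass E.poly G (E.hess g.1))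
              (sectorGenerator E.poly G 1))) ∧
    (∀ (r : ℕ) (E : Fin r → ElementaryInvertible) (G : Subgroup (Torus (BlockIndex E))),
      G ≤ symmetryGroup (invertiblePoly E) →
      (∀ g : G, ∃! c, IsSectorGenerator (invertiblePoly E) G g c) ∧
      (∀ c : OrbifoldHH (invertiblePoly E) G, ∃ f : G →₀ MvPolynomial (BlockIndex E) ℂ,
        c = f.sum fun g a => orbifoldCup (invertiblePoly E) G
          (functionClass (invertiblePoly E) G a) (sectorGenerator (invertiblePoly E) G g)) ∧
      (∀ (g h : G) (a b : MvPolynomial (BlockIndex E) ℂ),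
        orbifoldCup (invertiblePoly E) G
          (orbifoldCup (invertiblePoly E) G (functionClass (invertiblePoly E) G a)
            (sectorGenerator (invertiblePoly E) G g))
          (orbifoldCup (invertiblePoly E) G (functionClass (invertiblePoly E) G b)
            (sectorGenerator (invertiblePoly E) G h)) =
        kunnethSign E g.1 h.1 •
          orbifoldCup (invertiblePoly E) G
            (functionClass (invertiblePoly E) G (a * b *
              ∏ k, rename (blockVar E k)
                (structureConst (E k) (blockPart E g.1 k) (blockPart E h.1 k))))
            (sectorGenerator (invertiblePoly E) G (g * h)))) := by
  refine ⟨fun E G hG => ?_, fun r E G hG => ?_⟩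
  · refine ⟨existsUnique_isSectorGenerator hG, ?_⟩
    rw [E.poly_eq_linkPoly] at hG ⊢
    exact ⟨fun g h hg hh hgh => cup_sectorGenerator_elementary_eq_zero E hG hg hh hgh,
      fun g hg => cup_sectorGenerator_elementary_inv E hG hg⟩
  · refine ⟨existsUnique_isSectorGenerator hG, ?_⟩
    rw [invertiblePoly_eq_linkPoly E] at hG ⊢
    refine ⟨exists_sum_eq hG fun u hu => (isLink_block E).exists_X_pow_mem (hG hu),
      fun g h a b => ?_⟩
    rw [cup_smul_sectorGenerator hG (cup_sectorGenerator_block E hG g h), mul_smul_comm,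
      functionClass_zsmul_cup hG]
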